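/- **Setting.** Let $\omega$ be a random field on $\mathbb{R}^2$ whose law is invariant under the group $ISO(2)$ of rigid motions and whose restrictions $\omega_{\Lambda_i}$ to pairwise disjoint measurable sets are independent. For measurable $\Lambda\subset\mathbb{R}^2$ let $\omega^\Lambda$ be the field with $\Lambda^c$ resampled: $\omega^\Lambda$ has the law of $\omega$, agrees with $\omega$ on $\Lambda$, and the field $\omega$ and the restrictions of the $\omega^\Lambda$ to $\Lambda^c$ (for different $\Lambda$) are all independent. A rotationally invariant planar first passage percolation model is given by a class $\Upsilon$ of admissible continuous paths $\gamma:[0,1]\to\mathbb{R}^2$ (stable under rigid motions, reversal and reparametrisation), a measurable passage time $X_\gamma=X^\omega_\gamma\in[0,\infty]$, an operation of concatenation, and a measurable choice of paths $\gamma_{uv}$. Let $X_{uv}=\inf X_\gamma$ over the admissible paths from $u$ to $v$ (a random variable), $X^\Lambda$ the passage times for $\omega^\Lambda$, and $X_n=X_{(0,0),(n,0)}$, where $n$ is a positive real. Write $\mathbf 0$ for the origin and $B_r$ for the ball of radius $r$ about it. Assume that for some constants $\kappa,D_0>0$, $n_0\ge1$, $\mu\in(0,\infty)$ (below, $x>0$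 is arbitrary unless said otherwise): 1. $X^{\tau\omega}_{\tau\gamma}=X^\omega_\gamma$ for $\tau\in ISO(2)$, and $X_\gamma$ is invariant under time reversal and change of parametrisation. 2. Almost surely, for all $u,v$, the path $\gamma_{uv}$ is an admissible path from $u$ to $v$ with $X_{\gamma_{uv}}=X_{uv}$. 3. $\lim_{n\to\infty}\frac1n\mathbb{E}X_n=\mu$. 4. $\mathbb{P}[|X_n-\mathbb{E}X_n|>x\sqrt n]\le\exp(1-D_0x^\kappa)$ for all $n\ge1$. 5. $0\le\mathbb{E}X_n-\mu n\le n^{1/2}\log^2n$ for all $n\ge n_0$. 6. $\mathbb{P}[\sup_{u,v\in B_3}X_{uv}>x]\le\exp(1-D_0x^\kappa)$. 7. $X_{uv}\le X_{uw}+X_{wv}$ for all $u,v,w$, and $X_\gamma\le X_{\gamma_1}+X_{\gamma_2}$ if $\gamma$ is the concatenation of $\gamma_1$ and $\gamma_2$. 8. For $n\ge n_0$, with probability at least $1-\exp(1-D_0x^\kappa)$, one has $\sum_{i=1}^{m+1}X_{\gamma_{uv}(t_{i-1})\gamma_{uv}(t_i)}-X_{uv}\le x\,m\log^{1/\kappa}n$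 for all $u,v\in B_n$, $m\ge1$ and $0=t_0<t_1<\dots<t_m<t_{m+1}=1$; and the same holds for all $u\in B_n$ and $v\in\mathbb{R}^2$ with $\log^{1/\kappa}(n+\max_{0<i\le m}|\gamma_{uv}(t_i)|)$ in place of $\log^{1/\kappa}n$. 9. $\mathrm{Var}(X_n)\ge n^{1/6}$ for $n\ge n_0$, and $\inf_{n\ge1}\mathrm{Var}(X_n)>0$. 10. For $n\ge1$, $L\ge\frac32$, $|y_1|,|y_2|\le Ln$ and $x\ge1$, if $(n,H)$ is the first intersection of $\gamma_{(0,y_1),(Ln,y_2)}$ with the vertical line at abscissa $n$, then $\mathbb{P}[H\ge xn^{4/5}+y_1+(y_2-y_1)/L]\le\exp(1-D_0(xn^{1/10})^\kappa)$. 11. For $n\ge n_0$ and $\Lambda=[0,n]\times\mathbb{R}$, $\mathbb{P}[\sup_{0\le y_1,y_2\le n}|X_{(0,y_1),(n,y_2)}-X^\Lambda_{(0,y_1),(n,y_2)}|>x\log^{1/\kappa}n]\le\exp(1-D_0x^\kappa)$. 12. For $n\ge n_0$ and every $n\times W$ rectangle $\Lambda$ with $0<W\le n$, with $\Lambda^-=\{w\in\Lambda:d(w,\Lambda^c)\ge\log^2n\}$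 and $\Lambda^+=\{w:d(w,\Lambda)\le\log^2n\}$: with probability at least $1-n^{-10}$, $X_\gamma=X_\gamma^\Lambda$ for all $\gamma\in\Upsilon$ contained in $\Lambda^-$; and with probability at least $1-n^{-10}$, $X_\gamma=X_\gamma^{\Lambda^c}$ for all $\gamma\in\Upsilon$ contained in $(\Lambda^+)^c$. Put $\theta=\frac{\min\{1,\kappa^2\}}{10000}$, $\epsilon=\theta/10^6$, and fix $\alpha\in[\min\{\frac1{30},\frac\kappa2\},\min\{\frac1{15},\kappa\}]$. For real $n\ge1$ let $$\widehat Q_n=\inf\Big\{Q:\sup_{x>0}\frac{\mathbb{P}[|X_n-\mathbb{E}X_n|>xQ]}{\exp(1-x^\theta)}\le1\Big\},\qquad Q_n=\sup_{1\le m\le n}\Big(\frac nm\Big)^\alpha\widehat Q_m,\qquad W_n=\sqrt{nQ_n},$$ the supremum being over real $m$, and let $\mathfrak{W}_n$ be the maximal distance of a point of $\gamma_{\mathbf 0,(n,0)}$ from the line through $\mathbf 0$ and $(n,0)$. **Theorem.** There exists $D>0$ such that for all real $n\ge1$ and all $z\ge0$, $$\mathbb{P}[\mathfrak{W}_n\ge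 zW_n]\le\exp\big(1-Dz^{\frac12\epsilon\theta}\big).$$ -/

import Mathlib

open MeasureTheory ProbabilityTheory Filter Topology
open scoped ENNReal

noncomputable section

namespace RotFPP

/-- The Euclidean plane. -/
abbrev Plane := EuclideanSpace ℝ (Fin 2)

/-- The point with coordinates `(x, y)`. -/
def pt (x y : ℝ) : Plane := !₂[x, y]

/-- The group of rigid motions of the plane: translations, rotations, reflections and their
compositions. -/
abbrev ISO2 := Plane ≃ᵢ Plane

/-- Continuous parametrised paths in the plane. -/
abbrev PlanePath := C(unitInterval, Plane)

/-- The path space carries the Borel σ-algebra of uniform convergence. -/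
instance : MeasurableSpace PlanePath := borel _

instance : BorelSpace PlanePath := ⟨rfl⟩

/-- The image of a path under a rigid motion. -/
def movePath (τ : ISO2) (γ : PlanePath) : PlanePath :=
  ContinuousMap.comp ⟨τ, τ.continuous⟩ γ

/-- The path run backwards. -/
def reversePath (γ : PlanePath) : PlanePath :=
  γ.comp ⟨unitInterval.symm, unitInterval.continuous_symm⟩

/-- The path after a change of parametrisation by an increasing bijection of `[0,1]`. -/
def reparamPath (φ : unitInterval ≃o unitInterval) (γ : PlanePath) : PlanePath :=
  γ.comp ⟨φ, φ.continuous⟩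

/-- A random field on the plane, realised on the probability space `(Ω, P)`, together with its
resampled versions. `E` is the space of configurations, on which the rigid motions act. -/
structure RandomField (Ω E : Type*) [MeasurableSpace Ω] [mE : MeasurableSpace E]
    [MulAction ISO2 E] (P : Measure Ω) where
  /-- The field `ω`. -/
  field : Ω → E
  measurable_field : Measurable field
  /-- `info A` is the σ-algebra on configurations generated by the restriction to `A`. -/
  info : Set Plane → MeasurableSpace E
  /-- The whole configuration is its restriction to the plane. -/
  info_univ : info Set.univ = mE
  /-- The restriction to `A ∪ B` consists of the restrictions to `A` and to `B`. -/
  info_union : ∀ A B : Set Plane, MeasurableSet A → MeasurableSet B →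
    info (A ∪ B) = info A ⊔ info B
  /-- The restriction of `τ ω` to `τ A` carries the same information as that of `ω` to `A`. -/
  info_smul : ∀ (τ : ISO2) (A : Set Plane), MeasurableSet A →
    (info (τ '' A)).comap (fun η : E => τ • η) = info A
  /-- The law of the field is invariant under rigid motions. -/
  invariant_law : ∀ τ : ISO2,
    MeasurePreserving (fun η : E => τ • η) (P.map field) (P.map field)
  /-- Restrictions of the field to pairwise disjoint measurable sets are independent. -/
  spatial_indep : ∀ A : ℕ → Set Plane, (∀ i, MeasurableSet (A i)) →
    Pairwise (fun i j => Disjoint (A i) (A j)) →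
    iIndep (fun i => info (A i)) (P.map field)
  /-- `resampled Λ` is the field `ω^Λ`: the field `ω` with its restriction to `Λᶜ` resampled. -/
  resampled : Set Plane → Ω → E
  measurable_resampled : ∀ Λ, MeasurableSet Λ → Measurable (resampled Λ)
  /-- `ω` and `ω^Λ` are equal in distribution. -/
  resampled_law : ∀ Λ, MeasurableSet Λ → P.map (resampled Λ) = P.map field
  /-- `ω` and `ω^Λ` agree on `Λ`. -/
  resampled_eq : ∀ Λ, MeasurableSet Λ → ∀ S : Set E, MeasurableSet[info Λ] S →
    ∀ᵐ x ∂P, (resampled Λ x ∈ S ↔ field x ∈ S)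
  /-- `ω` and the restrictions of the `ω^Λ` to `Λᶜ`, for different `Λ`, are all independent. -/
  resampled_indep :
    iIndep (fun o : Option {Λ : Set Plane // MeasurableSet Λ} =>
      o.elim (mE.comap field) (fun Λ => (info Λ.1ᶜ).comap (resampled Λ.1))) P

/-- A rotationally invariant first passage percolation model on the plane. A path that is not
admissible for a given configuration may be given the passage time `∞`. -/
structure Model (Ω E : Type*) [MeasurableSpace Ω] [MeasurableSpace E] [MulAction ISO2 E]
    (P : Measure Ω) extends RandomField Ω E P where
  /-- The class `Υ` of admissible paths. -/
  paths : Set PlanePath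
  move_mem : ∀ τ : ISO2, ∀ γ ∈ paths, movePath τ γ ∈ paths
  reverse_mem : ∀ γ ∈ paths, reversePath γ ∈ paths
  reparam_mem : ∀ φ : unitInterval ≃o unitInterval, ∀ γ ∈ paths, reparamPath φ γ ∈ paths
  /-- The passage time `X_γ^ω` of a path. -/
  time : PlanePath → E → ℝ≥0∞
  measurable_time : Measurable (fun q : paths × E => time q.1 q.2)
  /-- The concatenation of paths that belongs to the model; it may depend on the field. -/
  concat : E → PlanePath → PlanePath → PlanePath
  concat_mem : ∀ (η : E), ∀ γ₁ ∈ paths, ∀ γ₂ ∈ paths, γ₁ 1 = γ₂ 0 →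
    concat η γ₁ γ₂ ∈ paths ∧ concat η γ₁ γ₂ 0 = γ₁ 0 ∧ concat η γ₁ γ₂ 1 = γ₂ 1
  /-- The choice `γ_{uv}` of an optimal path; it may use randomness besides that of the field. -/
  geodesic : Plane → Plane → Ω → PlanePath
  measurable_geodesic : ∀ u v, Measurable (geodesic u v)

namespace Model

variable {Ω E : Type*} [MeasurableSpace Ω] [MeasurableSpace E] [MulAction ISO2 E]
  {P : Measure Ω} (M : Model Ω E P)

/-- The class `Υ_{uv}` of admissible paths from `u` to `v`. -/
def pathsBetween (u v : Plane) : Set PlanePath := {γ ∈ M.paths | γ 0 = u ∧ γ 1 = v}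

/-- The first passage time `X_{uv}`, as a function of the configuration. -/
def passage (u v : Plane) (η : E) : ℝ≥0∞ := ⨅ γ ∈ M.pathsBetween u v, M.time γ η

/-- `X_n`, the passage time from the origin to `(n, 0)`. -/
def X (n : ℝ) (x : Ω) : ℝ := (M.passage 0 (pt n 0) (M.field x)).toReal

/-- The expectation of `X_n`. -/
def meanX (n : ℝ) : ℝ := ∫ x, M.X n x ∂P

/-- The sum of the passage times between successive points `γ_{uv}(t_0), …, γ_{uv}(t_{m+1})`. -/
def brokenTime {m : ℕ} (u v : Plane) (t : Fin (m + 2) → unitInterval) (x : Ω) : ℝ≥0∞ :=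
  ∑ i : Fin (m + 1),
    M.passage (M.geodesic u v x (t i.castSucc)) (M.geodesic u v x (t i.succ)) (M.field x)

/-- The vertical strip `{0 ≤ x ≤ n}`. -/
def strip (n : ℝ) : Set Plane := {w | 0 ≤ w 0 ∧ w 0 ≤ n}

/-- The rectangle `[0, n] × [0, W]`. -/
def rect (n W : ℝ) : Set Plane := {w | 0 ≤ w 0 ∧ w 0 ≤ n ∧ 0 ≤ w 1 ∧ w 1 ≤ W}

/-- `Λ⁻`: the points of `Λ` at distance at least `log² n` from the complement. -/
def shrink (n : ℝ) (Λ : Set Plane) : Set Plane :=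
  {w ∈ Λ | (Real.log n) ^ 2 ≤ Metric.infDist w Λᶜ}

/-- `Λ⁺`: the points at distance at most `log² n` from `Λ`. -/
def enlarge (n : ℝ) (Λ : Set Plane) : Set Plane :=
  {w | Metric.infDist w Λ ≤ (Real.log n) ^ 2}

/-- The standing assumptions on a model, with constants `κ`, `D₀`, `n₀` and speed `μ`. -/
structure Assumptions (κ D₀ n₀ μ : ℝ) : Prop where
  κ_pos : 0 < κ
  D₀_pos : 0 < D₀
  one_le_n₀ : 1 ≤ n₀
  /-- The first passage times are random variables. -/
  aemeasurable_passage : ∀ u v, AEMeasurable (M.passage u v) (P.map M.field)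
  /-- Invariance under rigid motions. -/
  invariance : ∀ τ : ISO2, ∀ᵐ η ∂(P.map M.field), ∀ γ ∈ M.paths,
    M.time (movePath τ γ) (τ • η) = M.time γ η
  /-- Invariance under time reversal. -/
  time_reversal : ∀ᵐ η ∂(P.map M.field), ∀ γ ∈ M.paths,
    M.time (reversePath γ) η = M.time γ η
  /-- Invariance under change of parametrisation. -/
  reparametrisation : ∀ᵐ η ∂(P.map M.field), ∀ γ ∈ M.paths,
    ∀ φ : unitInterval ≃o unitInterval, M.time (reparamPath φ γ) η = M.time γ η
  /-- Optimal paths: `γ_{uv}` attains the infimum. -/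
  optimal_paths : ∀ᵐ x ∂P, ∀ u v : Plane, M.geodesic u v x ∈ M.pathsBetween u v ∧
    M.time (M.geodesic u v x) (M.field x) = M.passage u v (M.field x)
  /-- Speed. -/
  μ_pos : 0 < μ
  speed : Tendsto (fun n : ℝ => M.meanX n / n) atTop (𝓝 μ)
  /-- Concentration. -/
  concentration : ∀ n : ℝ, 1 ≤ n → ∀ x : ℝ, 0 < x →
    P.real {a | |M.X n a - M.meanX n| > x * √n} ≤ Real.exp (1 - D₀ * x ^ κ)
  /-- Non-random fluctuations. -/
  nonrandom : ∀ n : ℝ, n₀ ≤ n →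
    0 ≤ M.meanX n - μ * n ∧ M.meanX n - μ * n ≤ √n * (Real.log n) ^ 2
  /-- Local passage times. -/
  local_times : ∀ x : ℝ, 0 < x →
    P.real {a | ∃ u ∈ Metric.ball (0 : Plane) 3, ∃ v ∈ Metric.ball (0 : Plane) 3,
      M.passage u v (M.field a) > ENNReal.ofReal x} ≤ Real.exp (1 - D₀ * x ^ κ)
  /-- Triangle inequality. -/
  triangle : ∀ᵐ η ∂(P.map M.field), ∀ u v w : Plane,
    M.passage u v η ≤ M.passage u w η + M.passage w v η
  triangle_concat : ∀ᵐ η ∂(P.map M.field), ∀ γ₁ ∈ M.paths, ∀ γ₂ ∈ M.paths, γ₁ 1 = γ₂ 0 →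
    M.time (M.concat η γ₁ γ₂) η ≤ M.time γ₁ η + M.time γ₂ η
  /-- Intermediate points, both end points in a ball. -/
  intermediate : ∀ n : ℝ, n₀ ≤ n → ∀ x : ℝ, 0 < x →
    P.real {a | ∃ u ∈ Metric.ball (0 : Plane) n, ∃ v ∈ Metric.ball (0 : Plane) n,
      ∃ m : ℕ, 1 ≤ m ∧ ∃ t : Fin (m + 2) → unitInterval,
        StrictMono t ∧ t 0 = 0 ∧ t (Fin.last (m + 1)) = 1 ∧
        M.brokenTime u v t a > M.passage u v (M.field a)
          + ENNReal.ofReal (x * m * (Real.log n) ^ (1 / κ))}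
      ≤ Real.exp (1 - D₀ * x ^ κ)
  /-- Intermediate points, one end point in a ball and the other one arbitrary. -/
  intermediate_far : ∀ n : ℝ, n₀ ≤ n → ∀ x : ℝ, 0 < x →
    P.real {a | ∃ u ∈ Metric.ball (0 : Plane) n, ∃ v : Plane,
      ∃ m : ℕ, 1 ≤ m ∧ ∃ t : Fin (m + 2) → unitInterval,
        StrictMono t ∧ t 0 = 0 ∧ t (Fin.last (m + 1)) = 1 ∧
        M.brokenTime u v t a > M.passage u v (M.field a)
          + ENNReal.ofReal (x * m *
            (Real.log (n + ⨆ i : Fin m, ‖M.geodesic u v a (t i.succ.castSucc)‖)) ^ (1 / κ))}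
      ≤ Real.exp (1 - D₀ * x ^ κ)
  /-- Variance lower bound. -/
  variance_growth : ∀ n : ℝ, n₀ ≤ n → n ^ (1 / 6 : ℝ) ≤ variance (M.X n) P
  variance_pos : ∃ c > 0, ∀ n : ℝ, 1 ≤ n → c ≤ variance (M.X n) P
  /-- Local transversal fluctuations, at the first intersection with the line `{x = n}`. -/
  local_transversal : ∀ n : ℝ, 1 ≤ n → ∀ L : ℝ, 3 / 2 ≤ L → ∀ y₁ y₂ : ℝ,
    |y₁| ≤ L * n → |y₂| ≤ L * n → ∀ x : ℝ, 1 ≤ x →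
    P.real {a | ∃ t : unitInterval,
        M.geodesic (pt 0 y₁) (pt (L * n) y₂) a t 0 = n ∧
        (∀ s < t, M.geodesic (pt 0 y₁) (pt (L * n) y₂) a s 0 ≠ n) ∧
        M.geodesic (pt 0 y₁) (pt (L * n) y₂) a t 1
          ≥ x * n ^ (4 / 5 : ℝ) + y₁ + (y₂ - y₁) / L}
      ≤ Real.exp (1 - D₀ * (x * n ^ (1 / 10 : ℝ)) ^ κ)
  /-- Resampling outside a strip. -/
  resampling_strip : ∀ n : ℝ, n₀ ≤ n → ∀ x : ℝ, 0 < x →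
    P.real {a | ∃ y₁ ∈ Set.Icc 0 n, ∃ y₂ ∈ Set.Icc 0 n,
      |(M.passage (pt 0 y₁) (pt n y₂) (M.field a)).toReal
        - (M.passage (pt 0 y₁) (pt n y₂) (M.resampled (strip n) a)).toReal|
        > x * (Real.log n) ^ (1 / κ)}
      ≤ Real.exp (1 - D₀ * x ^ κ)
  /-- Resampling outside a rectangle `Λ` does not affect the paths in `Λ⁻`. -/
  resampling_inside : ∀ n : ℝ, n₀ ≤ n → ∀ W : ℝ, 0 < W → W ≤ n → ∀ τ : ISO2,
    P.real {a | ∃ γ ∈ M.paths, Set.range γ ⊆ shrink n (τ '' rect n W) ∧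
      M.time γ (M.field a) ≠ M.time γ (M.resampled (τ '' rect n W) a)} ≤ n ^ (-10 : ℝ)
  /-- Resampling inside a rectangle `Λ` does not affect the paths outside `Λ⁺`. -/
  resampling_outside : ∀ n : ℝ, n₀ ≤ n → ∀ W : ℝ, 0 < W → W ≤ n → ∀ τ : ISO2,
    P.real {a | ∃ γ ∈ M.paths, Set.range γ ⊆ (enlarge n (τ '' rect n W))ᶜ ∧
      M.time γ (M.field a) ≠ M.time γ (M.resampled (τ '' rect n W)ᶜ a)} ≤ n ^ (-10 : ℝ)

/-- `𝔚_{uv}`: the maximal distance of a point of `γ_{uv}` from the line through `u` and `v`. -/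
def transversal (u v : Plane) (a : Ω) : ℝ :=
  ⨆ t : unitInterval, Metric.infDist (M.geodesic u v a t) (line[ℝ, u, v] : Set Plane)

/-- `𝔚_n`, the transversal fluctuation of the optimal path from the origin to `(n, 0)`. -/
def transversalN (n : ℝ) (a : Ω) : ℝ := M.transversal 0 (pt n 0) a

/-- The scale `Q̂_n` of stretched exponential concentration with exponent `θ`. -/
def Qhat (θ n : ℝ) : ℝ :=
  sInf {Q : ℝ | ∀ x : ℝ, 0 < x →
    P.real {a | |M.X n a - M.meanX n| > x * Q} / Real.exp (1 - x ^ θ) ≤ 1}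

/-- `Q_n = sup_{1 ≤ m ≤ n} (n/m)^α Q̂_m`, over real `m`. -/
def Q (α θ n : ℝ) : ℝ := sSup ((fun m : ℝ => (n / m) ^ α * M.Qhat θ m) '' Set.Icc 1 n)

/-- `W_n = √(n Q_n)`. -/
def W (α θ n : ℝ) : ℝ := √(n * M.Q α θ n)

end Model

/-- The exponent `θ = (1 ∧ κ²) / 10000`. -/
def theta (κ : ℝ) : ℝ := min 1 (κ ^ 2) / 10000

/-- The exponent `ε = θ / 10⁶`. -/
def eps (κ : ℝ) : ℝ := theta κ / 10 ^ 6

end RotFPP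

end

/-!
Why the bound holds: an optimal path from `0` to `(n, 0)` that leaves the axis by `δ` is longer than
the segment by a quantity of order `δ² / n`, and the resulting loss of time has to be made up by the
fluctuations of passage times, which are of order `Q_n` at scale `n`. Hence `δ` is of order
`√(n Q_n) = W_n`, and a deviation `z W_n` requires fluctuations of order `z² Q_n`. With `x`
proportional to `z ^ 2` the stretched exponent `β = ε θ / 4` in `x` is the exponent `ε θ / 2` in
`z`. Four ingredients make this rigorous.

*Rough geometry.* The hypotheses control passage times between the points of a countable set `D`,
whereas the points of an optimal path are random and need not be close, in passage time, to the
points of `D` in their neighbourhood. A planar argument settles this. Two optimal paths that meet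
can exchange their end points, so that they are disjoint if the exchange lengthens the segments
(`Controlled.disjoint`). Around a lattice point `o`, the optimal paths between the corners of a
square, those from the corners to a point near `o`, and those that lead outwards from the corners
form a wheel whose opposite parts do not meet. Its rim winds around the hub
(`wheel_winding_ne_zero`), so a path that comes close to `o` from far away meets the rim
(`Controlled.exists_meets_rim`) and is therefore close, in passage time, to the points of `D` near
`o` (`Controlled.close_of_near`). Optimal paths thus stay in a comparable ball and are almost
additive along the points of `D` in their neighbourhood: this is `Model.RoughGeometry`, and it fails
with stretched exponentially small probability (`Model.Assumptions.exists_roughGeometry`). The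
visits of an optimal path to equally spaced vertical lines, rounded to integer ordinates, form its
skeleton (`Model.Skeleton`).

*Slope of the mean.* Excess length has to cost time on average: up to an error of the order of the
fluctuations at scale `s`, the mean `𝔼 X_ℓ` grows at rate at least `μ / 4` beyond `ℓ = s`
(`Model.Assumptions.exists_slope_bound`). Since `𝔼 X_ℓ` lies between `μ ℓ` and
`μ ℓ + ℓ ^ (1 / 2) log² ℓ`, the function `𝔼 X_ℓ - (μ / 4) (ℓ - s)` almost attains its infimum over
`ℓ ≥ s` at some `t` not far from `s`, and an optimal path of length `t`, cut at the abscissa `s`,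
shows that `t - s` is at most of the order of the fluctuations.

*Windows.* `Model.WindowBound` is a simultaneous bound for the deviations of the passage times
between all pairs of integer points in a window of height comparable to `√(n τ)` on each of two
vertical lines at distance `n`, `τ` being the size of the deviations. It passes from scale `n / N`
to scale `n` (`Model.windowBound_step`). If the cells at scale `n / N` are good, then excess length
is costly, the skeleton of every optimal path across the window stays close to its chord
(`sq_chord_deviation_le_of_times`), and a small displacement of the end points is absorbed by the
first and the last cell (`Model.T_le_T_add_of_near`). So it suffices to control a grid whose
cardinality depends on `N` only. The union bound over the cells closes because
`Q_{n / N} ≤ N ^ (-α) Q_n`: this gain beats the polynomial number of cells once `N` is large.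

*Chaining.* At level `k` the path is compared with segments of length `n / N ^ k`, the passage times
across which may deviate by `x Q_n N ^ (-k α / 2)`, much more than their typical fluctuation. The
probabilities of the bad events decay superexponentially in `k`, so a union bound over the `N ^ k`
segments and over the possible positions of the path is affordable. On the good event the
transversal deviations at the successive levels are bounded by a geometric series with sum of order
`√(n x Q_n)` (`Model.Skeleton.abs_le_of_cells`). The chaining stops where the admissible deviation
exceeds the power `3 / 5` of the length; there, as for `x Q_n ≥ n`, the rough geometry suffices.
-/

noncomputable section

namespace RotFPP

/-! ### Variation of the logarithm along planar paths -/

/-- A nowhere vanishing function on a simply connected space has a continuous logarithm. -/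
theorem exists_continuous_log {A : Type*} [TopologicalSpace A] [SimplyConnectedSpace A]
    [LocallyPathConnectedSpace A] (f : C(A, ℂ)) (hf : ∀ a, f a ≠ 0) (a₀ : A) :
    ∃ L : C(A, ℂ), ∀ a, Complex.exp (L a) = f a := by
  obtain ⟨L, ⟨_, h⟩, _⟩ := Complex.isCoveringMapOn_exp.existsUnique_continuousMap_lifts f
    (a₀ := a₀) (e₀ := Complex.log (f a₀)) (Complex.exp_log (hf a₀)) (fun a => hf a)
  exact ⟨L, fun a => congrFun h a⟩

/-- Two continuous logarithms of the same function have the same increments. -/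
theorem log_increment_unique {A : Type*} [TopologicalSpace A] [SimplyConnectedSpace A]
    [LocallyPathConnectedSpace A] (L L' : C(A, ℂ))
    (h : ∀ a, Complex.exp (L a) = Complex.exp (L' a)) (a b : A) : L b - L a = L' b - L' a := by
  obtain ⟨F, _, hu⟩ := Complex.isCoveringMapOn_exp.existsUnique_continuousMap_lifts
    (⟨fun x => Complex.exp (L x), by fun_prop⟩ : C(A, ℂ))
    (a₀ := a) (e₀ := L a) rfl (fun x => Complex.exp_ne_zero _)
  have h1 : L = F := hu L ⟨rfl, by ext; simp⟩
  have h2 : L' + ContinuousMap.const A (L a - L' a) = F := by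
    refine hu _ ⟨by simp, ?_⟩
    ext x
    have : Complex.exp (L a - L' a) = 1 := by
      rw [Complex.exp_sub, h a, div_self (Complex.exp_ne_zero _)]
    simp [Complex.exp_add, this, h x]
  have h3 := congrArg (fun G : C(A, ℂ) => G b) (h1.trans h2.symm)
  simp only [ContinuousMap.add_apply, ContinuousMap.const_apply] at h3
  rw [h3]; ring

/-- The increment between the times `0` and `1` of a continuous logarithm of `e - p`, for a curve
`e : ℝ → ℂ` that avoids the point `p`; it is `0` if there is no such logarithm. A path on `[0, 1]` is
extended to `ℝ` by constants. -/
def logVar (e : C(ℝ, ℂ)) (p : ℂ) : ℂ :=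
  open Classical in
  if h : ∃ L : C(ℝ, ℂ), ∀ t, Complex.exp (L t) = e t - p then h.choose 1 - h.choose 0 else 0

theorem logVar_eq {e : C(ℝ, ℂ)} {p : ℂ} (L : C(ℝ, ℂ)) (hL : ∀ t, Complex.exp (L t) = e t - p) :
    logVar e p = L 1 - L 0 := by
  have h : ∃ L : C(ℝ, ℂ), ∀ t, Complex.exp (L t) = e t - p := ⟨L, hL⟩
  rw [logVar, dif_pos h]
  exact log_increment_unique _ _ (fun t => by rw [h.choose_spec, hL]) _ _

theorem exp_logVar {e : C(ℝ, ℂ)} {p : ℂ} (h : ∀ t, e t ≠ p) :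
    Complex.exp (logVar e p) = (e 1 - p) / (e 0 - p) := by
  obtain ⟨L, hL⟩ := exists_continuous_log (⟨fun t => e t - p, by fun_prop⟩ : C(ℝ, ℂ))
    (fun t => sub_ne_zero.2 (h t)) 0
  rw [logVar_eq L hL, Complex.exp_sub, hL, hL]; rfl

/-- Reciprocity for disjoint curves: a continuous logarithm of `e t - p s` on the square has the
same total increment along both pairs of sides. -/
theorem logVar_reciprocity {e p : C(ℝ, ℂ)} (h : ∀ t s, e t ≠ p s) :
    logVar e (p 1) - logVar e (p 0) = logVar p (e 1) - logVar p (e 0) := by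
  obtain ⟨L, hL⟩ := exists_continuous_log
    (⟨fun z : ℝ × ℝ => e z.1 - p z.2, by fun_prop⟩ : C(ℝ × ℝ, ℂ))
    (fun z => sub_ne_zero.2 (h _ _)) (0, 0)
  have h1 : ∀ s, logVar e (p s) = L (1, s) - L (0, s) := fun s =>
    logVar_eq (⟨fun t => L (t, s), by fun_prop⟩ : C(ℝ, ℂ)) (fun t => hL (t, s))
  have h2 : ∀ t, logVar p (e t) = L (t, 1) - L (t, 0) := by
    intro t
    refine logVar_eq (L := (⟨fun s => L (t, s) + Real.pi * Complex.I, by fun_prop⟩ : C(ℝ, ℂ)))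
      (fun s => ?_) |>.trans (by simp)
    have := hL (t, s)
    simp only [ContinuousMap.coe_mk] at this ⊢
    rw [Complex.exp_add, this, Complex.exp_pi_mul_I]; ring
  rw [h1, h1, h2, h2]; ring

/-- Seen from a point `x` outside a disc that contains the curve, the increment of the logarithm
is given by the principal branch. -/
theorem logVar_far {e : C(ℝ, ℂ)} {x : ℂ} (h : ∀ t, ‖e t‖ < ‖x‖) :
    logVar e x = Complex.log (1 - e 1 / x) - Complex.log (1 - e 0 / x) := by
  have hx : x ≠ 0 := norm_pos_iff.1 ((norm_nonneg _).trans_lt (h 0))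
  have hlt : ∀ t, ‖e t / x‖ < 1 := fun t => by
    rw [norm_div, div_lt_one (norm_pos_iff.2 hx)]; exact h t
  have hs : ∀ t, 1 - e t / x ∈ Complex.slitPlane := by
    intro t
    refine Or.inl ?_
    have := (Complex.abs_re_le_norm (e t / x)).trans_lt (hlt t)
    simp only [Complex.sub_re, Complex.one_re]
    linarith [le_abs_self (e t / x).re]
  have hc : Continuous fun t => Complex.log (1 - e t / x) + Complex.log (-x) :=
    (Continuous.clog (by fun_prop) hs).add continuous_const
  refine (logVar_eq (⟨_, hc⟩ : C(ℝ, ℂ)) (fun t => ?_)).trans (by simp)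
  simp only [ContinuousMap.coe_mk]
  rw [Complex.exp_add, Complex.exp_log (Complex.slitPlane_ne_zero (hs t)),
    Complex.exp_log (neg_ne_zero.2 hx)]
  field_simp
  ring

/-- A closed one-chain of curves: the boundaries cancel. -/
def ClosedChain {ι : Type*} [Fintype ι] (c : ι → ℂ) (e : ι → C(ℝ, ℂ)) : Prop :=
  ∀ f : ℂ → ℂ, ∑ i, c i * (f (e i 1) - f (e i 0)) = 0

/-- The total increment of the logarithm along a closed chain, `2πi` times the winding number. -/
def winding {ι : Type*} [Fintype ι] (c : ι → ℂ) (e : ι → C(ℝ, ℂ)) (p : ℂ) : ℂ :=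
  ∑ i, c i * logVar (e i) p

/-- The winding number is constant along curves that avoid the chain. -/
theorem ClosedChain.winding_const {ι : Type*} [Fintype ι] {c : ι → ℂ} {e : ι → C(ℝ, ℂ)}
    (hc : ClosedChain c e) {p : C(ℝ, ℂ)} (h : ∀ i t s, e i t ≠ p s) :
    winding c e (p 1) = winding c e (p 0) := by
  rw [← sub_eq_zero, winding, winding, ← Finset.sum_sub_distrib, ← hc (logVar p)]
  refine Finset.sum_congr rfl fun i _ => ?_
  rw [← mul_sub, logVar_reciprocity (h i)]

theorem ClosedChain.winding_far {ι : Type*} [Fintype ι] {c : ι → ℂ} {e : ι → C(ℝ, ℂ)}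
    (hc : ClosedChain c e) {x : ℂ} (h : ∀ i t, ‖e i t‖ < ‖x‖) : winding c e x = 0 := by
  rw [winding, ← hc (fun y => Complex.log (1 - y / x))]
  exact Finset.sum_congr rfl fun i _ => by rw [logVar_far (h i)]

/-- A closed chain does not wind around a point from which a sequence of curves, disjoint from the
chain, leads to infinity. -/
theorem ClosedChain.winding_eq_zero {ι : Type*} [Fintype ι] {c : ι → ℂ} {e : ι → C(ℝ, ℂ)}
    (hc : ClosedChain c e) (hb : ∀ i, ∃ B, ∀ t, ‖e i t‖ ≤ B) (p : ℕ → C(ℝ, ℂ))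
    (hp : ∀ m, p m 1 = p (m + 1) 0) (hinf : Tendsto (fun m => ‖p m 0‖) atTop atTop)
    (h : ∀ m i t s, e i t ≠ p m s) : winding c e (p 0 0) = 0 := by
  choose B hB using hb
  have h1 : ∀ m, winding c e (p m 0) = winding c e (p 0 0) := by
    intro m
    induction m with
    | zero => rfl
    | succ m ih => rw [← ih, ← hp m, hc.winding_const (h m)]
  obtain ⟨m, hm⟩ := (hinf.eventually_gt_atTop (∑ i, |B i|)).exists
  rw [← h1 m]
  refine hc.winding_far fun i t => ((hB i t).trans (le_abs_self _)).trans_lt (lt_of_le_of_lt ?_ hm)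
  exact Finset.single_le_sum (f := fun i => |B i|) (fun i _ => abs_nonneg _) (Finset.mem_univ i)

/-- Moving the two ends of a chord of a four-cycle half way around the cycle turns the chord by an
odd multiple of `π`. -/
theorem exp_half_turn {e : Fin 4 → C(ℝ, ℂ)} (he : ∀ i, e i 1 = e (i + 1) 0)
    (h02 : ∀ t s, e 0 t ≠ e 2 s) (h13 : ∀ t s, e 1 t ≠ e 3 s) :
    Complex.exp (logVar (e 0) (e 2 0) + logVar (e 2) (e 1 0) + logVar (e 1) (e 3 0)
      + logVar (e 3) (e 2 0)) = -1 := by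
  have e0 : e 0 1 = e 1 0 := he 0
  have e1 : e 1 1 = e 2 0 := he 1
  have e2 : e 2 1 = e 3 0 := he 2
  have e3 : e 3 1 = e 0 0 := he 3
  rw [Complex.exp_add, Complex.exp_add, Complex.exp_add, exp_logVar (fun t => h02 t 0),
    exp_logVar (fun t => by rw [← e0]; exact (h02 1 t).symm), exp_logVar (fun t => h13 t 0),
    exp_logVar (fun t => by rw [← e1]; exact (h13 1 t).symm), e0, e1, e2, e3]
  have a1 : e 0 0 - e 2 0 ≠ 0 := sub_ne_zero.2 (h02 0 0)
  have a2 : e 2 0 - e 1 0 ≠ 0 := by rw [← e0]; exact sub_ne_zero.2 (h02 1 0).symm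
  have a3 : e 1 0 - e 3 0 ≠ 0 := sub_ne_zero.2 (h13 0 0)
  have a4 : e 3 0 - e 2 0 ≠ 0 := by rw [← e1]; exact sub_ne_zero.2 (h13 1 0).symm
  field_simp
  ring

/-- The rim of a wheel with four spokes, drawn so that opposite parts are disjoint and no triangle
winds around the opposite vertices, winds around the hub: by reciprocity, twice the total increment
of the logarithm seen from the hub is four times the increment in `exp_half_turn`, which is not
`0`. -/
theorem wheel_winding_ne_zero {e r : Fin 4 → C(ℝ, ℂ)} (he : ∀ i, e i 1 = e (i + 1) 0)
    (hr0 : ∀ i, r i 0 = r 0 0) (hr1 : ∀ i, r i 1 = e i 0)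
    (hee : ∀ i t s, e i t ≠ e (i + 2) s)
    (her2 : ∀ i t s, e i t ≠ r (i + 2) s) (her3 : ∀ i t s, e i t ≠ r (i + 3) s)
    (htri2 : ∀ i, logVar (r i) (e (i + 2) 0) + logVar (e i) (e (i + 2) 0)
      - logVar (r (i + 1)) (e (i + 2) 0) = 0)
    (htri3 : ∀ i, logVar (r i) (e (i + 3) 0) + logVar (e i) (e (i + 3) 0)
      - logVar (r (i + 1)) (e (i + 3) 0) = 0) :
    ∑ i, logVar (e i) (r 0 0) ≠ 0 := by
  have hH := exp_half_turn he (hee 0) (hee 1)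
  have e0 : e 0 1 = e 1 0 := he 0
  have e1 : e 1 1 = e 2 0 := he 1
  have e2 : e 2 1 = e 3 0 := he 2
  have e3 : e 3 1 = e 0 0 := he 3
  -- moving the hub along a spoke
  have m2 : ∀ i, logVar (e i) (e (i + 2) 0) - logVar (e i) (r 0 0)
      = logVar (r (i + 2)) (e i 1) - logVar (r (i + 2)) (e i 0) := fun i => by
    rw [← hr0 (i + 2), ← hr1 (i + 2)]; exact logVar_reciprocity (her2 i)
  have m3 : ∀ i, logVar (e i) (e (i + 3) 0) - logVar (e i) (r 0 0)
      = logVar (r (i + 3)) (e i 1) - logVar (r (i + 3)) (e i 0) := fun i => by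
    rw [← hr0 (i + 3), ← hr1 (i + 3)]; exact logVar_reciprocity (her3 i)
  have s0 := logVar_reciprocity (hee 0)
  have s1 := logVar_reciprocity (hee 1)
  have a0 := m2 0; have a1 := m2 1; have a2 := m2 2; have a3 := m2 3
  have b0 := m3 0; have b1 := m3 1; have b2 := m3 2; have b3 := m3 3
  have c0 := htri2 0; have c1 := htri2 1; have c2 := htri2 2; have c3 := htri2 3
  have d0 := htri3 0; have d1 := htri3 1; have d2 := htri3 2; have d3 := htri3 3
  simp only [Fin.isValue, zero_add, show (1 : Fin 4) + 1 = 2 from rfl,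
    show (1 : Fin 4) + 2 = 3 from rfl, show (1 : Fin 4) + 3 = 0 from rfl,
    show (2 : Fin 4) + 1 = 3 from rfl,
    show (2 : Fin 4) + 2 = 0 from rfl, show (2 : Fin 4) + 3 = 1 from rfl,
    show (3 : Fin 4) + 1 = 0 from rfl,
    show (3 : Fin 4) + 2 = 1 from rfl, show (3 : Fin 4) + 3 = 2 from rfl, e0, e1, e2, e3] at *
  intro hS
  rw [Fin.sum_univ_four] at hS
  have h0 : logVar (e 0) (e 2 0) + logVar (e 2) (e 1 0) + logVar (e 1) (e 3 0)
      + logVar (e 3) (e 2 0) = 0 := by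
    have key : 4 * (logVar (e 0) (e 2 0) + logVar (e 2) (e 1 0) + logVar (e 1) (e 3 0)
      + logVar (e 3) (e 2 0)) = 2 * (logVar (e 0) (r 0 0) + logVar (e 1) (r 0 0)
      + logVar (e 2) (r 0 0) + logVar (e 3) (r 0 0)) := by
      linear_combination a0+a1+a2+a3+b0+b1+b2+b3+c0+c1+c2+c3+d0+d1+d2+d3-2*s0-2*s1
    rw [hS] at key
    simpa using key
  rw [h0, Complex.exp_zero] at hH
  norm_num at hH

/-! ### Geodesics between fixed points as planar curves -/

@[simp] theorem pt_zero (x y : ℝ) : pt x y 0 = x := rfl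
@[simp] theorem pt_one (x y : ℝ) : pt x y 1 = y := rfl

theorem dist_plane (a b : Plane) : dist a b = √((a 0 - b 0) ^ 2 + (a 1 - b 1) ^ 2) := by
  simp [EuclideanSpace.dist_eq, Real.dist_eq, Fin.sum_univ_two, sq_abs]

theorem norm_plane (a : Plane) : ‖a‖ = √(a 0 ^ 2 + a 1 ^ 2) := by
  simp [EuclideanSpace.norm_eq, Fin.sum_univ_two, Real.norm_eq_abs, sq_abs]

/-- The plane as the complex plane. -/
def toC (z : Plane) : ℂ := ⟨z 0, z 1⟩

theorem continuous_toC : Continuous toC := by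
  have : toC = fun z : Plane => ((z 0 : ℝ) : ℂ) + ((z 1 : ℝ) : ℂ) * Complex.I := by
    funext z; apply Complex.ext <;> simp [toC]
  rw [this]; fun_prop

theorem toC_injective : Function.Injective toC := by
  intro a b h
  ext i
  fin_cases i
  · exact congrArg Complex.re h
  · exact congrArg Complex.im h

theorem norm_toC (z : Plane) : ‖toC z‖ = ‖z‖ := by
  rw [norm_plane, Complex.norm_def, Complex.normSq_apply]; simp [toC, sq]

/-- A path on `[0, 1]` as a curve in the complex plane, constant outside `[0, 1]`. -/
def curve (γ : PlanePath) : C(ℝ, ℂ) :=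
  ⟨fun t => toC (γ (Set.projIcc 0 1 zero_le_one t)),
    continuous_toC.comp (γ.continuous.comp continuous_projIcc)⟩

@[simp] theorem curve_zero (γ : PlanePath) : curve γ 0 = toC (γ 0) := by
  simp [curve]
@[simp] theorem curve_one (γ : PlanePath) : curve γ 1 = toC (γ 1) := by
  simp [curve]

theorem curve_ne {γ γ' : PlanePath} (h : ∀ t s, γ t ≠ γ' s) (t s : ℝ) :
    curve γ t ≠ curve γ' s := fun h' => h _ _ (toC_injective h')

theorem curve_bdd (γ : PlanePath) : ∃ B, ∀ t, ‖curve γ t‖ ≤ B := by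
  obtain ⟨B, hB⟩ := (isCompact_range (γ.continuous.norm)).bddAbove
  exact ⟨B, fun t => by
    simp only [curve, ContinuousMap.coe_mk, norm_toC]; exact hB ⟨_, rfl⟩⟩

/-- The part of a path up to the time `t₀`. -/
def initialPart (γ : PlanePath) (t₀ : unitInterval) : PlanePath :=
  ⟨fun t => γ (t * t₀), γ.continuous.comp (by fun_prop)⟩

/-- The first coordinates of the corners of the square of half side `1`, in cyclic order. -/
def cornerX : Fin 4 → ℤ := ![1, -1, -1, 1]
/-- The second coordinates of the corners, see `cornerX`. -/
def cornerY : Fin 4 → ℤ := ![1, 1, -1, -1]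

/-- The points `4 ^ m s` times the corners of the unit square, around the lattice point `o`. -/
def hopPt (o : ℤ × ℤ) (s : ℕ) (i : Fin 4) (m : ℕ) : Plane :=
  pt (o.1 + 4 ^ m * s * cornerX i) (o.2 + 4 ^ m * s * cornerY i)

/-- Quantitative geometry of one realisation: `X` is the passage time, `G` the choice of optimal
paths, `D` a set of fixed points. At the scale `4 ^ m s` passage times between fixed points are
close to `μ` times the distance, and the points of an optimal path are almost aligned. -/
structure Controlled (X : Plane → Plane → ℝ≥0∞) (G : Plane → Plane → PlanePath) (D : Set Plane)
    (R μ : ℝ) (s : ℕ) : Prop where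
  mu_pos : 0 < μ
  ten_le : (10 : ℝ) ≤ s
  scale_le : (s : ℝ) ≤ R
  dense : ∀ z : Plane, ∀ δ > 0, ∃ k ∈ D, dist z k < δ
  tri : ∀ u v w, X u v ≤ X u w + X w v
  symm : ∀ u v, X u v = X v u
  ends : ∀ u v, G u v 0 = u ∧ G u v 1 = v
  lattice : ∀ i j : ℤ, pt i j ∈ D
  fin : ∀ a ∈ D, ∀ b ∈ D, X a b ≠ ⊤
  near : ∀ m : ℕ, ∀ a ∈ D, ∀ b ∈ D, ‖a‖ < 40 * 4 ^ m * R → ‖b‖ < 40 * 4 ^ m * R →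
    dist a b ≤ 100 * 4 ^ m * s → |(X a b).toReal - μ * dist a b| ≤ μ / 1000 * (4 ^ m * s)
  align : ∀ m : ℕ, ∀ u ∈ D, ∀ v ∈ D, ‖u‖ < 40 * 4 ^ m * R → ‖v‖ < 40 * 4 ^ m * R →
    ∀ t₁ t₂ t₃ : unitInterval, t₁ < t₂ → t₂ < t₃ →
    X (G u v t₁) (G u v t₂) + X (G u v t₂) (G u v t₃)
      ≤ X (G u v t₁) (G u v t₃) + ENNReal.ofReal (μ / 1000 * (4 ^ m * s))

namespace Controlled

variable {X : Plane → Plane → ℝ≥0∞} {G : Plane → Plane → PlanePath} {D : Set Plane}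
  {R μ : ℝ} {s : ℕ}

/-- Alignment of the two end points with an arbitrary point of an optimal path. -/
theorem align_ends (h : Controlled X G D R μ s) {m : ℕ} {u v : Plane} (hu : u ∈ D)
    (hv : v ∈ D)
    (hu' : ‖u‖ < 40 * 4 ^ m * R) (hv' : ‖v‖ < 40 * 4 ^ m * R) (t : unitInterval) :
    X u (G u v t) + X (G u v t) v ≤ X u v + ENNReal.ofReal (μ / 1000 * (4 ^ m * s)) := by
  have hμ := h.mu_pos
  have self : ∀ a ∈ D, ‖a‖ < 40 * 4 ^ m * R → X a a ≤ ENNReal.ofReal (μ / 1000 * (4 ^ m * s)) := by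
    intro a ha ha'
    have := h.near m a ha a ha ha' ha' (by rw [dist_self]; positivity)
    rw [dist_self, mul_zero, sub_zero] at this
    rw [← ENNReal.ofReal_toReal (h.fin a ha a ha)]
    exact ENNReal.ofReal_le_ofReal ((le_abs_self _).trans this)
  rcases eq_or_lt_of_le (show (0 : unitInterval) ≤ t from t.2.1) with h0 | h0
  · rw [← h0, (h.ends u v).1, add_comm]
    exact add_le_add le_rfl (self u hu hu')
  rcases eq_or_lt_of_le (show t ≤ (1 : unitInterval) from t.2.2) with h1 | h1
  · rw [h1, (h.ends u v).2]
    exact add_le_add le_rfl (self v hv hv')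
  simpa [(h.ends u v).1, (h.ends u v).2] using h.align m u hu v hv hu' hv' 0 t 1 h0 h1

/-- Two pairs of fixed points whose optimal passage times are both nearly attained through a common
point `w` cannot be re-paired so as to lengthen the segments. -/
theorem exchange_lt (h : Controlled X G D R μ s) {m : ℕ} {a b c d w : Plane}
    (ha : a ∈ D) (hb : b ∈ D) (hc : c ∈ D) (hd : d ∈ D)
    (ha' : ‖a‖ < 40 * 4 ^ m * R) (hb' : ‖b‖ < 40 * 4 ^ m * R)
    (hc' : ‖c‖ < 40 * 4 ^ m * R) (hd' : ‖d‖ < 40 * 4 ^ m * R)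
    (hab : dist a b ≤ 100 * 4 ^ m * s) (hcd : dist c d ≤ 100 * 4 ^ m * s)
    (hac : dist a c ≤ 100 * 4 ^ m * s) (hbd : dist b d ≤ 100 * 4 ^ m * s)
    (hlt : dist a b + dist c d + 1 / 100 * (4 ^ m * s) ≤ dist a c + dist b d)
    (h1 : X a w + X w b ≤ X a b + ENNReal.ofReal (μ / 1000 * (4 ^ m * s)))
    (h2 : X c w + X w d ≤ X c d + ENNReal.ofReal (μ / 1000 * (4 ^ m * s))) : False := by
  have hμ := h.mu_pos
  have hs : (0 : ℝ) < s := by linarith [h.ten_le]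
  have h3 : X a c + X b d ≤ X a b + X c d + ENNReal.ofReal (μ / 1000 * (4 ^ m * s))
      + ENNReal.ofReal (μ / 1000 * (4 ^ m * s)) := by
    calc X a c + X b d ≤ (X a w + X w c) + (X b w + X w d) := add_le_add (h.tri _ _ _) (h.tri _ _ _)
      _ = (X a w + X w b) + (X c w + X w d) := by rw [h.symm w c, h.symm b w]; ring
      _ ≤ _ := (add_le_add h1 h2).trans (le_of_eq (by ring))
  have e1 := abs_le.1 (h.near m a ha b hb ha' hb' hab)
  have e2 := abs_le.1 (h.near m c hc d hd hc' hd' hcd)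
  have e3 := abs_le.1 (h.near m a ha c hc ha' hc' hac)
  have e4 := abs_le.1 (h.near m b hb d hd hb' hd' hbd)
  have hpos : (0 : ℝ) < 4 ^ m * s := by positivity
  have h4 := (ENNReal.toReal_le_toReal (by finiteness [h.fin a ha c hc, h.fin b hb d hd])
    (by finiteness [h.fin a ha b hb, h.fin c hc d hd])).2 h3
  have f1 := h.fin a ha c hc
  have f2 := h.fin b hb d hd
  have f3 := h.fin a ha b hb
  have f4 := h.fin c hc d hd
  rw [ENNReal.toReal_add f1 f2, ENNReal.toReal_add (by finiteness) (by finiteness),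
    ENNReal.toReal_add (by finiteness) (by finiteness), ENNReal.toReal_add f3 f4,
    ENNReal.toReal_ofReal (by positivity)] at h4
  nlinarith [mul_pos hμ hpos]

/-- Two optimal paths between fixed points do not meet if exchanging their end points
lengthens the segments. -/
theorem disjoint (h : Controlled X G D R μ s) {m : ℕ} {a b c d : Plane}
    (ha : a ∈ D) (hb : b ∈ D) (hc : c ∈ D) (hd : d ∈ D)
    (ha' : ‖a‖ < 40 * 4 ^ m * R) (hb' : ‖b‖ < 40 * 4 ^ m * R)
    (hc' : ‖c‖ < 40 * 4 ^ m * R) (hd' : ‖d‖ < 40 * 4 ^ m * R)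
    (hab : dist a b ≤ 100 * 4 ^ m * s) (hcd : dist c d ≤ 100 * 4 ^ m * s)
    (hac : dist a c ≤ 100 * 4 ^ m * s) (hbd : dist b d ≤ 100 * 4 ^ m * s)
    (hlt : dist a b + dist c d + 1 / 100 * (4 ^ m * s) ≤ dist a c + dist b d)
    (t t' : unitInterval) : G a b t ≠ G c d t' := by
  intro he
  have h1 := h.align_ends ha hb ha' hb' t
  have h2 := h.align_ends hc hd hc' hd' t'
  rw [← he] at h2
  exact h.exchange_lt ha hb hc hd ha' hb' hc' hd' hab hcd hac hbd hlt h1 h2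

/-- Two optimal paths between fixed points do not meet if exchanging their end points
lengthens the segments; the other way of pairing the end points. -/
theorem disjoint' (h : Controlled X G D R μ s) {m : ℕ} {a b c d : Plane}
    (ha : a ∈ D) (hb : b ∈ D) (hc : c ∈ D) (hd : d ∈ D)
    (ha' : ‖a‖ < 40 * 4 ^ m * R) (hb' : ‖b‖ < 40 * 4 ^ m * R)
    (hc' : ‖c‖ < 40 * 4 ^ m * R) (hd' : ‖d‖ < 40 * 4 ^ m * R)
    (hab : dist a b ≤ 100 * 4 ^ m * s) (hcd : dist c d ≤ 100 * 4 ^ m * s)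
    (had : dist a d ≤ 100 * 4 ^ m * s) (hbc : dist b c ≤ 100 * 4 ^ m * s)
    (hlt : dist a b + dist c d + 1 / 100 * (4 ^ m * s) ≤ dist a d + dist b c)
    (t t' : unitInterval) : G a b t ≠ G c d t' := by
  intro he
  set w := G a b t with hw
  have h1 := h.align_ends ha hb ha' hb' t
  have h2 := h.align_ends hc hd hc' hd' t'
  rw [← hw] at h1
  rw [← he] at h2
  refine h.exchange_lt (m := m) ha hb hd hc ha' hb' hd' hc' hab (by rwa [dist_comm]) had hbc
    (by rwa [dist_comm d c]) (w := w) h1 ?_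
  rw [h.symm d w, h.symm w c, h.symm d c, add_comm]
  exact h2

end Controlled

/-! ### The square around a lattice point -/

theorem cornerX_sq (i : Fin 4) : ((cornerX i : ℤ) : ℝ) ^ 2 = 1 := by
  fin_cases i <;> simp [cornerX]
theorem cornerY_sq (i : Fin 4) : ((cornerY i : ℤ) : ℝ) ^ 2 = 1 := by
  fin_cases i <;> simp [cornerY]

@[simp] theorem hopPt_zero (o : ℤ × ℤ) (s : ℕ) (i : Fin 4) (m : ℕ) :
    hopPt o s i m 0 = o.1 + 4 ^ m * s * cornerX i := rfl
@[simp] theorem hopPt_one (o : ℤ × ℤ) (s : ℕ) (i : Fin 4) (m : ℕ) :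
    hopPt o s i m 1 = o.2 + 4 ^ m * s * cornerY i := rfl

/-- The lattice point `o` in the plane. -/
def latticePt (o : ℤ × ℤ) : Plane := pt o.1 o.2

@[simp] theorem latticePt_zero (o : ℤ × ℤ) : latticePt o 0 = o.1 := rfl
@[simp] theorem latticePt_one (o : ℤ × ℤ) : latticePt o 1 = o.2 := rfl

theorem exists_lattice_near (z : Plane) : ∃ o : ℤ × ℤ, dist z (latticePt o) ≤ 1 := by
  refine ⟨(round (z 0), round (z 1)), ?_⟩
  rw [dist_plane, Real.sqrt_le_iff]
  refine ⟨zero_le_one, ?_⟩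
  have h0 := abs_le.1 (abs_sub_round (z 0))
  have h1 := abs_le.1 (abs_sub_round (z 1))
  simp only [latticePt_zero, latticePt_one]
  nlinarith

/-- The distance dominates the component along a diagonal direction. -/
theorem diag_le_dist (a b : Plane) (i : Fin 4) :
    cornerX i * (b 0 - a 0) + cornerY i * (b 1 - a 1) ≤ √2 * dist a b := by
  rw [dist_plane, ← Real.sqrt_mul (by norm_num)]
  refine Real.le_sqrt_of_sq_le ?_
  have hx := cornerX_sq i
  have hy := cornerY_sq i
  nlinarith [sq_nonneg (cornerX i * (b 1 - a 1) - cornerY i * (b 0 - a 0))]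

theorem sqrt_two_bounds : 1.414 < √2 ∧ √2 < 1.415 := by
  constructor
  · rw [Real.lt_sqrt] <;> norm_num
  · rw [Real.sqrt_lt'] <;> norm_num

theorem dist_hopPt_center (o : ℤ × ℤ) (s : ℕ) (i : Fin 4) (m : ℕ) :
    dist (hopPt o s i m) (latticePt o) = √2 * (4 ^ m * s) := by
  rw [dist_plane]
  simp only [hopPt_zero, hopPt_one, latticePt_zero, latticePt_one]
  rw [show ((o.1 : ℝ) + 4 ^ m * s * cornerX i - o.1) ^ 2 + (o.2 + 4 ^ m * s * cornerY i - o.2) ^ 2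
    = 2 * (4 ^ m * s) ^ 2 by
      have hx := cornerX_sq i
      have hy := cornerY_sq i
      linear_combination (4 ^ m * (s:ℝ)) ^ 2 * hx + (4 ^ m * (s:ℝ)) ^ 2 * hy]
  rw [Real.sqrt_mul (by norm_num), Real.sqrt_sq (by positivity)]

theorem dist_hopPt_succ (o : ℤ × ℤ) (s : ℕ) (i : Fin 4) (m : ℕ) :
    dist (hopPt o s i m) (hopPt o s i (m + 1)) = √2 * (3 * (4 ^ m * s)) := by
  rw [dist_plane]
  simp only [hopPt_zero, hopPt_one]
  rw [show ((o.1 : ℝ) + 4 ^ m * s * cornerX i - (o.1 + 4 ^ (m + 1) * s * cornerX i)) ^ 2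
      + (o.2 + 4 ^ m * s * cornerY i - (o.2 + 4 ^ (m + 1) * s * cornerY i)) ^ 2
    = 2 * (3 * (4 ^ m * s)) ^ 2 by
      have hx := cornerX_sq i
      have hy := cornerY_sq i
      rw [pow_succ]
      linear_combination (3 * 4 ^ m * (s:ℝ)) ^ 2 * hx + (3 * 4 ^ m * (s:ℝ)) ^ 2 * hy]
  rw [Real.sqrt_mul (by norm_num), Real.sqrt_sq (by positivity)]

theorem dist_corners (o : ℤ × ℤ) (s : ℕ) (i j : Fin 4) :
    dist (hopPt o s i 0) (hopPt o s j 0) ≤ √2 * (2 * s) := by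
  have h := dist_triangle (hopPt o s i 0) (latticePt o) (hopPt o s j 0)
  rw [dist_comm (latticePt o), dist_hopPt_center, dist_hopPt_center] at h
  calc _ ≤ _ := h
    _ = _ := by ring

theorem dist_corners_succ (o : ℤ × ℤ) (s : ℕ) (i : Fin 4) :
    dist (hopPt o s i 0) (hopPt o s (i + 1) 0) = 2 * s := by
  rw [dist_plane, Real.sqrt_eq_iff_mul_self_eq (by positivity) (by positivity)]
  simp only [hopPt_zero, hopPt_one, pow_zero, one_mul]
  fin_cases i <;> simp [cornerX, cornerY] <;> ring

theorem dist_corners_opp (o : ℤ × ℤ) (s : ℕ) (i : Fin 4) :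
    dist (hopPt o s i 0) (hopPt o s (i + 2) 0) = √2 * (2 * s) := by
  rw [dist_plane, Real.sqrt_eq_iff_mul_self_eq (by positivity) (by positivity)]
  have : √2 * √2 = 2 := Real.mul_self_sqrt (by norm_num)
  rw [show √2 * (2 * (s : ℝ)) * (√2 * (2 * s)) = 4 * s ^ 2 * (√2 * √2) by ring, this]
  simp only [hopPt_zero, hopPt_one, pow_zero, one_mul]
  fin_cases i <;> simp [cornerX, cornerY] <;> ring

namespace Controlled

variable {X : Plane → Plane → ℝ≥0∞} {G : Plane → Plane → PlanePath} {D : Set Plane}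
  {R μ : ℝ} {s : ℕ}

theorem hopPt_mem (h : Controlled X G D R μ s) (o : ℤ × ℤ) (i : Fin 4) (m : ℕ) :
    hopPt o s i m ∈ D := by
  have := h.lattice (o.1 + 4 ^ m * s * cornerX i) (o.2 + 4 ^ m * s * cornerY i)
  push_cast at this
  exact this

theorem hopPt_norm (h : Controlled X G D R μ s) {o : ℤ × ℤ} (ho : ‖latticePt o‖ ≤ 12 * R)
    (i : Fin 4) (m : ℕ) : ‖hopPt o s i m‖ ≤ 12 * R + 3 / 2 * 4 ^ m * R := by
  have h1 : ‖hopPt o s i m‖ ≤ ‖latticePt o‖ + dist (hopPt o s i m) (latticePt o) := by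
    rw [dist_eq_norm]; simpa using norm_add_le (latticePt o) (hopPt o s i m - latticePt o)
  rw [dist_hopPt_center] at h1
  have h2 := sqrt_two_bounds
  have h3 : (1 : ℝ) ≤ 4 ^ m := one_le_pow₀ (by norm_num)
  have h4 := h.ten_le
  have h5 := h.scale_le
  have h6 : (4 : ℝ) ^ m * s ≤ 4 ^ m * R := by gcongr
  have h7 : √2 * (4 ^ m * s) ≤ 1.415 * (4 ^ m * s) := by gcongr; exact h2.2.le
  have h8 : R ≤ 4 ^ m * R := le_mul_of_one_le_left (by linarith) h3
  linarith

/-- The outward optimal path from `y_m = hopPt o s i m` to `y_{m + 1}` does not meet the optimal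
path from `a` to `b` if these points are not too far in the direction of the corner `i`. -/
theorem hop_disjoint (h : Controlled X G D R μ s) {o : ℤ × ℤ} (ho : ‖latticePt o‖ ≤ 12 * R)
    (i : Fin 4) (m : ℕ) {a b : Plane} (ha : a ∈ D) (hb : b ∈ D)
    (hao : dist a (latticePt o) ≤ 2 * s) (hbo : dist b (latticePt o) ≤ 2 * s)
    (hab : cornerX i * (a 0 - o.1) + cornerY i * (a 1 - o.2)
      + (cornerX i * (b 0 - o.1) + cornerY i * (b 1 - o.2)) + √2 * dist a b ≤ 3.9 * (4 ^ m * s))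
    (t t' : unitInterval) : G a b t ≠ G (hopPt o s i m) (hopPt o s i (m + 1)) t' := by
  have h2 := sqrt_two_bounds
  have h3 : (1 : ℝ) ≤ 4 ^ m := one_le_pow₀ (by norm_num)
  have h4 := h.ten_le
  have h5 := h.scale_le
  have h6 : (s : ℝ) ≤ 4 ^ m * s := le_mul_of_one_le_left (by linarith) h3
  have h6' : R ≤ 4 ^ m * R := le_mul_of_one_le_left (by linarith) h3
  have nrm : ∀ {c : Plane}, dist c (latticePt o) ≤ 2 * s → ‖c‖ < 40 * 4 ^ m * R := by
    intro c hc
    have : ‖c‖ ≤ ‖latticePt o‖ + dist c (latticePt o) := by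
      rw [dist_eq_norm]; simpa using norm_add_le (latticePt o) (c - latticePt o)
    linarith
  have ny0 := h.hopPt_norm ho i m
  have ny1 := h.hopPt_norm ho i (m + 1)
  have dy0 := dist_hopPt_center o s i m
  have dy1 := dist_hopPt_center o s i (m + 1)
  have dyy := dist_hopPt_succ o s i m
  have tab := dist_triangle_right a b (latticePt o)
  have ty0 := dist_triangle_right a (hopPt o s i m) (latticePt o)
  have ty1 := dist_triangle_right b (hopPt o s i (m + 1)) (latticePt o)
  have l0 := diag_le_dist a (hopPt o s i m) i
  have l1 := diag_le_dist b (hopPt o s i (m + 1)) i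
  simp only [hopPt_zero, hopPt_one] at l0 l1
  have hx := cornerX_sq i
  have hy := cornerY_sq i
  rw [pow_succ] at ny1 dy1
  have hR : (0 : ℝ) < 4 ^ m * R := by linarith
  set S : ℝ := 4 ^ m * s with hS
  have hS' : (4 : ℝ) ^ m * 4 * s = 4 * S := by rw [hS]; ring
  have e0 : cornerX i * ((o.1 : ℝ) + S * cornerX i - a 0) + cornerY i * (o.2 + S * cornerY i - a 1)
      = 2 * S - (cornerX i * (a 0 - o.1) + cornerY i * (a 1 - o.2)) := by
    linear_combination S * hx + S * hy
  have e1 : cornerX i * ((o.1 : ℝ) + 4 ^ (m + 1) * s * cornerX i - b 0)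
      + cornerY i * (o.2 + 4 ^ (m + 1) * s * cornerY i - b 1)
      = 8 * S - (cornerX i * (b 0 - o.1) + cornerY i * (b 1 - o.2)) := by
    rw [pow_succ, hS']
    linear_combination 4 * S * hx + 4 * S * hy
  rw [e0] at l0
  rw [e1] at l1
  rw [hS'] at dy1
  have hS0 : 0 < S := by linarith
  have r1 : √2 * S ≤ 1.415 * S := by gcongr; exact h2.2.le
  have key : √2 * (dist a b + dist (hopPt o s i m) (hopPt o s i (m + 1)) + 1 / 100 * S)
      ≤ √2 * (dist a (hopPt o s i m) + dist b (hopPt o s i (m + 1))) := by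
    have : √2 * √2 = 2 := Real.mul_self_sqrt (by norm_num)
    have e : √2 * (√2 * (3 * S)) = 6 * S := by linear_combination 3 * S * this
    rw [mul_add, mul_add, mul_add, dyy, e]
    linarith
  have h100 : (100 : ℝ) * 4 ^ m * s = 100 * S := by rw [hS]; ring
  refine h.disjoint (m := m) ha hb (h.hopPt_mem o i m) (h.hopPt_mem o i (m + 1)) (nrm hao) (nrm hbo)
    (by linarith) (by linarith) ?_ ?_ ?_ ?_ (le_of_mul_le_mul_left key (by linarith)) t t'
  all_goals rw [h100]; linarith

theorem side_hop_disjoint (h : Controlled X G D R μ s) {o : ℤ × ℤ} (ho : ‖latticePt o‖ ≤ 12 * R)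
    (i j : Fin 4) (m : ℕ) (hm : 1 ≤ m ∨ (i ≠ j ∧ i ≠ j + 1)) (t t' : unitInterval) :
    G (hopPt o s j 0) (hopPt o s (j + 1) 0) t ≠ G (hopPt o s i m) (hopPt o s i (m + 1)) t' := by
  have h2 := sqrt_two_bounds
  have h4 := h.ten_le
  have dc : ∀ l, dist (hopPt o s l 0) (latticePt o) ≤ 2 * s := fun l => by
    rw [dist_hopPt_center, pow_zero, one_mul]; nlinarith
  refine h.hop_disjoint ho i m (h.hopPt_mem o j 0) (h.hopPt_mem o (j + 1) 0) (dc _) (dc _) ?_ t t'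
  rw [dist_corners_succ]
  simp only [hopPt_zero, hopPt_one, pow_zero, one_mul, add_sub_cancel_left]
  rcases hm with hm | ⟨hm1, hm2⟩
  · have h3 : (4 : ℝ) ≤ 4 ^ m := by
      calc (4 : ℝ) = 4 ^ 1 := by norm_num
        _ ≤ 4 ^ m := pow_le_pow_right₀ (by norm_num) hm
    have : (cornerX i : ℝ) * (s * cornerX j) + cornerY i * (s * cornerY j)
      + (cornerX i * (s * cornerX (j + 1)) + cornerY i * (s * cornerY (j + 1))) ≤ 2 * s := by
      fin_cases i <;> fin_cases j <;> simp [cornerX, cornerY] <;> linarith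
    nlinarith
  · have h3 : (1 : ℝ) ≤ 4 ^ m := one_le_pow₀ (by norm_num)
    have : (cornerX i : ℝ) * (s * cornerX j) + cornerY i * (s * cornerY j)
      + (cornerX i * (s * cornerX (j + 1)) + cornerY i * (s * cornerY (j + 1))) ≤ 0 := by
      fin_cases i <;> fin_cases j <;> simp_all [cornerX, cornerY]
    nlinarith

theorem spoke_hop_disjoint (h : Controlled X G D R μ s) {o : ℤ × ℤ}
    (ho : ‖latticePt o‖ ≤ 12 * R) {k : Plane} (hk : k ∈ D) (hko : dist k (latticePt o) ≤ 2)
    (i j : Fin 4) (m : ℕ) (hij : i ≠ j) (t t' : unitInterval) :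
    G k (hopPt o s j 0) t ≠ G (hopPt o s i m) (hopPt o s i (m + 1)) t' := by
  have h2 := sqrt_two_bounds
  have h4 := h.ten_le
  have dc : dist (hopPt o s j 0) (latticePt o) = √2 * s := by
    rw [dist_hopPt_center, pow_zero, one_mul]
  refine h.hop_disjoint ho i m hk (h.hopPt_mem o j 0) (by linarith) (by nlinarith) ?_ t t'
  have l0 := diag_le_dist (latticePt o) k i
  have l1 := dist_triangle_right k (hopPt o s j 0) (latticePt o)
  rw [dist_comm] at l0
  simp only [hopPt_zero, hopPt_one, pow_zero, one_mul, add_sub_cancel_left, latticePt_zero,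
    latticePt_one] at l0 ⊢
  have h3 : (1 : ℝ) ≤ 4 ^ m := one_le_pow₀ (by norm_num)
  have : (cornerX i : ℝ) * (s * cornerX j) + cornerY i * (s * cornerY j) ≤ 0 := by
    fin_cases i <;> fin_cases j <;> simp_all [cornerX, cornerY]
  have h5 : √2 * √2 = 2 := Real.mul_self_sqrt (by norm_num)
  rw [dc] at l1
  have h6 : √2 * dist k (hopPt o s j 0) ≤ 1.415 * 2 + 2 * s := by
    calc _ ≤ √2 * (2 + √2 * s) := by gcongr; linarith
      _ = √2 * 2 + 2 * s := by linear_combination s * h5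
      _ ≤ _ := by linarith
  nlinarith [dist_nonneg (x := k) (y := latticePt o)]

end Controlled

/-! ### Winding numbers of squares of optimal paths -/

/-- The side `c_i → c_{i+1}` of the square of optimal paths around `o`, as a planar curve. -/
def rim (G : Plane → Plane → PlanePath) (o : ℤ × ℤ) (s : ℕ) (i : Fin 4) : C(ℝ, ℂ) :=
  curve (G (hopPt o s i 0) (hopPt o s (i + 1) 0))

/-- The optimal path from the hub `k` to the corner `c_i`, as a planar curve. -/
def spoke (G : Plane → Plane → PlanePath) (o : ℤ × ℤ) (s : ℕ) (k : Plane) (i : Fin 4) : C(ℝ, ℂ) :=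
  curve (G k (hopPt o s i 0))

namespace Controlled

variable {X : Plane → Plane → ℝ≥0∞} {G : Plane → Plane → PlanePath} {D : Set Plane}
  {R μ : ℝ} {s : ℕ}

theorem rim_zero (h : Controlled X G D R μ s) (o : ℤ × ℤ) (i : Fin 4) :
    rim G o s i 0 = toC (hopPt o s i 0) := by simp [rim, h.ends]
theorem rim_one (h : Controlled X G D R μ s) (o : ℤ × ℤ) (i : Fin 4) :
    rim G o s i 1 = toC (hopPt o s (i + 1) 0) := by simp [rim, h.ends]
theorem spoke_zero (h : Controlled X G D R μ s) (o : ℤ × ℤ) (k : Plane) (i : Fin 4) :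
    spoke G o s k i 0 = toC k := by simp [spoke, h.ends]
theorem spoke_one (h : Controlled X G D R μ s) (o : ℤ × ℤ) (k : Plane) (i : Fin 4) :
    spoke G o s k i 1 = toC (hopPt o s i 0) := by simp [spoke, h.ends]

theorem norm_of_near_center (h : Controlled X G D R μ s) {o : ℤ × ℤ}
    (ho : ‖latticePt o‖ ≤ 12 * R) {c : Plane} (m : ℕ)
    (hc : dist c (latticePt o) ≤ 3 / 2 * (4 ^ m * s)) :
    ‖c‖ < 40 * 4 ^ m * R := by
  have h3 : (1 : ℝ) ≤ 4 ^ m := one_le_pow₀ (by norm_num)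
  have h4 := h.ten_le
  have h5 := h.scale_le
  have h6 : (4 : ℝ) ^ m * s ≤ 4 ^ m * R := by gcongr
  have h8 : R ≤ 4 ^ m * R := le_mul_of_one_le_left (by linarith) h3
  have : ‖c‖ ≤ ‖latticePt o‖ + dist c (latticePt o) := by
    rw [dist_eq_norm]; simpa using norm_add_le (latticePt o) (c - latticePt o)
  linarith

theorem dist_corner_center (h : Controlled X G D R μ s) (o : ℤ × ℤ) (i : Fin 4) :
    dist (hopPt o s i 0) (latticePt o) ≤ 3 / 2 * (4 ^ 0 * s) := by
  have h2 := sqrt_two_bounds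
  have h4 := h.ten_le
  rw [dist_hopPt_center]
  gcongr
  linarith

theorem sides_disjoint (h : Controlled X G D R μ s) {o : ℤ × ℤ} (ho : ‖latticePt o‖ ≤ 12 * R)
    (i : Fin 4) (t t' : ℝ) : rim G o s i t ≠ rim G o s (i + 2) t' := by
  have h2 := sqrt_two_bounds
  have h4 := h.ten_le
  have nc := fun l => h.norm_of_near_center ho 0 (h.dist_corner_center o l)
  have d1 := dist_corners_succ o s i
  have d2 := dist_corners_succ o s (i + 2)
  have d3 := dist_corners_opp o s i
  have d4 := dist_corners_opp o s (i + 1)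
  rw [show i + 1 + 2 = i + 2 + 1 by fin_cases i <;> rfl] at d4
  have r1 : √2 * s ≤ 1.415 * s := by gcongr; exact h2.2.le
  have r2 : 1.414 * s ≤ √2 * s := by gcongr; exact h2.1.le
  refine curve_ne (h.disjoint (m := 0) (h.hopPt_mem o _ 0) (h.hopPt_mem o _ 0) (h.hopPt_mem o _ 0)
    (h.hopPt_mem o _ 0) (nc _) (nc _) (nc _) (nc _) ?_ ?_ ?_ ?_ ?_) t t'
  all_goals linarith

theorem side_spoke_disjoint (h : Controlled X G D R μ s) {o : ℤ × ℤ}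
    (ho : ‖latticePt o‖ ≤ 12 * R) {k : Plane} (hk : k ∈ D) (hko : dist k (latticePt o) ≤ 2)
    (i : Fin 4) (t t' : ℝ) :
    rim G o s i t ≠ spoke G o s k (i + 2) t' ∧ rim G o s i t ≠ spoke G o s k (i + 3) t' := by
  have h2 := sqrt_two_bounds
  have h4 := h.ten_le
  have nc := fun l => h.norm_of_near_center ho 0 (h.dist_corner_center o l)
  have nk : ‖k‖ < 40 * 4 ^ 0 * R := h.norm_of_near_center ho 0 (by linarith)
  have d1 := dist_corners_succ o s i
  have d3 := dist_corners_opp o s i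
  have d4 := dist_corners_opp o s (i + 1)
  rw [show i + 1 + 2 = i + 3 by fin_cases i <;> rfl] at d4
  have r1 : √2 * s ≤ 1.415 * s := by gcongr; exact h2.2.le
  have r2 : 1.414 * s ≤ √2 * s := by gcongr; exact h2.1.le
  have ku : ∀ l, dist k (hopPt o s l 0) ≤ 2 + √2 * s := fun l => by
    have := dist_triangle_right k (hopPt o s l 0) (latticePt o)
    rw [dist_hopPt_center, pow_zero, one_mul] at this
    linarith
  have kl : ∀ l, √2 * s - 2 ≤ dist k (hopPt o s l 0) := fun l => by
    have := dist_triangle_left (hopPt o s l 0) (latticePt o) k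
    rw [dist_hopPt_center, pow_zero, one_mul] at this
    linarith
  have ku2 := ku (i + 2)
  have ku3 := ku (i + 3)
  have ku1 := ku (i + 1)
  have ku0 := ku i
  have kl1 := kl (i + 1)
  have kl0 := kl i
  constructor
  · refine curve_ne (h.disjoint' (m := 0) (h.hopPt_mem o _ 0) (h.hopPt_mem o _ 0) hk
      (h.hopPt_mem o _ 0) (nc _) (nc _) nk (nc _) ?_ ?_ ?_ ?_ ?_) t t'
    all_goals (try rw [dist_comm (hopPt o s (i + 1) 0) k]); linarith
  · refine curve_ne (h.disjoint (m := 0) (h.hopPt_mem o _ 0) (h.hopPt_mem o _ 0) hk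
      (h.hopPt_mem o _ 0) (nc _) (nc _) nk (nc _) ?_ ?_ ?_ ?_ ?_) t t'
    all_goals (try rw [dist_comm (hopPt o s i 0) k]); linarith

/-- The outward hops from a corner lead to infinity. -/
theorem tendsto_hopPt (h : Controlled X G D R μ s) (o : ℤ × ℤ) (i : Fin 4) :
    Tendsto (fun m => ‖toC (hopPt o s i m)‖) atTop atTop := by
  have h1 : ∀ m, (4 : ℝ) ^ m * s - ‖latticePt o‖ ≤ ‖toC (hopPt o s i m)‖ := by
    intro m
    rw [norm_toC]
    have h1 : dist (hopPt o s i m) (latticePt o) ≤ ‖hopPt o s i m‖ + ‖latticePt o‖ :=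
      dist_le_norm_add_norm _ _
    rw [dist_hopPt_center] at h1
    have : 1 * ((4 : ℝ) ^ m * s) ≤ √2 * (4 ^ m * s) := by
      gcongr
      linarith [sqrt_two_bounds.1]
    linarith
  refine tendsto_atTop_mono h1 (tendsto_atTop_add_const_right _ _ ?_)
  exact (tendsto_pow_atTop_atTop_of_one_lt (by norm_num)).atTop_mul_const (by linarith [h.ten_le])

/-- The triangle of the hub and two adjacent corners does not wind around another corner, since
that corner is joined to infinity by outward hops that avoid the triangle. -/
theorem triangle_winding (h : Controlled X G D R μ s) {o : ℤ × ℤ}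
    (ho : ‖latticePt o‖ ≤ 12 * R) {k : Plane} (hk : k ∈ D) (hko : dist k (latticePt o) ≤ 2)
    (i j : Fin 4) (h1 : i ≠ j) (h2 : i ≠ j + 1) :
    logVar (spoke G o s k j) (toC (hopPt o s i 0)) + logVar (rim G o s j) (toC (hopPt o s i 0))
      - logVar (spoke G o s k (j + 1)) (toC (hopPt o s i 0)) = 0 := by
  have hc : ClosedChain ![1, 1, -1] ![spoke G o s k j, rim G o s j, spoke G o s k (j + 1)] := by
    intro f
    simp [Fin.sum_univ_three, h.rim_zero, h.rim_one, h.spoke_zero, h.spoke_one]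
  have := hc.winding_eq_zero (fun l => by fin_cases l <;> exact curve_bdd _)
    (fun m => curve (G (hopPt o s i m) (hopPt o s i (m + 1))))
    (fun m => by simp [h.ends]) (by simpa [h.ends] using h.tendsto_hopPt o i) (fun m l t t' => by
      fin_cases l
      · exact curve_ne (h.spoke_hop_disjoint ho hk hko i j m h1) t t'
      · exact curve_ne (h.side_hop_disjoint ho i j m (Or.inr ⟨h1, h2⟩)) t t'
      · exact curve_ne (h.spoke_hop_disjoint ho hk hko i (j + 1) m h2) t t')
  simp [winding, Fin.sum_univ_three, h.ends] at this
  rw [← this]; ring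

/-- The square of optimal paths around `o` winds around every fixed point near `o`. -/
theorem rim_winding_hub (h : Controlled X G D R μ s) {o : ℤ × ℤ}
    (ho : ‖latticePt o‖ ≤ 12 * R) {k : Plane} (hk : k ∈ D) (hko : dist k (latticePt o) ≤ 2) :
    winding (fun _ => 1) (rim G o s) (toC k) ≠ 0 := by
  have := wheel_winding_ne_zero (e := rim G o s) (r := spoke G o s k)
    (fun i => by rw [h.rim_one, h.rim_zero])
    (fun i => by rw [h.spoke_zero, h.spoke_zero]) (fun i => by rw [h.spoke_one, h.rim_zero])
    (h.sides_disjoint ho) (fun i t t' => (h.side_spoke_disjoint ho hk hko i t t').1)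
    (fun i t t' => (h.side_spoke_disjoint ho hk hko i t t').2)
    (fun i => by
      rw [h.rim_zero]
      exact h.triangle_winding ho hk hko _ _ (by fin_cases i <;> decide) (by fin_cases i <;> decide))
    (fun i => by
      rw [h.rim_zero]
      exact h.triangle_winding ho hk hko _ _ (by fin_cases i <;> decide) (by fin_cases i <;> decide))
  rw [h.spoke_zero] at this
  simpa [winding] using this

theorem rim_closed (h : Controlled X G D R μ s) (o : ℤ × ℤ) :
    ClosedChain (fun _ => 1) (rim G o s) := by
  intro f
  simp only [h.rim_zero, h.rim_one, Fin.sum_univ_four]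
  simp [show (1 : Fin 4) + 1 = 2 from rfl, show (2 : Fin 4) + 1 = 3 from rfl,
    show (3 : Fin 4) + 1 = 0 from rfl]

/-- The square of optimal paths around `o` does not wind around the distant fixed points. -/
theorem rim_winding_far (h : Controlled X G D R μ s) {o : ℤ × ℤ} (ho : ‖latticePt o‖ ≤ 12 * R)
    {u : Plane} (hu : u ∈ D) (hu' : ‖u‖ ≤ R) (huo : 20 * s ≤ dist u (latticePt o)) :
    winding (fun _ => 1) (rim G o s) (toC u) = 0 := by
  have h2 := sqrt_two_bounds
  have h4 := h.ten_le
  have h5 := h.scale_le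
  set ℓ := dist u (latticePt o) with hℓ
  -- the scale of the distance to `u`
  obtain ⟨M, hM1, hM2⟩ : ∃ M : ℕ, ℓ ≤ 4 ^ (M + 1) * s ∧ 4 ^ (M + 1) * s ≤ 4 * ℓ := by
    obtain ⟨n, hn1, hn2⟩ := exists_nat_pow_near (x := ℓ / s) (y := 4)
      (by rw [le_div_iff₀] <;> linarith) (by norm_num)
    refine ⟨n, ?_, ?_⟩
    · rw [div_lt_iff₀ (by linarith)] at hn2
      exact hn2.le
    · rw [le_div_iff₀ (by linarith)] at hn1
      rw [pow_succ]
      linarith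
  -- a diagonal direction that makes an acute angle with `u - o`
  obtain ⟨i, hi⟩ : ∃ i : Fin 4, 0 ≤ cornerX i * (u 0 - o.1) + cornerY i * (u 1 - o.2) := by
    rcases le_total 0 ((u 0 - o.1) + (u 1 - o.2)) with h0 | h0
    · exact ⟨0, by simpa [cornerX, cornerY] using h0⟩
    · exact ⟨2, by simp [cornerX, cornerY]; linarith⟩
  set S : ℝ := 4 ^ (M + 1) * s with hS
  have hy0 := dist_hopPt_center o s i (M + 1)
  rw [← hS] at hy0
  have hS0 : 0 < S := by linarith
  have r1 : √2 * S ≤ 1.415 * S := by gcongr; exact h2.2.le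
  have r2 : 1.414 * S ≤ √2 * S := by gcongr; exact h2.1.le
  have r3 : √2 * s ≤ 1.415 * s := by gcongr; exact h2.2.le
  -- the first hop is at most the hypotenuse
  have hhyp : dist u (hopPt o s i (M + 1)) ^ 2 ≤ ℓ ^ 2 + (√2 * S) ^ 2 := by
    rw [hℓ, dist_plane, dist_plane, Real.sq_sqrt (by positivity), Real.sq_sqrt (by positivity),
      mul_pow, Real.sq_sqrt (by norm_num)]
    simp only [hopPt_zero, hopPt_one, latticePt_zero, latticePt_one, ← hS]
    have hx := cornerX_sq i
    have hy := cornerY_sq i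
    nlinarith [mul_nonneg hS0.le hi]
  have hd : dist u (hopPt o s i (M + 1)) ≤ ℓ + √2 * S - ℓ / 2 := by
    refine abs_le_of_sq_le_sq' (hhyp.trans ?_) (by linarith) |>.2
    nlinarith
  have hdis : ∀ j t t', rim G o s j t ≠ curve (G u (hopPt o s i (M + 1))) t' := by
    intro j t t'
    have nc := fun l => h.norm_of_near_center ho (M + 1)
      ((h.dist_corner_center o l).trans (by
        have : (4 : ℝ) ^ 0 ≤ 4 ^ (M + 1) := pow_le_pow_right₀ (by norm_num) (by omega)
        gcongr))
    have ny := h.norm_of_near_center ho (M + 1) (c := hopPt o s i (M + 1))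
      (by rw [hy0, ← hS]; linarith)
    have nu : ‖u‖ < 40 * 4 ^ (M + 1) * R := by
      have : (1 : ℝ) ≤ 4 ^ (M + 1) := one_le_pow₀ (by norm_num)
      nlinarith
    have h100 : (100 : ℝ) * 4 ^ (M + 1) * s = 100 * S := by rw [hS]; ring
    have cc : ∀ l, dist (hopPt o s l 0) (latticePt o) = √2 * s := fun l => by
      rw [dist_hopPt_center, pow_zero, one_mul]
    have a1 := dist_triangle_left u (latticePt o) (hopPt o s j 0)
    have a2 := dist_triangle_left (hopPt o s i (M + 1)) (latticePt o) (hopPt o s (j + 1) 0)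
    have a3 := dist_triangle_right (hopPt o s j 0) u (latticePt o)
    have a4 := dist_triangle_right (hopPt o s (j + 1) 0) (hopPt o s i (M + 1)) (latticePt o)
    rw [cc] at a1 a2 a3 a4
    rw [hy0] at a2 a4
    have ds := dist_corners_succ o s j
    refine curve_ne (h.disjoint (m := M + 1) (h.hopPt_mem o _ 0) (h.hopPt_mem o _ 0) hu
      (h.hopPt_mem o _ _) (nc _) (nc _) nu ny ?_ ?_ ?_ ?_ ?_) t t'
    all_goals (try rw [h100]); (try rw [← hS]); linarith
  have := (h.rim_closed o).winding_eq_zero (fun l => curve_bdd _)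
    (fun m => Nat.casesOn m (curve (G u (hopPt o s i (M + 1))))
      (fun m => curve (G (hopPt o s i (m + (M + 1))) (hopPt o s i (m + 1 + (M + 1))))))
    (fun m => by cases m <;> simp [h.ends]) ?_ (fun m l t t' => by
      cases m with
      | zero => exact hdis l t t'
      | succ m =>
        have := h.side_hop_disjoint ho i l (m + (M + 1)) (Or.inl (by omega))
        rw [show m + (M + 1) + 1 = m + 1 + (M + 1) by ring] at this
        exact curve_ne this t t')
  · simpa [h.ends] using this
  · rw [← tendsto_add_atTop_iff_nat 1]
    simpa [h.ends] using (tendsto_add_atTop_iff_nat (M + 1)).2 (h.tendsto_hopPt o i)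

end Controlled

/-! ### Confinement and alignment of optimal paths -/

/-- The straight path between two points. -/
def segmentPath (a b : Plane) : PlanePath :=
  ⟨fun t => a + (t : ℝ) • (b - a), by fun_prop⟩

@[simp] theorem segmentPath_zero (a b : Plane) : segmentPath a b 0 = a := by simp [segmentPath]
@[simp] theorem segmentPath_one (a b : Plane) : segmentPath a b 1 = b := by simp [segmentPath]

theorem dist_segmentPath_le (a b : Plane) (t : unitInterval) :
    dist (segmentPath a b t) a ≤ dist a b := by
  rw [dist_eq_norm, dist_comm a b, dist_eq_norm]
  simp only [segmentPath, ContinuousMap.coe_mk, add_sub_cancel_left, norm_smul]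
  rw [Real.norm_of_nonneg t.2.1]
  exact mul_le_of_le_one_left (norm_nonneg _) t.2.2

@[simp] theorem initialPart_zero (γ : PlanePath) (t₀ : unitInterval) : initialPart γ t₀ 0 = γ 0 := by
  simp [initialPart]
@[simp] theorem initialPart_one (γ : PlanePath) (t₀ : unitInterval) : initialPart γ t₀ 1 = γ t₀ := by
  simp [initialPart]

namespace Controlled

variable {X : Plane → Plane → ℝ≥0∞} {G : Plane → Plane → PlanePath} {D : Set Plane}
  {R μ : ℝ} {s : ℕ}

/-- A path from a distant fixed point to the neighbourhood of `o` crosses the square of optimal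
paths around `o`. -/
theorem exists_meets_rim (h : Controlled X G D R μ s) {o : ℤ × ℤ} (ho : ‖latticePt o‖ ≤ 12 * R)
    {u z : Plane} (hu : u ∈ D) (hu' : ‖u‖ ≤ R) (huo : 20 * s ≤ dist u (latticePt o))
    (hz : dist z (latticePt o) ≤ 1) (η : PlanePath) (h0 : η 0 = u) (h1 : η 1 = z) :
    ∃ i t t', G (hopPt o s i 0) (hopPt o s (i + 1) 0) t = η t' := by
  by_contra! hne
  set K : Set Plane := ⋃ i, Set.range (G (hopPt o s i 0) (hopPt o s (i + 1) 0)) with hK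
  have hKc : IsClosed K :=
    (isCompact_iUnion fun i => isCompact_range (ContinuousMap.continuous _)).isClosed
  have hzK : z ∈ Kᶜ := by
    simp only [hK, Set.mem_compl_iff, Set.mem_iUnion, Set.mem_range, not_exists]
    intro i t
    rw [← h1]
    exact hne i t 1
  obtain ⟨δ, hδ, hball⟩ := Metric.isOpen_iff.1 hKc.isOpen_compl z hzK
  obtain ⟨k, hk, hkz⟩ := h.dense z (min δ 1) (lt_min hδ one_pos)
  have hw := h.rim_closed o
  have w1 : winding (fun _ => 1) (rim G o s) (toC z) = winding (fun _ => 1) (rim G o s) (toC u) := by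
    have := hw.winding_const (p := curve η) (fun i => curve_ne (hne i))
    rwa [curve_zero, curve_one, h0, h1] at this
  have w2 : winding (fun _ => 1) (rim G o s) (toC k) = winding (fun _ => 1) (rim G o s) (toC z) := by
    have := hw.winding_const (p := curve (segmentPath z k)) (fun i => curve_ne fun t t' he => by
      have hb : segmentPath z k t' ∈ Metric.ball z δ :=
        (dist_segmentPath_le z k t').trans_lt (hkz.trans_le (min_le_left _ _))
      refine hball hb ?_
      rw [← he]
      exact Set.mem_iUnion.2 ⟨i, t, rfl⟩)
    rwa [curve_zero, curve_one, segmentPath_zero, segmentPath_one] at this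
  refine h.rim_winding_hub ho hk ?_ (w2.trans (w1.trans (h.rim_winding_far ho hu hu' huo)))
  have := dist_triangle_left k (latticePt o) z
  linarith [min_le_right δ 1]

theorem near_le (h : Controlled X G D R μ s) {m : ℕ} {a b : Plane} (ha : a ∈ D) (hb : b ∈ D)
    (ha' : ‖a‖ < 40 * 4 ^ m * R) (hb' : ‖b‖ < 40 * 4 ^ m * R) {c : ℝ}
    (hab : dist a b ≤ c) (hc : c ≤ 100 * 4 ^ m * s) :
    X a b ≤ ENNReal.ofReal (μ * c + μ / 1000 * (4 ^ m * s)) := by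
  have := (abs_le.1 (h.near m a ha b hb ha' hb' (hab.trans hc))).2
  rw [← ENNReal.ofReal_toReal (h.fin a ha b hb)]
  refine ENNReal.ofReal_le_ofReal ?_
  nlinarith [h.mu_pos]

/-- Some point of a path from a fixed point to the neighbourhood of `o` is close to a corner of
the square around `o`. -/
theorem exists_close_corner (h : Controlled X G D R μ s) {o : ℤ × ℤ} (ho : ‖latticePt o‖ ≤ 12 * R)
    {u z : Plane} (hu : u ∈ D) (hu' : ‖u‖ ≤ R)
    (hz : dist z (latticePt o) ≤ 1) (η : PlanePath) (h0 : η 0 = u) (h1 : η 1 = z) :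
    ∃ t i, X (η t) (hopPt o s i 0) ≤ ENNReal.ofReal (μ * (22 * s)) := by
  have h2 := sqrt_two_bounds
  have h4 := h.ten_le
  have h5 := h.scale_le
  have hμ := h.mu_pos
  have nc := fun l => h.norm_of_near_center ho 0 (h.dist_corner_center o l)
  have hms : 0 < μ * s := by positivity
  rcases le_or_gt (20 * (s : ℝ)) (dist u (latticePt o)) with huo | huo
  · obtain ⟨i, t, t', he⟩ := h.exists_meets_rim ho hu hu' huo hz η h0 h1
    refine ⟨t', i, ?_⟩
    have ha := h.align_ends (m := 0) (h.hopPt_mem o i 0) (h.hopPt_mem o (i + 1) 0) (nc _) (nc _) t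
    have hn := h.near_le (m := 0) (h.hopPt_mem o i 0) (h.hopPt_mem o (i + 1) 0) (nc _) (nc _)
      (dist_corners_succ o s i).le (by linarith)
    rw [he] at ha
    rw [h.symm]
    refine (le_self_add.trans ha).trans ((add_le_add hn le_rfl).trans ?_)
    rw [← ENNReal.ofReal_add (by positivity) (by positivity)]
    exact ENNReal.ofReal_le_ofReal (by linarith)
  · refine ⟨0, 0, ?_⟩
    rw [h0]
    have nu : ‖u‖ < 40 * 4 ^ 0 * R := by linarith
    have hd := dist_triangle_right u (hopPt o s 0 0) (latticePt o)
    have := h.dist_corner_center o 0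
    refine (h.near_le (m := 0) (c := 21.5 * s) hu (h.hopPt_mem o 0 0) nu (nc _) (by linarith)
      (by linarith)).trans (ENNReal.ofReal_le_ofReal (by linarith))

/-- The points of an optimal path between fixed points are close, in passage time, to the fixed
points in their neighbourhood. -/
theorem close_of_near (h : Controlled X G D R μ s) {u v d : Plane} (hu : u ∈ D) (hu' : ‖u‖ ≤ R)
    (hv : v ∈ D) (hv' : ‖v‖ ≤ R) (t : unitInterval) (ht : ‖G u v t‖ ≤ 11 * R)
    (hd : d ∈ D) (hdt : dist d (G u v t) ≤ 1) :
    X (G u v t) d ≤ ENNReal.ofReal (90 * (μ * s)) := by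
  have h2 := sqrt_two_bounds
  have h4 := h.ten_le
  have h5 := h.scale_le
  have hμ := h.mu_pos
  have hms : 0 < μ * s := by positivity
  obtain ⟨o, hzo⟩ := exists_lattice_near (G u v t)
  have ho : ‖latticePt o‖ ≤ 12 * R := by
    have : ‖latticePt o‖ ≤ ‖G u v t‖ + dist (G u v t) (latticePt o) := by
      rw [dist_eq_norm']; simpa using norm_add_le (G u v t) (latticePt o - G u v t)
    linarith
  have nc := fun l => h.norm_of_near_center ho 0 (h.dist_corner_center o l)
  have hdo : dist d (latticePt o) ≤ 2 := (dist_triangle _ (G u v t) _).trans (by linarith)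
  have nd : ‖d‖ < 40 * 4 ^ 0 * R := h.norm_of_near_center ho 0 (by linarith)
  have nu : ‖u‖ < 40 * 4 ^ 0 * R := by linarith
  have nv : ‖v‖ < 40 * 4 ^ 0 * R := by linarith
  obtain ⟨a, i, hai⟩ := h.exists_close_corner ho hu hu' hzo (initialPart (G u v) t)
    (by simp [h.ends]) (by simp)
  obtain ⟨b, j, hbj⟩ := h.exists_close_corner ho hv hv' hzo
    (initialPart (reversePath (G u v)) (unitInterval.symm t))
    (by simp [reversePath, h.ends]) (by simp [reversePath])
  set t₁ : unitInterval := a * t with ht₁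
  set t₃ : unitInterval := unitInterval.symm (b * unitInterval.symm t) with ht₃
  change X (G u v t₁) _ ≤ _ at hai
  change X (G u v t₃) _ ≤ _ at hbj
  have l1 : t₁ ≤ t := unitInterval.mul_le_right
  have l3 : t ≤ t₃ := by
    rw [ht₃, unitInterval.le_symm_comm]
    exact unitInterval.mul_le_right
  -- the optimal path spends little time near the square
  have key : X (G u v t₁) (G u v t) ≤ ENNReal.ofReal (μ * (47 * s)) := by
    have hcc : X (hopPt o s i 0) (hopPt o s j 0) ≤ ENNReal.ofReal (μ * (2.9 * s)) := by
      have r1 : √2 * (2 * s) ≤ 1.415 * (2 * s) := by gcongr; exact h2.2.le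
      exact (h.near_le (m := 0) (h.hopPt_mem o i 0) (h.hopPt_mem o j 0) (nc _) (nc _)
        ((dist_corners o s i j).trans r1) (by linarith)).trans
        (ENNReal.ofReal_le_ofReal (by linarith))
    have h13 : X (G u v t₁) (G u v t₃) ≤ ENNReal.ofReal (μ * (46.9 * s)) := by
      calc X (G u v t₁) (G u v t₃) ≤ X (G u v t₁) (hopPt o s i 0)
            + (X (hopPt o s i 0) (hopPt o s j 0) + X (hopPt o s j 0) (G u v t₃)) :=
            (h.tri _ _ _).trans (add_le_add le_rfl (h.tri _ _ _))
        _ ≤ _ := by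
            rw [h.symm _ (G u v t₃)]
            refine (add_le_add hai (add_le_add hcc hbj)).trans ?_
            rw [← ENNReal.ofReal_add (by positivity) (by positivity),
              ← ENNReal.ofReal_add (by positivity) (by positivity)]
            exact ENNReal.ofReal_le_ofReal (by linarith)
    rcases eq_or_lt_of_le l3 with e3 | l3
    · rw [← e3] at h13
      exact h13.trans (ENNReal.ofReal_le_ofReal (by linarith))
    rcases eq_or_lt_of_le l1 with e1 | l1
    · -- the passage time from a point to itself
      rw [e1] at hai ⊢
      refine (h.tri _ _ (hopPt o s i 0)).trans ?_
      rw [h.symm (hopPt o s i 0)]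
      refine (add_le_add hai hai).trans ?_
      rw [← ENNReal.ofReal_add (by positivity) (by positivity)]
      exact ENNReal.ofReal_le_ofReal (by linarith)
    refine (le_self_add.trans (h.align 0 u hu v hv nu nv _ _ _ l1 l3)).trans
      ((add_le_add h13 le_rfl).trans ?_)
    rw [← ENNReal.ofReal_add (by positivity) (by positivity)]
    exact ENNReal.ofReal_le_ofReal (by linarith)
  have hid : X (hopPt o s i 0) d ≤ ENNReal.ofReal (μ * (4 * s)) := by
    have hdd := dist_triangle_right (hopPt o s i 0) d (latticePt o)
    have := h.dist_corner_center o i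
    exact (h.near_le (m := 0) (c := 3 * s) (h.hopPt_mem o i 0) hd (nc _) nd (by linarith)
      (by linarith)).trans (ENNReal.ofReal_le_ofReal (by linarith))
  calc X (G u v t) d ≤ X (G u v t) (G u v t₁) + (X (G u v t₁) (hopPt o s i 0)
        + X (hopPt o s i 0) d) := (h.tri _ _ _).trans (add_le_add le_rfl (h.tri _ _ _))
    _ ≤ _ := by
        rw [h.symm (G u v t)]
        refine (add_le_add key (add_le_add hai hid)).trans ?_
        rw [← ENNReal.ofReal_add (by positivity) (by positivity),
          ← ENNReal.ofReal_add (by positivity) (by positivity)]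
        exact ENNReal.ofReal_le_ofReal (by linarith)

/-- An optimal path between two fixed points of a ball stays in a comparable ball. -/
theorem norm_path_le (h : Controlled X G D R μ s) (hsR : 20 * (s : ℝ) ≤ R) {u v : Plane} (hu : u ∈ D)
    (hu' : ‖u‖ ≤ R) (hv : v ∈ D) (hv' : ‖v‖ ≤ R) (t : unitInterval) : ‖G u v t‖ ≤ 10 * R := by
  have h4 := h.ten_le
  have hμ := h.mu_pos
  by_contra! hlt
  obtain ⟨τ, hτ⟩ : 10 * R ∈ Set.range fun τ => ‖G u v τ‖ :=
    mem_range_of_exists_le_of_exists_ge (G u v).continuous.norm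
      ⟨0, by rw [(h.ends u v).1]; linarith⟩ ⟨t, hlt.le⟩
  simp only at hτ
  set z := G u v τ with hz
  obtain ⟨d, hd, hdz⟩ := h.dense z 1 one_pos
  have hzd := h.close_of_near hu hu' hv hv' τ (by rw [hτ]; linarith) hd
    (by rw [dist_comm]; exact hdz.le)
  rw [← hz] at hzd
  have nu : ‖u‖ < 40 * 4 ^ 0 * R := by linarith
  have nv : ‖v‖ < 40 * 4 ^ 0 * R := by linarith
  have hal := h.align_ends hu hv nu nv τ
  rw [← hz] at hal
  -- compare at a scale of order `R`
  obtain ⟨m, hm1, hm2⟩ := exists_nat_pow_near (x := R / s) (y := 4)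
    (by rw [le_div_iff₀] <;> linarith) (by norm_num)
  rw [div_lt_iff₀ (by linarith)] at hm2
  rw [le_div_iff₀ (by linarith)] at hm1
  set T : ℝ := 4 ^ (m + 1) * s with hT
  have hT4 : T ≤ 4 * R := by rw [hT, pow_succ]; linarith
  have h100 : (100 : ℝ) * 4 ^ (m + 1) * s = 100 * T := by rw [hT]; ring
  have hR : 0 < R := by linarith
  have sc : ∀ {c : Plane}, ‖c‖ ≤ 11 * R → ‖c‖ < 40 * 4 ^ (m + 1) * R := by
    intro c hc
    have : (1 : ℝ) ≤ 4 ^ (m + 1) := one_le_pow₀ (by norm_num)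
    nlinarith
  have nzd : ‖d‖ ≤ ‖z‖ + dist z d := by
    rw [dist_eq_norm']; simpa using norm_add_le z (d - z)
  have nzd' : ‖z‖ ≤ ‖d‖ + dist z d := by
    rw [dist_eq_norm]; simpa using norm_add_le d (z - d)
  have e : ∀ {w : Plane}, w ∈ D → ‖w‖ ≤ R → 8.89 * (μ * R) ≤ (X w d).toReal := by
    intro w hw hwR
    have b1 : ‖d‖ ≤ ‖w‖ + dist w d := by
      rw [dist_eq_norm']; simpa using norm_add_le w (d - w)
    have b2 : dist w d ≤ ‖w‖ + ‖d‖ := dist_le_norm_add_norm _ _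
    have := (abs_le.1 (h.near (m + 1) w hw d hd (sc (by linarith)) (sc (by linarith))
      (by rw [h100]; linarith))).1
    rw [← hT] at this
    nlinarith
  have e1 := e hu hu'
  have e2 := e hv hv'
  have e3 : (X u v).toReal ≤ 2.01 * (μ * R) := by
    have b2 : dist u v ≤ ‖u‖ + ‖v‖ := dist_le_norm_add_norm _ _
    have := (abs_le.1 (h.near (m + 1) u hu v hv (sc (by linarith)) (sc (by linarith))
      (by rw [h100]; linarith))).2
    rw [← hT] at this
    nlinarith
  have hms : 0 < μ * s := by positivity
  have tot : X u d + X v d ≤ X u v + ENNReal.ofReal (181 * (μ * s)) := by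
    calc X u d + X v d ≤ (X u z + X z d) + (X v z + X z d) := add_le_add (h.tri _ _ _) (h.tri _ _ _)
      _ = (X u z + X z v) + (X z d + X z d) := by rw [h.symm v z]; ring
      _ ≤ (X u v + ENNReal.ofReal (μ / 1000 * (4 ^ 0 * s)))
          + (ENNReal.ofReal (90 * (μ * s)) + ENNReal.ofReal (90 * (μ * s))) :=
          add_le_add hal (add_le_add hzd hzd)
      _ ≤ _ := by
          rw [add_assoc, ← ENNReal.ofReal_add (by positivity) (by positivity),
            ← ENNReal.ofReal_add (by positivity) (by positivity)]
          exact add_le_add le_rfl (ENNReal.ofReal_le_ofReal (by linarith))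
  have f1 := h.fin u hu d hd
  have f2 := h.fin v hv d hd
  have f3 := h.fin u hu v hv
  have tot' := (ENNReal.toReal_le_toReal (by finiteness) (by finiteness)).2 tot
  rw [ENNReal.toReal_add f1 f2, ENNReal.toReal_add f3 (by finiteness),
    ENNReal.toReal_ofReal (by positivity)] at tot'
  nlinarith

/-- Fixed points in the neighbourhood of successive points of an optimal path are almost aligned. -/
theorem align_near (h : Controlled X G D R μ s) (hsR : 20 * (s : ℝ) ≤ R) {u v : Plane} (hu : u ∈ D)
    (hu' : ‖u‖ ≤ R) (hv : v ∈ D) (hv' : ‖v‖ ≤ R) {t₁ t₂ t₃ : unitInterval} (h12 : t₁ ≤ t₂)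
    (h23 : t₂ ≤ t₃) {d₁ d₂ d₃ : Plane} (hd₁ : d₁ ∈ D) (hd₂ : d₂ ∈ D) (hd₃ : d₃ ∈ D)
    (h₁ : dist d₁ (G u v t₁) ≤ 1) (h₂ : dist d₂ (G u v t₂) ≤ 1) (h₃ : dist d₃ (G u v t₃) ≤ 1) :
    (X d₁ d₂).toReal + (X d₂ d₃).toReal ≤ (X d₁ d₃).toReal + 1000 * (μ * s) := by
  have h4 := h.ten_le
  have hμ := h.mu_pos
  have hms : 0 < μ * s := by positivity
  have nrm := h.norm_path_le hsR hu hu' hv hv'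
  have cl : ∀ {t d}, d ∈ D → dist d (G u v t) ≤ 1 →
      X (G u v t) d ≤ ENNReal.ofReal (90 * (μ * s)) := fun {t d} hd hdt =>
    h.close_of_near hu hu' hv hv' t ((nrm t).trans (by linarith)) hd hdt
  have c1 := cl hd₁ h₁
  have c2 := cl hd₂ h₂
  have c3 := cl hd₃ h₃
  have tot : X d₁ d₂ + X d₂ d₃ ≤ X d₁ d₃ + ENNReal.ofReal (1000 * (μ * s)) := by
    rcases eq_or_lt_of_le h12 with e | h12
    · rw [e] at c1
      have : X d₁ d₂ ≤ ENNReal.ofReal (90 * (μ * s)) + ENNReal.ofReal (90 * (μ * s)) :=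
        (h.tri _ _ (G u v t₂)).trans (by rw [h.symm d₁]; exact add_le_add c1 c2)
      calc X d₁ d₂ + X d₂ d₃ ≤ X d₁ d₂ + (X d₁ d₂ + X d₁ d₃) :=
            add_le_add le_rfl ((h.tri _ _ d₁).trans (by rw [h.symm d₂]))
        _ = X d₁ d₃ + (X d₁ d₂ + X d₁ d₂) := by ring
        _ ≤ X d₁ d₃ + _ := add_le_add le_rfl (add_le_add this this)
        _ ≤ _ := by
          rw [← ENNReal.ofReal_add (by positivity) (by positivity),
            ← ENNReal.ofReal_add (by positivity) (by positivity)]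
          exact add_le_add le_rfl (ENNReal.ofReal_le_ofReal (by linarith))
    rcases eq_or_lt_of_le h23 with e | h23
    · rw [← e] at c3
      have : X d₂ d₃ ≤ ENNReal.ofReal (90 * (μ * s)) + ENNReal.ofReal (90 * (μ * s)) :=
        (h.tri _ _ (G u v t₂)).trans (by rw [h.symm d₂]; exact add_le_add c2 c3)
      calc X d₁ d₂ + X d₂ d₃ ≤ (X d₁ d₃ + X d₂ d₃) + X d₂ d₃ :=
            add_le_add ((h.tri _ _ d₃).trans (by rw [h.symm d₃ d₂])) le_rfl
        _ = X d₁ d₃ + (X d₂ d₃ + X d₂ d₃) := by ring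
        _ ≤ X d₁ d₃ + _ := add_le_add le_rfl (add_le_add this this)
        _ ≤ _ := by
          rw [← ENNReal.ofReal_add (by positivity) (by positivity),
            ← ENNReal.ofReal_add (by positivity) (by positivity)]
          exact add_le_add le_rfl (ENNReal.ofReal_le_ofReal (by linarith))
    have hal := h.align 0 u hu v hv (by linarith) (by linarith) _ _ _ h12 h23
    set z₁ := G u v t₁
    set z₂ := G u v t₂
    set z₃ := G u v t₃
    set q := ENNReal.ofReal (90 * (μ * s)) with hq
    calc X d₁ d₂ + X d₂ d₃ ≤ (X d₁ z₁ + (X z₁ z₂ + X z₂ d₂)) + (X d₂ z₂ + (X z₂ z₃ + X z₃ d₃)) :=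
          add_le_add ((h.tri _ _ _).trans (add_le_add le_rfl (h.tri _ _ _)))
            ((h.tri _ _ _).trans (add_le_add le_rfl (h.tri _ _ _)))
      _ = (X z₁ d₁ + X z₂ d₂ + X z₂ d₂ + X z₃ d₃) + (X z₁ z₂ + X z₂ z₃) := by
          rw [h.symm d₁, h.symm d₂]; ring
      _ ≤ (q + q + q + q) + (X z₁ z₃ + ENNReal.ofReal (μ / 1000 * (4 ^ 0 * s))) := by
          gcongr
      _ ≤ (q + q + q + q) + ((q + (X d₁ d₃ + q)) + ENNReal.ofReal (μ / 1000 * (4 ^ 0 * s))) := by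
          gcongr
          refine (h.tri _ _ d₁).trans (add_le_add c1 ((h.tri _ _ d₃).trans (add_le_add le_rfl ?_)))
          rw [h.symm]; exact c3
      _ = X d₁ d₃ + (q + q + q + q + q + q + ENNReal.ofReal (μ / 1000 * (4 ^ 0 * s))) := by ring
      _ ≤ _ := by
          rw [hq]
          repeat rw [← ENNReal.ofReal_add (by positivity) (by positivity)]
          exact add_le_add le_rfl (ENNReal.ofReal_le_ofReal (by linarith))
  have f1 := h.fin d₁ hd₁ d₂ hd₂
  have f2 := h.fin d₂ hd₂ d₃ hd₃
  have f3 := h.fin d₁ hd₁ d₃ hd₃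
  have tot' := (ENNReal.toReal_le_toReal (by finiteness) (by finiteness)).2 tot
  rwa [ENNReal.toReal_add f1 f2, ENNReal.toReal_add f3 (by finiteness),
    ENNReal.toReal_ofReal (by positivity)] at tot'

end Controlled

/-! ### Passage times between fixed points -/

theorem movePath_symm_cancel (τ : ISO2) (γ : PlanePath) : movePath τ (movePath τ.symm γ) = γ := by
  ext1 t
  simp [movePath]

namespace Model

variable {Ω E : Type*} [MeasurableSpace Ω] [MeasurableSpace E] [MulAction ISO2 E]
  {P : Measure Ω} {M : Model Ω E P} {κ D₀ n₀ μ : ℝ}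

theorem passage_smul_eq {τ : ISO2} {η : E}
    (h : ∀ γ ∈ M.paths, M.time (movePath τ γ) (τ • η) = M.time γ η) (u v : Plane) :
    M.passage (τ u) (τ v) (τ • η) = M.passage u v η := by
  apply le_antisymm
  · refine le_iInf₂ fun γ hγ => ?_
    rw [← h γ hγ.1]
    exact iInf₂_le (movePath τ γ) ⟨M.move_mem τ γ hγ.1, by simp [movePath, hγ.2.1],
      by simp [movePath, hγ.2.2]⟩
  · refine le_iInf₂ fun γ hγ => ?_
    have h1 : movePath τ.symm γ ∈ M.paths := M.move_mem _ _ hγ.1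
    have h2 := h _ h1
    rw [movePath_symm_cancel] at h2
    rw [h2]
    exact iInf₂_le _ ⟨h1, by simp [movePath, hγ.2.1], by simp [movePath, hγ.2.2]⟩

theorem passage_symm_le {η : E} (h : ∀ γ ∈ M.paths, M.time (reversePath γ) η = M.time γ η)
    (u v : Plane) : M.passage u v η ≤ M.passage v u η := by
  refine le_iInf₂ fun γ hγ => ?_
  rw [← h γ hγ.1]
  exact iInf₂_le (reversePath γ) ⟨M.reverse_mem γ hγ.1, by simp [reversePath, hγ.2.2],
    by simp [reversePath, hγ.2.1]⟩

/-- The passage time between two points, as a real random variable. -/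
def T (M : Model Ω E P) (u v : Plane) (x : Ω) : ℝ := (M.passage u v (M.field x)).toReal

namespace Assumptions

theorem ae_symm (hM : M.Assumptions κ D₀ n₀ μ) :
    ∀ᵐ x ∂P, ∀ u v, M.passage u v (M.field x) = M.passage v u (M.field x) := by
  filter_upwards [ae_of_ae_map M.measurable_field.aemeasurable hM.time_reversal] with x hx u v
  exact le_antisymm (passage_symm_le hx u v) (passage_symm_le hx v u)

theorem ae_triangle (hM : M.Assumptions κ D₀ n₀ μ) : ∀ᵐ x ∂P, ∀ u v w,
    M.passage u v (M.field x) ≤ M.passage u w (M.field x) + M.passage w v (M.field x) :=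
  ae_of_ae_map M.measurable_field.aemeasurable hM.triangle

theorem aemeasurable_family (hM : M.Assumptions κ D₀ n₀ μ) {ι : Type*} [Countable ι]
    (u v : ι → Plane) : AEMeasurable (fun η i => M.passage (u i) (v i) η) (P.map M.field) :=
  aemeasurable_pi_lambda _ fun _ => hM.aemeasurable_passage _ _

theorem aemeasurable_family' (hM : M.Assumptions κ D₀ n₀ μ) {ι : Type*} [Countable ι]
    (u v : ι → Plane) : AEMeasurable (fun x i => M.passage (u i) (v i) (M.field x)) P :=
  (hM.aemeasurable_family u v).comp_measurable M.measurable_field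

/-- The joint law of countably many passage times is invariant under rigid motions. -/
theorem map_family (hM : M.Assumptions κ D₀ n₀ μ) {ι : Type*} [Countable ι] (τ : ISO2)
    (u v : ι → Plane) :
    P.map (fun x i => M.passage (τ (u i)) (τ (v i)) (M.field x))
      = P.map (fun x i => M.passage (u i) (v i) (M.field x)) := by
  have hmp := M.invariant_law τ
  have h1 : ∀ u v : ι → Plane, P.map (fun x i => M.passage (u i) (v i) (M.field x))
      = (P.map M.field).map (fun η i => M.passage (u i) (v i) η) := fun u v =>
    (AEMeasurable.map_map_of_aemeasurable (hM.aemeasurable_family u v)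
      M.measurable_field.aemeasurable).symm
  rw [h1 u v, h1 (fun i => τ (u i)) (fun i => τ (v i))]
  conv_lhs => rw [← hmp.map_eq]
  rw [AEMeasurable.map_map_of_aemeasurable
    (by rw [hmp.map_eq]; exact hM.aemeasurable_family _ _) hmp.measurable.aemeasurable]
  refine Measure.map_congr ?_
  filter_upwards [hM.invariance τ] with η hη
  funext i
  exact passage_smul_eq hη _ _

theorem measureReal_family (hM : M.Assumptions κ D₀ n₀ μ) {ι : Type*} [Countable ι] (τ : ISO2)
    (u v : ι → Plane) {S : Set (ι → ℝ≥0∞)} (hS : MeasurableSet S) :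
    P.real {x | (fun i => M.passage (τ (u i)) (τ (v i)) (M.field x)) ∈ S}
      = P.real {x | (fun i => M.passage (u i) (v i) (M.field x)) ∈ S} := by
  have h1 := Measure.map_apply_of_aemeasurable
    (hM.aemeasurable_family' (fun i => τ (u i)) (fun i => τ (v i))) hS
  have h2 := Measure.map_apply_of_aemeasurable (hM.aemeasurable_family' u v) hS
  rw [hM.map_family τ u v, h2] at h1
  exact congrArg ENNReal.toReal h1.symm

/-- A rigid motion that carries one segment to another of the same length. -/
theorem exists_motion {a b c d : Plane} (h : dist a b = dist c d) :
    ∃ τ : ISO2, τ a = c ∧ τ b = d := by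
  have hn : ‖b - a‖ = ‖d - c‖ := by
    rw [← dist_eq_norm, ← dist_eq_norm, dist_comm b, dist_comm d, h]
  refine ⟨(IsometryEquiv.subRight a).trans
    (((ℝ ∙ ((b - a) - (d - c)))ᗮ.reflection.toIsometryEquiv).trans (IsometryEquiv.addRight c)), ?_, ?_⟩
  · simp
  · simp [Submodule.reflection_sub hn]

theorem dist_origin_pt {d : ℝ} (hd : 0 ≤ d) : dist (0 : Plane) (pt d 0) = d := by
  rw [dist_plane]; simp [Real.sqrt_sq_eq_abs, abs_of_nonneg hd]

theorem aemeasurable_T (hM : M.Assumptions κ D₀ n₀ μ) (u v : Plane) : AEMeasurable (M.T u v) P :=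
  ((hM.aemeasurable_passage u v).comp_measurable M.measurable_field).ennreal_toReal

/-- The passage time between two points at distance `d` has the law of `X_d`. -/
theorem map_T (hM : M.Assumptions κ D₀ n₀ μ) (a b : Plane) :
    P.map (M.T a b) = P.map (M.X (dist a b)) := by
  have hd := dist_origin_pt (dist_nonneg (x := a) (y := b))
  obtain ⟨τ, h1, h2⟩ := exists_motion hd
  have := hM.map_family τ (fun _ : Unit => (0 : Plane)) (fun _ => pt (dist a b) 0)
  have := congrArg (fun ν => ν.map (fun f : Unit → ℝ≥0∞ => (f ()).toReal)) this
  have hm : Measurable fun f : Unit → ℝ≥0∞ => (f ()).toReal := by fun_prop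
  rw [AEMeasurable.map_map_of_aemeasurable hm.aemeasurable (hM.aemeasurable_family' _ _),
    AEMeasurable.map_map_of_aemeasurable hm.aemeasurable (hM.aemeasurable_family' _ _), h1, h2] at this
  exact this

theorem aemeasurable_X (hM : M.Assumptions κ D₀ n₀ μ) (d : ℝ) : AEMeasurable (M.X d) P :=
  hM.aemeasurable_T _ _

theorem measureReal_T (hM : M.Assumptions κ D₀ n₀ μ) (a b : Plane) {S : Set ℝ}
    (hS : MeasurableSet S) : P.real {x | M.T a b x ∈ S} = P.real {x | M.X (dist a b) x ∈ S} := by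
  have h1 := Measure.map_apply_of_aemeasurable (hM.aemeasurable_T a b) hS
  have h2 := Measure.map_apply_of_aemeasurable (hM.aemeasurable_X (dist a b)) hS
  rw [hM.map_T, h2] at h1
  exact congrArg ENNReal.toReal h1.symm

theorem integral_T (hM : M.Assumptions κ D₀ n₀ μ) (a b : Plane) :
    ∫ x, M.T a b x ∂P = M.meanX (dist a b) := by
  have h1 := integral_map (hM.aemeasurable_T a b) (f := id) (by fun_prop)
  have h2 := integral_map (hM.aemeasurable_X (dist a b)) (f := id) (by fun_prop)
  rw [hM.map_T, h2] at h1
  exact h1.symm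

/-- Local passage times around an arbitrary centre, for countably many points. -/
theorem local_times_countable [IsProbabilityMeasure P] (hM : M.Assumptions κ D₀ n₀ μ)
    {D : Set Plane} (hD : D.Countable)
    (c : Plane) {x : ℝ} (hx : 0 < x) :
    P.real {a | ∃ u ∈ D ∩ Metric.ball c 3, ∃ v ∈ D ∩ Metric.ball c 3,
      M.passage u v (M.field a) > ENNReal.ofReal x} ≤ Real.exp (1 - D₀ * x ^ κ) := by
  have hc : Countable ((D ∩ Metric.ball c 3 : Set Plane) × (D ∩ Metric.ball c 3 : Set Plane)) := by
    have : Countable (D ∩ Metric.ball c 3 : Set Plane) := (hD.mono Set.inter_subset_left).to_subtype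
    infer_instance
  set ι := (D ∩ Metric.ball c 3 : Set Plane) × (D ∩ Metric.ball c 3 : Set Plane)
  have hS : MeasurableSet {f : ι → ℝ≥0∞ | ∃ i, ENNReal.ofReal x < f i} := by
    simp only [Set.ofPred_exists]
    exact MeasurableSet.iUnion fun i => measurableSet_lt measurable_const (measurable_pi_apply i)
  have key := hM.measureReal_family (IsometryEquiv.addRight (-c)) (fun i : ι => i.1.1)
    (fun i => i.2.1) hS
  refine le_trans (le_of_eq ?_) ((key.symm.le).trans ((measureReal_mono ?_).trans
    (hM.local_times x hx)))
  · congr 1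
    ext a
    simp only [Set.mem_ofPred_eq, Prod.exists, Subtype.exists, ι]
    constructor
    · rintro ⟨u, hu, v, hv, h⟩; exact ⟨u, hu, v, hv, h⟩
    · rintro ⟨u, hu, v, hv, h⟩; exact ⟨u, hu, v, hv, h⟩
  · rintro a ⟨i, hi⟩
    have : ∀ p ∈ Metric.ball c 3, IsometryEquiv.addRight (-c) p ∈ Metric.ball (0 : Plane) 3 := by
      intro p hp
      rw [Metric.mem_ball, dist_eq_norm] at hp
      simpa [sub_eq_add_neg] using hp
    exact ⟨_, this _ i.1.2.2, _, this _ i.2.2.2, hi⟩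

/-- The tail of the passage time between two nearby points. -/
theorem tail_local [IsProbabilityMeasure P] (hM : M.Assumptions κ D₀ n₀ μ) {a b : Plane}
    (hab : dist a b < 3) {x : ℝ} (hx : 0 < x) :
    P.real {w | M.passage a b (M.field w) > ENNReal.ofReal x} ≤ Real.exp (1 - D₀ * x ^ κ) := by
  refine (measureReal_mono ?_).trans (hM.local_times_countable (D := {a, b})
    (Set.toFinite _).countable a hx)
  intro w hw
  exact ⟨a, ⟨by simp, by simp⟩, b, ⟨by simp, by rwa [Metric.mem_ball, dist_comm]⟩, hw⟩

theorem tendsto_tail (hκ : 0 < κ) (hD : 0 < D₀) :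
    Tendsto (fun x : ℝ => Real.exp (1 - D₀ * x ^ κ)) atTop (𝓝 0) := by
  refine Real.tendsto_exp_atBot.comp (tendsto_atBot_add_const_left _ _ ?_)
  exact tendsto_neg_atTop_atBot.comp ((tendsto_rpow_atTop hκ).const_mul_atTop hD)

theorem ae_finite_of_dist_lt [IsProbabilityMeasure P] (hM : M.Assumptions κ D₀ n₀ μ) {a b : Plane}
    (hab : dist a b < 3) : ∀ᵐ x ∂P, M.passage a b (M.field x) ≠ ⊤ := by
  rw [ae_iff]
  have h0 : P.real {x | ¬ M.passage a b (M.field x) ≠ ⊤} ≤ 0 := by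
    refine ge_of_tendsto (tendsto_tail hM.κ_pos hM.D₀_pos) ?_
    filter_upwards [eventually_gt_atTop 0] with x hx
    refine (measureReal_mono ?_).trans (hM.tail_local hab hx)
    intro w hw
    simp only [ne_eq, not_not, Set.mem_ofPred_eq] at hw ⊢
    rw [hw]; exact ENNReal.ofReal_lt_top
  exact (measureReal_eq_zero_iff).1 (le_antisymm h0 measureReal_nonneg)

theorem ae_finite [IsProbabilityMeasure P] (hM : M.Assumptions κ D₀ n₀ μ) (a b : Plane) :
    ∀ᵐ x ∂P, M.passage a b (M.field x) ≠ ⊤ := by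
  obtain ⟨N, hN⟩ := exists_nat_gt (dist a b)
  have hN0 : (0 : ℝ) < N := dist_nonneg.trans_lt hN
  -- divide the segment into `N` pieces of length less than one
  set p : ℕ → Plane := fun i => AffineMap.lineMap a b ((i : ℝ) / N) with hp
  have hstep : ∀ i, dist (p i) (p (i + 1)) < 3 := by
    intro i
    rw [hp]
    simp only
    rw [dist_lineMap_lineMap, Real.dist_eq, ← sub_div]
    push_cast
    rw [show (i : ℝ) - (i + 1) = -1 by ring, abs_div, abs_neg, abs_one, Nat.abs_cast,
      div_mul_eq_mul_div, one_mul, div_lt_iff₀ hN0]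
    linarith
  have h1 := ae_all_iff.2 fun i => hM.ae_finite_of_dist_lt (hstep i)
  have h00 := hM.ae_finite_of_dist_lt (a := a) (b := a) (by simp)
  filter_upwards [h1, h00, hM.ae_triangle] with x hx hx0 htri
  have : ∀ i, M.passage a (p i) (M.field x) ≠ ⊤ := by
    intro i
    induction i with
    | zero => simpa [hp] using hx0
    | succ i ih => exact ne_top_of_le_ne_top (ENNReal.add_ne_top.2 ⟨ih, hx i⟩) (htri _ _ (p i))
  have := this N
  simpa only [hp, div_self hN0.ne', AffineMap.lineMap_apply_one] using this

end Assumptions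

end Model

/-! ### The mean passage time -/

/-- A power of a logarithm is dominated by every power. -/
theorem log_sq_le {δ d : ℝ} (hδ : 0 < δ) (hd : 1 ≤ d) : (Real.log d) ^ 2 ≤ 4 / δ ^ 2 * d ^ δ := by
  have h1 := Real.log_le_rpow_div (by linarith : 0 ≤ d) (half_pos hδ)
  have h0 := Real.log_nonneg hd
  calc (Real.log d) ^ 2 ≤ (d ^ (δ / 2) / (δ / 2)) ^ 2 := by gcongr
    _ = 4 / δ ^ 2 * (d ^ (δ / 2) * d ^ (δ / 2)) := by field_simp; norm_num
    _ = _ := by rw [← Real.rpow_add (by linarith)]; congr 2; ring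

namespace Model.Assumptions

variable {Ω E : Type*} [MeasurableSpace Ω] [MeasurableSpace E] [MulAction ISO2 E]
  {P : Measure Ω} {M : Model Ω E P} {κ D₀ n₀ μ : ℝ}

theorem T_nonneg (a b : Plane) (x : Ω) : 0 ≤ M.T a b x := ENNReal.toReal_nonneg

theorem meanX_nonneg (d : ℝ) : 0 ≤ M.meanX d := integral_nonneg fun _ => ENNReal.toReal_nonneg

variable [IsProbabilityMeasure P]

theorem memLp_X (hM : M.Assumptions κ D₀ n₀ μ) {n : ℝ} (hn : 1 ≤ n) : MemLp (M.X n) 2 P := by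
  obtain ⟨c, hc, h⟩ := hM.variance_pos
  exact memLp_two_of_variance_ne_zero (hM.aemeasurable_X n).aestronglyMeasurable
    (hc.trans_le (h n hn)).ne'

theorem ae_T_triangle (hM : M.Assumptions κ D₀ n₀ μ) (a b c : Plane) :
    ∀ᵐ x ∂P, M.T a b x ≤ M.T a c x + M.T c b x := by
  filter_upwards [hM.ae_triangle, hM.ae_finite a c, hM.ae_finite c b] with x h h1 h2
  rw [T, T, T, ← ENNReal.toReal_add h1 h2]
  exact ENNReal.toReal_mono (ENNReal.add_ne_top.2 ⟨h1, h2⟩) (h _ _ _)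

theorem integrable_T_of_one_le (hM : M.Assumptions κ D₀ n₀ μ) {a b : Plane} (h : 1 ≤ dist a b) :
    Integrable (M.T a b) P := by
  have h1 : Integrable (id : ℝ → ℝ) (P.map (M.T a b)) := by
    rw [hM.map_T, integrable_map_measure (by fun_prop) (hM.aemeasurable_X _)]
    exact (hM.memLp_X h).integrable (by norm_num)
  rwa [integrable_map_measure (by fun_prop) (hM.aemeasurable_T _ _)] at h1

/-- The segment of length at most two as the base of a triangle with two sides of length one. -/
theorem exists_apex {d : ℝ} (h0 : 0 ≤ d) (h2 : d ≤ 2) :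
    dist (0 : Plane) (pt (d / 2) (√(1 - d ^ 2 / 4))) = 1 ∧
    dist (pt (d / 2) (√(1 - d ^ 2 / 4))) (pt d 0) = 1 := by
  have h : 0 ≤ 1 - d ^ 2 / 4 := by nlinarith
  constructor <;>
  · rw [dist_plane, Real.sqrt_eq_one]
    simp only [pt_zero, pt_one, PiLp.zero_apply, zero_sub, sub_zero, even_two, Even.neg_pow,
      Real.sq_sqrt h]
    ring

theorem integrable_X (hM : M.Assumptions κ D₀ n₀ μ) {d : ℝ} (hd : 0 ≤ d) :
    Integrable (M.X d) P := by
  rcases le_or_gt 1 d with h1 | h1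
  · exact (hM.memLp_X h1).integrable (by norm_num)
  obtain ⟨e1, e2⟩ := exists_apex hd (by linarith)
  refine Integrable.mono' ((hM.integrable_T_of_one_le e1.ge).add (hM.integrable_T_of_one_le e2.ge))
    (hM.aemeasurable_X d).aestronglyMeasurable ?_
  filter_upwards [hM.ae_T_triangle 0 (pt d 0) (pt (d / 2) (√(1 - d ^ 2 / 4)))] with x hx
  rw [Real.norm_of_nonneg (show 0 ≤ M.X d x from ENNReal.toReal_nonneg)]
  exact hx

theorem integrable_T (hM : M.Assumptions κ D₀ n₀ μ) (a b : Plane) : Integrable (M.T a b) P := by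
  have h1 : Integrable (id : ℝ → ℝ) (P.map (M.T a b)) := by
    rw [hM.map_T, integrable_map_measure (by fun_prop) (hM.aemeasurable_X _)]
    exact hM.integrable_X dist_nonneg
  rwa [integrable_map_measure (by fun_prop) (hM.aemeasurable_T _ _)] at h1

theorem meanX_triangle (hM : M.Assumptions κ D₀ n₀ μ) (a b c : Plane) :
    M.meanX (dist a b) ≤ M.meanX (dist a c) + M.meanX (dist c b) := by
  rw [← hM.integral_T, ← hM.integral_T, ← hM.integral_T,
    ← integral_add (hM.integrable_T _ _) (hM.integrable_T _ _)]
  exact integral_mono_ae (hM.integrable_T _ _) ((hM.integrable_T _ _).add (hM.integrable_T _ _))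
    (hM.ae_T_triangle _ _ _)

theorem dist_pt_axis (s t : ℝ) : dist (pt s 0) (pt t 0) = |s - t| := by
  rw [dist_plane]; simp [Real.sqrt_sq_eq_abs]

theorem meanX_add_le (hM : M.Assumptions κ D₀ n₀ μ) {s t : ℝ} (hs : 0 ≤ s) (ht : 0 ≤ t) :
    M.meanX (s + t) ≤ M.meanX s + M.meanX t := by
  have := hM.meanX_triangle (pt 0 0) (pt (s + t) 0) (pt s 0)
  simpa only [dist_pt_axis, zero_sub, abs_neg, abs_of_nonneg hs, abs_of_nonneg (add_nonneg hs ht),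
    sub_add_cancel_left, abs_of_nonneg ht] using this

theorem abs_meanX_sub_le (hM : M.Assumptions κ D₀ n₀ μ) {s t : ℝ} (hs : 0 ≤ s) (ht : 0 ≤ t) :
    |M.meanX s - M.meanX t| ≤ M.meanX |s - t| := by
  have h1 := hM.meanX_triangle (pt 0 0) (pt s 0) (pt t 0)
  have h2 := hM.meanX_triangle (pt 0 0) (pt t 0) (pt s 0)
  simp only [dist_pt_axis, zero_sub, abs_neg, abs_of_nonneg hs, abs_of_nonneg ht] at h1 h2
  rw [abs_sub_comm t s] at h1
  rw [abs_le]
  constructor <;> linarith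

theorem meanX_le_linear (hM : M.Assumptions κ D₀ n₀ μ) {d : ℝ} (hd : 0 ≤ d) :
    M.meanX d ≤ 2 * M.meanX 1 * (d + 1) := by
  have hbase : ∀ d : ℝ, 0 ≤ d → d ≤ 2 → M.meanX d ≤ 2 * M.meanX 1 := by
    intro d h0 h2
    obtain ⟨e1, e2⟩ := exists_apex h0 h2
    have := hM.meanX_triangle 0 (pt d 0) (pt (d / 2) (√(1 - d ^ 2 / 4)))
    rw [e1, e2, dist_origin_pt h0] at this
    linarith
  have h1 := meanX_nonneg (M := M) 1
  have key : ∀ k : ℕ, ∀ d : ℝ, 0 ≤ d → d ≤ k + 1 → M.meanX d ≤ 2 * M.meanX 1 * (k + 1) := by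
    intro k
    induction k with
    | zero => intro d h0 hd; simpa using hbase d h0 (by norm_num at hd; linarith)
    | succ k ih =>
      intro d h0 hd
      push_cast at hd ⊢
      rcases le_or_gt d 1 with h | h
      · refine (hbase d h0 (by linarith)).trans ?_
        exact le_mul_of_one_le_right (by linarith) (by linarith [(Nat.cast_nonneg k : (0:ℝ) ≤ k)])
      · have := hM.meanX_add_le (s := d - 1) (t := 1) (by linarith) zero_le_one
        rw [sub_add_cancel] at this
        have := ih (d - 1) (by linarith) (by linarith)
        linarith
  have := key ⌊d⌋₊ d hd (Nat.lt_floor_add_one d).le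
  have h2 := Nat.floor_le hd
  nlinarith

theorem exists_lipschitz_meanX (hM : M.Assumptions κ D₀ n₀ μ) : ∃ C, 1 ≤ C ∧ ∀ s t : ℝ, 0 ≤ s → 0 ≤ t →
    |M.meanX s - M.meanX t| ≤ C * (|s - t| + 1) := by
  refine ⟨2 * M.meanX 1 + 1, by linarith [meanX_nonneg (M := M) 1], fun s t hs ht => ?_⟩
  refine ((hM.abs_meanX_sub_le hs ht).trans (hM.meanX_le_linear (abs_nonneg _))).trans ?_
  gcongr
  linarith

theorem le_meanX (hM : M.Assumptions κ D₀ n₀ μ) {d : ℝ} (hd : 0 ≤ d) : μ * d ≤ M.meanX d := by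
  rcases hd.eq_or_lt with rfl | hd
  · simpa using meanX_nonneg 0
  have hsub : ∀ k : ℕ, M.meanX ((k + 1) * d) ≤ (k + 1) * M.meanX d := by
    intro k
    induction k with
    | zero => simp
    | succ k ih =>
      push_cast
      have := hM.meanX_add_le (s := (k + 1) * d) (t := d) (by positivity) hd.le
      rw [show ((k : ℝ) + 1 + 1) * d = (k + 1) * d + d by ring]
      linarith
  obtain ⟨k, hk⟩ := exists_nat_gt (n₀ / d)
  rw [div_lt_iff₀ hd] at hk
  have h1 := (hM.nonrandom ((k + 1) * d) (by linarith)).1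
  have h2 := hsub k
  have : (0 : ℝ) < k + 1 := by positivity
  nlinarith

theorem exists_meanX_le (hM : M.Assumptions κ D₀ n₀ μ) {δ : ℝ} (hδ : 0 < δ) :
    ∃ C, 0 ≤ C ∧ ∀ d : ℝ, 0 ≤ d → M.meanX d ≤ μ * d + C * (√(1 + d) * (1 + d) ^ δ) := by
  have h1 := meanX_nonneg (M := M) 1
  have hn := hM.one_le_n₀
  refine ⟨2 * M.meanX 1 * (n₀ + 1) + 4 / δ ^ 2, by positivity, fun d hd => ?_⟩
  have hs : 1 ≤ √(1 + d) := by rw [Real.one_le_sqrt]; linarith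
  have hp : 1 ≤ (1 + d) ^ δ := Real.one_le_rpow (by linarith) hδ.le
  have hsp : 1 ≤ √(1 + d) * (1 + d) ^ δ := one_le_mul_of_one_le_of_one_le hs hp
  rw [add_mul]
  have hμd : 0 ≤ μ * d := mul_nonneg hM.μ_pos.le hd
  rcases le_or_gt n₀ d with h | h
  · have h2 := (hM.nonrandom d h).2
    have h3 : √d * (Real.log d) ^ 2 ≤ 4 / δ ^ 2 * (√(1 + d) * (1 + d) ^ δ) := by
      calc √d * (Real.log d) ^ 2 ≤ √(1 + d) * (4 / δ ^ 2 * (1 + d) ^ δ) := by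
            gcongr
            · linarith
            · refine (log_sq_le hδ (by linarith)).trans ?_
              gcongr; linarith
        _ = _ := by ring
    have : 0 ≤ 2 * M.meanX 1 * (n₀ + 1) * (√(1 + d) * (1 + d) ^ δ) := by positivity
    linarith
  · have h2 := hM.meanX_le_linear hd
    have h3 : 2 * M.meanX 1 * (d + 1) ≤ 2 * M.meanX 1 * (n₀ + 1) * (√(1 + d) * (1 + d) ^ δ) := by
      refine le_trans ?_ (le_mul_of_one_le_right (by positivity) hsp)
      gcongr
    have : 0 ≤ 4 / δ ^ 2 * (√(1 + d) * (1 + d) ^ δ) := by positivity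
    linarith

end Model.Assumptions

/-! ### The fluctuation scale -/

/-- A stretched exponential tail at scale `Q` bounds the second moment by a multiple of `Q ^ 2`. -/
theorem exists_second_moment_bound {θ : ℝ} (hθ : 0 < θ) : ∃ C > 0, ∀ {Ω : Type*} [MeasurableSpace Ω]
    (P : Measure Ω) [IsProbabilityMeasure P] (Y : Ω → ℝ), AEMeasurable Y P → ∀ Q > 0,
    (∀ x > 0, P.real {a | |Y a| > x * Q} ≤ Real.exp (1 - x ^ θ)) →
    ∫ a, Y a ^ 2 ∂P ≤ C * Q ^ 2 := by
  have hint := integrableOn_rpow_mul_exp_neg_mul_rpow (s := 1) (b := 1) (by norm_num) hθ one_pos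
  set I := ∫ t in Set.Ioi (0 : ℝ), t ^ (1 : ℝ) * Real.exp (-1 * t ^ θ) with hI
  have hI0 : 0 ≤ I := setIntegral_nonneg measurableSet_Ioi fun t ht => by
    have : 0 < t := ht
    positivity
  refine ⟨2 * (Real.exp 1 * I) + 1, by positivity, ?_⟩
  intro Ω _ P _ Y hY Q hQ htail
  have hlc := lintegral_rpow_eq_lintegral_meas_lt_mul P (f := fun a => |Y a| / Q)
    (Eventually.of_forall fun a => by positivity) (hY.abs.div_const Q) two_pos
  have hb : ∫⁻ t in Set.Ioi (0 : ℝ), P {a | t < |Y a| / Q} * ENNReal.ofReal (t ^ ((2 : ℝ) - 1))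
      ≤ ENNReal.ofReal (Real.exp 1 * I) := by
    rw [hI, ← integral_const_mul, ofReal_integral_eq_lintegral_ofReal (hint.const_mul _)
      ((ae_restrict_iff' measurableSet_Ioi).2 (Eventually.of_forall fun t ht => by
        have : 0 < t := ht
        change 0 ≤ Real.exp 1 * (t ^ (1 : ℝ) * Real.exp (-1 * t ^ θ))
        positivity))]
    refine setLIntegral_mono' measurableSet_Ioi fun t ht => ?_
    have ht0 : 0 < t := ht
    have h1 : P {a | t < |Y a| / Q} ≤ ENNReal.ofReal (Real.exp (1 - t ^ θ)) := by
      rw [← ofReal_measureReal]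
      refine ENNReal.ofReal_le_ofReal ((le_of_eq ?_).trans (htail t ht0))
      congr 1
      ext a
      simp only [Set.mem_ofPred_eq, gt_iff_lt, lt_div_iff₀ hQ]
    refine (mul_le_mul_left h1 _).trans ?_
    rw [← ENNReal.ofReal_mul (Real.exp_nonneg _)]
    refine ENNReal.ofReal_le_ofReal (le_of_eq ?_)
    rw [show (2 : ℝ) - 1 = 1 by norm_num, sub_eq_add_neg, Real.exp_add, neg_one_mul]
    ring
  have h2 : ∫⁻ a, ENNReal.ofReal ((|Y a| / Q) ^ (2 : ℝ)) ∂P ≤ ENNReal.ofReal (2 * (Real.exp 1 * I)) := by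
    rw [hlc, ENNReal.ofReal_mul two_pos.le]
    gcongr
  have h3 : ∫ a, (Y a / Q) ^ 2 ∂P ≤ 2 * (Real.exp 1 * I) := by
    rw [integral_eq_lintegral_of_nonneg_ae (Eventually.of_forall fun a => by positivity)
      ((hY.div_const Q).pow_const 2).aestronglyMeasurable]
    refine ENNReal.toReal_le_of_le_ofReal (by positivity) (le_trans (le_of_eq ?_) h2)
    refine lintegral_congr fun a => ?_
    rw [Real.rpow_two, div_pow, div_pow, sq_abs]
  have h4 : ∫ a, Y a ^ 2 ∂P = (∫ a, (Y a / Q) ^ 2 ∂P) * Q ^ 2 := by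
    rw [← integral_mul_const]
    refine integral_congr_ae (Eventually.of_forall fun a => ?_)
    simp only
    field_simp
  rw [h4]
  gcongr
  linarith

/-! ### Fluctuation scales -/

namespace Model

variable {Ω E : Type*} [MeasurableSpace Ω] [MeasurableSpace E] [MulAction ISO2 E]
  {P : Measure Ω} {M : Model Ω E P} {κ D₀ n₀ μ : ℝ}

theorem theta_pos (hκ : 0 < κ) : 0 < theta κ := by
  rw [theta]; positivity

theorem theta_le (hκ : 0 < κ) : theta κ ≤ κ / 10000 := by
  rw [theta]
  gcongr
  rcases le_total κ 1 with h | h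
  · exact (min_le_right _ _).trans (by nlinarith)
  · exact (min_le_left _ _).trans h

theorem theta_le_one (κ : ℝ) : theta κ ≤ 1 / 10000 := by
  rw [theta]
  gcongr
  exact min_le_left _ _

variable (M) in
/-- The admissible scales in the definition of `Q̂_n`. -/
def ScaleOK (θ n Q : ℝ) : Prop :=
  ∀ x : ℝ, 0 < x → P.real {a | |M.X n a - M.meanX n| > x * Q} ≤ Real.exp (1 - x ^ θ)

theorem Qhat_eq (θ n : ℝ) : M.Qhat θ n = sInf {Q | M.ScaleOK θ n Q} := by
  rw [Qhat]
  congr 1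
  ext Q
  exact forall₂_congr fun x _ => div_le_one (Real.exp_pos _)

variable [IsProbabilityMeasure P]

theorem ScaleOK.mono {θ n Q Q' : ℝ} (h : M.ScaleOK θ n Q) (hQ : Q ≤ Q') : M.ScaleOK θ n Q' :=
  fun x hx => by
    refine (measureReal_mono ?_).trans (h x hx)
    intro a ha
    exact lt_of_le_of_lt (mul_le_mul_of_nonneg_left hQ hx.le) ha

namespace Assumptions

/-- The admissible scales are bounded below by the standard deviation. -/
theorem exists_le_scale (hM : M.Assumptions κ D₀ n₀ μ) {θ : ℝ} (hθ : 0 < θ) :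
    ∃ c > 0, ∀ n : ℝ, 1 ≤ n → ∀ Q, M.ScaleOK θ n Q → c * n ^ (1 / 12 : ℝ) ≤ Q := by
  obtain ⟨C, hC, hb⟩ := exists_second_moment_bound hθ
  obtain ⟨v, hv, hvar⟩ := hM.variance_pos
  have hn0 := hM.one_le_n₀
  -- a lower bound for the variance that holds for all `n ≥ 1`
  have hvar' : ∀ n : ℝ, 1 ≤ n → min 1 (v / n₀ ^ (1 / 6 : ℝ)) * n ^ (1 / 6 : ℝ)
      ≤ variance (M.X n) P := by
    intro n hn
    rcases le_or_gt n₀ n with h | h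
    · refine le_trans ?_ (hM.variance_growth n h)
      exact mul_le_of_le_one_left (by positivity) (min_le_left _ _)
    · refine le_trans ?_ (hvar n hn)
      calc _ ≤ v / n₀ ^ (1 / 6 : ℝ) * n₀ ^ (1 / 6 : ℝ) := by
            gcongr
            exact min_le_right _ _
        _ = v := by field_simp
  set b := min 1 (v / n₀ ^ (1 / 6 : ℝ)) with hbdef
  have hb0 : 0 < b := lt_min one_pos (by positivity)
  refine ⟨√(b / C) / 2, by positivity, fun n hn Q hQ => ?_⟩
  have hbound : ∀ q > 0, M.ScaleOK θ n q → √(b / C) * n ^ (1 / 12 : ℝ) ≤ q := by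
    intro q hq0 hq
    have h1 := hb P (fun a => M.X n a - M.meanX n) ((hM.aemeasurable_X n).sub_const _) q hq0 hq
    have h2 : variance (M.X n) P = ∫ a, (M.X n a - M.meanX n) ^ 2 ∂P :=
      variance_eq_integral (hM.aemeasurable_X n)
    have h3 := hvar' n hn
    refine abs_le_of_sq_le_sq' ?_ hq0.le |>.2
    rw [mul_pow, Real.sq_sqrt (by positivity), ← Real.rpow_natCast, ← Real.rpow_mul (by linarith)]
    norm_num
    rw [div_mul_eq_mul_div, div_le_iff₀ hC]
    linarith
  have hpos : 0 < √(b / C) * n ^ (1 / 12 : ℝ) := by positivity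
  by_contra! hlt
  have := hbound (√(b / C) / 2 * n ^ (1 / 12 : ℝ)) (by positivity) (hQ.mono hlt.le)
  linarith

/-- Diffusive scales are admissible. -/
theorem exists_scale_ok (hM : M.Assumptions κ D₀ n₀ μ) {θ : ℝ} (hθ : 0 < θ) (hθκ : θ ≤ κ) :
    ∃ A > 0, ∀ n : ℝ, 1 ≤ n → M.ScaleOK θ n (A * √n) := by
  have hκ := hM.κ_pos
  have hD := hM.D₀_pos
  refine ⟨(1 / D₀) ^ (1 / κ), by positivity, fun n hn x hx => ?_⟩
  rcases le_or_gt x 1 with h | h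
  · refine measureReal_le_one.trans (Real.one_le_exp ?_)
    linarith [Real.rpow_le_one hx.le h hθ.le]
  · have := hM.concentration n hn (x * (1 / D₀) ^ (1 / κ)) (by positivity)
    rw [Real.mul_rpow hx.le (by positivity), ← Real.rpow_mul (by positivity),
      one_div_mul_cancel hκ.ne', Real.rpow_one] at this
    rw [← mul_assoc]
    refine this.trans (Real.exp_le_exp.2 ?_)
    have h1 : x ^ θ ≤ x ^ κ := Real.rpow_le_rpow_of_exponent_le h.le hθκ
    have h2 : D₀ * (x ^ κ * (1 / D₀)) = x ^ κ := by field_simp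
    linarith

end Assumptions

/-- The properties of a scale function `q` for the fluctuations of the passage times: a uniform
stretched exponential tail at all distances up to `n`, growth at least like the power `α`, and a
polynomial lower bound. -/
structure FluctuationScale (M : Model Ω E P) (α θ : ℝ) (q : ℝ → ℝ) (c : ℝ) : Prop where
  tail : ∀ {n : ℝ} {a b : Plane}, 1 ≤ dist a b → dist a b ≤ n → ∀ {x : ℝ}, 0 < x →
    P.real {w | |M.T a b w - M.meanX (dist a b)| > x * q n} ≤ Real.exp (1 - x ^ θ)
  growth : ∀ {m n : ℝ}, 1 ≤ m → m ≤ n → q m ≤ (m / n) ^ α * q n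
  lower : ∀ {n : ℝ}, 1 ≤ n → c * n ^ (1 / 12 : ℝ) ≤ q n

/-- Twice `Q_n` is a scale function: `Q̂_n` itself need not be admissible, being an infimum. -/
theorem Assumptions.exists_fluctuationScale (hM : M.Assumptions κ D₀ n₀ μ) {α : ℝ} (hα0 : 0 < α)
    (hα1 : α ≤ 1 / 2) :
    ∃ c, 0 < c ∧ M.FluctuationScale α (theta κ) (fun n => 2 * M.Q α (theta κ) n) c := by
  have hκ := hM.κ_pos
  have hθ := theta_pos hκ
  obtain ⟨c, hc, hlow⟩ := hM.exists_le_scale hθ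
  obtain ⟨A, hA, hup⟩ := hM.exists_scale_ok hθ ((theta_le hκ).trans (by linarith))
  set θ := theta κ with hθdef
  have hat_low : ∀ n, 1 ≤ n → c * n ^ (1 / 12 : ℝ) ≤ M.Qhat θ n := fun n hn => by
    rw [Qhat_eq]
    exact le_csInf ⟨_, hup n hn⟩ fun Q hQ => hlow n hn Q hQ
  have hat_up : ∀ n, 1 ≤ n → M.Qhat θ n ≤ A * √n := fun n hn => by
    rw [Qhat_eq]
    exact csInf_le ⟨_, fun Q hQ => hlow n hn Q hQ⟩ (hup n hn)
  have hat_pos : ∀ n, 1 ≤ n → 0 < M.Qhat θ n := fun n hn =>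
    lt_of_lt_of_le (by positivity) (hat_low n hn)
  have el_up : ∀ {m n : ℝ}, 1 ≤ m → m ≤ n → (n / m) ^ α * M.Qhat θ m ≤ A * √n := by
    intro m n hm hmn
    calc (n / m) ^ α * M.Qhat θ m ≤ (n / m) ^ (1 / 2 : ℝ) * (A * √m) := by
          have h1 : (n / m) ^ α ≤ (n / m) ^ (1 / 2 : ℝ) :=
            Real.rpow_le_rpow_of_exponent_le (by rwa [one_le_div (by linarith)]) hα1
          exact mul_le_mul h1 (hat_up m hm) (hat_pos m hm).le
            (Real.rpow_nonneg (div_nonneg (by linarith) (by linarith)) _)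
      _ = A * √n := by
          rw [← Real.sqrt_eq_rpow, Real.sqrt_div (by linarith)]
          field_simp
  have bdd : ∀ n, BddAbove ((fun m : ℝ => (n / m) ^ α * M.Qhat θ m) '' Set.Icc 1 n) := by
    rintro n
    refine ⟨A * √n, ?_⟩
    rintro _ ⟨m, hm, rfl⟩
    exact el_up hm.1 hm.2
  have el_le : ∀ {m n : ℝ}, 1 ≤ m → m ≤ n → (n / m) ^ α * M.Qhat θ m ≤ M.Q α θ n :=
    fun {m n} hm hmn => le_csSup (bdd n) ⟨m, ⟨hm, hmn⟩, rfl⟩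
  have hat_le : ∀ {m n : ℝ}, 1 ≤ m → m ≤ n → M.Qhat θ m ≤ M.Q α θ n := by
    intro m n hm hmn
    refine le_trans ?_ (el_le hm hmn)
    refine le_mul_of_one_le_left (hat_pos m hm).le (Real.one_le_rpow ?_ hα0.le)
    rwa [one_le_div (by linarith)]
  refine ⟨c, hc, ?_, ?_, ?_⟩
  · intro n a b hd hdn x hx
    have hOK : M.ScaleOK θ (dist a b) (2 * M.Q α θ n) := by
      have h1 := hat_le hd hdn
      have h2 := hat_pos _ hd
      rw [Qhat_eq] at h1 h2
      obtain ⟨Q, hQ, hlt⟩ := exists_lt_of_csInf_lt ⟨_, hup _ hd⟩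
        (show sInf {Q | M.ScaleOK θ (dist a b) Q} < 2 * M.Q α θ n by linarith)
      exact hQ.mono hlt.le
    refine (le_of_eq ?_).trans (hOK x hx)
    have hS : MeasurableSet {y : ℝ | |y - M.meanX (dist a b)| > x * (2 * M.Q α θ n)} :=
      measurableSet_lt measurable_const (by fun_prop)
    exact hM.measureReal_T a b hS
  · intro m n hm hmn
    have hm0 : 0 < m := by linarith
    have hn0 : 0 < n := by linarith
    have : M.Q α θ m ≤ (m / n) ^ α * M.Q α θ n := by
      refine csSup_le ⟨_, ⟨1, ⟨le_rfl, hm⟩, rfl⟩⟩ ?_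
      rintro _ ⟨l, hl, rfl⟩
      have hl0 : 0 < l := by linarith [hl.1]
      calc (m / l) ^ α * M.Qhat θ l = (m / n) ^ α * ((n / l) ^ α * M.Qhat θ l) := by
            rw [← mul_assoc, ← Real.mul_rpow (by positivity) (by positivity)]
            congr 2
            field_simp
        _ ≤ _ := by
            gcongr
            exact el_le hl.1 (hl.2.trans hmn)
    calc 2 * M.Q α θ m ≤ 2 * ((m / n) ^ α * M.Q α θ n) := by gcongr
      _ = _ := by ring
  · intro n hn
    have h1 := hat_low n hn
    have h2 := hat_le hn le_rfl
    have h3 := hat_pos n hn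
    linarith

end Model

/-! ### Rough geometry of optimal paths -/

/-- A smaller power is dominated by a larger one, up to a constant. -/
theorem rpow_sub_rpow_le {K D a b ρ : ℝ} (hK : 0 < K) (hD : 0 < D) (hb : 0 < b) (hab : b < a)
    (hρ : 1 ≤ ρ) : K * ρ ^ b - D * ρ ^ a ≤ K * (K / D) ^ (b / (a - b)) := by
  have hρ0 : 0 < ρ := by linarith
  have h1 : ρ ^ a = ρ ^ b * ρ ^ (a - b) := by rw [← Real.rpow_add hρ0]; congr 1; ring
  rcases le_or_gt (K / D) (ρ ^ (a - b)) with h | h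
  · rw [div_le_iff₀ hD] at h
    have h2 : 0 < ρ ^ b := by positivity
    have : 0 ≤ K * (K / D) ^ (b / (a - b)) := by positivity
    rw [h1]
    nlinarith
  · have h2 : ρ ^ b ≤ (K / D) ^ (b / (a - b)) := by
      have : (ρ ^ (a - b)) ^ (b / (a - b)) ≤ (K / D) ^ (b / (a - b)) := by
        have : 0 ≤ b / (a - b) := div_nonneg hb.le (by linarith)
        gcongr
      rwa [← Real.rpow_mul hρ0.le, mul_div_cancel₀ _ (by linarith : a - b ≠ 0)] at this
    have : 0 ≤ D * ρ ^ a := by positivity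
    have := mul_le_mul_of_nonneg_left h2 hK.le
    linarith

theorem exists_stretched_bound {A k D a b : ℝ} (hA : 0 ≤ A) (hk : 0 ≤ k) (hD : 0 < D) (hb : 0 < b)
    (hab : b < a) :
    ∃ C > 0, ∀ ρ : ℝ, 1 ≤ ρ → A * ρ ^ k * Real.exp (1 - D * ρ ^ a) ≤ C * Real.exp (-ρ ^ b) := by
  have hK : 0 < 1 + k / b := by positivity
  refine ⟨(A + 1) * Real.exp (1 + (1 + k / b) * ((1 + k / b) / D) ^ (b / (a - b))), by positivity,
    fun ρ hρ => ?_⟩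
  have hρ0 : 0 < ρ := by linarith
  have h1 : ρ ^ k ≤ Real.exp (k / b * ρ ^ b) := by
    rw [Real.rpow_def_of_pos hρ0]
    have := Real.log_le_rpow_div hρ0.le hb
    refine Real.exp_le_exp.2 ?_
    calc Real.log ρ * k ≤ ρ ^ b / b * k := by gcongr
      _ = _ := by ring
  have h2 := rpow_sub_rpow_le hK hD hb hab hρ
  calc A * ρ ^ k * Real.exp (1 - D * ρ ^ a)
      ≤ (A + 1) * Real.exp (k / b * ρ ^ b) * Real.exp (1 - D * ρ ^ a) := by gcongr; linarith
    _ = (A + 1) * Real.exp (1 + ((1 + k / b) * ρ ^ b - D * ρ ^ a)) * Real.exp (-ρ ^ b) := by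
        rw [mul_assoc, mul_assoc, ← Real.exp_add, ← Real.exp_add]; congr 2; ring
    _ ≤ _ := by gcongr

theorem one_le_dist_lattice {o o' : ℤ × ℤ} (h : o ≠ o') : 1 ≤ dist (latticePt o) (latticePt o') := by
  rw [dist_plane, Real.one_le_sqrt]
  simp only [latticePt_zero, latticePt_one]
  have : (1 : ℤ) ≤ (o.1 - o'.1) ^ 2 + (o.2 - o'.2) ^ 2 := by
    by_contra! hlt
    have h1 : (o.1 - o'.1) ^ 2 = 0 := by nlinarith [sq_nonneg (o.1 - o'.1), sq_nonneg (o.2 - o'.2)]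
    have h2 : (o.2 - o'.2) ^ 2 = 0 := by nlinarith [sq_nonneg (o.1 - o'.1), sq_nonneg (o.2 - o'.2)]
    rw [sq_eq_zero_iff, sub_eq_zero] at h1 h2
    exact h (Prod.ext h1 h2)
  exact_mod_cast this

/-- The lattice points of a ball. -/
theorem exists_lattice_finset {ρ : ℝ} (hρ : 1 ≤ ρ) : ∃ L : Finset (ℤ × ℤ),
    (L.card : ℝ) ≤ (85 * ρ) ^ 2 ∧ ∀ o : ℤ × ℤ, ‖latticePt o‖ ≤ 41 * ρ → o ∈ L := by
  set N : ℤ := ⌊41 * ρ⌋ with hN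
  have hN0 : 0 ≤ N := Int.floor_nonneg.2 (by linarith)
  refine ⟨Finset.Icc (-N) N ×ˢ Finset.Icc (-N) N, ?_, ?_⟩
  · have h1 : (((Finset.Icc (-N) N ×ˢ Finset.Icc (-N) N).card : ℕ) : ℝ) = (2 * N + 1) ^ 2 := by
      rw [Finset.card_product, Int.card_Icc, sq]
      push_cast
      have : (((N + 1 - -N).toNat : ℤ) : ℝ) = 2 * N + 1 := by
        rw [Int.toNat_of_nonneg (by omega)]; push_cast; ring
      simp only [Int.cast_natCast] at this
      rw [this]
    rw [h1]
    have h2 : (N : ℝ) ≤ 41 * ρ := Int.floor_le _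
    have h3 : (0 : ℝ) ≤ N := by exact_mod_cast hN0
    exact pow_le_pow_left₀ (by linarith) (by linarith) 2
  · intro o ho
    have hc : ∀ i, |latticePt o i| ≤ 41 * ρ := fun i => (PiLp.norm_apply_le (latticePt o) i).trans ho
    have h0 := abs_le.1 (hc 0)
    have h1 := abs_le.1 (hc 1)
    simp only [latticePt_zero, latticePt_one] at h0 h1
    simp only [Finset.mem_product, Finset.mem_Icc]
    refine ⟨⟨?_, Int.le_floor.2 h0.2⟩, ⟨?_, Int.le_floor.2 h1.2⟩⟩
    · rw [neg_le]; exact Int.le_floor.2 (by push_cast; linarith)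
    · rw [neg_le]; exact Int.le_floor.2 (by push_cast; linarith)

namespace Model

variable {Ω E : Type*} [MeasurableSpace Ω] [MeasurableSpace E] [MulAction ISO2 E]
  {P : Measure Ω} {M : Model Ω E P} {κ D₀ n₀ μ : ℝ}

variable (M) in
/-- Up to small powers of `ρ`, the passage times between the points of `D` of norm at most `40 ρ`
have diffusive fluctuations around `μ` times the distance. -/
def Crude (μ : ℝ) (D : Set Plane) (ρ : ℝ) (x : Ω) : Prop :=
  ∀ a ∈ D, ∀ b ∈ D, ‖a‖ < 40 * ρ → ‖b‖ < 40 * ρ →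
    |M.T a b x - μ * dist a b| ≤ ρ ^ (1 / 200 : ℝ) * √(1 + dist a b)

variable (M) in
/-- Passage times are additive along optimal paths, up to a small power of `ρ`. -/
def Aligned (D : Set Plane) (ρ : ℝ) (x : Ω) : Prop :=
  ∀ u ∈ D, ∀ v ∈ D, ‖u‖ < 40 * ρ → ‖v‖ < 40 * ρ → ∀ t₁ t₂ t₃ : unitInterval, t₁ < t₂ → t₂ < t₃ →
    M.passage (M.geodesic u v x t₁) (M.geodesic u v x t₂) (M.field x)
      + M.passage (M.geodesic u v x t₂) (M.geodesic u v x t₃) (M.field x)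
      ≤ M.passage (M.geodesic u v x t₁) (M.geodesic u v x t₃) (M.field x)
        + ENNReal.ofReal (ρ ^ (1 / 80 : ℝ))

namespace Assumptions

/-- Deterministic step: local and lattice bounds imply the crude bound. -/
theorem crude_of_lattice {D : Set Plane} {C ρ y : ℝ} {x : Ω}
    (hlow : ∀ d : ℝ, 0 ≤ d → μ * d ≤ M.meanX d)
    (hup : ∀ d : ℝ, 0 ≤ d → M.meanX d ≤ μ * d + C * (√(1 + d) * (1 + d) ^ (1 / 400 : ℝ)))
    (hμ : 0 < μ) (hC : 0 ≤ C) (hρ : 1 ≤ ρ) (hy : 1 ≤ y)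
    (hbig : 5 * y + 4 * C * ρ ^ (1 / 400 : ℝ) + 2 * μ ≤ ρ ^ (1 / 200 : ℝ))
    (hlat : ∀ o : ℤ × ℤ, latticePt o ∈ D)
    (htri : ∀ u ∈ D, ∀ v ∈ D, ∀ w ∈ D, M.T u v x ≤ M.T u w x + M.T w v x)
    (hloc : ∀ o : ℤ × ℤ, ‖latticePt o‖ ≤ 41 * ρ → ∀ u ∈ D ∩ Metric.ball (latticePt o) 3,
      ∀ v ∈ D ∩ Metric.ball (latticePt o) 3, M.T u v x ≤ y)
    (htail : ∀ o o' : ℤ × ℤ, ‖latticePt o‖ ≤ 41 * ρ → ‖latticePt o'‖ ≤ 41 * ρ →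
      1 ≤ dist (latticePt o) (latticePt o') →
      |M.T (latticePt o) (latticePt o') x - M.meanX (dist (latticePt o) (latticePt o'))|
        ≤ y * √(dist (latticePt o) (latticePt o'))) : M.Crude μ D ρ x := by
  intro a ha b hb ha' hb'
  obtain ⟨o, hao⟩ := exists_lattice_near a
  obtain ⟨o', hbo⟩ := exists_lattice_near b
  have nlat : ∀ {c : Plane} {o : ℤ × ℤ}, dist c (latticePt o) ≤ 1 → ‖c‖ < 40 * ρ →
      ‖latticePt o‖ ≤ 41 * ρ := by
    intro c o h1 h2
    have : ‖latticePt o‖ ≤ ‖c‖ + dist c (latticePt o) := by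
      rw [dist_eq_norm']; simpa using norm_add_le c (latticePt o - c)
    linarith
  have no := nlat hao ha'
  have no' := nlat hbo hb'
  have mem : ∀ {c : Plane} {o : ℤ × ℤ}, c ∈ D → dist c (latticePt o) ≤ 1 →
      c ∈ D ∩ Metric.ball (latticePt o) 3 := fun hc h => ⟨hc, by rw [Metric.mem_ball]; linarith⟩
  have memo : ∀ o : ℤ × ℤ, latticePt o ∈ D ∩ Metric.ball (latticePt o) 3 := fun o =>
    ⟨hlat o, by simp⟩
  have l1 := hloc o no _ (mem ha hao) _ (memo o)
  have l2 := hloc o no _ (memo o) _ (mem ha hao)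
  have l3 := hloc o' no' _ (mem hb hbo) _ (memo o')
  have l4 := hloc o' no' _ (memo o') _ (mem hb hbo)
  set d := dist a b with hd
  set d' := dist (latticePt o) (latticePt o') with hd'
  have d0 : 0 ≤ d := dist_nonneg
  have d0' : 0 ≤ d' := dist_nonneg
  have q1 : d' ≤ d + 2 := by
    have h1 := dist_triangle_left (latticePt o) (latticePt o') a
    have h2 := dist_triangle a b (latticePt o')
    linarith
  have q2 : d ≤ d' + 2 := by
    have h1 := dist_triangle a (latticePt o) b
    have h2 := dist_triangle (latticePt o) (latticePt o') b
    rw [dist_comm (latticePt o') b] at h2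
    linarith
  have q3 : d' ≤ 82 * ρ := by
    have : d' ≤ ‖latticePt o‖ + ‖latticePt o'‖ := dist_le_norm_add_norm _ _
    linarith
  have s1 : 1 ≤ √(1 + d) := by rw [Real.one_le_sqrt]; linarith
  have s2 : √(1 + d') ≤ 2 * √(1 + d) := by
    rw [Real.sqrt_le_left (by positivity), mul_pow, Real.sq_sqrt (by linarith)]
    linarith
  have s3 : (1 + d') ^ (1 / 400 : ℝ) ≤ 2 * ρ ^ (1 / 400 : ℝ) := by
    calc (1 + d') ^ (1 / 400 : ℝ) ≤ (2 ^ (400 : ℝ) * ρ) ^ (1 / 400 : ℝ) := by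
          have h83 : (83 : ℝ) ≤ 2 ^ (400 : ℝ) := by
            calc (83 : ℝ) ≤ 2 ^ ((7 : ℕ) : ℝ) := by rw [Real.rpow_natCast]; norm_num
              _ ≤ 2 ^ (400 : ℝ) := Real.rpow_le_rpow_of_exponent_le (by norm_num) (by norm_num)
          have : 1 + d' ≤ 2 ^ (400 : ℝ) * ρ :=
            (show 1 + d' ≤ 83 * ρ by linarith).trans (by gcongr)
          gcongr
      _ = _ := by
          rw [Real.mul_rpow (by positivity) (by linarith), ← Real.rpow_mul (by norm_num)]
          norm_num
  -- the lattice points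
  have key : |M.T (latticePt o) (latticePt o') x - μ * d'|
      ≤ (2 * y + 4 * C * ρ ^ (1 / 400 : ℝ)) * √(1 + d) := by
    rcases eq_or_ne o o' with h | h
    · have : d' = 0 := by rw [hd', h, dist_self]
      rw [this, mul_zero, sub_zero, abs_of_nonneg (T_nonneg _ _ _), h]
      have := hloc o' no' _ (memo o') _ (memo o')
      have h2 : 0 ≤ 4 * C * ρ ^ (1 / 400 : ℝ) := by positivity
      nlinarith
    · have h1 := htail o o' no no' (one_le_dist_lattice h)
      rw [← hd'] at h1
      have h2 := hlow d' d0'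
      have h3 := hup d' d0'
      have h4 : √d' ≤ √(1 + d') := Real.sqrt_le_sqrt (by linarith)
      have h5 : C * (√(1 + d') * (1 + d') ^ (1 / 400 : ℝ))
          ≤ C * (2 * √(1 + d) * (2 * ρ ^ (1 / 400 : ℝ))) := by gcongr
      have h6 : y * √d' ≤ y * (2 * √(1 + d)) := by gcongr; linarith
      rw [abs_le] at h1 ⊢
      have h7 : 0 ≤ C * (2 * √(1 + d) * (2 * ρ ^ (1 / 400 : ℝ))) := by positivity
      constructor <;> linarith
  have t1 := htri a ha b hb _ (hlat o)
  have t2 := htri _ (hlat o) b hb _ (hlat o')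
  have t3 := htri _ (hlat o) _ (hlat o') a ha
  have t4 := htri a ha _ (hlat o') b hb
  have hfin : (2 * y + 2 * μ + (2 * y + 4 * C * ρ ^ (1 / 400 : ℝ))) * √(1 + d)
      ≤ ρ ^ (1 / 200 : ℝ) * √(1 + d) := by gcongr; linarith
  have hone : 2 * y + 2 * μ ≤ (2 * y + 2 * μ) * √(1 + d) :=
    le_mul_of_one_le_right (by linarith) s1
  have m1 := mul_le_mul_of_nonneg_left q1 hμ.le
  have m2 := mul_le_mul_of_nonneg_left q2 hμ.le
  rw [abs_le] at key ⊢
  constructor <;> linarith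

variable [IsProbabilityMeasure P]

theorem ae_finite_on (hM : M.Assumptions κ D₀ n₀ μ) {D : Set Plane} (hD : D.Countable) :
    ∀ᵐ x ∂P, ∀ a ∈ D, ∀ b ∈ D, M.passage a b (M.field x) ≠ ⊤ :=
  (ae_ball_iff hD).2 fun a _ => (ae_ball_iff hD).2 fun b _ => hM.ae_finite a b

theorem measureReal_le_of_ae_imp {A B : Set Ω} (h : ∀ᵐ x ∂P, x ∈ A → x ∈ B) :
    P.real A ≤ P.real B :=
  ENNReal.toReal_mono (measure_ne_top _ _) (measure_mono_ae h)

/-- Local passage times and passage times between lattice points determine those between all the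
points of `D`, so a union bound over polynomially many pairs of lattice points suffices. -/
theorem exists_crude (hM : M.Assumptions κ D₀ n₀ μ) : ∃ C > 0, ∀ D : Set Plane, D.Countable →
    (∀ o : ℤ × ℤ, latticePt o ∈ D) → ∀ ρ : ℝ, 1 ≤ ρ →
    P.real {x | ¬ M.Crude μ D ρ x} ≤ C * Real.exp (-ρ ^ (κ / 500)) := by
  have hκ := hM.κ_pos
  have hD₀ := hM.D₀_pos
  have hμ := hM.μ_pos
  obtain ⟨C, hC, hup⟩ := hM.exists_meanX_le (δ := 1 / 400) (by norm_num)
  obtain ⟨C', hC', hbd⟩ := exists_stretched_bound (A := 2 * 85 ^ 4) (k := 4) (D := D₀) (b := κ / 500)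
    (a := κ / 400) (by norm_num) (by norm_num) hD₀ (by positivity) (by linarith)
  -- the threshold for `ρ`
  obtain ⟨K, hK⟩ : ∃ K : ℝ, K = 5 + 4 * C + 2 * μ := ⟨_, rfl⟩
  have hK0 : 1 ≤ K := by linarith
  refine ⟨C' + Real.exp ((K ^ (400 : ℝ)) ^ (κ / 500)), by positivity, fun D hDc hlat ρ hρ => ?_⟩
  have hρ0 : 0 < ρ := by linarith
  rcases lt_or_ge ρ (K ^ (400 : ℝ)) with hsmall | hlarge
  · refine measureReal_le_one.trans ?_
    rw [add_mul, ← Real.exp_add]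
    have : ρ ^ (κ / 500) ≤ (K ^ (400 : ℝ)) ^ (κ / 500) :=
      Real.rpow_le_rpow hρ0.le hsmall.le (by positivity)
    have := Real.one_le_exp (show 0 ≤ (K ^ (400 : ℝ)) ^ (κ / 500) + -ρ ^ (κ / 500) by linarith)
    have : 0 ≤ C' * Real.exp (-ρ ^ (κ / 500)) := by positivity
    linarith
  obtain ⟨y, hy⟩ : ∃ y, y = ρ ^ (1 / 400 : ℝ) := ⟨_, rfl⟩
  have hy1 : 1 ≤ y := hy ▸ Real.one_le_rpow hρ (by norm_num)
  have hKy : K ≤ y := by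
    calc K = (K ^ (400 : ℝ)) ^ (1 / 400 : ℝ) := by
          rw [← Real.rpow_mul (by linarith), show (400 : ℝ) * (1 / 400) = 1 by norm_num,
            Real.rpow_one]
      _ ≤ y := hy ▸ Real.rpow_le_rpow (Real.rpow_nonneg (by linarith) _) hlarge (by norm_num)
  have hyy : ρ ^ (1 / 200 : ℝ) = y * y := by
    rw [hy, ← Real.rpow_add hρ0]; congr 1; norm_num
  have hbig : 5 * y + 4 * C * ρ ^ (1 / 400 : ℝ) + 2 * μ ≤ ρ ^ (1 / 200 : ℝ) := by
    rw [hyy, ← hy]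
    calc 5 * y + 4 * C * y + 2 * μ ≤ K * y := by
          rw [hK]; nlinarith
      _ ≤ y * y := by gcongr
  obtain ⟨L, hcard, hmemL⟩ := exists_lattice_finset hρ
  set A : ℤ × ℤ → Set Ω := fun o => {a | ∃ u ∈ D ∩ Metric.ball (latticePt o) 3,
    ∃ v ∈ D ∩ Metric.ball (latticePt o) 3, M.passage u v (M.field a) > ENNReal.ofReal y} with hA
  set B : (ℤ × ℤ) × (ℤ × ℤ) → Set Ω := fun o =>
    {a | 1 ≤ dist (latticePt o.1) (latticePt o.2) ∧
      |M.T (latticePt o.1) (latticePt o.2) a - M.meanX (dist (latticePt o.1) (latticePt o.2))|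
        > y * √(dist (latticePt o.1) (latticePt o.2))} with hB
  have hAP : ∀ o, P.real (A o) ≤ Real.exp (1 - D₀ * y ^ κ) := fun o =>
    hM.local_times_countable hDc _ (by linarith)
  have hBP : ∀ o, P.real (B o) ≤ Real.exp (1 - D₀ * y ^ κ) := by
    intro o
    by_cases h1 : 1 ≤ dist (latticePt o.1) (latticePt o.2)
    · have hS : MeasurableSet {z : ℝ | |z - M.meanX (dist (latticePt o.1) (latticePt o.2))|
          > y * √(dist (latticePt o.1) (latticePt o.2))} :=
        measurableSet_lt measurable_const (by fun_prop)
      have h2 := hM.measureReal_T (latticePt o.1) (latticePt o.2) hS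
      refine (measureReal_mono fun a ha => ha.2).trans (h2.le.trans ?_)
      exact hM.concentration _ h1 y (by linarith)
    · have : B o = ∅ := by
        ext a; simp [hB, h1]
      rw [this, measureReal_empty]
      positivity
  have hsub : ∀ᵐ x ∂P, x ∈ {x | ¬ M.Crude μ D ρ x} →
      x ∈ (⋃ o ∈ L, A o) ∪ ⋃ o ∈ L ×ˢ L, B o := by
    filter_upwards [hM.ae_finite_on hDc, hM.ae_triangle] with x hfin htri hx
    by_contra hnot
    simp only [Set.mem_union, Set.mem_iUnion, not_or, not_exists] at hnot
    refine hx (crude_of_lattice (fun d => hM.le_meanX) hup hμ hC hρ hy1 hbig hlat ?_ ?_ ?_)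
    · intro u hu v hv w hw
      rw [T, T, T, ← ENNReal.toReal_add (hfin u hu w hw) (hfin w hw v hv)]
      exact ENNReal.toReal_mono (ENNReal.add_ne_top.2 ⟨hfin u hu w hw, hfin w hw v hv⟩) (htri _ _ _)
    · intro o ho u hu v hv
      by_contra! hlt
      refine hnot.1 o (hmemL o ho) ⟨u, hu, v, hv, ?_⟩
      rw [gt_iff_lt, ← ENNReal.ofReal_toReal (hfin u hu.1 v hv.1)]
      exact (ENNReal.ofReal_lt_ofReal_iff (lt_trans (by linarith : (0 : ℝ) < y) hlt)).2 hlt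
    · intro o o' ho ho' hd
      by_contra! hlt
      exact hnot.2 (o, o') (Finset.mem_product.2 ⟨hmemL o ho, hmemL o' ho'⟩) ⟨hd, hlt⟩
  have hρ85 : 1 ≤ (85 * ρ) ^ 2 := one_le_pow₀ (by linarith)
  calc P.real {x | ¬ M.Crude μ D ρ x} ≤ P.real ((⋃ o ∈ L, A o) ∪ ⋃ o ∈ L ×ˢ L, B o) :=
        measureReal_le_of_ae_imp hsub
    _ ≤ ∑ o ∈ L, P.real (A o) + ∑ o ∈ L ×ˢ L, P.real (B o) :=
        (measureReal_union_le _ _).trans (add_le_add (measureReal_biUnion_finset_le _ _)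
          (measureReal_biUnion_finset_le _ _))
    _ ≤ L.card • Real.exp (1 - D₀ * y ^ κ) + (L ×ˢ L).card • Real.exp (1 - D₀ * y ^ κ) :=
        add_le_add (Finset.sum_le_card_nsmul _ _ _ fun o _ => hAP o)
          (Finset.sum_le_card_nsmul _ _ _ fun o _ => hBP o)
    _ ≤ (85 * ρ) ^ 4 * Real.exp (1 - D₀ * y ^ κ) + (85 * ρ) ^ 4 * Real.exp (1 - D₀ * y ^ κ) := by
        rw [nsmul_eq_mul, nsmul_eq_mul, Finset.card_product, Nat.cast_mul]
        gcongr
        · exact hcard.trans (by nlinarith)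
        · calc (L.card : ℝ) * L.card ≤ (85 * ρ) ^ 2 * (85 * ρ) ^ 2 := by gcongr
            _ = _ := by ring
    _ = 2 * 85 ^ 4 * ρ ^ (4 : ℝ) * Real.exp (1 - D₀ * ρ ^ (κ / 400)) := by
        rw [hy, ← Real.rpow_mul hρ0.le, show (1 / 400 : ℝ) * κ = κ / 400 by ring,
          show (4 : ℝ) = ((4 : ℕ) : ℝ) by norm_num, Real.rpow_natCast]
        ring
    _ ≤ C' * Real.exp (-ρ ^ (κ / 500)) := hbd ρ hρ
    _ ≤ _ := by
        gcongr
        linarith [Real.exp_pos ((K ^ (400 : ℝ)) ^ (κ / 500))]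

end Assumptions

end Model

/-! ### Additivity along optimal paths -/

namespace Model

variable {Ω E : Type*} [MeasurableSpace Ω] [MeasurableSpace E] [MulAction ISO2 E]
  {P : Measure Ω} {M : Model Ω E P} {κ D₀ n₀ μ : ℝ}

/-- Additivity at one or two intermediate times and at the end points gives alignment at any three
times. -/
theorem align_of_broken {x : Ω} {u v : Plane} {τ : ℝ≥0∞}
    (hends : M.geodesic u v x 0 = u ∧ M.geodesic u v x 1 = v)
    (htri : ∀ a b c, M.passage a b (M.field x)
      ≤ M.passage a c (M.field x) + M.passage c b (M.field x))
    (hfin : M.passage u v (M.field x) ≠ ⊤) (hτ : τ ≠ ⊤)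
    (hbr : ∀ m : ℕ, 1 ≤ m → m ≤ 3 → ∀ t : Fin (m + 2) → unitInterval, StrictMono t → t 0 = 0 →
      t (Fin.last (m + 1)) = 1 → M.brokenTime u v t x ≤ M.passage u v (M.field x) + τ)
    {t₁ t₂ t₃ : unitInterval} (h12 : t₁ < t₂) (h23 : t₂ < t₃) :
    M.passage (M.geodesic u v x t₁) (M.geodesic u v x t₂) (M.field x)
      + M.passage (M.geodesic u v x t₂) (M.geodesic u v x t₃) (M.field x)
      ≤ M.passage (M.geodesic u v x t₁) (M.geodesic u v x t₃) (M.field x) + τ := by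
  obtain ⟨e0, e1⟩ := hends
  set X := fun a b => M.passage a b (M.field x) with hX
  set γ := M.geodesic u v x with hγ
  change X (γ t₁) (γ t₂) + X (γ t₂) (γ t₃) ≤ X (γ t₁) (γ t₃) + τ
  change ∀ a b c, X a b ≤ X a c + X c b at htri
  change X u v ≠ ⊤ at hfin
  rcases eq_or_lt_of_le (show (0 : unitInterval) ≤ t₁ from t₁.2.1) with h0 | h0 <;>
  rcases eq_or_lt_of_le (show t₃ ≤ (1 : unitInterval) from t₃.2.2) with h1 | h1
  · have := hbr 1 le_rfl (by norm_num) ![0, t₂, 1] (by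
      rw [Fin.strictMono_iff_lt_succ]; intro i
      fin_cases i
      · exact h0 ▸ h12
      · exact h1 ▸ h23) rfl rfl
    simpa [brokenTime, Fin.sum_univ_succ, ← h0, h1, e0, e1, ← hγ] using this
  · have := hbr 2 (by norm_num) (by norm_num) ![0, t₂, t₃, 1] (by
      rw [Fin.strictMono_iff_lt_succ]; intro i
      fin_cases i
      · exact h0 ▸ h12
      · exact h23
      · exact h1) rfl rfl
    have h : X u (γ t₂) + (X (γ t₂) (γ t₃) + X (γ t₃) v) ≤ X u v + τ := by
      simpa [brokenTime, Fin.sum_univ_succ, e0, e1, ← hγ] using this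
    rw [← h0, e0]
    have hf : X (γ t₃) v ≠ ⊤ := by
      refine ne_top_of_le_ne_top (ENNReal.add_ne_top.2 ⟨hfin, hτ⟩) (le_trans ?_ h)
      exact le_add_self.trans le_add_self
    refine (ENNReal.add_le_add_iff_right hf).1 ?_
    calc _ = X u (γ t₂) + (X (γ t₂) (γ t₃) + X (γ t₃) v) := by ring
      _ ≤ X u v + τ := h
      _ ≤ (X u (γ t₃) + X (γ t₃) v) + τ := add_le_add (htri _ _ _) le_rfl
      _ = _ := by ring
  · have := hbr 2 (by norm_num) (by norm_num) ![0, t₁, t₂, 1] (by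
      rw [Fin.strictMono_iff_lt_succ]; intro i
      fin_cases i
      · exact h0
      · exact h12
      · exact h1 ▸ h23) rfl rfl
    have h : X u (γ t₁) + (X (γ t₁) (γ t₂) + X (γ t₂) v) ≤ X u v + τ := by
      simpa [brokenTime, Fin.sum_univ_succ, e0, e1, ← hγ] using this
    rw [h1, e1]
    have hf : X u (γ t₁) ≠ ⊤ := by
      refine ne_top_of_le_ne_top (ENNReal.add_ne_top.2 ⟨hfin, hτ⟩) (le_trans ?_ h)
      exact le_self_add
    refine (ENNReal.add_le_add_iff_left hf).1 (h.trans ?_)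
    rw [← add_assoc]
    exact add_le_add (htri _ _ _) le_rfl
  · have := hbr 3 (by norm_num) (by norm_num) ![0, t₁, t₂, t₃, 1] (by
      rw [Fin.strictMono_iff_lt_succ]; intro i
      fin_cases i
      · exact h0
      · exact h12
      · exact h23
      · exact h1) rfl rfl
    have h : X u (γ t₁) + (X (γ t₁) (γ t₂) + (X (γ t₂) (γ t₃) + X (γ t₃) v)) ≤ X u v + τ := by
      simpa [brokenTime, Fin.sum_univ_succ, e0, e1, ← hγ] using this
    have hf : X u (γ t₁) + X (γ t₃) v ≠ ⊤ := by
      refine ne_top_of_le_ne_top (ENNReal.add_ne_top.2 ⟨hfin, hτ⟩) (le_trans ?_ h)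
      exact add_le_add le_rfl (le_add_self.trans le_add_self)
    refine (ENNReal.add_le_add_iff_left hf).1 ?_
    calc _ = X u (γ t₁) + (X (γ t₁) (γ t₂) + (X (γ t₂) (γ t₃) + X (γ t₃) v)) := by ring
      _ ≤ X u v + τ := h
      _ ≤ (X u (γ t₁) + (X (γ t₁) (γ t₃) + X (γ t₃) v)) + τ :=
          add_le_add ((htri _ _ _).trans (add_le_add le_rfl (htri _ _ _))) le_rfl
      _ = _ := by ring

namespace Assumptions

variable [IsProbabilityMeasure P]

/-- The hypothesis on broken optimal paths, with end points of norm up to `40 ρ` and at most three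
intermediate times, yields additivity up to `ρ ^ (1 / 80)`. -/
theorem exists_aligned (hM : M.Assumptions κ D₀ n₀ μ) : ∃ C > 0, ∀ D : Set Plane, D.Countable →
    ∀ ρ : ℝ, 1 ≤ ρ → P.real {x | ¬ M.Aligned D ρ x} ≤ C * Real.exp (-ρ ^ (κ / 500)) := by
  have hκ := hM.κ_pos
  have hD₀ := hM.D₀_pos
  have hn₀ := hM.one_le_n₀
  obtain ⟨C', hC', hbd⟩ := exists_stretched_bound (A := 1) (k := 0) (D := D₀) (b := κ / 500)
    (a := κ / 160) (by norm_num) (by norm_num) hD₀ (by positivity) (by linarith)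
  -- a constant with `3 (log (40 ρ)) ^ (1 / κ) ≤ K ρ ^ (1 / 320)`
  obtain ⟨K, hK⟩ : ∃ K : ℝ, K = 3 * (40 ^ (κ / 320) / (κ / 320)) ^ (1 / κ) := ⟨_, rfl⟩
  have hK0 : 0 < K := by rw [hK]; positivity
  have hlog : ∀ ρ : ℝ, 1 ≤ ρ → 3 * (Real.log (40 * ρ)) ^ (1 / κ) ≤ K * ρ ^ (1 / 320 : ℝ) := by
    intro ρ hρ
    have h1 := Real.log_le_rpow_div (x := 40 * ρ) (by linarith) (show 0 < κ / 320 by positivity)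
    have h2 : 0 ≤ Real.log (40 * ρ) := Real.log_nonneg (by linarith)
    calc 3 * (Real.log (40 * ρ)) ^ (1 / κ) ≤ 3 * ((40 * ρ) ^ (κ / 320) / (κ / 320)) ^ (1 / κ) :=
          mul_le_mul_of_nonneg_left (Real.rpow_le_rpow h2 h1 (by positivity)) (by norm_num)
      _ = 3 * ((40 ^ (κ / 320) / (κ / 320)) * ρ ^ (κ / 320)) ^ (1 / κ) := by
          rw [Real.mul_rpow (by norm_num) (by linarith)]; congr 2; ring
      _ = K * ρ ^ (1 / 320 : ℝ) := by
          rw [Real.mul_rpow (by positivity) (by positivity), ← Real.rpow_mul (by linarith), hK]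
          rw [show κ / 320 * (1 / κ) = 1 / 320 by field_simp]
          ring
  obtain ⟨ρ₀, hρ₀⟩ : ∃ ρ₀ : ℝ, ρ₀ = n₀ + K ^ (320 : ℝ) := ⟨_, rfl⟩
  have hρ₀0 : 0 < ρ₀ := by rw [hρ₀]; positivity
  refine ⟨C' + Real.exp (ρ₀ ^ (κ / 500)), by positivity, fun D hDc ρ hρ => ?_⟩
  have hρ0 : 0 < ρ := by linarith
  rcases lt_or_ge ρ ρ₀ with hsmall | hlarge
  · refine measureReal_le_one.trans ?_
    rw [add_mul, ← Real.exp_add]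
    have : ρ ^ (κ / 500) ≤ ρ₀ ^ (κ / 500) := Real.rpow_le_rpow hρ0.le hsmall.le (by positivity)
    have := Real.one_le_exp (show 0 ≤ ρ₀ ^ (κ / 500) + -ρ ^ (κ / 500) by linarith)
    have : 0 ≤ C' * Real.exp (-ρ ^ (κ / 500)) := by positivity
    linarith
  have hKρ : K ≤ ρ ^ (1 / 320 : ℝ) := by
    have h1 : K ^ (320 : ℝ) ≤ ρ := by linarith
    calc K = (K ^ (320 : ℝ)) ^ (1 / 320 : ℝ) := by
          rw [← Real.rpow_mul hK0.le, show (320 : ℝ) * (1 / 320) = 1 by norm_num, Real.rpow_one]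
      _ ≤ _ := Real.rpow_le_rpow (by positivity) h1 (by norm_num)
  have hKpos : 0 < K ^ (320 : ℝ) := by positivity
  have hn : n₀ ≤ 40 * ρ := by linarith
  set y := ρ ^ (1 / 160 : ℝ) with hy
  have hy0 : 0 < y := by positivity
  have hlogn : 0 ≤ (Real.log (40 * ρ)) ^ (1 / κ) :=
    Real.rpow_nonneg (Real.log_nonneg (by linarith)) _
  have htol : ∀ m : ℕ, m ≤ 3 → y * m * (Real.log (40 * ρ)) ^ (1 / κ) ≤ ρ ^ (1 / 80 : ℝ) := by
    intro m hm
    have hm' : (m : ℝ) ≤ 3 := by exact_mod_cast hm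
    calc y * m * (Real.log (40 * ρ)) ^ (1 / κ) ≤ y * 3 * (Real.log (40 * ρ)) ^ (1 / κ) := by gcongr
      _ = y * (3 * (Real.log (40 * ρ)) ^ (1 / κ)) := by ring
      _ ≤ y * (K * ρ ^ (1 / 320 : ℝ)) := mul_le_mul_of_nonneg_left (hlog ρ hρ) hy0.le
      _ ≤ y * (ρ ^ (1 / 320 : ℝ) * ρ ^ (1 / 320 : ℝ)) := by gcongr
      _ = ρ ^ (1 / 80 : ℝ) := by
          rw [hy, ← Real.rpow_add hρ0, ← Real.rpow_add hρ0]; congr 1; norm_num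
  have hint := hM.intermediate (40 * ρ) hn y hy0
  calc P.real {x | ¬ M.Aligned D ρ x} ≤ _ := measureReal_le_of_ae_imp ?_
    _ ≤ Real.exp (1 - D₀ * y ^ κ) := hint
    _ = 1 * ρ ^ (0 : ℝ) * Real.exp (1 - D₀ * ρ ^ (κ / 160)) := by
        rw [hy, ← Real.rpow_mul hρ0.le, Real.rpow_zero, show 1 / 160 * κ = κ / 160 by ring]
        ring
    _ ≤ C' * Real.exp (-ρ ^ (κ / 500)) := hbd ρ hρ
    _ ≤ _ := by
        gcongr
        linarith [Real.exp_pos (ρ₀ ^ (κ / 500))]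
  filter_upwards [hM.ae_finite_on hDc, hM.ae_triangle, hM.optimal_paths] with x hfin htri hopt hx
  by_contra hnot
  refine hx fun u hu v hv hun hvn t₁ t₂ t₃ h12 h23 => ?_
  refine align_of_broken (hopt u v).1.2 (fun a b c => htri a b c) (hfin u hu v hv)
    ENNReal.ofReal_ne_top ?_ h12 h23
  intro m hm1 hm3 t hmono h0 h1
  by_contra! hlt
  refine hnot ⟨u, by simpa using hun, v, by simpa using hvn, m, hm1, t, hmono, h0, h1,
    lt_of_le_of_lt ?_ hlt⟩
  exact add_le_add le_rfl (ENNReal.ofReal_le_ofReal (htol m hm3))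

end Assumptions

/-- The rough geometry of one realisation at scale `R`: optimal paths between the points of `D` in
the ball of radius `R` stay in a comparable ball, the points of `D` in the neighbourhood of such a
path are almost aligned, and passage times are close to `μ` times the distance. -/
structure RoughGeometry (M : Model Ω E P) (μ : ℝ) (D : Set Plane) (R : ℝ) (x : Ω) : Prop where
  tri : ∀ a ∈ D, ∀ b ∈ D, ∀ c ∈ D, M.T a b x ≤ M.T a c x + M.T c b x
  ends : ∀ u v, M.geodesic u v x 0 = u ∧ M.geodesic u v x 1 = v
  norm_le : ∀ u ∈ D, ∀ v ∈ D, ‖u‖ ≤ R → ‖v‖ ≤ R → ∀ t, ‖M.geodesic u v x t‖ ≤ 10 * R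
  align : ∀ u ∈ D, ∀ v ∈ D, ‖u‖ ≤ R → ‖v‖ ≤ R → ∀ t₁ t₂ t₃ : unitInterval, t₁ ≤ t₂ → t₂ ≤ t₃ →
    ∀ d₁ ∈ D, ∀ d₂ ∈ D, ∀ d₃ ∈ D, dist d₁ (M.geodesic u v x t₁) ≤ 1 →
    dist d₂ (M.geodesic u v x t₂) ≤ 1 → dist d₃ (M.geodesic u v x t₃) ≤ 1 →
    M.T d₁ d₂ x + M.T d₂ d₃ x ≤ M.T d₁ d₃ x + 2000 * μ * R ^ (1 / 40 : ℝ)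
  crude : M.Crude μ D R x

namespace Assumptions

/-- Controlled passage times at all the scales `4 ^ m R` yield the rough geometry at scale `R`. -/
theorem roughGeometry_of_scales {D : Set Plane} {R : ℝ} {x : Ω} (hμ : 0 < μ)
    (hlat : ∀ o : ℤ × ℤ, latticePt o ∈ D)
    (hdense : ∀ z : Plane, ∀ δ > 0, ∃ k ∈ D, dist z k < δ) (hR : 1 ≤ R)
    (hR1 : 10 ≤ R ^ (1 / 40 : ℝ)) (hR2 : (11000 / μ) ^ (4 : ℝ) ≤ R ^ (1 / 40 : ℝ))
    (hfin : ∀ a ∈ D, ∀ b ∈ D, M.passage a b (M.field x) ≠ ⊤)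
    (htri : ∀ a b c, M.passage a b (M.field x)
      ≤ M.passage a c (M.field x) + M.passage c b (M.field x))
    (hsymm : ∀ a b, M.passage a b (M.field x) = M.passage b a (M.field x))
    (hends : ∀ u v, M.geodesic u v x 0 = u ∧ M.geodesic u v x 1 = v)
    (hcrude : ∀ m : ℕ, M.Crude μ D (4 ^ m * R) x)
    (halign : ∀ m : ℕ, M.Aligned D (4 ^ m * R) x) : M.RoughGeometry μ D R x := by
  have hR0 : 0 < R := by linarith
  set s := ⌈R ^ (1 / 40 : ℝ)⌉₊ with hs
  have hs1 : R ^ (1 / 40 : ℝ) ≤ s := Nat.le_ceil _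
  have hs2 : (s : ℝ) ≤ 2 * R ^ (1 / 40 : ℝ) := by
    have := (Nat.ceil_lt_add_one (by positivity : 0 ≤ R ^ (1 / 40 : ℝ))).le
    linarith
  have hs20 : 20 * (s : ℝ) ≤ R := by
    have h1 : R = R ^ (1 / 40 : ℝ) * (R ^ (1 / 40 : ℝ) * (R ^ (1 / 40 : ℝ) * R ^ (37 / 40 : ℝ))) := by
      rw [← Real.rpow_add hR0, ← Real.rpow_add hR0, ← Real.rpow_add hR0]
      norm_num
    have h2 : 1 ≤ R ^ (37 / 40 : ℝ) := Real.one_le_rpow hR (by norm_num)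
    have h3 : R ^ (1 / 40 : ℝ) * (10 * (10 * 1))
        ≤ R ^ (1 / 40 : ℝ) * (R ^ (1 / 40 : ℝ) * (R ^ (1 / 40 : ℝ) * R ^ (37 / 40 : ℝ))) := by gcongr
    linarith
  -- the scale `S = 4 ^ m s` compared with `ρ = 4 ^ m R`
  have hS : ∀ m : ℕ, (4 ^ m * R) ^ (1 / 40 : ℝ) ≤ 4 ^ m * s ∧
      (11000 / μ) ^ (4 : ℝ) ≤ 4 ^ m * s ∧ (10 : ℝ) ≤ 4 ^ m * s := by
    intro m
    have h1 : (1 : ℝ) ≤ 4 ^ m := one_le_pow₀ (by norm_num)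
    have h2 : (s : ℝ) ≤ 4 ^ m * s := le_mul_of_one_le_left (by positivity) h1
    refine ⟨?_, by linarith, by linarith⟩
    rw [Real.mul_rpow (by positivity) hR0.le]
    gcongr
    calc ((4 : ℝ) ^ m) ^ (1 / 40 : ℝ) ≤ ((4 : ℝ) ^ m) ^ (1 : ℝ) :=
          Real.rpow_le_rpow_of_exponent_le h1 (by norm_num)
      _ = 4 ^ m := Real.rpow_one _
  have hC : Controlled (fun a b => M.passage a b (M.field x)) (fun a b => M.geodesic a b x) D R μ s :=
    { mu_pos := hμ
      ten_le := hR1.trans hs1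
      scale_le := by linarith
      dense := hdense
      tri := fun u v w => htri u v w
      symm := hsymm
      ends := hends
      lattice := fun i j => hlat (i, j)
      fin := hfin
      near := by
        intro m a ha b hb ha' hb' hab
        obtain ⟨k1, k2, k3⟩ := hS m
        refine (hcrude m a ha b hb (by linarith) (by linarith)).trans ?_
        obtain ⟨S, hSdef⟩ : ∃ S : ℝ, S = 4 ^ m * s := ⟨_, rfl⟩
        rw [← hSdef] at k1 k2 k3 ⊢
        have hS0 : 0 < S := by linarith
        have e1 : (4 ^ m * R) ^ (1 / 200 : ℝ) ≤ S ^ (1 / 5 : ℝ) := by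
          have := Real.rpow_le_rpow (by positivity) k1 (show (0 : ℝ) ≤ 1 / 5 by norm_num)
          rwa [← Real.rpow_mul (by positivity), show (1 / 40 : ℝ) * (1 / 5) = 1 / 200 by norm_num]
            at this
        have e2 : √(1 + dist a b) ≤ 11 * S ^ (1 / 2 : ℝ) := by
          rw [← Real.sqrt_eq_rpow, Real.sqrt_le_left (by positivity), mul_pow, Real.sq_sqrt hS0.le]
          have : dist a b ≤ 100 * S := by rw [hSdef]; linarith
          linarith
        have e3 : 11000 / μ ≤ S ^ (1 / 4 : ℝ) := by
          have := Real.rpow_le_rpow (by positivity) k2 (show (0 : ℝ) ≤ 1 / 4 by norm_num)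
          rwa [← Real.rpow_mul (by positivity), show (4 : ℝ) * (1 / 4) = 1 by norm_num,
            Real.rpow_one] at this
        have e4 : 1 ≤ S ^ (1 / 20 : ℝ) := Real.one_le_rpow (by linarith) (by norm_num)
        have e5 : S = S ^ (1 / 4 : ℝ) * S ^ (1 / 20 : ℝ) * (S ^ (1 / 5 : ℝ) * S ^ (1 / 2 : ℝ)) := by
          rw [← Real.rpow_add hS0, ← Real.rpow_add hS0, ← Real.rpow_add hS0]
          norm_num
        calc (4 ^ m * R) ^ (1 / 200 : ℝ) * √(1 + dist a b)
            ≤ S ^ (1 / 5 : ℝ) * (11 * S ^ (1 / 2 : ℝ)) := by gcongr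
          _ = μ / 1000 * ((11000 / μ) * 1 * (S ^ (1 / 5 : ℝ) * S ^ (1 / 2 : ℝ))) := by
              field_simp; norm_num
          _ ≤ μ / 1000 * (S ^ (1 / 4 : ℝ) * S ^ (1 / 20 : ℝ)
              * (S ^ (1 / 5 : ℝ) * S ^ (1 / 2 : ℝ))) := by gcongr
          _ = μ / 1000 * S := by rw [← e5]
      align := by
        intro m u hu v hv hu' hv' t₁ t₂ t₃ h12 h23
        obtain ⟨k1, k2, k3⟩ := hS m
        refine (halign m u hu v hv (by linarith) (by linarith) t₁ t₂ t₃ h12 h23).trans ?_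
        refine add_le_add le_rfl (ENNReal.ofReal_le_ofReal ?_)
        obtain ⟨S, hSdef⟩ : ∃ S : ℝ, S = 4 ^ m * s := ⟨_, rfl⟩
        rw [← hSdef] at k1 k2 k3 ⊢
        have hS0 : 0 < S := by linarith
        have e1 : (4 ^ m * R) ^ (1 / 80 : ℝ) ≤ S ^ (1 / 2 : ℝ) := by
          have := Real.rpow_le_rpow (by positivity) k1 (show (0 : ℝ) ≤ 1 / 2 by norm_num)
          rwa [← Real.rpow_mul (by positivity), show (1 / 40 : ℝ) * (1 / 2) = 1 / 80 by norm_num]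
            at this
        have e3 : 11000 / μ ≤ S ^ (1 / 4 : ℝ) := by
          have := Real.rpow_le_rpow (by positivity) k2 (show (0 : ℝ) ≤ 1 / 4 by norm_num)
          rwa [← Real.rpow_mul (by positivity), show (4 : ℝ) * (1 / 4) = 1 by norm_num,
            Real.rpow_one] at this
        have e4 : 1 ≤ S ^ (1 / 4 : ℝ) := Real.one_le_rpow (by linarith) (by norm_num)
        have e5 : S = S ^ (1 / 4 : ℝ) * S ^ (1 / 4 : ℝ) * S ^ (1 / 2 : ℝ) := by
          rw [← Real.rpow_add hS0, ← Real.rpow_add hS0]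
          norm_num
        calc (4 ^ m * R) ^ (1 / 80 : ℝ) ≤ S ^ (1 / 2 : ℝ) := e1
          _ ≤ 11 * S ^ (1 / 2 : ℝ) := by linarith [Real.rpow_nonneg hS0.le (1 / 2 : ℝ)]
          _ = μ / 1000 * ((11000 / μ) * 1 * S ^ (1 / 2 : ℝ)) := by
              field_simp; norm_num
          _ ≤ μ / 1000 * (S ^ (1 / 4 : ℝ) * S ^ (1 / 4 : ℝ) * S ^ (1 / 2 : ℝ)) := by gcongr
          _ = μ / 1000 * S := by rw [← e5] }
  refine ⟨?_, hends, ?_, ?_, ?_⟩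
  · intro a ha b hb c hc
    rw [T, T, T, ← ENNReal.toReal_add (hfin a ha c hc) (hfin c hc b hb)]
    exact ENNReal.toReal_mono (ENNReal.add_ne_top.2 ⟨hfin a ha c hc, hfin c hc b hb⟩) (htri _ _ _)
  · exact fun u hu v hv hu' hv' t => hC.norm_path_le hs20 hu hu' hv hv' t
  · intro u hu v hv hu' hv' t₁ t₂ t₃ h12 h23 d₁ hd₁ d₂ hd₂ d₃ hd₃ h1 h2 h3
    refine (hC.align_near hs20 hu hu' hv hv' h12 h23 hd₁ hd₂ hd₃ h1 h2 h3).trans ?_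
    have : μ * s ≤ μ * (2 * R ^ (1 / 40 : ℝ)) := by gcongr
    change M.T d₁ d₃ x + _ ≤ _
    linarith
  · simpa using hcrude 0

variable [IsProbabilityMeasure P]

/-- A union bound over the scales `4 ^ m R`. -/
theorem measureReal_iUnion_scales {A : ℕ → Set Ω} {C c R : ℝ} (hC : 0 ≤ C) (hc : 0 < c) (hR : 1 ≤ R)
    (h : ∀ m : ℕ, P.real (A m) ≤ C * Real.exp (-(4 ^ m * R) ^ c)) :
    P.real (⋃ m, A m) ≤ C * (1 - Real.exp (-c))⁻¹ * Real.exp (-R ^ c) := by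
  have hR0 : 0 < R := by linarith
  have hRc : 1 ≤ R ^ c := Real.one_le_rpow hR hc.le
  have hterm : ∀ m : ℕ, P.real (A m) ≤ C * Real.exp (-R ^ c) * Real.exp (-c) ^ m := by
    intro m
    refine (h m).trans ?_
    rw [mul_assoc, ← Real.exp_nat_mul, ← Real.exp_add]
    gcongr
    have h1 : 1 + m * c ≤ ((4 : ℝ) ^ m) ^ c := by
      rw [← Real.rpow_natCast, ← Real.rpow_mul (by norm_num), Real.rpow_def_of_pos (by norm_num)]
      have h4 : 1 ≤ Real.log 4 := by
        rw [Real.le_log_iff_exp_le (by norm_num)]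
        linarith [Real.exp_one_lt_d9]
      have := Real.add_one_le_exp (Real.log 4 * (m * c))
      have h5 : 1 * (m * c) ≤ Real.log 4 * (m * c) := by gcongr
      linarith
    rw [Real.mul_rpow (by positivity) hR0.le]
    have h2 : 0 ≤ (m : ℝ) * c := by positivity
    nlinarith
  have he : Real.exp (-c) < 1 := by rw [Real.exp_lt_one_iff]; linarith
  have hs := (summable_geometric_of_lt_one (Real.exp_nonneg (-c)) he).mul_left
    (C * Real.exp (-R ^ c))
  refine ENNReal.toReal_le_of_le_ofReal ?_ ?_
  · have : 0 ≤ (1 - Real.exp (-c))⁻¹ := inv_nonneg.2 (by linarith)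
    positivity
  calc P (⋃ m, A m) ≤ ∑' m, P (A m) := measure_iUnion_le _
    _ ≤ ∑' m, ENNReal.ofReal (C * Real.exp (-R ^ c) * Real.exp (-c) ^ m) := by
        refine ENNReal.tsum_le_tsum fun m => ?_
        rw [← ofReal_measureReal]
        exact ENNReal.ofReal_le_ofReal (hterm m)
    _ = ENNReal.ofReal (∑' m, C * Real.exp (-R ^ c) * Real.exp (-c) ^ m) :=
        (ENNReal.ofReal_tsum_of_nonneg (fun m => by positivity) hs).symm
    _ = _ := by
        rw [tsum_mul_left, tsum_geometric_of_lt_one (Real.exp_nonneg _) he]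
        congr 1; ring

/-- Every realisation has the rough geometry at scale `R`, except with a stretched exponentially
small probability. -/
theorem exists_roughGeometry (hM : M.Assumptions κ D₀ n₀ μ) : ∃ C > 0, ∀ D : Set Plane,
    D.Countable → (∀ o : ℤ × ℤ, latticePt o ∈ D) →
    (∀ z : Plane, ∀ δ > 0, ∃ k ∈ D, dist z k < δ) → ∀ R : ℝ, 1 ≤ R →
    P.real {x | ¬ M.RoughGeometry μ D R x} ≤ C * Real.exp (-R ^ (κ / 500)) := by
  have hκ := hM.κ_pos
  have hμ := hM.μ_pos
  obtain ⟨C₁, hC₁, h₁⟩ := hM.exists_crude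
  obtain ⟨C₂, hC₂, h₂⟩ := hM.exists_aligned
  obtain ⟨K, hK⟩ : ∃ K : ℝ, K = max 10 ((11000 / μ) ^ (4 : ℝ)) := ⟨_, rfl⟩
  have hK0 : 10 ≤ K := hK ▸ le_max_left _ _
  have he : Real.exp (-(κ / 500)) < 1 := by rw [Real.exp_lt_one_iff]; linarith
  have hg : 0 < (1 - Real.exp (-(κ / 500)))⁻¹ := inv_pos.2 (by linarith)
  obtain ⟨C₃, hC₃⟩ : ∃ C₃, C₃ = (C₁ + C₂) * (1 - Real.exp (-(κ / 500)))⁻¹ := ⟨_, rfl⟩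
  have hC₃0 : 0 < C₃ := by rw [hC₃]; positivity
  refine ⟨C₃ + Real.exp ((K ^ (40 : ℝ)) ^ (κ / 500)), by positivity,
    fun D hDc hlat hdense R hR => ?_⟩
  have hR0 : 0 < R := by linarith
  rcases lt_or_ge R (K ^ (40 : ℝ)) with hsmall | hlarge
  · refine measureReal_le_one.trans ?_
    rw [add_mul, ← Real.exp_add]
    have : R ^ (κ / 500) ≤ (K ^ (40 : ℝ)) ^ (κ / 500) :=
      Real.rpow_le_rpow hR0.le hsmall.le (by positivity)
    have := Real.one_le_exp (show 0 ≤ (K ^ (40 : ℝ)) ^ (κ / 500) + -R ^ (κ / 500) by linarith)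
    have : 0 ≤ C₃ * Real.exp (-R ^ (κ / 500)) := by positivity
    linarith
  have hKR : K ≤ R ^ (1 / 40 : ℝ) := by
    calc K = (K ^ (40 : ℝ)) ^ (1 / 40 : ℝ) := by
          rw [← Real.rpow_mul (by linarith), show (40 : ℝ) * (1 / 40) = 1 by norm_num, Real.rpow_one]
      _ ≤ _ := Real.rpow_le_rpow (Real.rpow_nonneg (by linarith) _) hlarge (by norm_num)
  have hU := measureReal_iUnion_scales (P := P)
    (A := fun m => {x | ¬ M.Crude μ D (4 ^ m * R) x} ∪ {x | ¬ M.Aligned D (4 ^ m * R) x})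
    (add_pos hC₁ hC₂).le (show 0 < κ / 500 by positivity) hR (fun m => by
      have h1 : 1 ≤ 4 ^ m * R := one_le_mul_of_one_le_of_one_le (one_le_pow₀ (by norm_num)) hR
      rw [add_mul]
      exact (measureReal_union_le _ _).trans (add_le_add (h₁ D hDc hlat _ h1) (h₂ D hDc _ h1)))
  rw [← hC₃] at hU
  refine (measureReal_le_of_ae_imp ?_).trans (hU.trans ?_)
  · filter_upwards [hM.ae_finite_on hDc, hM.ae_triangle, hM.ae_symm, hM.optimal_paths]
      with x hfin htri hsymm hopt hx
    by_contra hnot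
    simp only [Set.mem_iUnion, Set.mem_union, not_exists, not_or, Set.mem_ofPred_eq, not_not]
      at hnot
    exact hx (roughGeometry_of_scales hμ hlat hdense hR (hK0.trans hKR)
      ((hK ▸ le_max_right _ _ : (11000 / μ) ^ (4 : ℝ) ≤ K).trans hKR) hfin htri hsymm
      (fun u v => (hopt u v).1.2) (fun m => (hnot m).1) (fun m => (hnot m).2))
  · gcongr
    linarith [Real.exp_pos ((K ^ (40 : ℝ)) ^ (κ / 500))]

end Assumptions

end Model

/-! ### Skeletons of optimal paths -/

/-- The points with abscissa in `S` and rational ordinate. -/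
def stripes (S : Set ℝ) : Set Plane := {p | p 0 ∈ S ∧ p 1 ∈ Set.range ((↑) : ℚ → ℝ)}

theorem stripes_countable {S : Set ℝ} (hS : S.Countable) : (stripes S).Countable := by
  have h : (stripes S) ⊆ (fun q : ℝ × ℝ => pt q.1 q.2) '' (S ×ˢ Set.range ((↑) : ℚ → ℝ)) := by
    rintro p ⟨h0, h1⟩
    refine ⟨(p 0, p 1), ⟨h0, h1⟩, ?_⟩
    ext i; fin_cases i <;> rfl
  exact ((hS.prod (Set.countable_range _)).image _).mono h

theorem pt_mem_stripes {S : Set ℝ} {x : ℝ} (hx : x ∈ S) (j : ℤ) : pt x j ∈ stripes S :=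
  ⟨hx, (j : ℚ), by simp⟩

theorem lattice_mem_stripes {S : Set ℝ} (hS : Set.range ((↑) : ℚ → ℝ) ⊆ S) (o : ℤ × ℤ) :
    latticePt o ∈ stripes S := pt_mem_stripes (hS ⟨(o.1 : ℚ), by simp⟩) _

theorem stripes_dense {S : Set ℝ} (hS : Set.range ((↑) : ℚ → ℝ) ⊆ S) (z : Plane) (δ : ℝ)
    (hδ : 0 < δ) : ∃ k ∈ stripes S, dist z k < δ := by
  obtain ⟨a, ha1, ha2⟩ := exists_rat_btwn (show z 0 < z 0 + δ / 2 by linarith)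
  obtain ⟨b, hb1, hb2⟩ := exists_rat_btwn (show z 1 < z 1 + δ / 2 by linarith)
  refine ⟨pt a b, ⟨hS ⟨a, rfl⟩, ⟨b, rfl⟩⟩, ?_⟩
  rw [dist_plane, Real.sqrt_lt' hδ]
  simp only [pt_zero, pt_one]
  nlinarith

/-- Times at which a path from left to right visits the vertical lines, in increasing order. -/
theorem exists_hits (γ : PlanePath) {x₀ L : ℝ} (hL : 0 < L) (h0 : γ 0 0 = x₀)
    (h1 : γ 1 0 = x₀ + L) : ∃ h : ℝ → unitInterval, h 0 = 0 ∧ h L = 1 ∧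
      (∀ a, 0 ≤ a → a ≤ L → γ (h a) 0 = x₀ + a) ∧
      ∀ a b, 0 ≤ a → a ≤ b → b ≤ L → h a ≤ h b := by
  have hc : Continuous fun t => γ t 0 := by fun_prop
  set S : ℝ → Set unitInterval := fun a => {t | x₀ + a ≤ γ t 0} with hS
  have hclosed : ∀ a, IsClosed (S a) := fun a => isClosed_le continuous_const hc
  have hmem1 : ∀ a ≤ L, (1 : unitInterval) ∈ S a := fun a ha => by
    change x₀ + a ≤ γ 1 0; rw [h1]; linarith
  have hmem : ∀ a ≤ L, sInf (S a) ∈ S a := fun a ha =>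
    (hclosed a).isCompact.sInf_mem ⟨1, hmem1 a ha⟩
  have hval : ∀ a, 0 ≤ a → a ≤ L → γ (sInf (S a)) 0 = x₀ + a := by
    intro a ha haL
    have hm : x₀ + a ≤ γ (sInf (S a)) 0 := hmem a haL
    obtain ⟨t, ht, hta⟩ := intermediate_value_Icc (show (0 : unitInterval) ≤ sInf (S a) from
      (sInf (S a)).2.1) hc.continuousOn (show x₀ + a ∈ Set.Icc (γ 0 0) (γ (sInf (S a)) 0) from
      ⟨by rw [h0]; linarith, hm⟩)
    have : sInf (S a) ≤ t := sInf_le (show x₀ + a ≤ γ t 0 from hta.ge)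
    rw [← hta, le_antisymm this ht.2]
  refine ⟨fun a => if a = L then 1 else sInf (S a), ?_, by simp, ?_, ?_⟩
  · simp only [if_neg hL.ne]
    refine le_antisymm (sInf_le ?_) (sInf (S 0)).2.1
    change x₀ + 0 ≤ γ 0 0
    rw [h0, add_zero]
  · intro a ha haL
    by_cases h : a = L
    · simp only [h, if_true, h1]
    · simp only [if_neg h]; exact hval a ha haL
  · intro a b ha hab hbL
    by_cases hb : b = L
    · simp only [hb, if_true]
      exact (_ : unitInterval).2.2
    · have : a ≠ L := by rintro rfl; exact hb (le_antisymm hbL hab)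
      simp only [hb, this, if_false]
      exact sInf_le_sInf fun t (ht : x₀ + b ≤ γ t 0) => (show x₀ + a ≤ γ t 0 by linarith)

namespace Model

variable {Ω E : Type*} [MeasurableSpace Ω] [MeasurableSpace E] [MulAction ISO2 E]
  {P : Measure Ω} {M : Model Ω E P} {κ D₀ n₀ μ : ℝ}

/-- The skeleton of the optimal path from `(x₀, j)` to `(x₀ + L, j')`: at the time `h a` the path
visits the vertical line at abscissa `x₀ + a`, and `Y a` is the ordinate, rounded to an integer.
Passage times are additive along the points of the skeleton, up to the error `err`. -/
structure Skeleton (M : Model Ω E P) (D : Set Plane) (x₀ L err H : ℝ) (j j' : ℤ) (x : Ω)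
    (h : ℝ → unitInterval) (Y : ℝ → ℤ) : Prop where
  h_zero : h 0 = 0
  h_end : h L = 1
  Y_zero : Y 0 = j
  Y_end : Y L = j'
  bound : ∀ a, 0 ≤ a → a ≤ L → |(Y a : ℝ)| ≤ H
  near : ∀ a, 0 ≤ a → a ≤ L →
    dist (pt (x₀ + a) (Y a)) (M.geodesic (pt x₀ j) (pt (x₀ + L) j') x (h a)) ≤ 1
  super : ∀ a b c, 0 ≤ a → a ≤ b → b ≤ c → c ≤ L → pt (x₀ + a) (Y a) ∈ D →
    pt (x₀ + b) (Y b) ∈ D → pt (x₀ + c) (Y c) ∈ D →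
    M.T (pt (x₀ + a) (Y a)) (pt (x₀ + b) (Y b)) x + M.T (pt (x₀ + b) (Y b)) (pt (x₀ + c) (Y c)) x
      ≤ M.T (pt (x₀ + a) (Y a)) (pt (x₀ + c) (Y c)) x + err

theorem RoughGeometry.exists_skeleton {D : Set Plane} {R : ℝ} {x : Ω}
    (hx : M.RoughGeometry μ D R x) {x₀ L : ℝ} (hL : 0 < L) {j j' : ℤ} (hu : pt x₀ j ∈ D)
    (hv : pt (x₀ + L) j' ∈ D) (hu' : ‖pt x₀ j‖ ≤ R) (hv' : ‖pt (x₀ + L) j'‖ ≤ R) :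
    ∃ h Y, M.Skeleton D x₀ L (2000 * μ * R ^ (1 / 40 : ℝ)) (10 * R + 1) j j' x h Y := by
  set γ := M.geodesic (pt x₀ j) (pt (x₀ + L) j') x with hγ
  obtain ⟨e0, e1⟩ := hx.ends (pt x₀ j) (pt (x₀ + L) j')
  rw [← hγ] at e0 e1
  obtain ⟨h, a0, aL, hit, mono⟩ := exists_hits γ (x₀ := x₀) hL (by simp [e0]) (by simp [e1])
  have near : ∀ a, 0 ≤ a → a ≤ L → dist (pt (x₀ + a) ⌊γ (h a) 1⌋) (γ (h a)) ≤ 1 := by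
    intro a ha haL
    rw [dist_plane, hit a ha haL, Real.sqrt_le_iff]
    refine ⟨zero_le_one, ?_⟩
    simp only [pt_zero, pt_one]
    have h1 := Int.floor_le (γ (h a) 1)
    have h2 := Int.lt_floor_add_one (γ (h a) 1)
    nlinarith
  refine ⟨h, fun a => ⌊γ (h a) 1⌋, a0, aL, ?_, ?_, ?_, near, ?_⟩
  · simp [a0, e0]
  · simp [aL, e1]
  · intro a ha haL
    have h1 := hx.norm_le _ hu _ hv hu' hv' (h a)
    rw [← hγ] at h1
    have h2 := (PiLp.norm_apply_le (γ (h a)) 1).trans h1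
    rw [Real.norm_eq_abs, abs_le] at h2
    have h3 := Int.floor_le (γ (h a) 1)
    have h4 := Int.lt_floor_add_one (γ (h a) 1)
    rw [abs_le]
    constructor <;> linarith
  · intro a b c ha hab hbc hc da db dc
    exact hx.align _ hu _ hv hu' hv' _ _ _ (mono a b ha hab (hbc.trans hc))
      (mono b c (ha.trans hab) hbc hc) _ da _ db _ dc (near a ha (hab.trans (hbc.trans hc)))
      (near b (ha.trans hab) (hbc.trans hc)) (near c (ha.trans (hab.trans hbc)) hc)

theorem Skeleton.sum_le {D : Set Plane} {x₀ L err H : ℝ} {j j' : ℤ} {x : Ω} {h : ℝ → unitInterval}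
    {Y : ℝ → ℤ} (hs : M.Skeleton D x₀ L err H j j' x h Y) {a r : ℝ} (ha : 0 ≤ a) (hr : 0 ≤ r)
    (herr : 0 ≤ err) {N : ℕ} (hN1 : 1 ≤ N) (hN : a + N * r ≤ L)
    (hD : ∀ i : ℕ, i ≤ N → pt (x₀ + (a + i * r)) (Y (a + i * r)) ∈ D) :
    ∑ i ∈ Finset.range N, M.T (pt (x₀ + (a + i * r)) (Y (a + i * r)))
        (pt (x₀ + (a + (i + 1 : ℕ) * r)) (Y (a + (i + 1 : ℕ) * r))) x
      ≤ M.T (pt (x₀ + (a + (0 : ℕ) * r)) (Y (a + (0 : ℕ) * r)))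
          (pt (x₀ + (a + N * r)) (Y (a + N * r))) x + N * err := by
  induction N, hN1 using Nat.le_induction with
  | base => simpa using herr
  | succ N hN1 ih =>
    have hle : a + (N : ℝ) * r ≤ a + (N + 1 : ℕ) * r := by gcongr; omega
    have h1 := hs.super (a + (0 : ℕ) * r) (a + N * r) (a + (N + 1 : ℕ) * r) (by positivity)
      (by gcongr; omega) hle hN (hD 0 (by omega)) (hD N (by omega)) (hD _ le_rfl)
    have h2 := ih (hle.trans hN) fun i hi => hD i (by omega)
    rw [Finset.sum_range_succ]
    have h3 : ((N + 1 : ℕ) : ℝ) * err = N * err + err := by push_cast; ring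
    linarith

end Model

/-! ### Deviations from a chord -/

/-! ### Polygonal lines -/

/-- A detour through a point at distance `δ` from a chord of length `d` costs at least of order
`δ ^ 2 / d`. -/
theorem cross_sq_le (a b c : Plane) :
    ((c 0 - a 0) * (b 1 - c 1) - (c 1 - a 1) * (b 0 - c 0)) ^ 2
      ≤ dist a c * dist c b * ((dist a c + dist c b) ^ 2 - dist a b ^ 2) := by
  have h1 : dist a c ^ 2 = (a 0 - c 0) ^ 2 + (a 1 - c 1) ^ 2 := by
    rw [dist_plane, Real.sq_sqrt (by positivity)]
  have h2 : dist c b ^ 2 = (c 0 - b 0) ^ 2 + (c 1 - b 1) ^ 2 := by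
    rw [dist_plane, Real.sq_sqrt (by positivity)]
  have h3 : dist a b ^ 2 = (a 0 - b 0) ^ 2 + (a 1 - b 1) ^ 2 := by
    rw [dist_plane, Real.sq_sqrt (by positivity)]
  set p := dist a c
  set q := dist c b
  have hpq : 0 ≤ p * q := by positivity
  set ip := (c 0 - a 0) * (b 0 - c 0) + (c 1 - a 1) * (b 1 - c 1) with hip
  have e1 : (p + q) ^ 2 - dist a b ^ 2 = 2 * (p * q - ip) := by rw [h3, add_sq, h1, h2, hip]; ring
  have e2 : ((c 0 - a 0) * (b 1 - c 1) - (c 1 - a 1) * (b 0 - c 0)) ^ 2 = (p * q) ^ 2 - ip ^ 2 := by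
    rw [mul_pow, h1, h2, hip]; ring
  rw [e1, e2]
  nlinarith [sq_nonneg (p * q - ip)]

/-- The polygonal line through the points `(x₀ + i r, y i)`. -/
def polyPt (x₀ r : ℝ) (y : ℕ → ℝ) (i : ℕ) : Plane := pt (x₀ + i * r) (y i)

/-- The length of the first `N` edges of the polygonal line. -/
def polyLen (r : ℝ) (y : ℕ → ℝ) (N : ℕ) : ℝ :=
  ∑ i ∈ Finset.range N, √(r ^ 2 + (y (i + 1) - y i) ^ 2)

theorem dist_polyPt_succ (x₀ r : ℝ) (y : ℕ → ℝ) (i : ℕ) :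
    dist (polyPt x₀ r y i) (polyPt x₀ r y (i + 1)) = √(r ^ 2 + (y (i + 1) - y i) ^ 2) := by
  rw [dist_plane]
  simp only [polyPt, pt_zero, pt_one]
  congr 1
  push_cast
  ring

theorem dist_add_dist_le_polyLen (x₀ r : ℝ) (y : ℕ → ℝ) {i N : ℕ} (hi : i ≤ N) :
    dist (polyPt x₀ r y 0) (polyPt x₀ r y i) + dist (polyPt x₀ r y i) (polyPt x₀ r y N)
      ≤ polyLen r y N := by
  have h1 := dist_le_range_sum_dist (polyPt x₀ r y) i
  have h2 := dist_le_Ico_sum_dist (polyPt x₀ r y) hi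
  have h3 := Finset.sum_range_add_sum_Ico (fun i => dist (polyPt x₀ r y i) (polyPt x₀ r y (i + 1))) hi
  rw [polyLen]
  simp only [dist_polyPt_succ] at h1 h2 h3
  linarith

/-- Deviations of a polygonal line from its chord, in terms of its excess length. -/
theorem sq_chord_deviation_le {r n d : ℝ} {y : ℕ → ℝ} {N : ℕ} (hN : 0 < N) (hr : 0 < r)
    (hn : n = N * r) (hd : d = √(n ^ 2 + (y N - y 0) ^ 2)) (hd2 : d ≤ 2 * n)
    {i : ℕ} (hi : i ≤ N)
    (hdev : |y i - (y 0 + i / N * (y N - y 0))| ≤ 100 * n) :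
    (y i - (y 0 + i / N * (y N - y 0))) ^ 2 ≤ 150 * n * (polyLen r y N - d) := by
  have hN' : (0 : ℝ) < N := by exact_mod_cast hN
  have hn0 : 0 < n := by rw [hn]; positivity
  set ℓ := polyLen r y N with hℓ
  set δ := y i - (y 0 + i / N * (y N - y 0)) with hδ
  have hlen := dist_add_dist_le_polyLen 0 r y hi
  rw [← hℓ] at hlen
  have hcross := cross_sq_le (polyPt 0 r y 0) (polyPt 0 r y N) (polyPt 0 r y i)
  have hdd : dist (polyPt 0 r y 0) (polyPt 0 r y N) = d := by
    rw [dist_plane, hd, hn]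
    simp only [polyPt, pt_zero, pt_one]
    congr 1
    push_cast
    ring
  have htri := dist_triangle (polyPt 0 r y 0) (polyPt 0 r y i) (polyPt 0 r y N)
  rw [hdd] at htri hcross
  have p0 : 0 ≤ dist (polyPt 0 r y 0) (polyPt 0 r y i) := dist_nonneg
  have q0 : 0 ≤ dist (polyPt 0 r y i) (polyPt 0 r y N) := dist_nonneg
  have hc : (polyPt 0 r y i 0 - polyPt 0 r y 0 0) * (polyPt 0 r y N 1 - polyPt 0 r y i 1)
      - (polyPt 0 r y i 1 - polyPt 0 r y 0 1) * (polyPt 0 r y N 0 - polyPt 0 r y i 0) = - n * δ := by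
    simp only [polyPt, pt_zero, pt_one, hδ, hn]
    field_simp
    push_cast
    ring
  rw [hc] at hcross
  have hnd : n ≤ d := by
    rw [hd]; exact Real.le_sqrt_of_sq_le (by nlinarith [sq_nonneg (y N - y 0)])
  have hℓd : d ≤ ℓ := htri.trans hlen
  set p := dist (polyPt 0 r y 0) (polyPt 0 r y i)
  set q := dist (polyPt 0 r y i) (polyPt 0 r y N)
  rcases le_or_gt ℓ (6 * n) with h6 | h6
  · have h1 : p * q ≤ ℓ ^ 2 / 4 := by
      have : (p + q) ^ 2 ≤ ℓ ^ 2 := pow_le_pow_left₀ (by positivity) hlen 2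
      nlinarith only [sq_nonneg (p - q), this]
    have h0 : 0 ≤ (p + q) ^ 2 - d ^ 2 :=
      sub_nonneg.2 (pow_le_pow_left₀ (by linarith) htri 2)
    have h2 : (p + q) ^ 2 - d ^ 2 ≤ 12 * n * (ℓ - d) := by
      have e1 : (p + q) ^ 2 ≤ ℓ ^ 2 := pow_le_pow_left₀ (by positivity) hlen 2
      have e2 : 0 ≤ (ℓ - d) * (12 * n - ℓ - d) := mul_nonneg (by linarith) (by linarith)
      nlinarith only [e1, e2]
    have h3 : (n * δ) ^ 2 ≤ (9 * n ^ 2) * (12 * n * (ℓ - d)) := by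
      have e1 : ℓ ^ 2 ≤ (6 * n) ^ 2 := pow_le_pow_left₀ (by linarith) h6 2
      calc (n * δ) ^ 2 = (-n * δ) ^ 2 := by ring
        _ ≤ _ := hcross
        _ ≤ (ℓ ^ 2 / 4) * (12 * n * (ℓ - d)) := mul_le_mul h1 h2 h0 (by positivity)
        _ ≤ _ := by
            refine mul_le_mul_of_nonneg_right (by linarith) ?_
            exact mul_nonneg (by linarith) (by linarith)
    have h4 : n ^ 2 * δ ^ 2 ≤ n ^ 2 * (108 * n * (ℓ - d)) := by linarith
    have h5 := le_of_mul_le_mul_left h4 (by positivity)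
    have h6 : 0 ≤ n * (ℓ - d) := mul_nonneg hn0.le (by linarith)
    linarith
  · -- a very long line: the deviation is at most the length
    have hy0 : |y i - y 0| ≤ p := by
      have := PiLp.norm_apply_le (polyPt 0 r y 0 - polyPt 0 r y i) 1
      rw [← dist_eq_norm, Real.norm_eq_abs] at this
      simp only [polyPt, pt_one, PiLp.sub_apply] at this
      rwa [abs_sub_comm] at this
    have hyN : |y i - y N| ≤ q := by
      have := PiLp.norm_apply_le (polyPt 0 r y i - polyPt 0 r y N) 1
      rw [← dist_eq_norm, Real.norm_eq_abs] at this
      simp only [polyPt, pt_one, PiLp.sub_apply] at this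
      exact this
    have hw0 : (0 : ℝ) ≤ i / N := by positivity
    have hw1 : (i : ℝ) / N ≤ 1 := by rw [div_le_one hN']; exact_mod_cast hi
    have hδe : δ = (1 - i / N) * (y i - y 0) + i / N * (y i - y N) := by rw [hδ]; ring
    have hδℓ : |δ| ≤ ℓ := by
      rw [hδe]
      refine (abs_add_le _ _).trans ?_
      rw [abs_mul, abs_mul, abs_of_nonneg hw0, abs_of_nonneg (by linarith : 0 ≤ 1 - (i : ℝ) / N)]
      nlinarith [abs_nonneg (y i - y 0), abs_nonneg (y i - y N)]
    have h1 : δ ^ 2 ≤ 100 * n * ℓ := by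
      rw [← sq_abs, sq]
      exact mul_le_mul hdev hδℓ (abs_nonneg _) (by positivity)
    have h2 : 0 ≤ n * (ℓ - 3 * d) := mul_nonneg hn0.le (by linarith)
    linarith

/-- Deviations of a polygonal line from a horizontal line through its starting point. -/
theorem sq_axis_deviation_le {r s : ℝ} {y : ℕ → ℝ} {N : ℕ} (hr : 0 < r) (hN : 0 < N)
    (hs : s = N * r) (hy : y 0 = 0) {i : ℕ} (hi : i ≤ N) (hdev : |y i| ≤ 100 * s) :
    s ≤ polyLen r y N ∧ (y i) ^ 2 ≤ 150 * s * (polyLen r y N - s) := by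
  have hN' : (0 : ℝ) < N := by exact_mod_cast hN
  have hs0 : 0 < s := by rw [hs]; positivity
  set ℓ := polyLen r y N with hℓ
  set v := √(s ^ 2 + (y i) ^ 2) with hv
  have hv2 : v ^ 2 = s ^ 2 + (y i) ^ 2 := Real.sq_sqrt (by positivity)
  have hv0 : 0 < v := by positivity
  -- compare each edge with its component in the direction `(s, |y i|)`
  have hedge : ∀ k, (s * r + |y i| * |y (k + 1) - y k|) / v ≤ √(r ^ 2 + (y (k + 1) - y k) ^ 2) := by
    intro k
    refine Real.le_sqrt_of_sq_le ?_
    rw [div_pow, div_le_iff₀ (by positivity), hv2, ← sq_abs (y i), ← sq_abs (y (k + 1) - y k)]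
    nlinarith [sq_nonneg (s * |y (k + 1) - y k| - |y i| * r)]
  have hsum : |y i| ≤ ∑ k ∈ Finset.range N, |y (k + 1) - y k| := by
    have h1 : y i = ∑ k ∈ Finset.range i, (y (k + 1) - y k) := by
      rw [Finset.sum_range_sub, hy, sub_zero]
    calc |y i| ≤ ∑ k ∈ Finset.range i, |y (k + 1) - y k| := by
          conv_lhs => rw [h1]
          exact Finset.abs_sum_le_sum_abs _ _
      _ ≤ _ := Finset.sum_le_sum_of_subset_of_nonneg (Finset.range_mono hi)
          fun _ _ _ => abs_nonneg _
  have hvℓ : v ≤ ℓ := by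
    have h1 : ∑ k ∈ Finset.range N, (s * r + |y i| * |y (k + 1) - y k|) / v ≤ ℓ :=
      Finset.sum_le_sum fun k _ => hedge k
    rw [← Finset.sum_div, Finset.sum_add_distrib, Finset.sum_const, Finset.card_range,
      ← Finset.mul_sum, nsmul_eq_mul] at h1
    refine le_trans ?_ h1
    rw [le_div_iff₀ hv0, ← sq, hv2]
    have h2 : |y i| * |y i| ≤ |y i| * ∑ k ∈ Finset.range N, |y (k + 1) - y k| := by gcongr
    rw [abs_mul_abs_self] at h2
    have : (N : ℝ) * (s * r) = s ^ 2 := by rw [hs]; ring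
    nlinarith
  have hsv : s ≤ v := Real.le_sqrt_of_sq_le (by nlinarith [sq_nonneg (y i)])
  refine ⟨hsv.trans hvℓ, ?_⟩
  rcases le_or_gt ℓ (6 * s) with h6 | h6
  · have h1 : v ^ 2 ≤ ℓ ^ 2 := pow_le_pow_left₀ hv0.le hvℓ 2
    have h2 : 0 ≤ (ℓ - s) * (7 * s - ℓ - s) := mul_nonneg (by linarith) (by linarith)
    have h3 : 0 ≤ s * (ℓ - s) := mul_nonneg hs0.le (by linarith)
    rw [hv2] at h1
    linarith
  · have hyv : |y i| ≤ v := Real.le_sqrt_of_sq_le (by rw [sq_abs]; nlinarith)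
    have h1 : (y i) ^ 2 ≤ 100 * s * ℓ := by
      rw [← sq_abs, sq]
      exact mul_le_mul hdev (hyv.trans hvℓ) (abs_nonneg _) (by positivity)
    have h2 : 0 ≤ s * (ℓ - 3 * s) := mul_nonneg hs0.le (by linarith)
    linarith

/-! ### Passage times across windows -/

theorem dist_pt_right (a n y y' : ℝ) : dist (pt a y) (pt (a + n) y') = √(n ^ 2 + (y' - y) ^ 2) := by
  rw [dist_plane]
  simp only [pt_zero, pt_one]
  congr 1
  ring

/-- Hypotenuses over a common leg `r`. -/
theorem abs_hypot_sub_le {r a b : ℝ} (hr : 0 < r) :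
    |√(r ^ 2 + a ^ 2) - √(r ^ 2 + b ^ 2)| ≤ |a - b| * (|a| + |b|) / (2 * r) := by
  have h1 : r ≤ √(r ^ 2 + a ^ 2) := Real.le_sqrt_of_sq_le (by nlinarith)
  have h2 : r ≤ √(r ^ 2 + b ^ 2) := Real.le_sqrt_of_sq_le (by nlinarith)
  have h3 : √(r ^ 2 + a ^ 2) ^ 2 = r ^ 2 + a ^ 2 := Real.sq_sqrt (by positivity)
  have h4 : √(r ^ 2 + b ^ 2) ^ 2 = r ^ 2 + b ^ 2 := Real.sq_sqrt (by positivity)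
  set p := √(r ^ 2 + a ^ 2)
  set q := √(r ^ 2 + b ^ 2)
  rw [le_div_iff₀ (by positivity)]
  calc |p - q| * (2 * r) ≤ |p - q| * |p + q| := by
        gcongr
        exact le_trans (by linarith) (le_abs_self _)
    _ = |a - b| * |a + b| := by
        rw [← abs_mul, ← abs_mul]
        congr 1
        linear_combination h3 - h4
    _ ≤ _ := by gcongr; exact abs_add_le _ _

namespace Model

variable {Ω E : Type*} [MeasurableSpace Ω] [MeasurableSpace E] [MulAction ISO2 E]
  {P : Measure Ω} {M : Model Ω E P} {κ D₀ n₀ μ : ℝ}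

variable (M) in
/-- Some passage time from the vertical line at abscissa `a` to the one at distance `n` deviates
from its mean by more than `τ`; the end points have integer offsets of size at most `K √(n τ)` from
the ordinate `b`. -/
def BadWindow (K n τ a b : ℝ) : Set Ω :=
  {x | ∃ p : ℤ × ℤ, |(p.1 : ℝ)| ≤ K * √(n * τ) ∧ |(p.2 : ℝ)| ≤ K * √(n * τ) ∧
    τ < |M.T (pt a (b + p.1)) (pt (a + n) (b + p.2)) x
      - M.meanX (dist (pt a (b + p.1)) (pt (a + n) (b + p.2)))|}

variable (M) in
/-- One of the events `BadWindow` at the levels `4 ^ k τ` occurs. -/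
def BadCell (K n τ a b : ℝ) : Set Ω := ⋃ k : ℕ, M.BadWindow K n (4 ^ k * τ) a b

/-- Outside of `BadCell` the deviations are controlled for arbitrary end points, at the expense of a
penalty that is quadratic in the offsets. -/
theorem le_of_notMem_badCell {K n τ a : ℝ} {c : ℤ} {x : Ω} (hK : 0 < K) (hn : 0 < n) (hτ : 0 < τ)
    (hx : x ∉ M.BadCell K n τ a c) (y y' : ℤ) :
    |M.T (pt a y) (pt (a + n) y') x - M.meanX (√(n ^ 2 + ((y' : ℝ) - y) ^ 2))|
      ≤ τ + 4 * (((y : ℝ) - c) ^ 2 + ((y' : ℝ) - c) ^ 2) / (K ^ 2 * n) := by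
  simp only [BadCell, Set.mem_iUnion, not_exists] at hx
  set S := ((y : ℝ) - c) ^ 2 + ((y' : ℝ) - c) ^ 2 with hS
  have hS0 : 0 ≤ S := by positivity
  have key : ∀ k : ℕ, S ≤ K ^ 2 * n * (4 ^ k * τ) →
      |M.T (pt a y) (pt (a + n) y') x - M.meanX (√(n ^ 2 + ((y' : ℝ) - y) ^ 2))| ≤ 4 ^ k * τ := by
    intro k hk
    by_contra! hlt
    have hw : ∀ z : ℝ, z ^ 2 ≤ S → |z| ≤ K * √(n * (4 ^ k * τ)) := by
      intro z hz
      refine abs_le_of_sq_le_sq ?_ (by positivity)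
      rw [mul_pow, Real.sq_sqrt (by positivity)]
      linarith
    refine hx k ⟨(y - c, y' - c), ?_, ?_, ?_⟩
    · push_cast
      exact hw _ (by rw [hS]; nlinarith [sq_nonneg ((y' : ℝ) - c)])
    · push_cast
      exact hw _ (by rw [hS]; nlinarith [sq_nonneg ((y : ℝ) - c)])
    · push_cast
      rw [add_sub_cancel, add_sub_cancel, dist_pt_right]
      exact hlt
  have hKn : 0 < K ^ 2 * n := by positivity
  have hex : ∃ k : ℕ, S ≤ K ^ 2 * n * (4 ^ k * τ) := by
    obtain ⟨k, hk⟩ := pow_unbounded_of_one_lt (S / (K ^ 2 * n * τ)) (show (1 : ℝ) < 4 by norm_num)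
    refine ⟨k, ?_⟩
    rw [div_lt_iff₀ (by positivity)] at hk
    linarith
  classical
  have h1 := Nat.find_spec hex
  have h2 := fun m => Nat.find_min (m := m) hex
  rcases hk : Nat.find hex with _ | k
  · rw [hk] at h1
    have h3 := key 0 h1
    have : 0 ≤ 4 * S / (K ^ 2 * n) := by positivity
    simp only [pow_zero, one_mul] at h3
    linarith
  · rw [hk] at h1 h2
    have h3 := key _ h1
    have h4 := not_le.1 (h2 k (by omega))
    have : (4 : ℝ) ^ (k + 1) * τ ≤ 4 * S / (K ^ 2 * n) := by
      rw [le_div_iff₀ hKn, pow_succ]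
      linarith
    linarith

namespace Assumptions

theorem measureReal_badWindow (hM : M.Assumptions κ D₀ n₀ μ) (K n τ a b : ℝ) :
    P.real (M.BadWindow K n τ a b) = P.real (M.BadWindow K n τ 0 0) := by
  set u : ℤ × ℤ → Plane := fun p => pt 0 (0 + p.1) with hu
  set v : ℤ × ℤ → Plane := fun p => pt (0 + n) (0 + p.2) with hv
  set S : Set (ℤ × ℤ → ℝ≥0∞) := {f | ∃ p : ℤ × ℤ, |(p.1 : ℝ)| ≤ K * √(n * τ) ∧
    |(p.2 : ℝ)| ≤ K * √(n * τ) ∧ τ < |(f p).toReal - M.meanX (dist (u p) (v p))|} with hS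
  have hSm : MeasurableSet S := by
    simp only [hS, Set.ofPred_exists]
    refine MeasurableSet.iUnion fun p => ?_
    refine (MeasurableSet.const _).inter ((MeasurableSet.const _).inter ?_)
    have hf : Measurable fun f : ℤ × ℤ → ℝ≥0∞ => |(f p).toReal - M.meanX (dist (u p) (v p))| := by
      have : Measurable fun f : ℤ × ℤ → ℝ≥0∞ => f p := measurable_pi_apply p
      fun_prop
    exact measurableSet_lt measurable_const hf
  have hmv : ∀ x y : ℝ, IsometryEquiv.addRight (pt a b) (pt x y) = pt (a + x) (b + y) := by
    intro x y
    ext i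
    fin_cases i <;> simp [add_comm]
  have key := hM.measureReal_family (IsometryEquiv.addRight (pt a b)) u v hSm
  have e1 : {x | (fun i => M.passage (IsometryEquiv.addRight (pt a b) (u i))
      (IsometryEquiv.addRight (pt a b) (v i)) (M.field x)) ∈ S} = M.BadWindow K n τ a b := by
    ext x
    simp only [hS, hu, hv, hmv, BadWindow, Set.mem_ofPred_eq, T, dist_plane, pt_zero, pt_one]
    refine exists_congr fun p => and_congr_right fun _ => and_congr_right fun _ => ?_
    rw [show a - (a + n) = (0 : ℝ) - (0 + n) by ring,
      show b + (p.1 : ℝ) - (b + p.2) = 0 + p.1 - (0 + p.2) by ring]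
    simp only [add_zero, zero_add]
  rw [e1] at key
  exact key

variable [IsProbabilityMeasure P]

/-- The level `4 ^ k τ` of a bad cell is the event of a bad window with a deviation that is larger
by the factor `4 ^ k`, so the probabilities are summable in `k`. -/
theorem measureReal_badCell_le (hM : M.Assumptions κ D₀ n₀ μ) {K n q Λ β : ℝ} (hβ : 0 < β)
    (hΛ : 0 < Λ) (hq : 0 < q)
    (hcl : ∀ x > 0, P.real (M.BadWindow K n (x * q) 0 0) ≤ Real.exp (1 - (x / Λ) ^ β))
    {X τ : ℝ} (hX : 1 ≤ X) (hτ : Λ * X * q ≤ τ) (a b : ℝ) :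
    P.real (M.BadCell K n τ a b)
      ≤ Real.exp 1 * (1 - Real.exp (-β))⁻¹ * Real.exp (-X ^ β) := by
  have hX0 : 0 < X := by linarith
  have hτX : X ≤ τ / (Λ * q) := by rw [le_div_iff₀ (by positivity)]; linarith
  refine (measureReal_iUnion_scales (R := τ / (Λ * q)) (Real.exp_pos 1).le hβ (hX.trans hτX)
    fun k => ?_).trans ?_
  · rw [hM.measureReal_badWindow, ← Real.exp_add]
    have h1 := hcl (4 ^ k * τ / q) (by
      have : 0 < τ := lt_of_lt_of_le (by positivity) hτ
      positivity)
    rw [div_mul_cancel₀ _ hq.ne'] at h1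
    refine h1.trans (le_of_eq ?_)
    rw [sub_eq_add_neg]
    congr 4
    field_simp
  · have : 0 ≤ (1 - Real.exp (-β))⁻¹ := by
      rw [inv_nonneg, sub_nonneg, Real.exp_le_one_iff]
      linarith
    gcongr

theorem meanX_polyLen_le (hM : M.Assumptions κ D₀ n₀ μ) (r : ℝ) (y : ℕ → ℝ) {N : ℕ} (hN : 1 ≤ N) :
    M.meanX (polyLen r y N) ≤ ∑ i ∈ Finset.range N, M.meanX (√(r ^ 2 + (y (i + 1) - y i) ^ 2)) := by
  induction N, hN using Nat.le_induction with
  | base => simp [polyLen]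
  | succ N _ ih =>
    have e : polyLen r y (N + 1) = polyLen r y N + √(r ^ 2 + (y (N + 1) - y N) ^ 2) :=
      Finset.sum_range_succ _ _
    rw [Finset.sum_range_succ, e]
    have h0 : 0 ≤ polyLen r y N := Finset.sum_nonneg fun _ _ => Real.sqrt_nonneg _
    have h1 := hM.meanX_add_le h0 (Real.sqrt_nonneg (r ^ 2 + (y (N + 1) - y N) ^ 2))
    linarith

end Assumptions

end Model

/-! ### Localisation and the slope of the mean passage time -/

/-- The point with weight `i / N` on the chord from `y 0` to `y N`. -/
def chord (y : ℕ → ℝ) (N i : ℕ) : ℝ := y 0 + i / N * (y N - y 0)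

theorem sq_add_le_two (a b : ℝ) : (a + b) ^ 2 ≤ 2 * a ^ 2 + 2 * b ^ 2 := by
  nlinarith [sq_nonneg (a - b)]

theorem eventually_mul_rpow_le {a b : ℝ} (hab : a < b) (A : ℝ) :
    ∀ᶠ s : ℝ in atTop, A * s ^ a ≤ s ^ b := by
  filter_upwards [(tendsto_rpow_atTop (sub_pos.2 hab)).eventually_ge_atTop A,
    eventually_gt_atTop 0] with s h1 h2
  calc A * s ^ a ≤ s ^ (b - a) * s ^ a := by gcongr
    _ = s ^ b := by rw [← Real.rpow_add h2]; congr 1; ring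

/-- Localisation. If the excess length of a polygonal line costs time at a positive rate, if the
times of the edges are bounded below up to a quadratic penalty, and if the line is almost optimal,
then it stays close to its chord. -/
theorem sq_chord_deviation_le_of_times {c₀ n r d B b U G Fd : ℝ} {N : ℕ} {y c t F : ℕ → ℝ}
    (hc₀ : 0 < c₀) (hN : 0 < N) (hNc : 4800 / c₀ ≤ (N : ℝ) ^ 2) (hr : 0 < r) (hn : n = N * r)
    (hd : d = √(n ^ 2 + (y N - y 0) ^ 2)) (hd2 : d ≤ 2 * n)
    (ht : ∀ i < N, F i - B - 4 * ((y i - c i) ^ 2 + (y (i + 1) - c i) ^ 2)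
      / (((N : ℝ) ^ 2) ^ 2 * r) ≤ t i)
    (hF : Fd + c₀ * (polyLen r y N - d) - G ≤ ∑ i ∈ Finset.range N, F i)
    (hU : ∑ i ∈ Finset.range N, t i ≤ Fd + U)
    (hc : ∀ i < N, |c i - chord y N i| ≤ b) (hslope : |y N - y 0| / N ≤ b)
    (hdev : ∀ i ≤ N, |y i - chord y N i| ≤ 100 * n) {i : ℕ} (hi : i ≤ N) :
    (y i - chord y N i) ^ 2
      ≤ 300 * n / c₀ * (U + G + N * B + 40 * b ^ 2 / ((N : ℝ) ^ 2 * n)) := by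
  have hN' : (0 : ℝ) < N := by exact_mod_cast hN
  have hn0 : 0 < n := by rw [hn]; positivity
  set ℓ := polyLen r y N
  have hδ : ∀ i ≤ N, (y i - chord y N i) ^ 2 ≤ 150 * n * (ℓ - d) := fun i hi =>
    sq_chord_deviation_le hN hr hn hd hd2 hi (hdev i hi)
  have hb : 0 ≤ b := le_trans (by positivity) hslope
  have hpen : ∀ i < N, 4 * ((y i - c i) ^ 2 + (y (i + 1) - c i) ^ 2) / (((N : ℝ) ^ 2) ^ 2 * r)
      ≤ (2400 * (ℓ - d) / N ^ 2 + 40 * b ^ 2 / ((N : ℝ) ^ 2 * n)) / N := by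
    intro i hi
    have h1 : (y i - c i) ^ 2 ≤ 2 * (150 * n * (ℓ - d)) + 2 * b ^ 2 := by
      have e : y i - c i = (y i - chord y N i) + (chord y N i - c i) := by ring
      have e2 : (chord y N i - c i) ^ 2 ≤ b ^ 2 := by
        rw [sq_le_sq, abs_sub_comm, abs_of_nonneg hb]; exact hc i hi
      rw [e]
      exact (sq_add_le_two _ _).trans (by linarith [hδ i hi.le])
    have h2 : (y (i + 1) - c i) ^ 2 ≤ 2 * (150 * n * (ℓ - d)) + 8 * b ^ 2 := by
      have e : y (i + 1) - c i = (y (i + 1) - chord y N (i + 1))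
          + ((y N - y 0) / N + (chord y N i - c i)) := by
        simp only [chord]; push_cast; field_simp; ring
      have e2 : ((y N - y 0) / N + (chord y N i - c i)) ^ 2 ≤ (2 * b) ^ 2 := by
        rw [sq_le_sq, abs_of_nonneg (by linarith : 0 ≤ 2 * b)]
        refine (abs_add_le _ _).trans ?_
        rw [abs_div, abs_of_pos hN', abs_sub_comm (chord y N i)]
        linarith [hc i hi]
      rw [e]
      exact (sq_add_le_two _ _).trans (by linarith [hδ (i + 1) (by omega)])
    have e : (2400 * (ℓ - d) / N ^ 2 + 40 * b ^ 2 / ((N : ℝ) ^ 2 * n)) / N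
        = 4 * (600 * n * (ℓ - d) + 10 * b ^ 2) / (((N : ℝ) ^ 2) ^ 2 * r) := by
      rw [hn]; field_simp; ring
    rw [e]
    exact div_le_div_of_nonneg_right (by linarith) (by positivity)
  have hsum : ∑ i ∈ Finset.range N, F i - (N * B + (2400 * (ℓ - d) / N ^ 2
      + 40 * b ^ 2 / ((N : ℝ) ^ 2 * n))) ≤ ∑ i ∈ Finset.range N, t i := by
    have h1 : ∑ i ∈ Finset.range N, (F i - (B + (2400 * (ℓ - d) / N ^ 2
        + 40 * b ^ 2 / ((N : ℝ) ^ 2 * n)) / N)) ≤ ∑ i ∈ Finset.range N, t i := by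
      refine Finset.sum_le_sum fun i hi => ?_
      rw [Finset.mem_range] at hi
      linarith [ht i hi, hpen i hi]
    rw [Finset.sum_sub_distrib, Finset.sum_const, Finset.card_range, nsmul_eq_mul, mul_add,
      mul_div_cancel₀ _ hN'.ne'] at h1
    exact h1
  have hℓd : 0 ≤ ℓ - d := by
    have := (sq_nonneg _).trans (hδ 0 (by omega))
    exact nonneg_of_mul_nonneg_right this (by positivity)
  have hsmall : 2400 * (ℓ - d) / N ^ 2 ≤ c₀ / 2 * (ℓ - d) := by
    rw [div_le_iff₀ hc₀] at hNc
    rw [div_le_iff₀ (by positivity)]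
    nlinarith
  have hfin : c₀ / 2 * (ℓ - d) ≤ U + G + N * B + 40 * b ^ 2 / ((N : ℝ) ^ 2 * n) := by linarith
  refine (hδ i hi).trans ?_
  calc 150 * n * (ℓ - d) = 300 * n / c₀ * (c₀ / 2 * (ℓ - d)) := by field_simp; ring
    _ ≤ _ := by gcongr

namespace Model

variable {Ω E : Type*} [MeasurableSpace Ω] [MeasurableSpace E] [MulAction ISO2 E]
  {P : Measure Ω} {M : Model Ω E P} {κ D₀ n₀ μ : ℝ}

/-- A lower bound for the last piece of an optimal path, where only crude information is
available. -/
theorem crude_lower_bound {a b : Plane} {x : Ω} {ρ : ℝ} (hμ : 0 < μ)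
    (h : |M.T a b x - μ * dist a b| ≤ ρ * √(1 + dist a b)) :
    3 * μ / 4 * dist a b - μ / 4 - ρ ^ 2 / μ ≤ M.T a b x := by
  have h0 : 0 ≤ 1 + dist a b := by positivity
  have h1 := Real.sq_sqrt h0
  have h2 : ρ * √(1 + dist a b) ≤ μ / 4 * (1 + dist a b) + ρ ^ 2 / μ := by
    have : μ / 4 * √(1 + dist a b) ^ 2 + ρ ^ 2 / μ - ρ * √(1 + dist a b)
        = (μ / 2 * √(1 + dist a b) - ρ) ^ 2 / μ := by field_simp; ring
    have : 0 ≤ (μ / 2 * √(1 + dist a b) - ρ) ^ 2 / μ := by positivity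
    rw [h1] at *
    linarith
  linarith [(abs_le.1 h).1]

/-- Deterministic part of the lower bound for the slope of the mean passage time: a good
configuration for the near-minimiser `t`. -/
theorem near_minimizer_le {s t m τ R : ℝ} {N : ℕ} {x : Ω} {D : Set Plane} (hμ : 0 < μ)
    (hN : 0 < N) (hNμ : 4800 / μ ≤ (N : ℝ) ^ 2) (hs : 1 ≤ s) (hst : s < t) (ht2 : t ≤ 2 * s) (hτ : 0 < τ)
    (hR : R = 4 * s)
    (hsub : ∀ r : ℝ, ∀ y : ℕ → ℝ, M.meanX (polyLen r y N)
      ≤ ∑ i ∈ Finset.range N, M.meanX (√(r ^ 2 + (y (i + 1) - y i) ^ 2)))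
    (hmin : ∀ ℓ, s ≤ ℓ → m + μ / 4 * (ℓ - s) ≤ M.meanX ℓ)
    (hm : M.meanX t ≤ m + 1 + μ / 4 * (t - s))
    (hrough : M.RoughGeometry μ D R x)
    (hD : ∀ i : ℕ, i ≤ N → ∀ k : ℤ, pt (i * (s / N)) k ∈ D) (hDt : pt t 0 ∈ D)
    (hcell : ∀ i : ℕ, i < N → x ∉ M.BadCell ((N : ℝ) ^ 2) (s / N) τ (i * (s / N)) 0)
    (hT : M.T (pt 0 0) (pt t 0) x ≤ M.meanX t + τ) :
    μ / 2 * (t - s) ≤ (N + 1) * τ + 1 + (N + 1) * (2000 * μ * R ^ (1 / 40 : ℝ)) + μ / 4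
      + (R ^ (1 / 200 : ℝ)) ^ 2 / μ := by
  have hN' : (0 : ℝ) < N := by exact_mod_cast hN
  obtain ⟨r, hr⟩ : ∃ r, r = s / N := ⟨_, rfl⟩
  have hr0 : 0 < r := by rw [hr]; positivity
  have hsr : s = N * r := by rw [hr]; field_simp
  rw [← hr] at hD hcell
  have hnorm : ‖pt t 0‖ ≤ R := by
    have := Assumptions.dist_origin_pt (show 0 ≤ t by linarith)
    rw [dist_zero_left] at this
    rw [this, hR]; linarith
  have hn0 : ‖pt 0 0‖ ≤ R := by
    have := Assumptions.dist_origin_pt (le_refl (0 : ℝ))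
    rw [dist_zero_left] at this
    rw [this, hR]; linarith
  have hD0 : ∀ k : ℤ, pt 0 k ∈ D := fun k => by simpa using hD 0 (by omega) k
  obtain ⟨h, Y, hsk⟩ := hrough.exists_skeleton (x₀ := 0) (L := t) (j := 0) (j' := 0) (by linarith)
    (hD0 0) (by simpa using hDt) (by simpa using hn0) (by simpa using hnorm)
  set err := 2000 * μ * R ^ (1 / 40 : ℝ) with herr
  have herr0 : 0 ≤ err := by rw [herr, hR]; positivity
  have hlast := hsk.super (0 + (0 : ℕ) * r) (0 + N * r) t (by simp)
    (by simp; positivity) (by linarith) le_rfl (by simpa using hD 0 (by omega) _)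
    (by simpa using hD N le_rfl _) (by rw [hsk.Y_end]; simpa using hDt)
  have hsum := hsk.sum_le (a := 0) le_rfl hr0.le herr0 hN (by linarith)
    (fun i hi => by simpa using hD i hi _)
  simp only [zero_add, Nat.cast_zero, zero_mul, hsk.Y_zero, hsk.Y_end, Int.cast_zero] at hsum hlast
  set y : ℕ → ℝ := fun i => (Y (i * r) : ℝ) with hy
  have hy0 : y 0 = 0 := by simp [hy, hsk.Y_zero]
  -- the last piece
  have hmemS : pt (N * r) (Y (N * r)) ∈ D := hD N le_rfl _
  have hbound : ∀ i : ℕ, i ≤ N → |y i| ≤ 100 * s := by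
    intro i hi
    have h1 : (i : ℝ) * r ≤ t := by
      have : (i : ℝ) * r ≤ N * r := by gcongr
      linarith
    refine (hsk.bound (i * r) (by positivity) h1).trans ?_
    rw [hR]; linarith
  have hdist : t - s ≤ dist (pt (N * r) (Y (N * r))) (pt t 0) := by
    have := PiLp.norm_apply_le (pt (N * r) (Y (N * r)) - pt t 0) 0
    rw [← dist_eq_norm, Real.norm_eq_abs] at this
    simp only [PiLp.sub_apply, pt_zero] at this
    rw [hsr]
    linarith [neg_le_abs (N * r - t)]
  have hnS : ‖pt (N * r) (Y (N * r))‖ < 40 * R := by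
    have h2 := pow_le_pow_left₀ (abs_nonneg _) (hbound N le_rfl) 2
    rw [hR, ← dist_zero_right, dist_plane, Real.sqrt_lt' (by positivity)]
    simp only [pt_zero, pt_one, PiLp.zero_apply, sub_zero]
    simp only [hy, sq_abs, ← hsr] at h2 ⊢
    nlinarith
  have hcr := crude_lower_bound hμ (hrough.crude _ hmemS _ hDt hnS (by linarith))
  -- the edges
  have hpiece : ∀ i : ℕ, i < N → M.meanX (√(r ^ 2 + (y (i + 1) - y i) ^ 2)) - τ
      - 4 * (y i ^ 2 + y (i + 1) ^ 2) / (((N : ℝ) ^ 2) ^ 2 * r)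
      ≤ M.T (pt (i * r) (Y (i * r))) (pt ((i + 1 : ℕ) * r) (Y ((i + 1 : ℕ) * r))) x := by
    intro i hi
    have := le_of_notMem_badCell (M := M) (K := (N : ℝ) ^ 2) (a := i * r)
      (c := 0) (x := x) (by positivity) hr0 hτ (by simpa using hcell i hi)
      (Y (i * r)) (Y ((i + 1 : ℕ) * r))
    have e : ((i + 1 : ℕ) : ℝ) * r = i * r + r := by push_cast; ring
    simp only [Int.cast_zero, sub_zero] at this
    simp only [hy]
    rw [← e] at this
    linarith [(abs_le.1 this).1]
  have haxis := fun i hi => sq_axis_deviation_le hr0 hN hsr hy0 (i := i) hi (hbound i hi)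
  have hsℓ : s ≤ polyLen r y N := (haxis 0 (by omega)).1
  set ℓ := polyLen r y N with hℓ
  have hpen : ∀ i : ℕ, i < N → 4 * (y i ^ 2 + y (i + 1) ^ 2) / (((N : ℝ) ^ 2) ^ 2 * r)
      ≤ 1200 * (ℓ - s) / N ^ 2 / N := by
    intro i hi
    have e : 1200 * (ℓ - s) / N ^ 2 / N = 4 * (300 * s * (ℓ - s)) / (((N : ℝ) ^ 2) ^ 2 * r) := by
      rw [hsr]; field_simp; ring
    rw [e]
    refine div_le_div_of_nonneg_right ?_ (by positivity)
    linarith [(haxis i hi.le).2, (haxis (i + 1) hi).2]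
  have hlow : M.meanX ℓ - N * τ - 1200 * (ℓ - s) / N ^ 2 ≤ ∑ i ∈ Finset.range N,
      M.T (pt (i * r) (Y (i * r))) (pt ((i + 1 : ℕ) * r) (Y ((i + 1 : ℕ) * r))) x := by
    have h1 : ∑ i ∈ Finset.range N, (M.meanX (√(r ^ 2 + (y (i + 1) - y i) ^ 2))
        - (τ + 1200 * (ℓ - s) / N ^ 2 / N)) ≤ _ := Finset.sum_le_sum fun i hi => by
      have hi' := Finset.mem_range.1 hi
      exact (show _ ≤ _ by linarith [hpen i hi']).trans (hpiece i hi')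
    rw [Finset.sum_sub_distrib, Finset.sum_const, Finset.card_range, nsmul_eq_mul, mul_add,
      mul_div_cancel₀ _ hN'.ne'] at h1
    linarith [hsub r y]
  have hsmall : 1200 * (ℓ - s) / N ^ 2 ≤ μ / 4 * (ℓ - s) := by
    rw [div_le_iff₀ hμ] at hNμ
    rw [div_le_iff₀ (by positivity)]
    nlinarith
  have h1 := hmin ℓ hsℓ
  have h2 : 3 * μ / 4 * (t - s) ≤ 3 * μ / 4 * dist (pt (N * r) (Y (N * r))) (pt t 0) := by gcongr
  linarith

variable [IsProbabilityMeasure P]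

/-- A union bound that produces a good configuration. -/
theorem exists_notMem_of_sum_lt_one {A B C : Set Ω} {a b c : ℝ} (hA : P.real A ≤ a)
    (hB : P.real B ≤ b) (hC : P.real C ≤ c) (h : a + b + c < 1) : ∃ x, x ∉ A ∧ x ∉ B ∧ x ∉ C := by
  by_contra! hne
  have h1 : (Set.univ : Set Ω) ⊆ (A ∪ B) ∪ C := fun x _ => by
    by_cases hxA : x ∈ A
    · exact Or.inl (Or.inl hxA)
    by_cases hxB : x ∈ B
    · exact Or.inl (Or.inr hxB)
    exact Or.inr (hne x hxA hxB)
  have h2 : P.real (Set.univ : Set Ω) ≤ P.real ((A ∪ B) ∪ C) := measureReal_mono h1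
  have h3 := measureReal_union_le (μ := P) (A ∪ B) C
  have h4 := measureReal_union_le (μ := P) A B
  rw [probReal_univ] at h2
  linarith

namespace Assumptions

/-- The mean passage time grows at a definite rate beyond `s`, up to an error of the order of the
fluctuations at scale `s`. -/
theorem exists_slope_bound (hM : M.Assumptions κ D₀ n₀ μ) : ∃ C₂ S₀ : ℝ, 0 < C₂ ∧ 1 ≤ S₀ ∧
    ∀ N : ℕ, 0 < N → 4800 / μ ≤ (N : ℝ) ^ 2 → ∀ s, S₀ ≤ s → ∀ τ, s ^ (1 / 20 : ℝ) ≤ τ →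
    (∀ t, s ≤ t → t ≤ s + s ^ (2 / 3 : ℝ) →
      P.real {x | τ < |M.T (pt 0 0) (pt t 0) x - M.meanX t|} ≤ 1 / 4) →
    (∀ i : ℕ, i < N → P.real (M.BadCell ((N : ℝ) ^ 2) (s / N) τ (i * (s / N)) 0) ≤ 1 / (4 * N)) →
    ∀ ℓ, s ≤ ℓ → M.meanX s + μ / 4 * (ℓ - s) - C₂ * (N * τ) ≤ M.meanX ℓ := by
  have hμ := hM.μ_pos
  have hκ := hM.κ_pos
  obtain ⟨C₁, hC₁, hlip⟩ := hM.exists_lipschitz_meanX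
  obtain ⟨C, hC, hup⟩ := hM.exists_meanX_le (δ := 1 / 100) (by norm_num)
  obtain ⟨G, hG, hrough⟩ := hM.exists_roughGeometry
  have ev1 := eventually_mul_rpow_le (a := 51 / 100) (b := 2 / 3) (by norm_num)
    ((1 + 2 * C) * (4 / (3 * μ)))
  have ev2 := eventually_mul_rpow_le (a := 1 / 40) (b := 1 / 20) (by norm_num) (8000 * μ)
  have ev3 := eventually_mul_rpow_le (a := 1 / 100) (b := 1 / 20) (by norm_num) 4
  have ev4 : ∀ᶠ s : ℝ in atTop, G * Real.exp (-(4 * s) ^ (κ / 500)) < 1 / 4 := by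
    have h1 : Tendsto (fun s : ℝ => (4 * s) ^ (κ / 500)) atTop atTop :=
      (tendsto_rpow_atTop (by positivity)).comp (tendsto_id.const_mul_atTop (by norm_num))
    have h2 := (Real.tendsto_exp_neg_atTop_nhds_zero.comp h1).const_mul G
    rw [mul_zero] at h2
    exact h2.eventually (gt_mem_nhds (by norm_num))
  obtain ⟨S₀, hS₀⟩ := eventually_atTop.1 (ev1.and (ev2.and (ev3.and ev4)))
  obtain ⟨K, hK⟩ : ∃ K : ℝ, K = 5 + μ / 4 + 1 / μ := ⟨_, rfl⟩
  have hK0 : 0 < K := by rw [hK]; positivity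
  refine ⟨1 + C₁ + (μ / 4 + C₁) * (2 * K / μ), max S₀ 1, by positivity, le_max_right _ _, ?_⟩
  intro N hN hNμ s hs τ hτ htail hcell ℓ hℓ
  have hs1 : 1 ≤ s := (le_max_right _ _).trans hs
  have hs0 : 0 < s := by linarith
  obtain ⟨e1, e2, e3, e4⟩ := hS₀ s ((le_max_left _ _).trans hs)
  have hN' : (1 : ℝ) ≤ N := by exact_mod_cast hN
  have hτ1 : 1 ≤ τ := (Real.one_le_rpow hs1 (by norm_num)).trans hτ
  have hNτ : τ ≤ N * τ := le_mul_of_one_le_left (by linarith) hN'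
  -- a near-minimiser of `t ↦ F t - μ / 4 (t - s)`
  set f : ℝ → ℝ := fun t => M.meanX t - μ / 4 * (t - s) with hf
  have hbdd : BddBelow (f '' Set.Ici s) := by
    refine ⟨0, ?_⟩
    rintro _ ⟨t, ht, rfl⟩
    have ht' : s ≤ t := ht
    have := hM.le_meanX (d := t) (by linarith)
    simp only [hf]
    nlinarith
  set m := sInf (f '' Set.Ici s) with hm
  have hmin : ∀ t, s ≤ t → m + μ / 4 * (t - s) ≤ M.meanX t := by
    intro t ht
    have := csInf_le hbdd ⟨t, ht, rfl⟩
    simp only [hf] at this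
    linarith
  obtain ⟨_, ⟨t, ht, rfl⟩, htm⟩ := exists_lt_of_csInf_lt
    (show (f '' Set.Ici s).Nonempty from ⟨_, s, Set.self_mem_Ici, rfl⟩)
    (show sInf (f '' Set.Ici s) < m + 1 by linarith)
  have ht' : s ≤ t := ht
  simp only [hf] at htm
  have hms := hmin s le_rfl
  have hts : t - s ≤ s ^ (2 / 3 : ℝ) := by
    have h1 := hM.le_meanX (d := t) (by linarith)
    have h2 := hup s hs0.le
    have h3 : √(1 + s) * (1 + s) ^ (1 / 100 : ℝ) ≤ 2 * s ^ (51 / 100 : ℝ) := by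
      rw [Real.sqrt_eq_rpow, ← Real.rpow_add (by linarith)]
      calc (1 + s) ^ (1 / 2 + 1 / 100 : ℝ) ≤ (2 * s) ^ (51 / 100 : ℝ) := by
            norm_num
            exact Real.rpow_le_rpow (by linarith) (by linarith) (by norm_num)
        _ = 2 ^ (51 / 100 : ℝ) * s ^ (51 / 100 : ℝ) := Real.mul_rpow (by norm_num) hs0.le
        _ ≤ _ := by
            gcongr
            calc (2 : ℝ) ^ (51 / 100 : ℝ) ≤ 2 ^ (1 : ℝ) :=
                  Real.rpow_le_rpow_of_exponent_le (by norm_num) (by norm_num)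
              _ = 2 := Real.rpow_one 2
    have h4 : C * (√(1 + s) * (1 + s) ^ (1 / 100 : ℝ)) ≤ C * (2 * s ^ (51 / 100 : ℝ)) := by gcongr
    have h5 : 1 ≤ s ^ (51 / 100 : ℝ) := Real.one_le_rpow hs1 (by norm_num)
    have h6 : 3 * μ / 4 * (t - s) ≤ (1 + 2 * C) * s ^ (51 / 100 : ℝ) := by linarith
    have h7 : (1 + 2 * C) * s ^ (51 / 100 : ℝ) ≤ 3 * μ / 4 * s ^ (2 / 3 : ℝ) := by
      calc (1 + 2 * C) * s ^ (51 / 100 : ℝ)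
          = 3 * μ / 4 * ((1 + 2 * C) * (4 / (3 * μ)) * s ^ (51 / 100 : ℝ)) := by field_simp
        _ ≤ _ := by gcongr
    exact le_of_mul_le_mul_left (h6.trans h7) (by positivity)
  have hts2 : t ≤ 2 * s := by
    have : s ^ (2 / 3 : ℝ) ≤ s ^ (1 : ℝ) := Real.rpow_le_rpow_of_exponent_le hs1 (by norm_num)
    rw [Real.rpow_one] at this
    linarith
  have hfin : t - s ≤ 2 * K / μ * (N * τ) := by
    rcases ht'.eq_or_lt with heq | hlt
    · rw [← heq, sub_self]; positivity
    set S : Set ℝ := Set.range ((↑) : ℚ → ℝ) ∪ (Set.range (fun i : ℕ => (i : ℝ) * (s / N)) ∪ {t})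
      with hS
    have hSc : S.Countable := (Set.countable_range _).union
      ((Set.countable_range _).union (Set.countable_singleton t))
    have hSQ : Set.range ((↑) : ℚ → ℝ) ⊆ S := Set.subset_union_left
    have p1 := htail t ht' (by linarith)
    have p2 : P.real (⋃ i ∈ Finset.range N, M.BadCell ((N : ℝ) ^ 2) (s / N) τ (i * (s / N)) 0)
        ≤ 1 / 4 := by
      refine (measureReal_biUnion_finset_le _ _).trans ?_
      refine (Finset.sum_le_sum fun i hi => hcell i (Finset.mem_range.1 hi)).trans (le_of_eq ?_)
      rw [Finset.sum_const, Finset.card_range, nsmul_eq_mul]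
      field_simp
    have p3 := hrough (stripes S) (stripes_countable hSc) (lattice_mem_stripes hSQ)
      (stripes_dense hSQ) (4 * s) (by linarith)
    obtain ⟨x, x1, x2, x3⟩ := exists_notMem_of_sum_lt_one p1 p2 p3 (by linarith)
    simp only [Set.mem_iUnion, not_exists, Finset.mem_range] at x2
    simp only [Set.mem_ofPred_eq, not_not, not_lt] at x1 x3
    have key := near_minimizer_le hμ hN hNμ hs1 hlt hts2 (by linarith) rfl
      (fun r y => hM.meanX_polyLen_le r y hN) hmin (by linarith) x3
      (fun i hi k => pt_mem_stripes (Or.inr (Or.inl ⟨i, rfl⟩)) k)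
      (by simpa using pt_mem_stripes (S := S) (Or.inr (Or.inr rfl)) 0) x2
      (by linarith [(abs_le.1 x1).2])
    have q1 : 2000 * μ * (4 * s) ^ (1 / 40 : ℝ) ≤ τ := by
      refine le_trans ?_ (e2.trans hτ)
      rw [Real.mul_rpow (by norm_num) hs0.le]
      have : (4 : ℝ) ^ (1 / 40 : ℝ) ≤ 4 ^ (1 : ℝ) :=
        Real.rpow_le_rpow_of_exponent_le (by norm_num) (by norm_num)
      rw [Real.rpow_one] at this
      have h2 : 0 ≤ 2000 * μ * s ^ (1 / 40 : ℝ) := by positivity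
      nlinarith
    have q2 : ((4 * s) ^ (1 / 200 : ℝ)) ^ 2 ≤ τ := by
      refine le_trans ?_ (e3.trans hτ)
      rw [← Real.rpow_natCast, ← Real.rpow_mul (by positivity), Real.mul_rpow (by norm_num) hs0.le]
      norm_num
      gcongr
      calc (4 : ℝ) ^ (1 / 100 : ℝ) ≤ 4 ^ (1 : ℝ) :=
            Real.rpow_le_rpow_of_exponent_le (by norm_num) (by norm_num)
        _ = 4 := Real.rpow_one 4
    have q3 : ((4 * s) ^ (1 / 200 : ℝ)) ^ 2 / μ ≤ 1 / μ * (N * τ) := by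
      rw [div_mul_eq_mul_div, one_mul]
      gcongr
      linarith
    have q4 : (N + 1 : ℝ) * (2000 * μ * (4 * s) ^ (1 / 40 : ℝ)) ≤ (N + 1) * τ := by gcongr
    have q5 : μ / 4 ≤ μ / 4 * (N * τ) := le_mul_of_one_le_right (by positivity) (by linarith)
    have q6 : μ / 2 * (t - s) ≤ K * (N * τ) := by
      rw [hK]
      linarith
    calc t - s = 2 / μ * (μ / 2 * (t - s)) := by field_simp
      _ ≤ 2 / μ * (K * (N * τ)) := by gcongr
      _ = _ := by ring
  have h1 := (abs_le.1 (hlip s t hs0.le (by linarith))).2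
  rw [abs_sub_comm, abs_of_nonneg (by linarith : 0 ≤ t - s)] at h1
  have h2 : (μ / 4 + C₁) * (t - s) ≤ (μ / 4 + C₁) * (2 * K / μ * (N * τ)) := by gcongr
  have h3 : 1 + C₁ ≤ (1 + C₁) * (N * τ) := le_mul_of_one_le_right (by linarith) (by linarith)
  have h4 := hmin ℓ hℓ
  linarith

end Assumptions

end Model

/-! ### Localisation of skeletons -/

theorem norm_pt_lt {a y R : ℝ} (hR : 0 < R) (ha : |a| ≤ R) (hy : |y| ≤ 11 * R) :
    ‖pt a y‖ < 40 * R := by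
  have h1 := pow_le_pow_left₀ (abs_nonneg _) ha 2
  have h2 := pow_le_pow_left₀ (abs_nonneg _) hy 2
  rw [← dist_zero_right, dist_plane, Real.sqrt_lt' (by positivity)]
  simp only [pt_zero, pt_one, PiLp.zero_apply, sub_zero]
  rw [sq_abs] at h1 h2
  nlinarith

theorem abs_sub_le_dist_pt (a b y z : ℝ) : |y - z| ≤ dist (pt a y) (pt b z) := by
  have := PiLp.norm_apply_le (pt a y - pt b z) 1
  rw [← dist_eq_norm, Real.norm_eq_abs] at this
  simpa only [PiLp.sub_apply, pt_one] using this

namespace Model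

variable {Ω E : Type*} [MeasurableSpace Ω] [MeasurableSpace E] [MulAction ISO2 E]
  {P : Measure Ω} {M : Model Ω E P} {κ D₀ n₀ μ : ℝ}

theorem crude_upper_bound {a b : Plane} {x : Ω} {ρ : ℝ} (hμ : 0 < μ)
    (h : |M.T a b x - μ * dist a b| ≤ ρ * √(1 + dist a b)) :
    M.T a b x ≤ 5 * μ / 4 * dist a b + μ / 4 + ρ ^ 2 / μ := by
  have h0 : 0 ≤ 1 + dist a b := by positivity
  have h1 := Real.sq_sqrt h0
  have h2 : ρ * √(1 + dist a b) ≤ μ / 4 * (1 + dist a b) + ρ ^ 2 / μ := by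
    have : μ / 4 * √(1 + dist a b) ^ 2 + ρ ^ 2 / μ - ρ * √(1 + dist a b)
        = (μ / 2 * √(1 + dist a b) - ρ) ^ 2 / μ := by field_simp; ring
    have : 0 ≤ (μ / 2 * √(1 + dist a b) - ρ) ^ 2 / μ := by positivity
    rw [h1] at *
    linarith
  linarith [(abs_le.1 h).2]

/-- An almost aligned intermediate point is at a distance comparable with that of the end points. -/
theorem dist_add_dist_le_of_crude {D : Set Plane} {R err : ℝ} {x : Ω} (hμ : 0 < μ)
    (hx : M.Crude μ D R x) (herr : 0 ≤ err) {a b c : Plane} (ha : a ∈ D) (hb : b ∈ D) (hc : c ∈ D)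
    (ha' : ‖a‖ < 40 * R) (hb' : ‖b‖ < 40 * R) (hc' : ‖c‖ < 40 * R)
    (h : M.T a b x + M.T b c x ≤ M.T a c x + err) :
    dist a b + dist b c ≤ 2 * dist a c + 4 / μ * (err + μ + 3 * (R ^ (1 / 200 : ℝ)) ^ 2 / μ) := by
  have h1 := crude_lower_bound hμ (hx a ha b hb ha' hb')
  have h2 := crude_lower_bound hμ (hx b hb c hc hb' hc')
  have h3 := crude_upper_bound hμ (hx a ha c hc ha' hc')
  set ρ := R ^ (1 / 200 : ℝ)
  have h4 : 3 * μ / 4 * (dist a b + dist b c) ≤ 5 * μ / 4 * dist a c + (err + μ + 3 * ρ ^ 2 / μ) := by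
    have : 3 * ρ ^ 2 / μ = ρ ^ 2 / μ + ρ ^ 2 / μ + ρ ^ 2 / μ := by ring
    linarith
  have h5 : 0 ≤ dist a c := dist_nonneg
  have h7 : μ * dist a c ≤ μ * (dist a b + dist b c) := by
    gcongr; exact dist_triangle _ _ _
  have h6 : μ / 2 * (dist a b + dist b c) ≤ μ * dist a c + (err + μ + 3 * ρ ^ 2 / μ) := by
    nlinarith [mul_nonneg hμ.le h5]
  have h8 : 0 ≤ μ * dist a c := by positivity
  calc dist a b + dist b c = 2 / μ * (μ / 2 * (dist a b + dist b c)) := by field_simp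
    _ ≤ 2 / μ * (μ * dist a c + (err + μ + 3 * ρ ^ 2 / μ)) := by gcongr
    _ = 2 * dist a c + 2 / μ * (err + μ + 3 * ρ ^ 2 / μ) := by field_simp
    _ ≤ _ := by
        have : 0 ≤ 2 / μ * (err + μ + 3 * ρ ^ 2 / μ) := by positivity
        have e : 4 / μ * (err + μ + 3 * ρ ^ 2 / μ) = 2 / μ * (err + μ + 3 * ρ ^ 2 / μ)
          + 2 / μ * (err + μ + 3 * ρ ^ 2 / μ) := by ring
        linarith

/-- Localisation of the skeleton of an optimal path: given good cells at the scale `n / N` along the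
chord of a segment of length `n`, the skeleton stays within distance `N √(n l)` of the chord. -/
theorem Skeleton.abs_sub_chord_le {D : Set Plane} {R L H : ℝ} {j j' : ℤ} {x : Ω}
    {h : ℝ → unitInterval} {Y : ℝ → ℤ} (hx : M.RoughGeometry μ D R x)
    (hs : M.Skeleton D 0 L (2000 * μ * R ^ (1 / 40 : ℝ)) H j j' x h Y) (hH : H ≤ 11 * R)
    (hR : 0 < R) (hLR : L ≤ R) {a n C₂ l B : ℝ} {N : ℕ} (hμ : 0 < μ) (hN0 : 0 < N) (hC₂ : 0 ≤ C₂)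
    (hN : 1200 / μ * (2 * C₂ + 1004) ≤ N) (ha : 0 ≤ a) (hn : 0 < n) (han : a + n ≤ L) (hl : 0 < l)
    (hB : 0 < B) (hBl : B ≤ l)
    (hD : ∀ i : ℕ, i ≤ N → ∀ k : ℤ, pt (a + i * (n / N)) k ∈ D)
    (herr : 2000 * μ * R ^ (1 / 40 : ℝ) ≤ l)
    (hsmall : 4 / μ * (l + μ + 3 * (R ^ (1 / 200 : ℝ)) ^ 2 / μ) ≤ n)
    (hwn : 5 * N ^ 2 * √(n * l) ≤ n)
    (hinc : |(Y (a + n) : ℝ) - Y a| ≤ 5 * N ^ 2 * √(n * l))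
    (hF : ∀ y : ℕ → ℝ, y 0 = Y a → y N = Y (a + n) →
      M.meanX (√(n ^ 2 + (y N - y 0) ^ 2)) + μ / 4 * (polyLen (n / N) y N
        - √(n ^ 2 + (y N - y 0) ^ 2)) - 2 * C₂ * (N * l)
        ≤ ∑ i ∈ Finset.range N, M.meanX (√((n / N) ^ 2 + (y (i + 1) - y i) ^ 2)))
    (hcell : ∀ i : ℕ, i < N → ∃ c : ℤ,
      |(c : ℝ) - ((Y a : ℝ) + i / N * (Y (a + n) - Y a))| ≤ 5 * N * √(n * l) ∧
      x ∉ M.BadCell ((N : ℝ) ^ 2) (n / N) B (a + i * (n / N)) c)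
    (hT : M.T (pt a (Y a)) (pt (a + n) (Y (a + n))) x
      ≤ M.meanX (√(n ^ 2 + ((Y (a + n) : ℝ) - Y a) ^ 2)) + N * l) {i : ℕ} (hi : i ≤ N) :
    |(Y (a + i * (n / N)) : ℝ) - ((Y a : ℝ) + i / N * (Y (a + n) - Y a))| ≤ N * √(n * l) := by
  have hN' : (1 : ℝ) ≤ N := by exact_mod_cast hN0
  have hN'0 : (0 : ℝ) < N := by linarith
  obtain ⟨r, hr⟩ : ∃ r, r = n / N := ⟨_, rfl⟩
  have hr0 : 0 < r := by rw [hr]; positivity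
  have hnr : n = N * r := by rw [hr]; field_simp
  rw [← hr] at hD hF hcell ⊢
  set w := √(n * l) with hw
  have hw0 : 0 ≤ w := Real.sqrt_nonneg _
  have hw2 : w ^ 2 = n * l := Real.sq_sqrt (by positivity)
  set err := 2000 * μ * R ^ (1 / 40 : ℝ) with herr'
  have herr0 : 0 ≤ err := by positivity
  set y : ℕ → ℝ := fun i => (Y (a + i * r) : ℝ) with hy
  have hy0 : y 0 = Y a := by simp [hy]
  have hyN : y N = Y (a + n) := by simp [hy, hnr]
  have hchord : ∀ i : ℕ, chord y N i = (Y a : ℝ) + i / N * (Y (a + n) - Y a) := fun i => by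
    rw [chord, hy0, hyN]
  have hle : ∀ i : ℕ, i ≤ N → a + i * r ≤ L := by
    intro i hi
    have : (i : ℝ) * r ≤ N * r := by gcongr
    linarith
  obtain ⟨d, hd⟩ : ∃ d, d = √(n ^ 2 + (y N - y 0) ^ 2) := ⟨_, rfl⟩
  have hincn : |y N - y 0| ≤ n := by rw [hy0, hyN]; exact hinc.trans hwn
  have hd2 : d ≤ 2 * n := by
    rw [hd, Real.sqrt_le_left (by positivity), ← sq_abs (y N - y 0)]
    have := pow_le_pow_left₀ (abs_nonneg _) hincn 2
    nlinarith
  have hnorm : ∀ i : ℕ, i ≤ N → ‖pt (a + i * r) (Y (a + i * r))‖ < 40 * R := by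
    intro i hi
    refine norm_pt_lt hR ?_ ((hs.bound _ (by positivity) (hle i hi)).trans hH)
    rw [abs_of_nonneg (by positivity)]
    exact (hle i hi).trans hLR
  -- rough localisation
  have hdev : ∀ i ≤ N, |y i - chord y N i| ≤ 100 * n := by
    intro i hi
    have h1 := hs.super (a + (0 : ℕ) * r) (a + i * r) (a + N * r) (by positivity)
      (by gcongr; omega) (by gcongr) (hle N le_rfl) (by simpa using hD 0 (by omega) _)
      (by simpa using hD i hi _) (by simpa using hD N le_rfl _)
    simp only [zero_add] at h1
    have h2 := dist_add_dist_le_of_crude hμ hx.crude herr0 (hD 0 (by omega) _) (hD i hi _) (hD N le_rfl _)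
      (hnorm 0 (by omega)) (hnorm i hi) (hnorm N le_rfl) h1
    have h3 : dist (pt (a + (0 : ℕ) * r) (Y (a + (0 : ℕ) * r))) (pt (a + N * r) (Y (a + N * r)))
        = d := by
      rw [hd, dist_plane, hnr]
      simp only [pt_zero, pt_one, hy]
      congr 1
      push_cast
      ring
    have h4 := abs_sub_le_dist_pt (a + (0 : ℕ) * r) (a + i * r) (Y (a + (0 : ℕ) * r))
      (Y (a + i * r))
    have h5 : 4 / μ * (err + μ + 3 * (R ^ (1 / 200 : ℝ)) ^ 2 / μ) ≤ n := by
      refine le_trans ?_ hsmall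
      gcongr
    rw [h3] at h2
    have h6 : |y i - y 0| ≤ 5 * n := by
      rw [abs_sub_comm]
      have := dist_nonneg (x := pt (a + i * r) (Y (a + i * r)))
        (y := pt (a + N * r) (Y (a + N * r)))
      refine h4.trans ((le_add_of_nonneg_right this).trans (h2.trans ?_))
      linarith only [h5, hd2]
    have h7 : |(i : ℝ) / N * (y N - y 0)| ≤ n := by
      rw [abs_mul, abs_of_nonneg (by positivity)]
      have : (i : ℝ) / N ≤ 1 := by rw [div_le_one hN'0]; exact_mod_cast hi
      exact (mul_le_of_le_one_left (abs_nonneg _) this).trans hincn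
    have e : y i - chord y N i = (y i - y 0) - (i : ℝ) / N * (y N - y 0) := by
      simp only [chord]; ring
    rw [e]
    refine (abs_sub _ _).trans ?_
    linarith
  choose! c hc1 hc2 using hcell
  have hsum := hs.sum_le ha hr0.le herr0 hN0 (hle N le_rfl) (fun i hi => by simpa using hD i hi _)
  simp only [zero_add] at hsum
  have hNe : (N : ℝ) * err ≤ N * l := by gcongr
  have hpiece : ∀ i < N, M.meanX (√(r ^ 2 + (y (i + 1) - y i) ^ 2)) - B
      - 4 * ((y i - c i) ^ 2 + (y (i + 1) - c i) ^ 2) / (((N : ℝ) ^ 2) ^ 2 * r)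
      ≤ M.T (pt (a + i * r) (Y (a + i * r))) (pt (a + (i + 1 : ℕ) * r)
        (Y (a + (i + 1 : ℕ) * r))) x := by
    intro i hi
    have := le_of_notMem_badCell (M := M) (K := (N : ℝ) ^ 2) (a := a + i * r) (c := c i) (x := x)
      (by positivity) hr0 hB (hc2 i hi) (Y (a + i * r)) (Y (a + (i + 1 : ℕ) * r))
    have e : a + ((i + 1 : ℕ) : ℝ) * r = a + i * r + r := by push_cast; ring
    simp only [hy]
    rw [← e] at this
    linarith [(abs_le.1 this).1]
  have key := sq_chord_deviation_le_of_times (c₀ := μ / 4) (B := B) (b := 5 * N * w)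
    (U := 2 * (N * l)) (G := 2 * C₂ * (N * l)) (Fd := M.meanX d) (y := y) (c := fun i => (c i : ℝ))
    (t := fun i => M.T (pt (a + i * r) (Y (a + i * r))) (pt (a + (i + 1 : ℕ) * r)
        (Y (a + (i + 1 : ℕ) * r))) x) (F := fun i => M.meanX (√(r ^ 2 + (y (i + 1) - y i) ^ 2)))
    (by positivity) hN0 (by
      have h1 : 1200 / μ * 1004 ≤ N := by
        refine le_trans ?_ hN
        gcongr
        linarith
      have h2 : (N : ℝ) ≤ N ^ 2 := by nlinarith
      have h3 : 4800 / (μ / 4) ≤ 1200 / μ * 1004 := by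
        rw [div_le_iff₀ (by positivity)]
        field_simp
        norm_num
      linarith) hr0 hnr hd hd2 hpiece
    (by rw [hd]; exact hF y hy0 hyN) (by
      have e1 : a + ((0 : ℕ) : ℝ) * r = a := by simp
      have e2 : a + (N : ℝ) * r = a + n := by rw [hnr]
      rw [e1, e2] at hsum
      rw [hd, hy0, hyN]
      linarith)
    (fun i hi => by rw [hchord]; exact hc1 i hi)
    (by
      rw [hy0, hyN, div_le_iff₀ hN'0]
      refine hinc.trans (le_of_eq ?_)
      ring) hdev hi
  rw [hchord] at key
  refine abs_le_of_sq_le_sq (key.trans ?_) (by positivity)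
  have e1 : 40 * (5 * N * w) ^ 2 / ((N : ℝ) ^ 2 * n) = 1000 * l := by
    rw [mul_pow, hw2]; field_simp; norm_num
  have e2 : 300 * n / (μ / 4) = 1200 / μ * n := by field_simp; norm_num
  rw [e1, e2, mul_pow, hw2]
  have h1 : 2 * (N * l) + 2 * C₂ * (N * l) + N * B + 1000 * l ≤ (2 * C₂ + 1004) * (N * l) := by
    have h2 : (N : ℝ) * B ≤ N * l := by gcongr
    have h3 : l ≤ N * l := le_mul_of_one_le_left hl.le hN'
    linarith
  calc 1200 / μ * n * (2 * (N * l) + 2 * C₂ * (N * l) + N * B + 1000 * l)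
      ≤ 1200 / μ * n * ((2 * C₂ + 1004) * (N * l)) := by gcongr
    _ = (1200 / μ * (2 * C₂ + 1004)) * (N * (n * l)) := by ring
    _ ≤ N * (N * (n * l)) := by gcongr
    _ = _ := by ring

/-- Comparison of the passage times across one cell for two pairs of end points with almost the
same offset. -/
theorem T_le_T_add_of_notMem_badCell {a r l w C₁ : ℝ} {N : ℕ} {c : ℤ} {x : Ω}
    (hlip : ∀ s t : ℝ, 0 ≤ s → 0 ≤ t → |M.meanX s - M.meanX t| ≤ C₁ * (|s - t| + 1)) (hC₁ : 0 ≤ C₁)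
    (hN : 20000 ≤ (N : ℝ)) (hr : 0 < r) (hl : 0 < l) (hw0 : 0 ≤ w) (hw : w ^ 2 = N * r * l)
    (hx : x ∉ M.BadCell ((N : ℝ) ^ 2) r (l / 16) a c) (hC : C₁ * 2 ≤ l / 64)
    (hCN : C₁ ≤ N) {u v u' v' : ℤ} (hu : |(u : ℝ) - c| ≤ 6 * N * w) (hv : |(v : ℝ) - c| ≤ 6 * N * w)
    (hu' : |(u' : ℝ) - c| ≤ 6 * N * w) (hv' : |(v' : ℝ) - c| ≤ 6 * N * w)
    (hd : |((v : ℝ) - u) - (v' - u')| ≤ 2 * w / N ^ 6) :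
    M.T (pt a u') (pt (a + r) v') x ≤ M.T (pt a u) (pt (a + r) v) x + 11 * l / 64 := by
  have hN0 : (0 : ℝ) < N := by linarith
  have hpen : ∀ p q : ℤ, |(p : ℝ) - c| ≤ 6 * N * w → |(q : ℝ) - c| ≤ 6 * N * w →
      4 * (((p : ℝ) - c) ^ 2 + ((q : ℝ) - c) ^ 2) / (((N : ℝ) ^ 2) ^ 2 * r) ≤ l / 64 := by
    intro p q hp hq
    have h1 := pow_le_pow_left₀ (abs_nonneg _) hp 2
    have h2 := pow_le_pow_left₀ (abs_nonneg _) hq 2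
    rw [sq_abs, mul_pow, hw] at h1 h2
    rw [div_le_iff₀ (by positivity)]
    have h3 : 20000 * (N ^ 3 * r * l) ≤ N * (N ^ 3 * r * l) := by gcongr
    have h4 : 0 ≤ N ^ 3 * r * l := by positivity
    have h5 : ((p : ℝ) - c) ^ 2 + ((q : ℝ) - c) ^ 2 ≤ 72 * (N ^ 3 * r * l) := by linarith
    linarith
  have h1 := (abs_le.1 (le_of_notMem_badCell (by positivity) hr (by linarith) hx u' v')).2
  have h2 := (abs_le.1 (le_of_notMem_badCell (by positivity) hr (by linarith) hx u v)).1
  have h3 := hpen u v hu hv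
  have h4 := hpen u' v' hu' hv'
  have h5 := (abs_le.1 (hlip (√(r ^ 2 + ((v' : ℝ) - u') ^ 2)) (√(r ^ 2 + ((v : ℝ) - u) ^ 2))
    (Real.sqrt_nonneg _) (Real.sqrt_nonneg _))).2
  have h6 := abs_hypot_sub_le (a := (v' : ℝ) - u') (b := (v : ℝ) - u) hr
  have hoff : ∀ p q : ℤ, |(p : ℝ) - c| ≤ 6 * N * w → |(q : ℝ) - c| ≤ 6 * N * w →
      |(q : ℝ) - p| ≤ 12 * N * w := by
    intro p q hp hq
    have : (q : ℝ) - p = (q - c) - (p - c) := by ring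
    rw [this]
    exact (abs_sub _ _).trans (by linarith)
  have h7 : |√(r ^ 2 + ((v' : ℝ) - u') ^ 2) - √(r ^ 2 + ((v : ℝ) - u) ^ 2)|
      ≤ 24 * l / N ^ 4 := by
    refine h6.trans ?_
    rw [div_le_iff₀ (by positivity)]
    rw [abs_sub_comm] at hd
    calc |((v' : ℝ) - u') - (v - u)| * (|(v' : ℝ) - u'| + |(v : ℝ) - u|)
        ≤ (2 * w / N ^ 6) * (12 * N * w + 12 * N * w) := by
          gcongr
          · exact hoff _ _ hu' hv'
          · exact hoff _ _ hu hv
      _ = 48 * w ^ 2 / N ^ 5 := by field_simp; ring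
      _ = _ := by rw [hw]; field_simp; ring
  have h8 : C₁ * (|√(r ^ 2 + ((v' : ℝ) - u') ^ 2) - √(r ^ 2 + ((v : ℝ) - u) ^ 2)| + 1)
      ≤ l / 64 := by
    have h9 : C₁ * (24 * l / N ^ 4) ≤ l / 128 := by
      calc C₁ * (24 * l / N ^ 4) ≤ N * (24 * l / N ^ 4) := by gcongr
        _ = 24 * l / N ^ 3 := by field_simp
        _ ≤ l / 128 := by
          rw [div_le_div_iff₀ (by positivity) (by norm_num)]
          have : (20000 : ℝ) ^ 3 ≤ N ^ 3 := by gcongr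
          nlinarith
    have h10 := mul_le_mul_of_nonneg_left h7 hC₁
    linarith
  linarith

end Model

/-! ### Moving the end points of an optimal path -/

theorem norm_pt_le (a y : ℝ) : ‖pt a y‖ ≤ |a| + |y| := by
  rw [← dist_zero_right, dist_plane, Real.sqrt_le_left (by positivity)]
  simp only [pt_zero, pt_one, PiLp.zero_apply, sub_zero]
  nlinarith [sq_abs a, sq_abs y, mul_nonneg (abs_nonneg a) (abs_nonneg y)]

theorem le_polyLen {r n : ℝ} (y : ℕ → ℝ) {N : ℕ} (hn : n = N * r) :
    √(n ^ 2 + (y N - y 0) ^ 2) ≤ polyLen r y N := by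
  have := dist_add_dist_le_polyLen 0 r y (le_refl N)
  rw [dist_self, add_zero] at this
  refine le_trans (le_of_eq ?_) this
  rw [dist_plane, hn]
  simp only [polyPt, pt_zero, pt_one]
  congr 1
  push_cast
  ring

/-- Rounding to a multiple of `σ`. -/
theorem exists_multiple_near (z : ℝ) {σ : ℤ} (hσ : 0 < σ) :
    ∃ k : ℤ, |((k * σ : ℤ) : ℝ) - z| ≤ σ ∧ |(k : ℝ)| ≤ |z| / σ + 1 := by
  have hσ' : (0 : ℝ) < σ := by exact_mod_cast hσ
  have h := abs_sub_round (z / σ)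
  refine ⟨round (z / σ), ?_, ?_⟩
  · push_cast
    have e : (round (z / σ) : ℝ) * σ - z = -((z / σ - round (z / σ)) * σ) := by field_simp; ring
    rw [e, abs_neg, abs_mul, abs_of_pos hσ']
    nlinarith
  · have e : (round (z / σ) : ℝ) = z / σ - (z / σ - round (z / σ)) := by ring
    rw [e]
    refine (abs_sub _ _).trans ?_
    rw [abs_div, abs_of_pos hσ']
    linarith

theorem abs_chord_le {a b W : ℝ} (ha : |a| ≤ W) (hb : |b| ≤ W) {i N : ℕ} (hi : i ≤ N) (hN : 0 < N) :
    |a + i / N * (b - a)| ≤ W := by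
  have hN' : (0 : ℝ) < N := by exact_mod_cast hN
  have h0 : (0 : ℝ) ≤ i / N := by positivity
  have h1 : (i : ℝ) / N ≤ 1 := by rw [div_le_one hN']; exact_mod_cast hi
  rw [abs_le] at ha hb ⊢
  constructor <;> nlinarith

namespace Model

variable {Ω E : Type*} [MeasurableSpace Ω] [MeasurableSpace E] [MulAction ISO2 E]
  {P : Measure Ω} {M : Model Ω E P} {κ D₀ n₀ μ : ℝ}

/-- Localisation of the skeleton of an optimal path across a window. -/
theorem Skeleton.abs_sub_chord_le_window {D : Set Plane} {n l C₂ w : ℝ} {N : ℕ} {x : Ω}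
    {j j' : ℤ} {h : ℝ → unitInterval} {Y : ℝ → ℤ}
    (hs : M.Skeleton D 0 n (2000 * μ * (4 * n) ^ (1 / 40 : ℝ)) (10 * (4 * n) + 1) j j' x h Y)
    (hx : M.RoughGeometry μ D (4 * n) x) (hμ : 0 < μ) (hC₂ : 0 ≤ C₂)
    (hN : 1200 / μ * (2 * C₂ + 1004) ≤ N) (hN0 : 0 < N) (hn : 1 ≤ n) (hl : 0 < l)
    (hw : w = √(n * l))
    (hD : ∀ i : ℕ, i ≤ N → ∀ k : ℤ, pt (i * (n / N)) k ∈ D)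
    (herr : 2000 * μ * (4 * n) ^ (1 / 40 : ℝ) ≤ l)
    (hsmall : 4 / μ * (l + μ + 3 * ((4 * n) ^ (1 / 200 : ℝ)) ^ 2 / μ) ≤ n)
    (hwn : 5 * N ^ 2 * w ≤ n)
    (hsub : ∀ r : ℝ, ∀ y : ℕ → ℝ, M.meanX (polyLen r y N)
      ≤ ∑ i ∈ Finset.range N, M.meanX (√(r ^ 2 + (y (i + 1) - y i) ^ 2)))
    (hslope : ∀ s, n ≤ s → s ≤ 2 * n → ∀ ℓ, s ≤ ℓ →
      M.meanX s + μ / 4 * (ℓ - s) - C₂ * (N * l) ≤ M.meanX ℓ)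
    (hjj : |(j' : ℝ) - j| ≤ 4 * N ^ 2 * w)
    (hcell : ∀ i : ℕ, i < N → ∃ c : ℤ,
      |(c : ℝ) - ((j : ℝ) + i / N * (j' - j))| ≤ 5 * N * w ∧
      x ∉ M.BadCell ((N : ℝ) ^ 2) (n / N) (l / 16) (i * (n / N)) c)
    (hT : M.T (pt 0 j) (pt n j') x ≤ M.meanX (√(n ^ 2 + ((j' : ℝ) - j) ^ 2)) + l)
    {i : ℕ} (hi : i ≤ N) :
    |(Y (i * (n / N)) : ℝ) - ((j : ℝ) + i / N * (j' - j))| ≤ N * w := by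
  have hN' : (1 : ℝ) ≤ N := by exact_mod_cast hN0
  have hn0 : 0 < n := by linarith
  have hNn : (N : ℝ) * (n / N) = n := by field_simp
  have hY0 := hs.Y_zero
  have hYn := hs.Y_end
  have hw0 : 0 ≤ w := hw ▸ Real.sqrt_nonneg _
  have hNw : 0 ≤ (N : ℝ) ^ 2 * w := by positivity
  have hjn : |(j' : ℝ) - j| ≤ n := by linarith
  have key := hs.abs_sub_chord_le hx (by linarith) (by linarith) (by linarith) (a := 0) (n := n)
    (C₂ := C₂) (l := l) (B := l / 16) hμ hN0 hC₂ hN le_rfl hn0 (by linarith) hl (by linarith)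
    (by linarith) (by simpa only [zero_add] using hD) herr hsmall (by rw [← hw]; exact hwn)
  simp only [zero_add, hY0, hYn, ← hw] at key
  refine key (by linarith) ?_ hcell ?_ hi
  · intro y hy0 hyN
    have h1 := le_polyLen y (N := N) (r := n / N) hNn.symm
    have h2 : n ≤ √(n ^ 2 + (y N - y 0) ^ 2) :=
      Real.le_sqrt_of_sq_le (by linarith [sq_nonneg (y N - y 0)])
    have h3 : √(n ^ 2 + (y N - y 0) ^ 2) ≤ 2 * n := by
      rw [Real.sqrt_le_left (by positivity), hyN, hy0, ← sq_abs ((j' : ℝ) - j)]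
      have := pow_le_pow_left₀ (abs_nonneg _) hjn 2
      nlinarith only [this, hn0]
    have h4 := hslope _ h2 h3 _ h1
    have h5 := hsub (n / N) y
    have h6 : 0 ≤ C₂ * (N * l) := by positivity
    linarith
  · refine hT.trans ?_
    gcongr
    exact le_mul_of_one_le_left hl.le hN'

/-- Moving the end points of an optimal path: if all the cells at scale `n / N` are good, the
passage time across a window is almost unchanged when the end points are moved a little, because the first
and the last cell absorb the change. -/
theorem T_le_T_add_of_near {D : Set Plane} {n l C₁ C₂ w : ℝ} {N : ℕ} {σ : ℤ} {x : Ω}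
    (hx : M.RoughGeometry μ D (4 * n) x) (hμ : 0 < μ) (hC₂ : 0 ≤ C₂)
    (hN : 1200 / μ * (2 * C₂ + 1004) ≤ N) (hN' : 20000 ≤ (N : ℝ))
    (hlip : ∀ s t : ℝ, 0 ≤ s → 0 ≤ t → |M.meanX s - M.meanX t| ≤ C₁ * (|s - t| + 1)) (hC₁ : 0 ≤ C₁)
    (hCN : C₁ ≤ N) (hn : 1 ≤ n) (hl : 0 < l) (hw : w = √(n * l))
    (hD : ∀ i : ℕ, i ≤ N → ∀ k : ℤ, pt (i * (n / N)) k ∈ D)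
    (herr : 2000 * μ * (4 * n) ^ (1 / 40 : ℝ) ≤ l / 128)
    (hsmall : 4 / μ * (l + μ + 3 * ((4 * n) ^ (1 / 200 : ℝ)) ^ 2 / μ) ≤ n)
    (hwn : 5 * N ^ 2 * w ≤ n) (hC : C₁ * 2 ≤ l / 64)
    (hsub : ∀ r : ℝ, ∀ y : ℕ → ℝ, M.meanX (polyLen r y N)
      ≤ ∑ i ∈ Finset.range N, M.meanX (√(r ^ 2 + (y (i + 1) - y i) ^ 2)))
    (hslope : ∀ s, n ≤ s → s ≤ 2 * n → ∀ ℓ, s ≤ ℓ →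
      M.meanX s + μ / 4 * (ℓ - s) - C₂ * (N * l) ≤ M.meanX ℓ)
    (hσ1 : w / N ^ 6 ≤ σ) (hσ2 : σ ≤ 2 * w / N ^ 6)
    (hcell : ∀ i : ℕ, i < N → ∀ c : ℤ, |(c : ℝ)| ≤ 4 * N ^ 8 →
      x ∉ M.BadCell ((N : ℝ) ^ 2) (n / N) (l / 16) (i * (n / N)) ((c * σ : ℤ) : ℝ))
    {j j' k k' : ℤ} (hj : |(j : ℝ)| ≤ 2 * N ^ 2 * w) (hj' : |(j' : ℝ)| ≤ 2 * N ^ 2 * w)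
    (hk : |(k : ℝ) - j| ≤ σ) (hk' : |(k' : ℝ) - j'| ≤ σ)
    (hT : M.T (pt 0 j) (pt n j') x ≤ M.meanX (√(n ^ 2 + ((j' : ℝ) - j) ^ 2)) + l) :
    M.T (pt 0 k) (pt n k') x ≤ M.T (pt 0 j) (pt n j') x + l / 2 := by
  have hN0' : (0 : ℝ) < N := by linarith
  have hN0 : 0 < N := by exact_mod_cast hN0'
  have hn0 : 0 < n := by linarith
  have hw0 : 0 < w := by rw [hw]; positivity
  have hw2 : w ^ 2 = n * l := by rw [hw]; exact Real.sq_sqrt (by positivity)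
  have hσ0 : (0 : ℝ) < σ := lt_of_lt_of_le (by positivity) hσ1
  have hσz : 0 < σ := by exact_mod_cast hσ0
  have hσw : (σ : ℝ) ≤ w := by
    refine hσ2.trans ?_
    rw [div_le_iff₀ (by positivity)]
    have : (2 : ℝ) ≤ N ^ 6 := by
      calc (2 : ℝ) ≤ 20000 ^ 6 := by norm_num
        _ ≤ N ^ 6 := by gcongr
    nlinarith
  have hNw : w ≤ N * w := le_mul_of_one_le_left hw0.le (by linarith)
  have hNNw : 0 ≤ (N : ℝ) ^ 2 * w := by positivity
  have hNn : (N : ℝ) * (n / N) = n := by field_simp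
  have hDn : ∀ k : ℤ, pt n k ∈ D := fun k => by simpa only [hNn] using hD N le_rfl k
  have hD0 : ∀ k : ℤ, pt 0 k ∈ D := fun k => by simpa using hD 0 (by omega) k
  have hwn2 : 2 * N ^ 2 * w ≤ n := le_trans (by linarith [hNNw]) hwn
  obtain ⟨h, Y, hs⟩ := hx.exists_skeleton (x₀ := 0) hn0 (hD0 j) (by simpa using hDn j')
    ((norm_pt_le _ _).trans (by rw [abs_zero]; linarith))
    ((norm_pt_le _ _).trans (by rw [zero_add, abs_of_pos hn0]; linarith))
  have hY0 := hs.Y_zero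
  have hYn := hs.Y_end
  obtain ⟨r, hr⟩ : ∃ r, r = n / N := ⟨_, rfl⟩
  have hr0 : 0 < r := by rw [hr]; positivity
  have hnr : n = N * r := by rw [hr]; field_simp
  -- centres of the cells along the chord
  have hcentre : ∀ i : ℕ, i < N → ∃ c : ℤ,
      |(c : ℝ) - ((j : ℝ) + i / N * (j' - j))| ≤ σ ∧
      x ∉ M.BadCell ((N : ℝ) ^ 2) (n / N) (l / 16) (i * (n / N)) c := by
    intro i hi
    have hz := abs_chord_le hj hj' hi.le hN0
    obtain ⟨m, hm1, hm2⟩ := exists_multiple_near ((j : ℝ) + i / N * (j' - j)) hσz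
    refine ⟨m * σ, hm1, hcell i hi m (hm2.trans ?_)⟩
    have h1 : |(j : ℝ) + i / N * (j' - j)| / σ ≤ 2 * N ^ 8 := by
      rw [div_le_iff₀ hσ0]
      calc |(j : ℝ) + i / N * (j' - j)| ≤ 2 * N ^ 2 * w := hz
        _ = 2 * N ^ 8 * (w / N ^ 6) := by field_simp
        _ ≤ _ := by gcongr
    have h2 : (1 : ℝ) ≤ N ^ 8 := one_le_pow₀ (by linarith)
    linarith
  have hjj : |(j' : ℝ) - j| ≤ 4 * N ^ 2 * w := (abs_sub _ _).trans (by linarith)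
  have hloc := fun i hi => hs.abs_sub_chord_le_window hx hμ hC₂ hN hN0 hn hl hw hD
    (herr.trans (by linarith)) hsmall hwn hsub hslope hjj (fun i hi => by
      obtain ⟨c, hc1, hc2⟩ := hcentre i hi
      exact ⟨c, hc1.trans (by linarith), hc2⟩) hT (i := i) hi
  rw [← hr] at hD hcentre hloc
  have hr1 : r ≤ (N - 1 : ℕ) * r := by
    have : (1 : ℝ) ≤ (N - 1 : ℕ) := by
      have h2 : (20000 : ℕ) ≤ N := by exact_mod_cast hN'
      exact_mod_cast (by omega : 1 ≤ N - 1)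
    exact le_mul_of_one_le_left hr0.le this
  have hN1 : ((N - 1 : ℕ) : ℝ) = N - 1 := by
    rw [Nat.cast_sub (by omega)]; simp
  have hr2 : ((N - 1 : ℕ) : ℝ) * r + r = n := by rw [hN1, hnr]; ring
  -- the first and the last cell
  have l1 := hloc 1 (by omega)
  have l2 := hloc (N - 1) (by omega)
  obtain ⟨c, hc1, hc2⟩ := hcentre 0 (by omega)
  obtain ⟨c', hc1', hc2'⟩ := hcentre (N - 1) (by omega)
  have hstep : |((j' : ℝ) - j) / N| ≤ 4 * N * w := by
    rw [abs_div, abs_of_pos hN0', div_le_iff₀ hN0']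
    refine hjj.trans (le_of_eq ?_); ring
  simp only [Nat.cast_one, one_mul] at l1
  simp only [Nat.cast_zero, zero_div, zero_mul, add_zero] at hc1 hc2
  rw [hN1] at l2 hc1' hc2' hr1 hr2
  have hwr : w ^ 2 = N * r * l := by rw [hw2, ← hnr]
  have e1 := T_le_T_add_of_notMem_badCell (u := j) (v := Y r) (u' := k) (v' := Y r) hlip hC₁ hN' hr0 hl
    hw0.le hwr hc2 hC hCN
    (by rw [abs_sub_comm]; exact hc1.trans (by linarith))
    (by
      have e : (Y r : ℝ) - c = (Y r - ((j : ℝ) + 1 / N * (j' - j))) + ((j' : ℝ) - j) / N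
        - (c - j) := by ring
      rw [e]
      refine (abs_sub _ _).trans ?_
      have := abs_add_le ((Y r : ℝ) - ((j : ℝ) + 1 / N * (j' - j))) (((j' : ℝ) - j) / N)
      linarith)
    (by
      have e : (k : ℝ) - c = (k - j) - (c - j) := by ring
      rw [e]
      refine (abs_sub _ _).trans ?_
      linarith)
    (by
      have e : (Y r : ℝ) - c = (Y r - ((j : ℝ) + 1 / N * (j' - j))) + ((j' : ℝ) - j) / N
        - (c - j) := by ring
      rw [e]
      refine (abs_sub _ _).trans ?_
      have := abs_add_le ((Y r : ℝ) - ((j : ℝ) + 1 / N * (j' - j))) (((j' : ℝ) - j) / N)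
      linarith)
    (by
      have e : (Y r : ℝ) - j - (Y r - k) = k - j := by ring
      rw [e]; exact hk.trans hσ2)
  have hc'' : |(c' : ℝ) - j'| ≤ 4 * N * w + σ := by
    have e : (c' : ℝ) - j' = (c' - ((j : ℝ) + (N - 1) / N * (j' - j))) - ((j' : ℝ) - j) / N := by
      field_simp; ring
    rw [e]
    exact (abs_sub _ _).trans (by linarith)
  have hYc : |(Y ((N - 1 : ℝ) * r) : ℝ) - c'| ≤ 6 * N * w := by
    have e : (Y ((N - 1 : ℝ) * r) : ℝ) - c' = (Y ((N - 1 : ℝ) * r)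
      - ((j : ℝ) + (N - 1) / N * (j' - j))) - (c' - ((j : ℝ) + (N - 1) / N * (j' - j))) := by ring
    rw [e]
    exact (abs_sub _ _).trans (by linarith)
  have e2 := T_le_T_add_of_notMem_badCell (u := Y ((N - 1 : ℝ) * r)) (v := j')
    (u' := Y ((N - 1 : ℝ) * r)) (v' := k') hlip hC₁ hN' hr0 hl hw0.le hwr hc2' hC hCN hYc
    (by rw [abs_sub_comm]; linarith) hYc
    (by
      have e : (k' : ℝ) - c' = (k' - j') - (c' - j') := by ring
      rw [e]
      refine (abs_sub _ _).trans ?_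
      linarith)
    (by
      have e : (j' : ℝ) - Y ((N - 1 : ℝ) * r) - (k' - Y ((N - 1 : ℝ) * r)) = -(k' - j') := by ring
      rw [e, abs_neg]; exact hk'.trans hσ2)
  rw [hr2] at e2
  rw [zero_add] at e1
  have m1 : pt r (Y r) ∈ D := by simpa using hD 1 (by omega) (Y r)
  have m2 : pt ((N - 1 : ℝ) * r) (Y ((N - 1 : ℝ) * r)) ∈ D := by
    simpa only [hN1] using hD (N - 1) (by omega) _
  have s1 := hs.super 0 r n le_rfl hr0.le (by linarith) le_rfl (by simpa using hD0 _)
    (by simpa using m1) (by simpa using hDn _)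
  have s2 := hs.super r ((N - 1 : ℝ) * r) n hr0.le hr1 (by linarith) le_rfl (by simpa using m1)
    (by simpa using m2) (by simpa using hDn _)
  simp only [zero_add, hY0, hYn] at s1 s2
  have t1 := hx.tri _ (hD0 k) _ (hDn k') _ m1
  have t2 := hx.tri _ m1 _ (hDn k') _ m2
  linarith

end Model

/-! ### Deterministic estimates for windows -/

theorem exists_threshold {A D b β : ℝ} (hD : 0 < D) (hβ : 0 < β) (hb : β < b) :
    ∃ Λ₀ : ℝ, 1 ≤ Λ₀ ∧ ∀ Λ, Λ₀ ≤ Λ → ∀ x, Λ ≤ x →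
      A * Real.exp (-(D * x ^ b)) ≤ 1 / 3 * Real.exp (1 - (x / Λ) ^ β) := by
  obtain ⟨K, hK0, hK⟩ : ∃ K : ℝ, 0 ≤ K ∧ 3 * A ≤ Real.exp K := by
    refine ⟨Real.log (max 1 (3 * A)), Real.log_nonneg (le_max_left _ _), ?_⟩
    rw [Real.exp_log (lt_of_lt_of_le one_pos (le_max_left _ _))]
    exact le_max_right _ _
  obtain ⟨Λ₀, h⟩ := eventually_atTop.1 (eventually_mul_rpow_le hb ((K + 1) / D))
  refine ⟨max 1 Λ₀, le_max_left _ _, fun Λ hΛ x hx => ?_⟩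
  have hΛ1 : 1 ≤ Λ := (le_max_left _ _).trans hΛ
  have hx1 : 1 ≤ x := hΛ1.trans hx
  have h1 := h x ((le_max_right _ _).trans (hΛ.trans hx))
  have h2 : (x / Λ) ^ β ≤ x ^ β :=
    Real.rpow_le_rpow (by positivity) (div_le_self (by linarith) hΛ1) hβ.le
  have h3 : 1 ≤ x ^ β := Real.one_le_rpow hx1 hβ.le
  rw [div_mul_eq_mul_div, div_le_iff₀ hD] at h1
  calc A * Real.exp (-(D * x ^ b)) = 1 / 3 * (3 * A * Real.exp (-(D * x ^ b))) := by ring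
    _ ≤ 1 / 3 * (Real.exp K * Real.exp (-(D * x ^ b))) := by gcongr
    _ ≤ _ := by
      rw [← Real.exp_add]
      gcongr
      nlinarith

namespace Model

variable {Ω E : Type*} [MeasurableSpace Ω] [MeasurableSpace E] [MulAction ISO2 E]
  {P : Measure Ω} {M : Model Ω E P} {κ D₀ n₀ μ : ℝ}

/-- The conclusion for the passage times across a window, on the event that the cells at the smaller
scale are good and that the passage times between the points of a coarse grid are close to their
means. -/
theorem notMem_badWindow_of_cells {D : Set Plane} {n l C₁ C₂ w : ℝ} {N : ℕ} {σ : ℤ} {x : Ω}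
    (hx : M.RoughGeometry μ D (4 * n) x) (hμ : 0 < μ) (hC₂ : 0 ≤ C₂)
    (hN : 1200 / μ * (2 * C₂ + 1004) ≤ N) (hN' : 20000 ≤ (N : ℝ))
    (hlip : ∀ s t : ℝ, 0 ≤ s → 0 ≤ t → |M.meanX s - M.meanX t| ≤ C₁ * (|s - t| + 1)) (hC₁ : 0 ≤ C₁)
    (hCN : C₁ ≤ N) (hn : 1 ≤ n) (hl : 0 < l) (hw : w = √(n * l))
    (hD : ∀ i : ℕ, i ≤ N → ∀ k : ℤ, pt (i * (n / N)) k ∈ D)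
    (herr : 2000 * μ * (4 * n) ^ (1 / 40 : ℝ) ≤ l / 128)
    (hsmall : 4 / μ * (l + μ + 3 * ((4 * n) ^ (1 / 200 : ℝ)) ^ 2 / μ) ≤ n)
    (hwn : 5 * N ^ 2 * w ≤ n) (hC : C₁ * 2 ≤ l / 64)
    (hsub : ∀ r : ℝ, ∀ y : ℕ → ℝ, M.meanX (polyLen r y N)
      ≤ ∑ i ∈ Finset.range N, M.meanX (√(r ^ 2 + (y (i + 1) - y i) ^ 2)))
    (hslope : ∀ s, n ≤ s → s ≤ 2 * n → ∀ ℓ, s ≤ ℓ →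
      M.meanX s + μ / 4 * (ℓ - s) - C₂ * (N * l) ≤ M.meanX ℓ)
    (hσ1 : w / N ^ 6 ≤ σ) (hσ2 : σ ≤ 2 * w / N ^ 6)
    (hcell : ∀ i : ℕ, i < N → ∀ c : ℤ, |(c : ℝ)| ≤ 4 * N ^ 8 →
      x ∉ M.BadCell ((N : ℝ) ^ 2) (n / N) (l / 16) (i * (n / N)) ((c * σ : ℤ) : ℝ))
    (hgrid : ∀ m m' : ℤ, |(m : ℝ)| ≤ 2 * N ^ 8 → |(m' : ℝ)| ≤ 2 * N ^ 8 →
      |M.T (pt 0 ((m * σ : ℤ) : ℝ)) (pt n ((m' * σ : ℤ) : ℝ)) x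
        - M.meanX (√(n ^ 2 + (((m' * σ : ℤ) : ℝ) - ((m * σ : ℤ) : ℝ)) ^ 2))| ≤ l / 8) :
    x ∉ M.BadWindow ((N : ℝ) ^ 2) n l 0 0 := by
  rintro ⟨⟨j, j'⟩, hj, hj', hlt⟩
  simp only at hj hj' hlt
  rw [← hw] at hj hj'
  have hN0 : (0 : ℝ) < N := by linarith
  have hn0 : 0 < n := by linarith
  have hw0 : 0 < w := by rw [hw]; positivity
  have hw2 : w ^ 2 = n * l := by rw [hw]; exact Real.sq_sqrt (by positivity)
  have hσ0 : (0 : ℝ) < σ := lt_of_lt_of_le (by positivity) hσ1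
  have hσz : 0 < σ := by exact_mod_cast hσ0
  have hNNw : 0 ≤ (N : ℝ) ^ 2 * w := by positivity
  have hσw : (σ : ℝ) ≤ N ^ 2 * w := by
    refine hσ2.trans ?_
    rw [div_le_iff₀ (by positivity)]
    have : (2 : ℝ) ≤ N ^ 8 := by
      calc (2 : ℝ) ≤ 20000 ^ 8 := by norm_num
        _ ≤ N ^ 8 := by gcongr
    calc 2 * w ≤ N ^ 8 * w := by gcongr
      _ = _ := by ring
  have hgr : ∀ z : ℤ, |(z : ℝ)| ≤ N ^ 2 * w → ∃ m : ℤ, |((m * σ : ℤ) : ℝ) - z| ≤ σ ∧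
      |(m : ℝ)| ≤ 2 * N ^ 8 := by
    intro z hz
    obtain ⟨m, hm1, hm2⟩ := exists_multiple_near z hσz
    refine ⟨m, hm1, hm2.trans ?_⟩
    have h1 : |(z : ℝ)| / σ ≤ N ^ 8 := by
      rw [div_le_iff₀ hσ0]
      calc |(z : ℝ)| ≤ N ^ 2 * w := hz
        _ = N ^ 8 * (w / N ^ 6) := by field_simp
        _ ≤ _ := by gcongr
    have h2 : (1 : ℝ) ≤ N ^ 8 := one_le_pow₀ (by linarith)
    linarith
  obtain ⟨m, hm1, hm2⟩ := hgr j hj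
  obtain ⟨m', hm1', hm2'⟩ := hgr j' hj'
  have hg := hgrid m m' hm2 hm2'
  set g : ℤ := m * σ
  set g' : ℤ := m' * σ
  rw [zero_add, zero_add, zero_add, show pt n j' = pt (0 + n) j' by rw [zero_add], dist_pt_right,
    zero_add] at hlt
  have hg2 : |(g : ℝ)| ≤ 2 * N ^ 2 * w := by
    have : (g : ℝ) = (g - j) + j := by ring
    rw [this]
    exact (abs_add_le _ _).trans (by linarith)
  have hg2' : |(g' : ℝ)| ≤ 2 * N ^ 2 * w := by
    have : (g' : ℝ) = (g' - j') + j' := by ring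
    rw [this]
    exact (abs_add_le _ _).trans (by linarith)
  -- the means
  have hmean : |M.meanX (√(n ^ 2 + ((j' : ℝ) - j) ^ 2)) - M.meanX (√(n ^ 2 + ((g' : ℝ) - g) ^ 2))|
      ≤ l / 32 := by
    refine (hlip _ _ (Real.sqrt_nonneg _) (Real.sqrt_nonneg _)).trans ?_
    have h1 := abs_hypot_sub_le (a := (j' : ℝ) - j) (b := (g' : ℝ) - g) hn0
    have h2 : |((j' : ℝ) - j) - (g' - g)| ≤ 4 * w / N ^ 6 := by
      have e : ((j' : ℝ) - j) - (g' - g) = (g - j) - (g' - j') := by ring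
      rw [e]
      refine (abs_sub _ _).trans ?_
      have : 4 * w / (N : ℝ) ^ 6 = 2 * w / N ^ 6 + 2 * w / N ^ 6 := by ring
      linarith
    have h3 : |(j' : ℝ) - j| ≤ 4 * N ^ 2 * w := (abs_sub _ _).trans (by linarith)
    have h4 : |(g' : ℝ) - g| ≤ 4 * N ^ 2 * w := (abs_sub _ _).trans (by linarith)
    have h5 : |√(n ^ 2 + ((j' : ℝ) - j) ^ 2) - √(n ^ 2 + ((g' : ℝ) - g) ^ 2)| ≤ 16 * l / N ^ 4 := by
      refine h1.trans ?_
      rw [div_le_iff₀ (by positivity)]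
      calc |((j' : ℝ) - j) - (g' - g)| * (|(j' : ℝ) - j| + |(g' : ℝ) - g|)
          ≤ (4 * w / N ^ 6) * (4 * N ^ 2 * w + 4 * N ^ 2 * w) := by gcongr
        _ = 32 * w ^ 2 / N ^ 4 := by field_simp; ring
        _ = _ := by rw [hw2]; field_simp; ring
    have h6 : C₁ * (16 * l / N ^ 4) ≤ l / 128 := by
      calc C₁ * (16 * l / N ^ 4) ≤ N * (16 * l / N ^ 4) := by gcongr
        _ = 16 * l / N ^ 3 := by field_simp
        _ ≤ l / 128 := by
          rw [div_le_div_iff₀ (by positivity) (by norm_num)]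
          have : (20000 : ℝ) ^ 3 ≤ N ^ 3 := by gcongr
          nlinarith only [this, hl]
    have h7 := mul_le_mul_of_nonneg_left h5 hC₁
    linarith
  have tr := fun {j j' k k' : ℤ} => T_le_T_add_of_near (j := j) (j' := j') (k := k) (k' := k') hx hμ hC₂
    hN hN' hlip hC₁ hCN hn hl hw hD herr hsmall hwn hC hsub hslope hσ1 hσ2 hcell
  rw [abs_le] at hg hmean
  have t1 := tr (j := g) (j' := g') (k := j) (k' := j') hg2 hg2' (by rw [abs_sub_comm]; exact hm1)
    (by rw [abs_sub_comm]; exact hm1') (by linarith)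
  have t2 := tr (j := j) (j' := j') (k := g) (k' := g') (by linarith) (by linarith) hm1 hm1'
    (by linarith)
  rw [lt_abs] at hlt
  rcases hlt with h | h <;> linarith

/-- The conclusion for the passage times across a window when the deviations are larger than
diffusive: the crude bounds suffice. -/
theorem notMem_badWindow_of_crude {D : Set Plane} {n l C : ℝ} {N : ℕ} {x : Ω} (hN : 1 ≤ N)
    (hx : M.Crude μ D (l ^ 2) x) (hn : 1 ≤ n) (hl : 1 ≤ l) (hnl : n ≤ l ^ (5 / 3 : ℝ))
    (hlow : ∀ d : ℝ, 0 ≤ d → μ * d ≤ M.meanX d)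
    (hup : ∀ d : ℝ, 0 ≤ d → M.meanX d ≤ μ * d + C * (√(1 + d) * (1 + d) ^ (1 / 100 : ℝ)))
    (hC : 0 ≤ C) (hlN : N ^ 2 * l ^ (4 / 3 : ℝ) ≤ l ^ 2)
    (hlarge : (4 * N ^ 2 + 16 * C * N ^ 4) * l ^ (17 / 20 : ℝ) ≤ l)
    (hD : ∀ k : ℤ, pt 0 k ∈ D) (hDn : ∀ k : ℤ, pt n k ∈ D) :
    x ∉ M.BadWindow ((N : ℝ) ^ 2) n l 0 0 := by
  rintro ⟨⟨j, j'⟩, hj, hj', hlt⟩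
  simp only at hj hj' hlt
  have hN' : (1 : ℝ) ≤ N := by exact_mod_cast hN
  have hl0 : 0 < l := by linarith
  have hw : √(n * l) ≤ l ^ (4 / 3 : ℝ) := by
    rw [Real.sqrt_le_left (by positivity), ← Real.rpow_natCast, ← Real.rpow_mul hl0.le]
    calc n * l ≤ l ^ (5 / 3 : ℝ) * l ^ (1 : ℝ) := by rw [Real.rpow_one]; gcongr
      _ = _ := by rw [← Real.rpow_add hl0]; norm_num
  have hwN : (N : ℝ) ^ 2 * √(n * l) ≤ N ^ 2 * l ^ (4 / 3 : ℝ) := by gcongr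
  have hnl2 : n ≤ l ^ 2 := by
    refine hnl.trans ?_
    rw [← Real.rpow_natCast]
    exact Real.rpow_le_rpow_of_exponent_le hl (by norm_num)
  have hnn : ∀ a : ℝ, ∀ k : ℤ, |a| ≤ n → |(k : ℝ)| ≤ N ^ 2 * √(n * l) → ‖pt a k‖ < 40 * l ^ 2 := by
    intro a k ha hk
    refine norm_pt_lt (by positivity) (ha.trans hnl2) ?_
    nlinarith [sq_nonneg l]
  rw [zero_add, zero_add, zero_add, show pt n j' = pt (0 + n) j' by rw [zero_add], dist_pt_right,
    zero_add] at hlt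
  have hcr := hx _ (hD j) _ (hDn j') (hnn 0 j (by rw [abs_zero]; linarith) hj)
    (hnn n j' (by rw [abs_of_nonneg (by linarith)]) hj')
  rw [show pt n j' = pt (0 + n) j' by rw [zero_add], dist_pt_right, zero_add] at hcr
  set d := √(n ^ 2 + ((j' : ℝ) - j) ^ 2) with hd
  have hd0 : 0 ≤ d := Real.sqrt_nonneg _
  have hdl : 1 + d ≤ 4 * N ^ 2 * l ^ (5 / 3 : ℝ) := by
    have h1 : d ≤ n + |(j' : ℝ) - j| := by
      rw [hd, Real.sqrt_le_left (by positivity)]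
      nlinarith [sq_abs ((j' : ℝ) - j), abs_nonneg ((j' : ℝ) - j)]
    have h2 : |(j' : ℝ) - j| ≤ 2 * (N ^ 2 * l ^ (4 / 3 : ℝ)) := (abs_sub _ _).trans (by linarith)
    have h3 : l ^ (4 / 3 : ℝ) ≤ l ^ (5 / 3 : ℝ) :=
      Real.rpow_le_rpow_of_exponent_le hl (by norm_num)
    have h4 : (N : ℝ) ^ 2 * l ^ (4 / 3 : ℝ) ≤ N ^ 2 * l ^ (5 / 3 : ℝ) := by gcongr
    have h5 : 1 ≤ l ^ (5 / 3 : ℝ) := Real.one_le_rpow hl (by norm_num)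
    have h6 : (1 : ℝ) ≤ N ^ 2 := one_le_pow₀ hN'
    have h7 : l ^ (5 / 3 : ℝ) ≤ N ^ 2 * l ^ (5 / 3 : ℝ) :=
      le_mul_of_one_le_left (by linarith) h6
    linarith
  have hNN : (4 * N ^ 2 : ℝ) = (2 * N) ^ 2 := by ring
  have hsq : √(1 + d) ≤ 2 * N * l ^ (5 / 6 : ℝ) := by
    rw [Real.sqrt_le_left (by positivity), mul_pow, ← Real.rpow_natCast (l ^ (5 / 6 : ℝ)),
      ← Real.rpow_mul hl0.le, ← hNN]
    norm_num at hdl ⊢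
    exact hdl
  have hpw : (1 + d) ^ (1 / 100 : ℝ) ≤ 4 * N ^ 2 * l ^ (1 / 60 : ℝ) := by
    calc (1 + d) ^ (1 / 100 : ℝ) ≤ (4 * N ^ 2 * l ^ (5 / 3 : ℝ)) ^ (1 / 100 : ℝ) :=
          Real.rpow_le_rpow (by linarith) hdl (by norm_num)
      _ = (4 * N ^ 2) ^ (1 / 100 : ℝ) * l ^ (1 / 60 : ℝ) := by
          rw [Real.mul_rpow (by positivity) (by positivity), ← Real.rpow_mul hl0.le]
          norm_num
      _ ≤ _ := by
          gcongr
          calc (4 * N ^ 2 : ℝ) ^ (1 / 100 : ℝ) ≤ (4 * N ^ 2 : ℝ) ^ (1 : ℝ) :=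
                Real.rpow_le_rpow_of_exponent_le (by nlinarith) (by norm_num)
            _ = _ := Real.rpow_one _
  have hρ : (l ^ 2) ^ (1 / 200 : ℝ) ≤ l ^ (1 / 60 : ℝ) := by
    rw [← Real.rpow_natCast, ← Real.rpow_mul hl0.le]
    exact Real.rpow_le_rpow_of_exponent_le hl (by norm_num)
  have h56 : l ^ (5 / 6 : ℝ) * l ^ (1 / 60 : ℝ) = l ^ (17 / 20 : ℝ) := by
    rw [← Real.rpow_add hl0]; norm_num
  have hA : (l ^ 2) ^ (1 / 200 : ℝ) * √(1 + d) ≤ 2 * N * l ^ (17 / 20 : ℝ) := by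
    calc (l ^ 2) ^ (1 / 200 : ℝ) * √(1 + d) ≤ l ^ (1 / 60 : ℝ) * (2 * N * l ^ (5 / 6 : ℝ)) := by
          gcongr
      _ = _ := by rw [← h56]; ring
  have hB : C * (√(1 + d) * (1 + d) ^ (1 / 100 : ℝ)) ≤ 8 * C * N ^ 3 * l ^ (17 / 20 : ℝ) := by
    calc C * (√(1 + d) * (1 + d) ^ (1 / 100 : ℝ))
        ≤ C * ((2 * N * l ^ (5 / 6 : ℝ)) * (4 * N ^ 2 * l ^ (1 / 60 : ℝ))) := by gcongr
      _ = _ := by rw [← h56]; ring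
  have hlo := hlow d hd0
  have hu := hup d hd0
  have hpl : 0 ≤ l ^ (17 / 20 : ℝ) := by positivity
  have hN2 : 2 * N * l ^ (17 / 20 : ℝ) ≤ 4 * N ^ 2 * l ^ (17 / 20 : ℝ) := by
    have : (N : ℝ) ≤ N ^ 2 := by nlinarith
    gcongr
    linarith
  have hN3 : 8 * C * N ^ 3 * l ^ (17 / 20 : ℝ) ≤ 16 * C * N ^ 4 * l ^ (17 / 20 : ℝ) := by
    have : (N : ℝ) ^ 3 ≤ N ^ 4 := pow_le_pow_right₀ hN' (by norm_num)
    gcongr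
    linarith
  rw [abs_le] at hcr
  rw [lt_abs] at hlt
  rcases hlt with h | h <;> linarith

variable (M) in
/-- The rate at which the mean passage time grows beyond a scale `s` is at least `μ / 4`, up to an
error that is controlled by the fluctuations at scale `s`. -/
def SlopeBound (μ C₂ S₀ : ℝ) : Prop :=
  ∀ N : ℕ, 0 < N → 4800 / μ ≤ (N : ℝ) ^ 2 → ∀ s, S₀ ≤ s → ∀ τ, s ^ (1 / 20 : ℝ) ≤ τ →
    (∀ t, s ≤ t → t ≤ s + s ^ (2 / 3 : ℝ) →
      P.real {x | τ < |M.T (pt 0 0) (pt t 0) x - M.meanX t|} ≤ 1 / 4) →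
    (∀ i : ℕ, i < N → P.real (M.BadCell ((N : ℝ) ^ 2) (s / N) τ (i * (s / N)) 0) ≤ 1 / (4 * N)) →
    ∀ ℓ, s ≤ ℓ → M.meanX s + μ / 4 * (ℓ - s) - C₂ * (N * τ) ≤ M.meanX ℓ

variable [IsProbabilityMeasure P]

variable (M) in
/-- Stretched exponential control of the passage times across windows at scale `n`. -/
def WindowBound (N : ℕ) (Λ β : ℝ) (q : ℝ → ℝ) (n : ℝ) : Prop :=
  ∀ x > 0, P.real (M.BadWindow ((N : ℝ) ^ 2) n (x * q (3 * n)) 0 0) ≤ Real.exp (1 - (x / Λ) ^ β)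

/-- The slope of the mean passage time at scale `s`, given control of the windows at scale
`s / N`. -/
theorem SlopeBound.of_windowBound {C₂ S₀ α θ β c : ℝ} {q : ℝ → ℝ} (hs : M.SlopeBound μ C₂ S₀)
    (hS₀ : 1 ≤ S₀)
    (hM : M.Assumptions κ D₀ n₀ μ) (hq : M.FluctuationScale α θ q c) (hc : 0 < c) (hβ : 0 < β)
    {N : ℕ} (hN : 0 < N) (hNμ : 4800 / μ ≤ (N : ℝ) ^ 2) {Λ s n' τ X : ℝ} (hΛ : 0 < Λ)
    (hΛθ : 3 ≤ Λ ^ θ) (hsS : S₀ ≤ s) (hsn : s + s ^ (2 / 3 : ℝ) ≤ n') (hsτ : s ^ (1 / 20 : ℝ) ≤ τ)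
    (hτ : Λ * q n' ≤ τ) (hcl : M.WindowBound N Λ β q (s / N)) (hsN : 1 ≤ 3 * (s / N)) (hX : 1 ≤ X)
    (hτX : Λ * X * q (3 * (s / N)) ≤ τ)
    (hXN : Real.exp 1 * (1 - Real.exp (-β))⁻¹ * Real.exp (-X ^ β) ≤ 1 / (4 * N)) :
    ∀ ℓ, s ≤ ℓ → M.meanX s + μ / 4 * (ℓ - s) - C₂ * (N * τ) ≤ M.meanX ℓ := by
  refine hs N hN hNμ s hsS τ hsτ (fun t ht ht' => ?_) fun i _ => ?_
  · have hd : dist (pt 0 0) (pt t 0) = t := by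
      rw [Assumptions.dist_pt_axis, zero_sub, abs_neg, abs_of_nonneg (by linarith)]
    have := hq.tail (n := n') (a := pt 0 0) (b := pt t 0) (by rw [hd]; linarith)
      (by rw [hd]; linarith) hΛ
    rw [hd] at this
    refine (measureReal_mono fun x hx => lt_of_le_of_lt hτ hx).trans (this.trans ?_)
    calc Real.exp (1 - Λ ^ θ) ≤ Real.exp (-2) := Real.exp_le_exp.2 (by linarith)
      _ ≤ 1 / 4 := by
        rw [Real.exp_neg, one_div]
        refine inv_anti₀ (by norm_num) ?_
        rw [show (2 : ℝ) = 1 + 1 by norm_num, Real.exp_add]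
        nlinarith [Real.add_one_le_exp (1 : ℝ)]
  · have hq0 : 0 < q (3 * (s / N)) :=
      lt_of_lt_of_le (by positivity) (hq.lower hsN)
    exact (hM.measureReal_badCell_le hβ hΛ hq0 hcl hX hτX _ _).trans hXN

end Model

/-! ### The union bound over the cells of a window -/

/-- The total weight in the union bound over the levels of a cell. -/
def levelWeight (β : ℝ) : ℝ := Real.exp 1 * (1 - Real.exp (-β))⁻¹

theorem levelWeight_pos {β : ℝ} (hβ : 0 < β) : 0 < levelWeight β := by
  have : 0 < 1 - Real.exp (-β) := by rw [sub_pos, Real.exp_lt_one_iff]; linarith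
  rw [levelWeight]; positivity

/-- The requirements on the ratio `N` of successive scales. -/
structure GoodFactor (μ C₁ C₂ α β : ℝ) (N : ℕ) : Prop where
  large : 20000 ≤ (N : ℝ)
  loc : 1200 / μ * (2 * C₂ + 1004) ≤ N
  lip : C₁ ≤ N
  gain : 16 ≤ (N : ℝ) ^ α
  slope : levelWeight β * Real.exp (-(((N : ℝ) / 6) ^ α) ^ β) ≤ 1 / (4 * N)
  cells : 9 * (N : ℝ) ^ 9 * levelWeight β * Real.exp (1 - ((N : ℝ) ^ α / 16) ^ β) ≤ 1 / 3
  scales : (1 + 6 * levelWeight β) * (N : ℝ) ^ 4 * Real.exp (1 - (N : ℝ) ^ (α * β / 2) / 3 ^ β)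
    ≤ 1 / 2

theorem eventually_poly_mul_exp_le {A D a ε : ℝ} (k : ℕ) (hD : 0 < D) (ha : 0 < a) (hε : 0 < ε) :
    ∀ᶠ N : ℕ in atTop, A * (N : ℝ) ^ k * Real.exp (1 - D * (N : ℝ) ^ a) ≤ ε := by
  have h1 := tendsto_rpow_mul_exp_neg_mul_atTop_nhds_zero (k / a) D hD
  have h2 : Tendsto (fun N : ℕ => (N : ℝ) ^ a) atTop atTop :=
    (tendsto_rpow_atTop ha).comp tendsto_natCast_atTop_atTop
  have h3 := (h1.comp h2).const_mul (A * Real.exp 1)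
  rw [mul_zero] at h3
  filter_upwards [h3.eventually (gt_mem_nhds hε)] with N hN
  refine le_trans (le_of_eq ?_) hN.le
  have e : ((N : ℝ) ^ a) ^ (k / a : ℝ) = (N : ℝ) ^ k := by
    rw [← Real.rpow_mul (by positivity), mul_div_cancel₀ _ ha.ne', Real.rpow_natCast]
  simp only [Function.comp, e]
  rw [sub_eq_add_neg, Real.exp_add, neg_mul]
  ring

theorem eventually_goodFactor {μ C₁ C₂ α β : ℝ} (hα : 0 < α) (hβ : 0 < β) :
    ∀ᶠ N : ℕ in atTop, GoodFactor μ C₁ C₂ α β N := by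
  have hαβ : 0 < α * β := by positivity
  have hN := tendsto_natCast_atTop_atTop (R := ℝ)
  have hNα : Tendsto (fun N : ℕ => (N : ℝ) ^ α) atTop atTop := (tendsto_rpow_atTop hα).comp hN
  filter_upwards [hN.eventually_ge_atTop 20000, hN.eventually_ge_atTop (1200 / μ * (2 * C₂ + 1004)),
    hN.eventually_ge_atTop C₁, hNα.eventually_ge_atTop 16,
    eventually_poly_mul_exp_le (A := 4 * levelWeight β) (D := 1 / (6 ^ α) ^ β) 1 (by positivity) hαβ
      (show (0 : ℝ) < 1 by norm_num),
    eventually_poly_mul_exp_le (A := 9 * levelWeight β) (D := 1 / 16 ^ β) 9 (by positivity) hαβ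
      (show (0 : ℝ) < 1 / 3 by norm_num),
    eventually_poly_mul_exp_le (A := 1 + 6 * levelWeight β) (D := 1 / 3 ^ β) 4 (by positivity)
      (half_pos hαβ) (show (0 : ℝ) < 1 / 2 by norm_num)] with N h1 h2 h3 h4 h5 h6 h7
  have hN0 : (0 : ℝ) < N := by linarith
  refine ⟨h1, h2, h3, h4, ?_, ?_, ?_⟩
  · have e : (((N : ℝ) / 6) ^ α) ^ β = 1 / (6 ^ α) ^ β * (N : ℝ) ^ (α * β) := by
      rw [Real.div_rpow hN0.le (by norm_num), Real.div_rpow (by positivity) (by positivity),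
        ← Real.rpow_mul hN0.le]
      ring
    rw [e, le_div_iff₀ (by positivity)]
    refine le_trans ?_ h5
    have : Real.exp (-(1 / (6 ^ α) ^ β * (N : ℝ) ^ (α * β)))
        ≤ Real.exp (1 - 1 / (6 ^ α) ^ β * (N : ℝ) ^ (α * β)) :=
      Real.exp_le_exp.2 (by linarith)
    calc _ = 4 * levelWeight β * (N : ℝ) ^ 1 * Real.exp (-(1 / (6 ^ α) ^ β * (N : ℝ) ^ (α * β))) := by
          ring
      _ ≤ _ := by
          have := (levelWeight_pos hβ).le
          gcongr
  · have e : ((N : ℝ) ^ α / 16) ^ β = 1 / 16 ^ β * (N : ℝ) ^ (α * β) := by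
      rw [Real.div_rpow (by positivity) (by positivity), ← Real.rpow_mul hN0.le]
      ring
    rw [e]
    refine le_trans (le_of_eq ?_) h6
    ring
  · refine le_trans (le_of_eq ?_) h7
    rw [div_mul_eq_mul_div, one_mul]

namespace Model

variable {Ω E : Type*} [MeasurableSpace Ω] [MeasurableSpace E] [MulAction ISO2 E]
  {P : Measure Ω} {M : Model Ω E P} {κ D₀ n₀ μ : ℝ}

theorem measureReal_pair_le {α θ c : ℝ} {q : ℝ → ℝ} (hq : M.FluctuationScale α θ q c)
    {n y y' x : ℝ} (hn : 1 ≤ n) (hy : |y' - y| ≤ 2 * n) (hx : 0 < x) :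
    P.real {ω | x * q (3 * n) < |M.T (pt 0 y) (pt n y') ω - M.meanX (√(n ^ 2 + (y' - y) ^ 2))|}
      ≤ Real.exp (1 - x ^ θ) := by
  have hd := dist_pt_right 0 n y y'
  rw [zero_add] at hd
  have h1 := hq.tail (n := 3 * n) (a := pt 0 y) (b := pt n y')
    (by
      rw [hd]
      exact hn.trans (Real.le_sqrt_of_sq_le (by linarith [sq_nonneg (y' - y)])))
    (by
      have h2 := pow_le_pow_left₀ (abs_nonneg _) hy 2
      rw [sq_abs] at h2
      rw [hd, Real.sqrt_le_left (by positivity)]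
      nlinarith only [h2, hn]) hx
  rw [hd] at h1
  exact h1

variable [IsProbabilityMeasure P]

/-- The slope of the mean passage time beyond a scale `s ∈ [n, 2 n]`, given control of the windows
at scale `s / N`. -/
theorem slope_of_windowBound {C₁ C₂ S₀ α θ β c : ℝ} {q : ℝ → ℝ}
    (hM : M.Assumptions κ D₀ n₀ μ) (hq : M.FluctuationScale α θ q c) (hc : 0 < c) (hα : 0 < α)
    (hβ : 0 < β) (hs : M.SlopeBound μ C₂ S₀) (hC₂ : 0 < C₂) (hS₀ : 1 ≤ S₀)
    {N : ℕ} (hN : GoodFactor μ C₁ C₂ α β N) {Λ n : ℝ} (hΛ : 1 ≤ Λ)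
    (hΛθ : 3 ≤ Λ ^ θ) (hNn : (N : ℝ) ≤ n)
    (hSn : S₀ ≤ n) (h23 : 2 * n + (2 * n) ^ (2 / 3 : ℝ) ≤ 3 * n)
    (hτ : (2 * n) ^ (1 / 20 : ℝ) ≤ Λ * q (3 * n))
    (hind : ∀ m, 1 ≤ m → m ≤ n / 2 → M.WindowBound N Λ β q m) :
    ∀ s, n ≤ s → s ≤ 2 * n → ∀ ℓ, s ≤ ℓ →
      M.meanX s + μ / 4 * (ℓ - s) - C₂ * (N * (Λ * q (3 * n))) ≤ M.meanX ℓ := by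
  have hμ := hM.μ_pos
  have hN1 := hN.large
  have hN0' : (0 : ℝ) < N := by linarith
  have hN0 : 0 < N := by exact_mod_cast hN0'
  have hn0 : 0 < n := by linarith
  have hnN : 1 ≤ n / N := by rwa [one_le_div hN0']
  have hN4800 : 4800 / μ ≤ (N : ℝ) ^ 2 := by
    have h1 : 4800 / μ ≤ 1200 / μ * (2 * C₂ + 1004) := by
      rw [div_mul_eq_mul_div]
      gcongr
      linarith
    have h2 := hN.loc
    have h3 : (N : ℝ) ≤ N ^ 2 := by nlinarith only [hN1]
    linarith
  have hq0 : 0 < q (3 * n) := by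
    have h : 0 < c * (3 * n) ^ (1 / 12 : ℝ) := by positivity
    exact h.trans_le (hq.lower (by linarith))
  intro s hns hsn ℓ hℓ
  have hs0 : 0 < s := by linarith
  have hsN : s / N ≤ n / 2 := by
    rw [div_le_div_iff₀ hN0' (by norm_num)]
    nlinarith only [hsn, hN1, hn0]
  have hsN1 : 1 ≤ s / N := hnN.trans (by gcongr)
  have hX : 1 ≤ ((N : ℝ) / 6) ^ α := Real.one_le_rpow (by linarith) hα.le
  have hgr : ((N : ℝ) / 6) ^ α * q (3 * (s / N)) ≤ q (3 * n) := by
    have h1 := hq.growth (m := 3 * (s / N)) (n := 3 * n) (by linarith) (by linarith)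
    have h2 : (3 * (s / N) / (3 * n)) ^ α ≤ (6 / N) ^ α := by
      have : 3 * (s / N) / (3 * n) ≤ 6 / N := by
        rw [div_le_div_iff₀ (by positivity) hN0']
        field_simp
        linarith
      gcongr
    calc ((N : ℝ) / 6) ^ α * q (3 * (s / N)) ≤ ((N : ℝ) / 6) ^ α * ((6 / N) ^ α * q (3 * n)) := by
          gcongr
          exact h1.trans (by gcongr)
      _ = q (3 * n) := by
          rw [← mul_assoc, ← Real.mul_rpow (by positivity) (by positivity)]
          rw [show (N : ℝ) / 6 * (6 / N) = 1 by field_simp, Real.one_rpow, one_mul]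
  have h23' : s ^ (2 / 3 : ℝ) ≤ (2 * n) ^ (2 / 3 : ℝ) := by gcongr
  have hτ' : s ^ (1 / 20 : ℝ) ≤ (2 * n) ^ (1 / 20 : ℝ) := by gcongr
  have hτX : Λ * (N / 6) ^ α * q (3 * (s / N)) ≤ Λ * q (3 * n) := by
    rw [mul_assoc]; gcongr
  exact hs.of_windowBound (s := s) (n' := 3 * n) (τ := Λ * q (3 * n)) hS₀ hM hq hc hβ hN0
    hN4800 (by linarith) hΛθ (hSn.trans hns) (by linarith) (hτ'.trans hτ) le_rfl
    (hind _ hsN1 hsN) (by linarith) hX hτX hN.slope ℓ hℓ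

theorem card_Icc_le {N : ℕ} (hN : 1 ≤ N) {A : ℕ} :
    ((Finset.Icc (-(A * (N : ℤ) ^ 8)) (A * (N : ℤ) ^ 8)).card : ℝ) ≤ (2 * A + 1) * N ^ 8 := by
  have h1 : ((Finset.Icc (-(A * (N : ℤ) ^ 8)) (A * (N : ℤ) ^ 8)).card : ℝ) = 2 * A * N ^ 8 + 1 := by
    rw [Int.card_Icc]
    have : (((A * (N : ℤ) ^ 8 + 1 - -(A * (N : ℤ) ^ 8)).toNat : ℤ) : ℝ) = 2 * A * N ^ 8 + 1 := by
      rw [Int.toNat_of_nonneg (by rw [sub_neg_eq_add]; positivity)]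
      push_cast
      ring
    exact_mod_cast this
  have h2 : (1 : ℝ) ≤ N ^ 8 := one_le_pow₀ (by exact_mod_cast hN)
  linarith

theorem measureReal_cell_le {C₁ C₂ α θ β c : ℝ} {q : ℝ → ℝ}
    (hM : M.Assumptions κ D₀ n₀ μ) (hq : M.FluctuationScale α θ q c) (hc : 0 < c)
    (hβ : 0 < β) {N : ℕ} (hN : GoodFactor μ C₁ C₂ α β N) {Λ n x : ℝ} (hΛ : 1 ≤ Λ) (hΛx : Λ ≤ x)
    (hNn : (N : ℝ) ≤ n) (hind : M.WindowBound N Λ β q (n / N)) (a b : ℝ) :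
    P.real (M.BadCell ((N : ℝ) ^ 2) (n / N) (x * q (3 * n) / 16) a b)
      ≤ levelWeight β * Real.exp (-(x / Λ * (N ^ α / 16)) ^ β) := by
  have hN1 := hN.large
  have hN0' : (0 : ℝ) < N := by linarith
  have hn0 : 0 < n := by linarith
  have hΛ0 : 0 < Λ := by linarith
  have hnN : 1 ≤ n / N := by rwa [one_le_div hN0']
  have hxΛ : 1 ≤ x / Λ := by rwa [one_le_div hΛ0]
  have hNα := hN.gain
  have hA : 1 ≤ (N : ℝ) ^ α / 16 := by linarith
  have hq0 : 0 < q (3 * (n / N)) := by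
    have h : 0 < c * (3 * (n / N)) ^ (1 / 12 : ℝ) := by positivity
    exact h.trans_le (hq.lower (by linarith))
  refine hM.measureReal_badCell_le hβ hΛ0 hq0 hind (one_le_mul_of_one_le_of_one_le hxΛ hA) ?_ _ _
  have h1 := hq.growth (m := 3 * (n / N)) (n := 3 * n) (by linarith)
    (by have := div_le_self hn0.le (show (1 : ℝ) ≤ N by linarith); linarith)
  rw [show 3 * (n / N) / (3 * n) = (N : ℝ)⁻¹ by field_simp, Real.inv_rpow hN0'.le] at h1
  calc Λ * (x / Λ * (N ^ α / 16)) * q (3 * (n / N))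
      ≤ Λ * (x / Λ * (N ^ α / 16)) * (((N : ℝ) ^ α)⁻¹ * q (3 * n)) := by
        have : 0 ≤ x / Λ := by linarith
        gcongr
    _ = x * q (3 * n) / 16 := by field_simp

set_option maxHeartbeats 800000 in
/-- The union bound for the passage times across a window in terms of the cells at scale `n / N`. -/
theorem measureReal_badWindow_le {C₁ C₂ S₀ α θ β c G : ℝ} {q : ℝ → ℝ}
    (hM : M.Assumptions κ D₀ n₀ μ) (hq : M.FluctuationScale α θ q c) (hc : 0 < c) (hα : 0 < α)
    (hβ : 0 < β) (hs : M.SlopeBound μ C₂ S₀) (hC₂ : 0 < C₂) (hS₀ : 1 ≤ S₀) (hC₁ : 0 ≤ C₁)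
    (hlip : ∀ s t : ℝ, 0 ≤ s → 0 ≤ t → |M.meanX s - M.meanX t| ≤ C₁ * (|s - t| + 1))
    (hrough : ∀ D : Set Plane, D.Countable → (∀ o : ℤ × ℤ, latticePt o ∈ D) →
      (∀ z : Plane, ∀ δ > 0, ∃ k ∈ D, dist z k < δ) → ∀ R : ℝ, 1 ≤ R →
      P.real {x | ¬ M.RoughGeometry μ D R x} ≤ G * Real.exp (-R ^ (κ / 500)))
    {N : ℕ} (hN : GoodFactor μ C₁ C₂ α β N) {Λ n l x : ℝ} (hΛ : 1 ≤ Λ) (hΛx : Λ ≤ x)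
    (hΛθ : 3 ≤ Λ ^ θ) (hl : l = x * q (3 * n)) (hn : 1 ≤ n) (hl1 : 1 ≤ l)
    (herr : 2000 * μ * (4 * n) ^ (1 / 40 : ℝ) ≤ l / 128)
    (hsmall : 4 / μ * (l + μ + 3 * ((4 * n) ^ (1 / 200 : ℝ)) ^ 2 / μ) ≤ n)
    (hwn : 5 * N ^ 2 * √(n * l) ≤ n) (hC : C₁ * 2 ≤ l / 64) (hNn : (N : ℝ) ^ 12 ≤ n)
    (hSn : S₀ ≤ n) (h23 : 2 * n + (2 * n) ^ (2 / 3 : ℝ) ≤ 3 * n)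
    (hτ : (2 * n) ^ (1 / 20 : ℝ) ≤ Λ * q (3 * n))
    (hind : ∀ m, 1 ≤ m → m ≤ n / 2 → M.WindowBound N Λ β q m) :
    P.real (M.BadWindow ((N : ℝ) ^ 2) n l 0 0)
      ≤ 9 * (N : ℝ) ^ 9 * (levelWeight β * Real.exp (-(x / Λ * (N ^ α / 16)) ^ β))
        + 25 * (N : ℝ) ^ 16 * Real.exp (1 - (x / 8) ^ θ) + G * Real.exp (-(4 * n) ^ (κ / 500)) := by
  have hμ := hM.μ_pos
  have hN1 := hN.large
  have hN0' : (0 : ℝ) < N := by linarith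
  have hN0 : 0 < N := by exact_mod_cast hN0'
  have hn0 : 0 < n := by linarith
  have hl0 : 0 < l := by linarith
  have hx0 : 0 < x := by linarith
  have hNle : (N : ℝ) ≤ n := le_trans (le_self_pow₀ (by linarith) (by norm_num)) hNn
  have hnN : 1 ≤ n / N := by rwa [one_le_div hN0']
  have hnN2 : n / N ≤ n / 2 := by gcongr; linarith
  obtain ⟨w, hw⟩ : ∃ w, w = √(n * l) := ⟨_, rfl⟩
  have hw0 : 0 < w := by rw [hw]; positivity
  rw [← hw] at hwn
  -- the mesh of the grid
  have hwN : 1 ≤ w / N ^ 6 := by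
    rw [one_le_div (by positivity), hw]
    refine Real.le_sqrt_of_sq_le ?_
    calc ((N : ℝ) ^ 6) ^ 2 = N ^ 12 := by ring
      _ ≤ n * 1 := by linarith
      _ ≤ n * l := by gcongr
  obtain ⟨σ, hσ⟩ : ∃ σ : ℤ, σ = ⌈w / (N : ℝ) ^ 6⌉ := ⟨_, rfl⟩
  have hσ1 : w / N ^ 6 ≤ σ := hσ ▸ Int.le_ceil _
  have hσ2 : (σ : ℝ) ≤ 2 * w / N ^ 6 := by
    have := Int.ceil_lt_add_one (w / (N : ℝ) ^ 6)
    rw [mul_div_assoc, hσ]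
    linarith
  have hσ0 : (0 : ℝ) ≤ σ := by linarith
  have hq0 : 0 ≤ q (3 * n) := by
    have h : 0 < c * (3 * n) ^ (1 / 12 : ℝ) := by positivity
    exact (h.trans_le (hq.lower (by linarith))).le
  have hslope : ∀ s, n ≤ s → s ≤ 2 * n → ∀ ℓ, s ≤ ℓ →
      M.meanX s + μ / 4 * (ℓ - s) - C₂ * (N * l) ≤ M.meanX ℓ := by
    intro s hns hsn ℓ hℓ
    have h1 := slope_of_windowBound hM hq hc hα hβ hs hC₂ hS₀ hN hΛ hΛθ hNle hSn h23 hτ hind s hns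
      hsn ℓ hℓ
    have h3 : C₂ * (N * (Λ * q (3 * n))) ≤ C₂ * (N * l) := by
      rw [hl]; gcongr
    linarith only [h1, h3]
  -- the exceptional events
  obtain ⟨S, hS⟩ : ∃ S : Set ℝ,
    S = Set.range ((↑) : ℚ → ℝ) ∪ Set.range (fun i : ℕ => (i : ℝ) * (n / N)) := ⟨_, rfl⟩
  have hSc : S.Countable := by
    rw [hS]; exact (Set.countable_range _).union (Set.countable_range _)
  have hSQ : Set.range ((↑) : ℚ → ℝ) ⊆ S := by rw [hS]; exact Set.subset_union_left
  have hSi : ∀ i : ℕ, (i : ℝ) * (n / N) ∈ S := fun i => by rw [hS]; exact Or.inr ⟨i, rfl⟩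
  have hmem : ∀ A : ℕ, ∀ m : ℤ, |(m : ℝ)| ≤ A * N ^ 8 →
      m ∈ Finset.Icc (-(A * (N : ℤ) ^ 8)) (A * (N : ℤ) ^ 8) := by
    intro A m hm
    rw [Finset.mem_Icc, ← abs_le]
    exact_mod_cast hm
  obtain ⟨I, hI⟩ : ∃ I : Finset ℤ, I = Finset.Icc (-((4 : ℕ) * (N : ℤ) ^ 8)) ((4 : ℕ) * (N : ℤ) ^ 8) :=
    ⟨_, rfl⟩
  obtain ⟨J, hJ⟩ : ∃ I : Finset ℤ, I = Finset.Icc (-((2 : ℕ) * (N : ℤ) ^ 8)) ((2 : ℕ) * (N : ℤ) ^ 8) :=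
    ⟨_, rfl⟩
  have hIc : (I.card : ℝ) ≤ 9 * N ^ 8 := by
    rw [hI]; exact (card_Icc_le hN0).trans (by norm_num)
  have hJc : (J.card : ℝ) ≤ 5 * N ^ 8 := by
    rw [hJ]; exact (card_Icc_le hN0).trans (by norm_num)
  have hJb : ∀ k ∈ J, |((k * σ : ℤ) : ℝ)| ≤ n := by
    intro k hk
    rw [hJ, Finset.mem_Icc, ← abs_le] at hk
    have hk' : |(k : ℝ)| ≤ 2 * N ^ 8 := by exact_mod_cast hk
    push_cast
    rw [abs_mul, abs_of_nonneg hσ0]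
    calc |(k : ℝ)| * σ ≤ 2 * N ^ 8 * (2 * w / N ^ 6) := by gcongr
      _ = 4 * N ^ 2 * w := by field_simp; ring
      _ ≤ n := by nlinarith only [hwn, hw0, hN1]
  have hBP : ∀ p ∈ J ×ˢ J, P.real {ω | x / 8 * q (3 * n) <
      |M.T (pt 0 ((p.1 * σ : ℤ) : ℝ)) (pt n ((p.2 * σ : ℤ) : ℝ)) ω
        - M.meanX (√(n ^ 2 + (((p.2 * σ : ℤ) : ℝ) - ((p.1 * σ : ℤ) : ℝ)) ^ 2))|}
      ≤ Real.exp (1 - (x / 8) ^ θ) := by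
    intro p hp
    rw [Finset.mem_product] at hp
    refine measureReal_pair_le hq hn ((abs_sub _ _).trans ?_) (by positivity)
    linarith only [hJb _ hp.1, hJb _ hp.2]
  have hCP := hrough (stripes S) (stripes_countable hSc) (lattice_mem_stripes hSQ)
    (stripes_dense hSQ) (4 * n) (by linarith)
  have hsub : M.BadWindow ((N : ℝ) ^ 2) n l 0 0 ⊆
      (⋃ p ∈ Finset.range N ×ˢ I,
        M.BadCell ((N : ℝ) ^ 2) (n / N) (l / 16) (p.1 * (n / N)) ((p.2 * σ : ℤ) : ℝ))
      ∪ (⋃ p ∈ J ×ˢ J, {ω | x / 8 * q (3 * n) <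
      |M.T (pt 0 ((p.1 * σ : ℤ) : ℝ)) (pt n ((p.2 * σ : ℤ) : ℝ)) ω
        - M.meanX (√(n ^ 2 + (((p.2 * σ : ℤ) : ℝ) - ((p.1 * σ : ℤ) : ℝ)) ^ 2))|})
      ∪ {x | ¬ M.RoughGeometry μ (stripes S) (4 * n) x} := by
    intro ω hω
    by_contra hnot
    simp only [Set.mem_union, Set.mem_iUnion, not_or, not_exists, Set.mem_ofPred_eq, not_not,
      not_lt] at hnot
    obtain ⟨⟨n1, n2⟩, n3⟩ := hnot
    refine notMem_badWindow_of_cells n3 hμ hC₂.le hN.loc hN1 hlip hC₁ hN.lip hn hl0 hw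
      (fun i _ k => pt_mem_stripes (hSi i) k) herr hsmall hwn hC
      (fun r y => hM.meanX_polyLen_le r y hN0) hslope hσ1 hσ2 ?_ ?_ hω
    · intro i hi m hm
      exact n1 (i, m) (Finset.mem_product.2 ⟨Finset.mem_range.2 hi, hI ▸ hmem 4 m (by exact_mod_cast hm)⟩)
    · intro m m' hm hm'
      have := n2 (m, m') (Finset.mem_product.2 ⟨hJ ▸ hmem 2 m (by exact_mod_cast hm),
        hJ ▸ hmem 2 m' (by exact_mod_cast hm')⟩)
      rw [hl]
      exact this.trans (le_of_eq (by ring))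
  refine (measureReal_mono hsub).trans ((measureReal_union_le _ _).trans ?_)
  refine add_le_add ((measureReal_union_le _ _).trans (add_le_add ?_ ?_)) hCP
  · refine (measureReal_biUnion_finset_le _ _).trans ?_
    refine (Finset.sum_le_card_nsmul _ _ _ fun p _ => ?_).trans
      (b := (Finset.range N ×ˢ I).card • (levelWeight β * Real.exp (-(x / Λ * (N ^ α / 16)) ^ β))) ?_
    · rw [hl]
      exact measureReal_cell_le hM hq hc hβ hN hΛ hΛx hNle (hind _ hnN hnN2) _ _
    rw [nsmul_eq_mul, Finset.card_product, Finset.card_range, Nat.cast_mul]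
    refine mul_le_mul_of_nonneg_right ?_ (by have := levelWeight_pos hβ; positivity)
    calc (N : ℝ) * I.card ≤ N * (9 * N ^ 8) := by gcongr
      _ = _ := by ring
  · refine (measureReal_biUnion_finset_le _ _).trans ?_
    refine (Finset.sum_le_card_nsmul _ _ _ hBP).trans ?_
    rw [nsmul_eq_mul, Finset.card_product, Nat.cast_mul]
    refine mul_le_mul_of_nonneg_right ?_ (Real.exp_pos _).le
    calc (J.card : ℝ) * J.card ≤ (5 * N ^ 8) * (5 * N ^ 8) := by gcongr
      _ = _ := by ring

end Model

/-! ### The multiscale induction for windows -/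

/-- The lower bounds on the length scales in the multiscale induction. -/
structure LargeScale (μ C₁ C' S₀ : ℝ) (N : ℕ) (t : ℝ) : Prop where
  one_le : 1 ≤ t
  small : 4 / μ * (1 + μ + 12 / μ) * t ^ (3 / 5 : ℝ) ≤ t
  window : 25 * (N : ℝ) ^ 4 * t ^ (3 / 5 : ℝ) ≤ t
  lip : 128 * C₁ ≤ t
  ratio : (N : ℝ) ^ 12 ≤ t
  slope : S₀ ≤ t
  gap : 2 * t ^ (2 / 3 : ℝ) ≤ t
  crude : (N : ℝ) ^ 2 * t ^ (4 / 3 : ℝ) ≤ t ^ 2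
  mean : (4 * (N : ℝ) ^ 2 + 16 * C' * N ^ 4) * t ^ (17 / 20 : ℝ) ≤ t

theorem eventually_largeScale (μ C₁ C' S₀ : ℝ) (N : ℕ) :
    ∀ᶠ t in atTop, LargeScale μ C₁ C' S₀ N t := by
  have h : ∀ a < 1, ∀ A : ℝ, ∀ᶠ t : ℝ in atTop, A * t ^ (a : ℝ) ≤ t := by
    intro a ha A
    filter_upwards [eventually_mul_rpow_le ha A] with t ht
    rwa [Real.rpow_one] at ht
  have h2 : ∀ᶠ t : ℝ in atTop, (N : ℝ) ^ 2 * t ^ (4 / 3 : ℝ) ≤ t ^ 2 := by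
    filter_upwards [eventually_mul_rpow_le (a := 4 / 3) (b := (2 : ℕ)) (by norm_num)
      ((N : ℝ) ^ 2)] with t ht
    rwa [Real.rpow_natCast] at ht
  filter_upwards [eventually_ge_atTop 1, h (3 / 5) (by norm_num) (4 / μ * (1 + μ + 12 / μ)),
    h (3 / 5) (by norm_num) (25 * (N : ℝ) ^ 4), eventually_ge_atTop (128 * C₁),
    eventually_ge_atTop ((N : ℝ) ^ 12), eventually_ge_atTop S₀, h (2 / 3) (by norm_num) 2, h2,
    h (17 / 20) (by norm_num) (4 * (N : ℝ) ^ 2 + 16 * C' * N ^ 4)]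
    with t a1 a2 a3 a4 a5 a6 a7 a8 a9
  exact ⟨a1, a2, a3, a4, a5, a6, a7, a8, a9⟩

theorem four_mul_rpow_le {n a : ℝ} (hn : 0 ≤ n) (ha1 : a ≤ 1) :
    (4 * n) ^ a ≤ 4 * n ^ a := by
  rw [Real.mul_rpow (by norm_num) hn]
  gcongr
  calc (4 : ℝ) ^ a ≤ 4 ^ (1 : ℝ) := Real.rpow_le_rpow_of_exponent_le (by norm_num) ha1
    _ = 4 := Real.rpow_one _

theorem window_le_of_sq {N : ℕ} {r l : ℝ} (hr : 0 ≤ r) (h : 25 * (N : ℝ) ^ 4 * l ≤ r) :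
    5 * N ^ 2 * √(r * l) ≤ r := by
  have h1 : (5 * (N : ℝ) ^ 2) ^ 2 * (r * l) ≤ r ^ 2 := by
    calc (5 * (N : ℝ) ^ 2) ^ 2 * (r * l) = r * (25 * N ^ 4 * l) := by ring
      _ ≤ r * r := by gcongr
      _ = r ^ 2 := by ring
  calc 5 * N ^ 2 * √(r * l) = √((5 * (N : ℝ) ^ 2) ^ 2 * (r * l)) := by
        rw [Real.sqrt_mul (sq_nonneg (5 * (N : ℝ) ^ 2)) (r * l), Real.sqrt_sq (by positivity)]
    _ ≤ √(r ^ 2) := Real.sqrt_le_sqrt h1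
    _ = r := Real.sqrt_sq hr

theorem LargeScale.two_mul_add_rpow_le {μ C₁ C' S₀ : ℝ} {N : ℕ} {t : ℝ}
    (h : LargeScale μ C₁ C' S₀ N t) : 2 * t + (2 * t) ^ (2 / 3 : ℝ) ≤ 3 * t := by
  have h0 := h.one_le
  have h1 : (2 * t) ^ (2 / 3 : ℝ) ≤ 2 * t ^ (2 / 3 : ℝ) := by
    rw [Real.mul_rpow (by norm_num) (by linarith)]
    gcongr
    calc (2 : ℝ) ^ (2 / 3 : ℝ) ≤ 2 ^ (1 : ℝ) :=
          Real.rpow_le_rpow_of_exponent_le (by norm_num) (by norm_num)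
      _ = 2 := Real.rpow_one _
  linarith [h.gap]

theorem exp_neg_mul_le {z A : ℝ} (hz : 1 ≤ z) (hA : 1 ≤ A) :
    Real.exp (-(z * A)) ≤ Real.exp (1 - A) * Real.exp (-z) := by
  rw [← Real.exp_add]
  gcongr
  nlinarith

/-- The factor `Λ` by which the random variables of the multiscale induction are rescaled. -/
structure GoodScaling (μ c β θ G κ : ℝ) (N : ℕ) (Y Λ : ℝ) : Prop where
  one_le : 1 ≤ Λ
  large : Y ≤ Λ * c
  err : 1024000 * μ ≤ Λ * c
  two_le : 2 ≤ Λ * c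
  theta : 3 ≤ Λ ^ θ
  tail : ∀ x, Λ ≤ x → 25 * (N : ℝ) ^ 16 * Real.exp 1 * Real.exp (-((1 / 8) ^ θ * x ^ θ))
    ≤ 1 / 3 * Real.exp (1 - (x / Λ) ^ β)
  far : ∀ x, Λ ≤ x → G * Real.exp (-(c ^ (κ / 1000) * x ^ (κ / 1000)))
    ≤ 1 / 3 * Real.exp (1 - (x / Λ) ^ β)
  rough : ∀ x, Λ ≤ x → G * Real.exp (-(c ^ (κ / 500) * x ^ (κ / 500)))
    ≤ 1 / 3 * Real.exp (1 - (x / Λ) ^ β)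

theorem exists_goodScaling {μ c β θ G κ : ℝ} (N : ℕ) (Y : ℝ) (hc : 0 < c) (hβ : 0 < β)
    (hθ : β < θ) (hκ : β < κ / 1000) :
    ∃ Λ₀ : ℝ, 1 ≤ Λ₀ ∧ ∀ Λ, Λ₀ ≤ Λ → GoodScaling μ c β θ G κ N Y Λ := by
  have hθ0 : 0 < θ := hβ.trans hθ
  obtain ⟨L₁, -, h1⟩ := exists_threshold (A := 25 * (N : ℝ) ^ 16 * Real.exp 1)
    (D := (1 / 8) ^ θ) (by positivity) hβ hθ
  obtain ⟨L₂, -, h2⟩ := exists_threshold (A := G) (D := c ^ (κ / 500)) (by positivity) hβ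
    (show β < κ / 500 by linarith)
  obtain ⟨L₃, -, h3⟩ := exists_threshold (A := G) (D := c ^ (κ / 1000)) (by positivity) hβ hκ
  have hev : ∀ᶠ Λ : ℝ in atTop, ((1 ≤ Λ ∧ L₁ ≤ Λ) ∧ L₂ ≤ Λ ∧ L₃ ≤ Λ) ∧
      ((Y ≤ Λ * c ∧ 1024000 * μ ≤ Λ * c) ∧ 2 ≤ Λ * c) ∧ 3 ≤ Λ ^ θ := by
    have t := tendsto_id.atTop_mul_const (α := ℝ) (β := ℝ) hc
    exact (((eventually_ge_atTop _).and (eventually_ge_atTop _)).and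
      ((eventually_ge_atTop _).and (eventually_ge_atTop _))).and
      ((((t.eventually_ge_atTop _).and (t.eventually_ge_atTop _)).and (t.eventually_ge_atTop _)).and
      ((tendsto_rpow_atTop hθ0).eventually_ge_atTop _))
  obtain ⟨Λ₀, h⟩ := eventually_atTop.1 hev
  refine ⟨max 1 Λ₀, le_max_left _ _, fun Λ hΛ => ?_⟩
  obtain ⟨⟨⟨a1, a2⟩, a3, a8⟩, ⟨⟨a4, a5⟩, a6⟩, a7⟩ := h Λ ((le_max_right _ _).trans hΛ)
  exact ⟨a1, a4, a5, a6, a7, h1 Λ a2, h3 Λ a8, h2 Λ a3⟩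

namespace Model

variable {Ω E : Type*} [MeasurableSpace Ω] [MeasurableSpace E] [MulAction ISO2 E]
  {P : Measure Ω} {M : Model Ω E P} {κ D₀ n₀ μ : ℝ}

theorem _root_.RotFPP.GoodScaling.rpow_le_scale {α θ β c G Y Λ n : ℝ} {q : ℝ → ℝ} {N : ℕ}
    (hΛ : GoodScaling μ c β θ G κ N Y Λ) (hq : M.FluctuationScale α θ q c) (hc : 0 < c)
    (hn : 1 ≤ n) : (2 * n) ^ (1 / 20 : ℝ) ≤ Λ * q (3 * n) := by
  have hn0 : 0 < n := by linarith
  have hΛ0 : 0 ≤ Λ := by linarith [hΛ.one_le]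
  have h1 : (2 * n) ^ (1 / 20 : ℝ) ≤ 2 * n ^ (1 / 20 : ℝ) := by
    rw [Real.mul_rpow (by norm_num) hn0.le]
    gcongr
    calc (2 : ℝ) ^ (1 / 20 : ℝ) ≤ 2 ^ (1 : ℝ) :=
          Real.rpow_le_rpow_of_exponent_le (by norm_num) (by norm_num)
      _ = 2 := Real.rpow_one _
  have h2 : n ^ (1 / 20 : ℝ) ≤ n ^ (1 / 12 : ℝ) :=
    Real.rpow_le_rpow_of_exponent_le hn (by norm_num)
  have h3 : 2 * n ^ (1 / 12 : ℝ) ≤ Λ * c * n ^ (1 / 12 : ℝ) :=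
    mul_le_mul_of_nonneg_right hΛ.two_le (by positivity)
  have h4 := hq.lower (n := 3 * n) (by linarith)
  have h5 : Λ * (c * n ^ (1 / 12 : ℝ)) ≤ Λ * (c * (3 * n) ^ (1 / 12 : ℝ)) := by
    gcongr; linarith
  have h6 : Λ * (c * (3 * n) ^ (1 / 12 : ℝ)) ≤ Λ * q (3 * n) := by gcongr
  linarith

variable [IsProbabilityMeasure P]

/-- The estimate for windows of length `n` whose deviation is larger than diffusive. -/
theorem windowBound_of_crude {α θ β c C' G : ℝ} {q : ℝ → ℝ}
    (hM : M.Assumptions κ D₀ n₀ μ) (hq : M.FluctuationScale α θ q c) (hc : 0 < c)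
    (hC' : 0 ≤ C') (hG : 0 ≤ G)
    (hup : ∀ d : ℝ, 0 ≤ d → M.meanX d ≤ μ * d + C' * (√(1 + d) * (1 + d) ^ (1 / 100 : ℝ)))
    (hrough : ∀ D : Set Plane, D.Countable → (∀ o : ℤ × ℤ, latticePt o ∈ D) →
      (∀ z : Plane, ∀ δ > 0, ∃ k ∈ D, dist z k < δ) → ∀ R : ℝ, 1 ≤ R →
      P.real {x | ¬ M.RoughGeometry μ D R x} ≤ G * Real.exp (-R ^ (κ / 500)))
    {N : ℕ} {C₁ S₀ : ℝ} (hN : 1 ≤ N) {Y Λ n x : ℝ}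
    (hY : ∀ t, Y ≤ t → LargeScale μ C₁ C' S₀ N t)
    (hΛ : GoodScaling μ c β θ G κ N Y Λ) (hΛx : Λ ≤ x) (hn : 1 ≤ n)
    (hl : n ^ (3 / 5 : ℝ) ≤ x * q (3 * n)) :
    P.real (M.BadWindow ((N : ℝ) ^ 2) n (x * q (3 * n)) 0 0) ≤ Real.exp (1 - (x / Λ) ^ β) := by
  have hκ := hM.κ_pos
  have hΛ1 := hΛ.one_le
  obtain ⟨l, hl'⟩ : ∃ l, l = x * q (3 * n) := ⟨_, rfl⟩
  rw [← hl'] at hl ⊢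
  have hcx : c * x ≤ l := by
    have h1 : c * 1 ≤ c * (3 * n) ^ (1 / 12 : ℝ) := by
      gcongr
      exact Real.one_le_rpow (by linarith) (by norm_num)
    have h2 := hq.lower (n := 3 * n) (by linarith)
    rw [hl', mul_comm]
    exact mul_le_mul_of_nonneg_left (by linarith) (by linarith)
  have hlY : Y ≤ l := hΛ.large.trans (le_trans (by rw [mul_comm]; gcongr) hcx)
  have hL := hY l hlY
  have hl1 := hL.one_le
  obtain ⟨S, hS⟩ : ∃ S : Set ℝ, S = Set.range ((↑) : ℚ → ℝ) ∪ {n} := ⟨_, rfl⟩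
  have hSc : S.Countable := by
    rw [hS]; exact (Set.countable_range _).union (Set.countable_singleton _)
  have hSQ : Set.range ((↑) : ℚ → ℝ) ⊆ S := by rw [hS]; exact Set.subset_union_left
  have h0S : (0 : ℝ) ∈ S := hSQ ⟨0, Rat.cast_zero⟩
  have hnS : n ∈ S := by rw [hS]; exact Or.inr rfl
  have hl2 : l ≤ l ^ 2 := by nlinarith only [hl1]
  have hCP := hrough (stripes S) (stripes_countable hSc) (lattice_mem_stripes hSQ)
    (stripes_dense hSQ) (l ^ 2) (by linarith)
  have hsub : M.BadWindow ((N : ℝ) ^ 2) n l 0 0 ⊆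
      {x | ¬ M.RoughGeometry μ (stripes S) (l ^ 2) x} := by
    intro ω hω
    by_contra hnot
    simp only [Set.mem_ofPred_eq, not_not] at hnot
    refine notMem_badWindow_of_crude hN hnot.crude hn hl1 ?_ (fun d hd => hM.le_meanX hd) hup hC'
      hL.crude hL.mean (fun k => pt_mem_stripes h0S k) (fun k => pt_mem_stripes hnS k) hω
    calc n = (n ^ (3 / 5 : ℝ)) ^ (5 / 3 : ℝ) := by
          rw [← Real.rpow_mul (by linarith)]; norm_num
      _ ≤ l ^ (5 / 3 : ℝ) := by gcongr
  refine (measureReal_mono hsub).trans (hCP.trans ?_)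
  have h3 := hΛ.rough x hΛx
  have h4 : c ^ (κ / 500) * x ^ (κ / 500) ≤ (l ^ 2) ^ (κ / 500) := by
    rw [← Real.mul_rpow hc.le (by linarith)]
    exact Real.rpow_le_rpow (by nlinarith only [hc, hΛ1, hΛx]) (hcx.trans hl2) (by positivity)
  have h5 : G * Real.exp (-(l ^ 2) ^ (κ / 500)) ≤
      G * Real.exp (-(c ^ (κ / 500) * x ^ (κ / 500))) := by gcongr
  have := Real.exp_pos (1 - (x / Λ) ^ β)
  linarith

/-- One step of the multiscale induction. -/
theorem windowBound_step {C₁ C₂ S₀ α θ β c C' G : ℝ} {q : ℝ → ℝ}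
    (hM : M.Assumptions κ D₀ n₀ μ) (hq : M.FluctuationScale α θ q c) (hc : 0 < c) (hα : 0 < α)
    (hβ : 0 < β) (hs : M.SlopeBound μ C₂ S₀) (hC₂ : 0 < C₂) (hS₀ : 1 ≤ S₀) (hC₁ : 0 ≤ C₁)
    (hlip : ∀ s t : ℝ, 0 ≤ s → 0 ≤ t → |M.meanX s - M.meanX t| ≤ C₁ * (|s - t| + 1))
    (hC' : 0 ≤ C') (hG : 0 ≤ G)
    (hup : ∀ d : ℝ, 0 ≤ d → M.meanX d ≤ μ * d + C' * (√(1 + d) * (1 + d) ^ (1 / 100 : ℝ)))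
    (hrough : ∀ D : Set Plane, D.Countable → (∀ o : ℤ × ℤ, latticePt o ∈ D) →
      (∀ z : Plane, ∀ δ > 0, ∃ k ∈ D, dist z k < δ) → ∀ R : ℝ, 1 ≤ R →
      P.real {x | ¬ M.RoughGeometry μ D R x} ≤ G * Real.exp (-R ^ (κ / 500)))
    {N : ℕ} (hN : GoodFactor μ C₁ C₂ α β N) {Y Λ n : ℝ}
    (hY : ∀ t, Y ≤ t → LargeScale μ C₁ C' S₀ N t)
    (hΛ : GoodScaling μ c β θ G κ N Y Λ) (hn : 1 ≤ n)
    (hind : ∀ m, 1 ≤ m → m ≤ n / 2 → M.WindowBound N Λ β q m) : M.WindowBound N Λ β q n := by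
  intro x hx
  have hμ := hM.μ_pos
  have hκ := hM.κ_pos
  have hΛ1 := hΛ.one_le
  have hΛ0 : 0 < Λ := by linarith
  have hN1 := hN.large
  rcases lt_or_ge x Λ with hxΛ | hxΛ
  · have h1 : (x / Λ) ^ β ≤ 1 := Real.rpow_le_one (by positivity) (by rw [div_le_one hΛ0]; exact hxΛ.le)
      hβ.le
    exact measureReal_le_one.trans (Real.one_le_exp (by linarith))
  rcases le_or_gt (n ^ (3 / 5 : ℝ)) (x * q (3 * n)) with hbig | hln
  · refine windowBound_of_crude hM hq hc hC' hG hup hrough ?_ hY hΛ hxΛ hn hbig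
    exact_mod_cast (show (1 : ℝ) ≤ N by linarith)
  obtain ⟨l, hl⟩ : ∃ l, l = x * q (3 * n) := ⟨_, rfl⟩
  rw [← hl] at hln
  have hlow : Λ * c * n ^ (1 / 12 : ℝ) ≤ l := by
    have h2 := hq.lower (n := 3 * n) (by linarith)
    have h3 : c * n ^ (1 / 12 : ℝ) ≤ c * (3 * n) ^ (1 / 12 : ℝ) := by gcongr; linarith
    rw [hl, mul_assoc]
    gcongr
    linarith
  have hcx : c * x ≤ l := by
    have h1 : c * 1 ≤ c * (3 * n) ^ (1 / 12 : ℝ) := by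
      gcongr
      exact Real.one_le_rpow (by linarith) (by norm_num)
    have h2 := hq.lower (n := 3 * n) (by linarith)
    rw [hl, mul_comm]
    exact mul_le_mul_of_nonneg_left (by linarith) (by linarith)
  have hlY : Y ≤ l := hΛ.large.trans (le_trans (by rw [mul_comm]; gcongr) hcx)
  have hln' : l ≤ n := by
    refine hln.le.trans ?_
    calc n ^ (3 / 5 : ℝ) ≤ n ^ (1 : ℝ) := Real.rpow_le_rpow_of_exponent_le hn (by norm_num)
      _ = n := Real.rpow_one n
  have hL := hY l hlY
  have hLn := hY n (hlY.trans hln')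
  have hl1 := hL.one_le
  have hn0 : 0 < n := by linarith
  have hpow : ∀ a : ℝ, a ≤ 1 / 12 → n ^ a ≤ n ^ (1 / 12 : ℝ) := fun a ha =>
    Real.rpow_le_rpow_of_exponent_le hn ha
  have herr : 2000 * μ * (4 * n) ^ (1 / 40 : ℝ) ≤ l / 128 := by
    have h1 := four_mul_rpow_le (a := 1 / 40) hn0.le (by norm_num)
    have h2 := hpow (1 / 40) (by norm_num)
    have h3 : 1024000 * μ * n ^ (1 / 12 : ℝ) ≤ l := 
      (mul_le_mul_of_nonneg_right hΛ.err (by positivity)).trans hlow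
    have h4 : 2000 * μ * (4 * n) ^ (1 / 40 : ℝ) ≤ 2000 * μ * (4 * n ^ (1 / 12 : ℝ)) := by
      gcongr; linarith
    linarith
  have hsmall : 4 / μ * (l + μ + 3 * ((4 * n) ^ (1 / 200 : ℝ)) ^ 2 / μ) ≤ n := by
    refine le_trans ?_ hLn.small
    have h1 : ((4 * n) ^ (1 / 200 : ℝ)) ^ 2 ≤ 4 * n ^ (3 / 5 : ℝ) := by
      rw [← Real.rpow_natCast, ← Real.rpow_mul (by linarith)]
      refine (four_mul_rpow_le hn0.le (by norm_num)).trans ?_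
      gcongr
      · norm_num
    have h2 : 1 ≤ n ^ (3 / 5 : ℝ) := Real.one_le_rpow hn (by norm_num)
    rw [mul_assoc]
    gcongr
    have h3 : 3 * ((4 * n) ^ (1 / 200 : ℝ)) ^ 2 / μ ≤ 12 / μ * n ^ (3 / 5 : ℝ) := by
      rw [div_mul_eq_mul_div]
      exact div_le_div_of_nonneg_right (by linarith) hμ.le
    have h4 : μ * 1 ≤ μ * n ^ (3 / 5 : ℝ) := by gcongr
    linarith
  have hwn : 5 * N ^ 2 * √(n * l) ≤ n := by
    refine window_le_of_sq hn0.le (le_trans ?_ hLn.window)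
    have := hln.le
    gcongr
  have key := measureReal_badWindow_le hM hq hc hα hβ hs hC₂ hS₀ hC₁ hlip hrough hN hΛ1 hxΛ hΛ.theta
    hl hn hl1 herr hsmall hwn (by linarith [hL.lip]) hLn.ratio hLn.slope hLn.two_mul_add_rpow_le
    (hΛ.rpow_le_scale hq hc hn) hind
  rw [← hl]
  refine key.trans ?_
  have hz : 1 ≤ (x / Λ) ^ β := Real.one_le_rpow (by rwa [one_le_div hΛ0]) hβ.le
  have hA : 1 ≤ ((N : ℝ) ^ α / 16) ^ β := Real.one_le_rpow (by linarith [hN.gain]) hβ.le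
  have t1 : 9 * (N : ℝ) ^ 9 * (levelWeight β * Real.exp (-(x / Λ * (N ^ α / 16)) ^ β))
      ≤ 1 / 3 * Real.exp (1 - (x / Λ) ^ β) := by
    have h1 := exp_neg_mul_le hz hA
    rw [← Real.mul_rpow (by positivity) (by positivity)] at h1
    have h2 := (levelWeight_pos hβ).le
    calc 9 * (N : ℝ) ^ 9 * (levelWeight β * Real.exp (-(x / Λ * (N ^ α / 16)) ^ β))
        ≤ 9 * (N : ℝ) ^ 9 * (levelWeight β * (Real.exp (1 - ((N : ℝ) ^ α / 16) ^ β)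
          * Real.exp (-(x / Λ) ^ β))) := by gcongr
      _ = 9 * (N : ℝ) ^ 9 * levelWeight β * Real.exp (1 - ((N : ℝ) ^ α / 16) ^ β)
          * Real.exp (-(x / Λ) ^ β) := by ring
      _ ≤ 1 / 3 * Real.exp (-(x / Λ) ^ β) := by gcongr; exact hN.cells
      _ ≤ _ := by gcongr; linarith
  have t2 : 25 * (N : ℝ) ^ 16 * Real.exp (1 - (x / 8) ^ θ) ≤ 1 / 3 * Real.exp (1 - (x / Λ) ^ β) := by
    refine le_trans (le_of_eq ?_) (hΛ.tail x hxΛ)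
    rw [← Real.mul_rpow (by norm_num) hx.le, mul_assoc _ (Real.exp 1), ← Real.exp_add]
    ring_nf
  have t3 : G * Real.exp (-(4 * n) ^ (κ / 500)) ≤ 1 / 3 * Real.exp (1 - (x / Λ) ^ β) := by
    refine le_trans ?_ (hΛ.rough x hxΛ)
    rw [← Real.mul_rpow hc.le hx.le]
    have : c * x ≤ 4 * n := by linarith
    gcongr
  linarith

/-- Stretched exponential control of the passage times across windows at all scales. -/
theorem exists_windowBound {C₁ C₂ S₀ α θ β c C' G : ℝ} {q : ℝ → ℝ}
    (hM : M.Assumptions κ D₀ n₀ μ) (hq : M.FluctuationScale α θ q c) (hc : 0 < c) (hα : 0 < α)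
    (hβ : 0 < β) (hs : M.SlopeBound μ C₂ S₀) (hC₂ : 0 < C₂) (hS₀ : 1 ≤ S₀) (hC₁ : 0 ≤ C₁)
    (hlip : ∀ s t : ℝ, 0 ≤ s → 0 ≤ t → |M.meanX s - M.meanX t| ≤ C₁ * (|s - t| + 1))
    (hC' : 0 ≤ C') (hG : 0 ≤ G)
    (hup : ∀ d : ℝ, 0 ≤ d → M.meanX d ≤ μ * d + C' * (√(1 + d) * (1 + d) ^ (1 / 100 : ℝ)))
    (hrough : ∀ D : Set Plane, D.Countable → (∀ o : ℤ × ℤ, latticePt o ∈ D) →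
      (∀ z : Plane, ∀ δ > 0, ∃ k ∈ D, dist z k < δ) → ∀ R : ℝ, 1 ≤ R →
      P.real {x | ¬ M.RoughGeometry μ D R x} ≤ G * Real.exp (-R ^ (κ / 500)))
    {N : ℕ} (hN : GoodFactor μ C₁ C₂ α β N) {Y Λ : ℝ}
    (hY : ∀ t, Y ≤ t → LargeScale μ C₁ C' S₀ N t)
    (hΛ : GoodScaling μ c β θ G κ N Y Λ) {n : ℝ} (hn : 1 ≤ n) : M.WindowBound N Λ β q n := by
  have hk : ∀ k : ℕ, ∀ n : ℝ, 1 ≤ n → n ≤ 2 ^ k → M.WindowBound N Λ β q n := by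
    intro k
    induction k with
    | zero =>
      intro n hn hnk
      refine windowBound_step hM hq hc hα hβ hs hC₂ hS₀ hC₁ hlip hC' hG hup hrough hN hY hΛ hn
        fun m hm hmn => ?_
      rw [pow_zero] at hnk
      linarith
    | succ k ih =>
      intro n hn hnk
      refine windowBound_step hM hq hc hα hβ hs hC₂ hS₀ hC₁ hlip hC' hG hup hrough hN hY hΛ hn
        fun m hm hmn => ih m hm ?_
      rw [pow_succ] at hnk
      linarith
  obtain ⟨k, hk'⟩ := pow_unbounded_of_one_lt n (show (1 : ℝ) < 2 by norm_num)
  exact hk k n hn hk'.le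

end Model

/-! ### Localisation at all scales -/

namespace Model

variable {Ω E : Type*} [MeasurableSpace Ω] [MeasurableSpace E] [MulAction ISO2 E]
  {P : Measure Ω} {M : Model Ω E P} {κ D₀ n₀ μ : ℝ}

variable (M) in
/-- The total mean passage time of `N` steps of width `r / N` exceeds the mean passage time of the
chord by a multiple of the excess length, up to an error. -/
def ChordBound (μ C₂ r l : ℝ) (N : ℕ) (y : ℕ → ℝ) : Prop :=
  M.meanX (√(r ^ 2 + (y N - y 0) ^ 2)) + μ / 4 * (polyLen (r / N) y N
    - √(r ^ 2 + (y N - y 0) ^ 2)) - 2 * C₂ * (N * l)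
    ≤ ∑ i ∈ Finset.range N, M.meanX (√((r / N) ^ 2 + (y (i + 1) - y i) ^ 2))

theorem T_le_of_notMem_badCell {a r l w b : ℝ} {N : ℕ} {c u v : ℤ} {x : Ω}
    (hN : 20000 ≤ (N : ℝ)) (hr : 0 < r) (hl : 0 < l) (hw : w = √(r * l))
    (hc : |(c : ℝ) - b| ≤ 2 * w) (hx : x ∉ M.BadCell ((N : ℝ) ^ 2) r l a c) (hu : (u : ℝ) = b)
    (huv : |(v : ℝ) - u| ≤ 5 * N ^ 2 * w) :
    M.T (pt a u) (pt (a + r) v) x ≤ M.meanX (√(r ^ 2 + ((v : ℝ) - u) ^ 2)) + N * l := by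
  have hN0 : (0 : ℝ) < N := by linarith
  have hw0 : 0 ≤ w := by rw [hw]; positivity
  have hw2 : w ^ 2 = r * l := by rw [hw]; exact Real.sq_sqrt (by positivity)
  have h := (abs_le.1 (le_of_notMem_badCell (by positivity) hr hl hx u v)).2
  have hN2 : (2 : ℝ) ≤ N ^ 2 := by nlinarith only [hN]
  have h1 : ((u : ℝ) - c) ^ 2 ≤ (N ^ 2 * w) ^ 2 := by
    rw [sq_le_sq, abs_of_nonneg (by positivity : 0 ≤ (N : ℝ) ^ 2 * w), hu, abs_sub_comm]
    exact hc.trans (by gcongr)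
  have h2 : ((v : ℝ) - c) ^ 2 ≤ (6 * N ^ 2 * w) ^ 2 := by
    rw [sq_le_sq, abs_of_nonneg (by positivity : 0 ≤ 6 * (N : ℝ) ^ 2 * w)]
    have e : (v : ℝ) - c = (v - u) - (c - b) := by rw [hu]; ring
    have h3 : 2 * w ≤ N ^ 2 * w := by gcongr
    rw [e]
    exact (abs_sub _ _).trans (by linarith)
  have h3 : 4 * (((u : ℝ) - c) ^ 2 + ((v : ℝ) - c) ^ 2) / (((N : ℝ) ^ 2) ^ 2 * r) ≤ 148 * l := by
    rw [div_le_iff₀ (by positivity)]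
    calc 4 * (((u : ℝ) - c) ^ 2 + ((v : ℝ) - c) ^ 2)
        ≤ 4 * ((N ^ 2 * w) ^ 2 + (6 * N ^ 2 * w) ^ 2) := by gcongr
      _ = 148 * N ^ 4 * w ^ 2 := by ring
      _ = _ := by rw [hw2]; ring
  have h4 : 20000 * l ≤ N * l := by gcongr
  linarith

/-- Localisation of the skeleton of an optimal path along an axis at all scales: the deviations at
the successive scales `r k` add up to a multiple of the transversal scale `w 0`. -/
theorem Skeleton.abs_le_of_cells {D : Set Plane} {n H : ℝ} {x : Ω}
    {h : ℝ → unitInterval} {Y : ℝ → ℤ} (hx : M.RoughGeometry μ D (4 * n) x)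
    (hs : M.Skeleton D 0 n (2000 * μ * (4 * n) ^ (1 / 40 : ℝ)) H 0 0 x h Y)
    (hH : H ≤ 11 * (4 * n)) (hn : 0 < n) {C₂ : ℝ} {N : ℕ} (hμ : 0 < μ) (hC₂ : 0 ≤ C₂)
    (hN : 1200 / μ * (2 * C₂ + 1004) ≤ N) (hN' : 20000 ≤ (N : ℝ)) {r l w : ℕ → ℝ}
    (hr0 : r 0 = n) (hrs : ∀ k, r (k + 1) = r k / N) (hl0 : ∀ k, 0 < l k)
    (hls : ∀ k, l (k + 1) ≤ l k) (hw : ∀ k, w k = √(r k * l k)) (hwd : ∀ k, 2 * w (k + 1) ≤ w k)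
    (hwu : ∀ k, 2 * w k ≤ N * w (k + 1)) {K : ℕ}
    (hD : ∀ i k : ℕ, ∀ j : ℤ, pt (i * r k) j ∈ D)
    (herr : ∀ k < K, 2000 * μ * (4 * n) ^ (1 / 40 : ℝ) ≤ l k)
    (hsmall : ∀ k < K, 4 / μ * (l k + μ + 3 * ((4 * n) ^ (1 / 200 : ℝ)) ^ 2 / μ) ≤ r k)
    (hwn : ∀ k < K, 5 * N ^ 2 * w k ≤ r k)
    (hF : ∀ k < K, ∀ y : ℕ → ℝ, |y N - y 0| ≤ r k → (k = 0 → y 0 = 0 ∧ y N = 0) →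
      M.ChordBound μ C₂ (r k) (l k) N y)
    (hcell : ∀ k, 1 ≤ k → k ≤ K → ∀ i : ℕ, i < N ^ k → ∀ b : ℝ, |b| ≤ 2 * N * w 0 →
      ∃ c : ℤ, |(c : ℝ) - b| ≤ 2 * w k ∧ x ∉ M.BadCell ((N : ℝ) ^ 2) (r k) (l k) (i * r k) c)
    (hT : M.T (pt 0 0) (pt n 0) x ≤ M.meanX n + N * l 0) :
    ∀ k ≤ K, (∀ i ≤ N ^ k, |(Y (i * r k) : ℝ)| ≤ 2 * N * (w 0 - w k)) ∧
      ∀ i < N ^ k, |(Y ((i + 1 : ℕ) * r k) : ℝ) - Y (i * r k)| ≤ 5 * N ^ 2 * w k := by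
  have hN0' : (0 : ℝ) < N := by linarith
  have hN0 : 0 < N := by exact_mod_cast hN0'
  have hrp : ∀ k, 0 < r k := by
    intro k
    induction k with
    | zero => rw [hr0]; exact hn
    | succ k ih => rw [hrs]; positivity
  have hNr : ∀ k, (N : ℝ) ^ k * r k = n := by
    intro k
    induction k with
    | zero => rw [hr0]; simp
    | succ k ih => rw [hrs, pow_succ, ← ih]; field_simp
  have hwp : ∀ k, 0 ≤ w k := fun k => by rw [hw]; positivity
  have hY0 : Y 0 = 0 := hs.Y_zero
  have hYn : Y n = 0 := hs.Y_end
  intro k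
  induction k with
  | zero =>
    intro _
    have e : ∀ i : ℕ, i ≤ 1 → Y (i * r 0) = 0 := by
      intro i hi
      interval_cases i
      · simpa using hY0
      · rw [hr0]; simpa using hYn
    constructor
    · intro i hi
      rw [e i (by simpa using hi)]
      simp
    · intro i hi
      rw [e i (by simp at hi; omega), e (i + 1) (by simp at hi; omega)]
      have := hwp 0
      simp only [Int.cast_zero, sub_zero, abs_zero]
      positivity
  | succ k ih =>
    intro hk
    obtain ⟨ih1, ih2⟩ := ih (by omega)
    have hw0k : w k ≤ w 0 := by
      have hanti : Antitone w := antitone_nat_of_succ_le fun j => by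
        have h1 := hwd j
        have h2 := hwp (j + 1)
        linarith
      exact hanti (by omega)
    have hloc : ∀ i < N ^ k, ∀ j ≤ N, |(Y ((i * N + j : ℕ) * r (k + 1)) : ℝ)
        - ((Y (i * r k) : ℝ) + j / N * ((Y ((i + 1 : ℕ) * r k) : ℝ) - Y (i * r k)))|
          ≤ N * w k := by
      intro i hi j hj
      have ep : (i * r k) + r k = (i + 1 : ℕ) * r k := by push_cast; ring
      have ej : ∀ j : ℕ, (i * r k) + j * (r k / N) = (i * N + j : ℕ) * r (k + 1) := by
        intro j; rw [hrs]; push_cast; field_simp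
      have hin : (i + 1 : ℕ) * r k ≤ n := by
        rw [← hNr k]
        have := hrp k
        gcongr
        exact_mod_cast hi
      have hb : ∀ j : ℕ, j < N → |(Y (i * r k) : ℝ) + j / N * ((Y ((i + 1 : ℕ) * r k) : ℝ)
          - Y (i * r k))| ≤ 2 * N * w 0 := by
        intro j hj
        have h1 := abs_chord_le (N := N) (ih1 i hi.le) (ih1 (i + 1) hi) hj.le hN0
        have h2 : 2 * N * (w 0 - w k) ≤ 2 * N * w 0 := by
          have := hwp k
          gcongr
          linarith
        exact h1.trans h2
      have hi2 := ih2 i hi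
      have key := Skeleton.abs_sub_chord_le (a := i * r k) (n := r k) (l := l k) (B := l (k + 1))
        (N := N) (C₂ := C₂) (i := j) hx hs hH (by positivity) (by linarith) hμ hN0 hC₂ hN
        (by have := hrp k; positivity) (hrp k) (by rw [ep]; exact hin) (hl0 k) (hl0 _) (hls k)
        (fun j _ z => by rw [ej]; exact hD _ _ _) (herr k hk) (hsmall k hk)
        (by rw [← hw]; exact hwn k hk) (by rw [← hw, ep]; exact hi2)
        (fun y hy0 hyN => hF k hk y (by
            rw [hy0, hyN, ep]; exact hi2.trans (hwn k hk)) (by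
            rintro rfl
            have hi0 : i = 0 := by simpa using hi
            rw [hi0] at hy0 hyN
            rw [hy0, hyN, hr0]
            simp [hY0, hYn]))
        (fun j hj' => by
          have hij : i * N + j < N ^ (k + 1) := by
            calc i * N + j < i * N + N := by omega
              _ = (i + 1) * N := by ring
              _ ≤ N ^ k * N := by gcongr; exact hi
              _ = N ^ (k + 1) := by ring
          obtain ⟨c, hc1, hc2⟩ := hcell (k + 1) (by omega) hk (i * N + j) hij _ (hb j hj')
          refine ⟨c, ?_, ?_⟩
          · rw [← hw, ep]
            refine hc1.trans ?_
            have h1 := hwd k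
            have h2 : 1 * w k ≤ 5 * N * w k := by
              have := hwp k
              gcongr
              linarith
            linarith
          · rw [ej, ← hrs]; exact hc2)
        (by
          rcases Nat.eq_zero_or_pos k with rfl | hkpos
          · have hi0 : i = 0 := by simpa using hi
            rw [hi0, hr0]
            simpa [hY0, hYn, Real.sqrt_sq hn.le] using hT
          · have h0 := ih1 i hi.le
            obtain ⟨c, hc1, hc2⟩ := hcell k hkpos (by omega) i hi (Y (i * r k)) (by
              refine h0.trans ?_
              have := hwp k
              gcongr
              linarith)
            exact T_le_of_notMem_badCell hN' (hrp k) (hl0 k) (hw k) hc1 hc2 rfl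
              (by rw [ep]; exact hi2)) hj
      rw [ej, ep, ← hw] at key
      exact key
    have hwk := hwp k
    have hdm : ∀ i, i < N ^ (k + 1) → i / N < N ^ k ∧ i % N < N ∧ i = i / N * N + i % N := by
      intro i hi
      refine ⟨(Nat.div_lt_iff_lt_mul hN0).2 (by rw [← pow_succ]; exact hi), Nat.mod_lt _ hN0, ?_⟩
      rw [Nat.div_add_mod']
    constructor
    · intro i hi
      rcases hi.eq_or_lt with rfl | hi
      · push_cast
        rw [hNr, hYn]
        have h1 := hwd k
        have h2 := hwp (k + 1)
        simp only [Int.cast_zero, abs_zero]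
        have : 0 ≤ w 0 - w (k + 1) := by linarith
        positivity
      · obtain ⟨h1, h2, h3⟩ := hdm i hi
        have h4 := hloc _ h1 _ h2.le
        rw [← h3] at h4
        have h5 := abs_chord_le (N := N) (ih1 _ h1.le) (ih1 (i / N + 1) h1) h2.le hN0
        have h6 := hwd k
        have h7 : N * (2 * w (k + 1)) ≤ N * w k := by gcongr
        have e : (Y (i * r (k + 1)) : ℝ) = (Y (i * r (k + 1))
          - ((Y ((i / N : ℕ) * r k) : ℝ) + (i % N : ℕ) / N * ((Y ((i / N + 1 : ℕ) * r k) : ℝ)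
            - Y ((i / N : ℕ) * r k)))) + ((Y ((i / N : ℕ) * r k) : ℝ)
              + (i % N : ℕ) / N * ((Y ((i / N + 1 : ℕ) * r k) : ℝ) - Y ((i / N : ℕ) * r k))) := by
          ring
        rw [e]
        refine (abs_add_le _ _).trans ?_
        linarith
    · intro i hi
      obtain ⟨h1, h2, h3⟩ := hdm i hi
      have h4 := hloc _ h1 _ h2.le
      have h5 := hloc _ h1 (i % N + 1) h2
      have h6 := ih2 _ h1
      have e3 : i / N * N + (i % N + 1) = i + 1 := by omega
      rw [← h3] at h4
      rw [e3] at h5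
      obtain ⟨A, hA⟩ : ∃ A : ℝ, A = Y ((i / N : ℕ) * r k) := ⟨_, rfl⟩
      obtain ⟨B, hB⟩ : ∃ B : ℝ, B = (Y ((i / N + 1 : ℕ) * r k) : ℝ) := ⟨_, rfl⟩
      rw [← hA, ← hB] at h4 h5 h6
      have h7 : |(B - A) / N| ≤ 5 * N * w k := by
        rw [abs_div, abs_of_pos hN0', div_le_iff₀ hN0']
        refine h6.trans (le_of_eq (by ring))
      have h8 : 7 * N * w k ≤ 5 * N ^ 2 * w (k + 1) := by
        have h9 : N * (2 * w k) ≤ N * (N * w (k + 1)) :=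
          mul_le_mul_of_nonneg_left (hwu k) hN0'.le
        have h10 : 0 ≤ N * (N * w (k + 1)) := by
          have := hwp (k + 1)
          positivity
        linarith only [h9, h10]
      have e : (Y ((i + 1 : ℕ) * r (k + 1)) : ℝ) - Y (i * r (k + 1))
          = (Y ((i + 1 : ℕ) * r (k + 1)) - (A + (i % N + 1 : ℕ) / N * (B - A)))
            - (Y (i * r (k + 1)) - (A + (i % N : ℕ) / N * (B - A))) + (B - A) / N := by
        push_cast; ring
      rw [e]
      refine (abs_add_le _ _).trans ((add_le_add_left (abs_sub _ _) _).trans ?_)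
      linarith

end Model

/-! ### Deviations between the points of a skeleton -/

/-- A point that is almost on the segment between two points close to the axis is close to the
axis. -/
theorem abs_le_of_dist_add_dist_le {a b t v m e : ℝ} {z : Plane} (ht : |t| ≤ m) (hv : |v| ≤ m)
    (he : 0 ≤ e) (h : dist (pt a t) z + dist z (pt b v) ≤ dist (pt a t) (pt b v) + e) :
    |z 1| ≤ m + (|v - t| + √(2 * dist (pt a t) (pt b v) * e) + e) := by
  obtain ⟨D, hD⟩ : ∃ D, D = dist (pt a t) (pt b v) := ⟨_, rfl⟩
  rw [← hD] at h ⊢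
  have hD0 : 0 ≤ D := by rw [hD]; exact dist_nonneg
  have hD2 : D ^ 2 = (a - b) ^ 2 + (t - v) ^ 2 := by
    rw [hD, dist_plane]
    simp only [pt_zero, pt_one]
    exact Real.sq_sqrt (by positivity)
  obtain ⟨s, hs⟩ : ∃ s, s = |z 1| - m := ⟨_, rfl⟩
  have h0 : 0 ≤ |v - t| + √(2 * D * e) + e := by positivity
  rcases le_or_gt s 0 with hs0 | hs0
  · linarith
  have hle : ∀ y : ℝ, |y| ≤ m → s ^ 2 ≤ (y - z 1) ^ 2 := by
    intro y hy
    rw [sq_le_sq, abs_of_pos hs0, hs, abs_sub_comm]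
    have := abs_sub_abs_le_abs_sub (z 1) y
    linarith
  have h1 : dist (pt a 0) (pt (z 0) s) ≤ dist (pt a t) z := by
    rw [dist_plane, dist_plane]
    simp only [pt_zero, pt_one]
    apply Real.sqrt_le_sqrt
    have := hle t ht
    linarith
  have h2 : dist (pt (z 0) s) (pt b (2 * s)) ≤ dist z (pt b v) := by
    rw [dist_plane, dist_plane]
    simp only [pt_zero, pt_one]
    apply Real.sqrt_le_sqrt
    have := hle v hv
    linarith
  have h3 := dist_triangle (pt a 0) (pt (z 0) s) (pt b (2 * s))
  have h4 : dist (pt a 0) (pt b (2 * s)) ^ 2 = (a - b) ^ 2 + (2 * s) ^ 2 := by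
    rw [dist_plane]
    simp only [pt_zero, pt_one]
    rw [Real.sq_sqrt (by positivity)]
    ring
  have h5 := pow_le_pow_left₀ dist_nonneg (h3.trans ((add_le_add h1 h2).trans h)) 2
  have h6 : √(2 * D * e) ^ 2 = 2 * D * e := Real.sq_sqrt (by positivity)
  have h7 : (2 * s) ^ 2 ≤ (|v - t| + √(2 * D * e) + e) ^ 2 := by
    have h8 : (t - v) ^ 2 = |v - t| ^ 2 := by rw [sq_abs]; ring
    have h9 : 0 ≤ |v - t| * √(2 * D * e) := by positivity
    have h10 : 0 ≤ |v - t| * e := by positivity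
    have h11 : 0 ≤ √(2 * D * e) * e := by positivity
    linarith
  have h8 := abs_le_of_sq_le_sq' h7 h0
  linarith [h8.2]

namespace Model

variable {Ω E : Type*} [MeasurableSpace Ω] [MeasurableSpace E] [MulAction ISO2 E]
  {P : Measure Ω} {M : Model Ω E P} {κ D₀ n₀ μ : ℝ}

/-- An almost aligned intermediate point is close to the segment between the end points. -/
theorem excess_le_of_crude {D : Set Plane} {R err : ℝ} {x : Ω} (hμ : 0 < μ) (hR : 0 ≤ R)
    (hx : M.Crude μ D R x) (herr : 0 ≤ err) {a b c : Plane} (ha : a ∈ D) (hb : b ∈ D) (hc : c ∈ D)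
    (ha' : ‖a‖ < 40 * R) (hb' : ‖b‖ < 40 * R) (hc' : ‖c‖ < 40 * R)
    (h : M.T a b x + M.T b c x ≤ M.T a c x + err) {U : ℝ}
    (hU : 2 * dist a c + 4 / μ * (err + μ + 3 * (R ^ (1 / 200 : ℝ)) ^ 2 / μ) ≤ U) :
    dist a b + dist b c ≤ dist a c + (err + 3 * (R ^ (1 / 200 : ℝ) * √(1 + U))) / μ := by
  have hsum := dist_add_dist_le_of_crude hμ hx herr ha hb hc ha' hb' hc' h
  have h1 := (abs_le.1 (hx a ha b hb ha' hb')).1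
  have h2 := (abs_le.1 (hx b hb c hc hb' hc')).1
  have h3 := (abs_le.1 (hx a ha c hc ha' hc')).2
  have hab : 0 ≤ dist a b := dist_nonneg
  have hbc : 0 ≤ dist b c := dist_nonneg
  have hac := dist_triangle a b c
  have hρ : 0 ≤ R ^ (1 / 200 : ℝ) := by positivity
  have hle : ∀ d, d ≤ U → R ^ (1 / 200 : ℝ) * √(1 + d) ≤ R ^ (1 / 200 : ℝ) * √(1 + U) := by
    intro d hd; gcongr
  have k1 := hle (dist a b) (by linarith)
  have k2 := hle (dist b c) (by linarith)
  have k3 := hle (dist a c) (by linarith)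
  have h4 : μ * (dist a b + dist b c) ≤ μ * dist a c + (err + 3 * (R ^ (1 / 200 : ℝ) * √(1 + U))) := by
    linarith
  calc dist a b + dist b c = μ * (dist a b + dist b c) / μ := by field_simp
    _ ≤ (μ * dist a c + (err + 3 * (R ^ (1 / 200 : ℝ) * √(1 + U)))) / μ := by gcongr
    _ = _ := by field_simp

/-- The constant in the bound for the excess length of almost aligned points. -/
def excessConst (μ B : ℝ) : ℝ := (1 + 6 * √(1 + 2 * B + 4 / μ * (1 + μ + 12 / μ))) / μ

theorem excessConst_pos {B : ℝ} (hμ : 0 < μ) : 0 < excessConst μ B := by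
  rw [excessConst]; positivity

theorem excess_le_of_scale {D : Set Plane} {R err l r B : ℝ} {x : Ω} (hμ : 0 < μ) (hR : 0 ≤ R)
    (hx : M.Crude μ D R x) (herr : 0 ≤ err) {a b c : Plane} (ha : a ∈ D) (hb : b ∈ D) (hc : c ∈ D)
    (ha' : ‖a‖ < 40 * R) (hb' : ‖b‖ < 40 * R) (hc' : ‖c‖ < 40 * R)
    (h : M.T a b x + M.T b c x ≤ M.T a c x + err) (hB : 0 ≤ B) (hl : 1 ≤ l) (hel : err ≤ l)
    (hρ : R ^ (1 / 200 : ℝ) ≤ 2 * l ^ (1 / 6 : ℝ)) (hr : r ≤ l ^ (5 / 3 : ℝ))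
    (hac : dist a c ≤ B * r) :
    dist a b + dist b c ≤ dist a c + excessConst μ B * l := by
  have hl0 : 0 < l := by linarith
  obtain ⟨A, hA⟩ : ∃ A, A = 4 / μ * (1 + μ + 12 / μ) := ⟨_, rfl⟩
  have hA0 : 0 ≤ A := by rw [hA]; positivity
  obtain ⟨ρ, hρ'⟩ : ∃ ρ, ρ = R ^ (1 / 200 : ℝ) := ⟨_, rfl⟩
  have hρ0 : 0 ≤ ρ := by rw [hρ']; positivity
  have hll : l ≤ l ^ (5 / 3 : ℝ) := by
    calc l = l ^ (1 : ℝ) := (Real.rpow_one l).symm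
      _ ≤ _ := Real.rpow_le_rpow_of_exponent_le hl (by norm_num)
  have h1 : ρ ^ 2 ≤ 4 * l := by
    have h2 : (l ^ (1 / 6 : ℝ)) ^ 2 ≤ l := by
      rw [← Real.rpow_natCast, ← Real.rpow_mul hl0.le]
      calc l ^ ((1 / 6 : ℝ) * (2 : ℕ)) ≤ l ^ (1 : ℝ) :=
            Real.rpow_le_rpow_of_exponent_le hl (by norm_num)
        _ = l := Real.rpow_one l
    calc ρ ^ 2 ≤ (2 * l ^ (1 / 6 : ℝ)) ^ 2 := by rw [hρ']; gcongr
      _ = 4 * (l ^ (1 / 6 : ℝ)) ^ 2 := by ring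
      _ ≤ _ := by linarith
  have hU : 2 * dist a c + 4 / μ * (err + μ + 3 * ρ ^ 2 / μ) ≤ (2 * B + A) * l ^ (5 / 3 : ℝ) := by
    have h2 : err + μ + 3 * ρ ^ 2 / μ ≤ (1 + μ + 12 / μ) * l := by
      have h3 : 3 * ρ ^ 2 / μ ≤ 12 / μ * l := by
        rw [div_mul_eq_mul_div]
        exact div_le_div_of_nonneg_right (by linarith) hμ.le
      have h4 : μ * 1 ≤ μ * l := by gcongr
      linarith
    have h3 : 4 / μ * (err + μ + 3 * ρ ^ 2 / μ) ≤ A * l := by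
      rw [hA, mul_assoc]
      gcongr
    have h4 : A * l ≤ A * l ^ (5 / 3 : ℝ) := by gcongr
    have h5 : B * r ≤ B * l ^ (5 / 3 : ℝ) := by gcongr
    linarith
  rw [hρ'] at hU
  refine (excess_le_of_crude hμ hR hx herr ha hb hc ha' hb' hc' h hU).trans ?_
  rw [excessConst, ← hA, ← hρ', div_mul_eq_mul_div]
  gcongr
  have h6 : √(1 + (2 * B + A) * l ^ (5 / 3 : ℝ)) ≤ √(1 + 2 * B + A) * l ^ (5 / 6 : ℝ) := by
    have h7 : l ^ (5 / 6 : ℝ) = √(l ^ (5 / 3 : ℝ)) := by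
      rw [Real.sqrt_eq_rpow, ← Real.rpow_mul hl0.le]; norm_num
    rw [h7, ← Real.sqrt_mul (by positivity)]
    apply Real.sqrt_le_sqrt
    linarith
  have h7 : ρ * √(1 + (2 * B + A) * l ^ (5 / 3 : ℝ)) ≤ 2 * √(1 + 2 * B + A) * l := by
    calc ρ * √(1 + (2 * B + A) * l ^ (5 / 3 : ℝ))
        ≤ (2 * l ^ (1 / 6 : ℝ)) * (√(1 + 2 * B + A) * l ^ (5 / 6 : ℝ)) := by
          rw [← hρ'] at hρ; gcongr
      _ = 2 * √(1 + 2 * B + A) * (l ^ (1 / 6 : ℝ) * l ^ (5 / 6 : ℝ)) := by ring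
      _ = _ := by
        rw [← Real.rpow_add hl0]
        norm_num
  linarith

/-- Between the points of the skeleton at spacing `r`, the optimal path stays close to the axis. -/
theorem Skeleton.abs_geodesic_le {D : Set Plane} {n H : ℝ} {x : Ω}
    {h : ℝ → unitInterval} {Y : ℝ → ℤ} (hx : M.RoughGeometry μ D (4 * n) x)
    (hs : M.Skeleton D 0 n (2000 * μ * (4 * n) ^ (1 / 40 : ℝ)) H 0 0 x h Y)
    (hH : H ≤ 11 * (4 * n)) (hn : 1 ≤ n) (hμ : 0 < μ)
    (hdense : ∀ z : Plane, ∀ δ > 0, ∃ k ∈ D, dist z k < δ) {r l A I B : ℝ} {m : ℕ}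
    (hr : 0 < r) (hm : m * r = n) (hD : ∀ i : ℕ, ∀ j : ℤ, pt (i * r) j ∈ D)
    (hl : 1 ≤ l) (hel : 2000 * μ * (4 * n) ^ (1 / 40 : ℝ) ≤ l)
    (hρ : (4 * n) ^ (1 / 200 : ℝ) ≤ 2 * l ^ (1 / 6 : ℝ)) (hrl : r ≤ l ^ (5 / 3 : ℝ)) (hB : 0 ≤ B)
    (hIB : r + I ≤ B * r)
    (hA : ∀ i ≤ m, |(Y (i * r) : ℝ)| ≤ A)
    (hI : ∀ i < m, |(Y ((i + 1 : ℕ) * r) : ℝ) - Y (i * r)| ≤ I) (t : unitInterval) :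
    |M.geodesic (pt 0 0) (pt n 0) x t 1|
      ≤ 1 + A + I + √(2 * (B * r) * (excessConst μ B * l)) + excessConst μ B * l := by
  have hE := excessConst_pos (B := B) hμ
  have hn0 : 0 < n := by linarith
  have hir : ∀ i : ℕ, i ≤ m → (i : ℝ) * r ≤ n := by
    intro i hi
    rw [← hm]
    gcongr
  obtain ⟨i, him, hi1, hi2⟩ : ∃ i < m, h (i * r) ≤ t ∧ t ≤ h ((i + 1 : ℕ) * r) := by
    by_contra hcon
    push Not at hcon
    have hall : ∀ i ≤ m, h (i * r) ≤ t := by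
      intro i
      induction i with
      | zero =>
        intro _
        rw [Nat.cast_zero, zero_mul, hs.h_zero]
        exact unitInterval.nonneg'
      | succ i ih => exact fun hi => (hcon i hi (ih (by omega))).le
    have hm0 : m ≠ 0 := by
      rintro rfl
      rw [Nat.cast_zero, zero_mul] at hm
      linarith
    have h1 := hcon (m - 1) (by omega) (hall _ (by omega))
    rw [show m - 1 + 1 = m by omega, hm, hs.h_end] at h1
    exact absurd h1 (not_lt.2 unitInterval.le_one')
  obtain ⟨z, hz, hzd⟩ := hdense (M.geodesic (pt 0 0) (pt n 0) x t) 1 one_pos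
  have hu : pt 0 0 ∈ D := by simpa using hD 0 0
  have hv : pt n 0 ∈ D := by simpa [hm] using hD m 0
  have hun : ‖pt 0 0‖ ≤ 4 * n := by
    rw [← dist_zero_right, dist_plane]
    simp only [pt_zero, pt_one, PiLp.zero_apply]
    norm_num
    linarith
  have hvn : ‖pt n 0‖ ≤ 4 * n := by
    rw [← dist_zero_right, dist_plane]
    simp only [pt_zero, pt_one, PiLp.zero_apply]
    norm_num
    rw [Real.sqrt_sq hn0.le]
    linarith
  have hnear : ∀ i ≤ m, dist (pt (i * r) (Y (i * r))) (M.geodesic (pt 0 0) (pt n 0) x (h (i * r)))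
      ≤ 1 := by
    intro i hi
    have := hs.near (i * r) (by positivity) (hir i hi)
    simpa using this
  have hal := hx.align _ hu _ hv hun hvn _ _ _ hi1 hi2 _ (hD i (Y (i * r))) _ hz _
    (hD (i + 1) (Y ((i + 1 : ℕ) * r))) (hnear i him.le) (by rw [dist_comm]; exact hzd.le)
    (hnear (i + 1) him)
  have hnorm : ∀ i ≤ m, ‖pt (i * r) (Y (i * r))‖ < 40 * (4 * n) := by
    intro i hi
    refine norm_pt_lt (by positivity) ?_ ((hs.bound _ (by positivity) (hir i hi)).trans hH)
    rw [abs_of_nonneg (by positivity)]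
    linarith [hir i hi]
  have hzn : ‖z‖ < 40 * (4 * n) := by
    have h1 := hx.norm_le _ hu _ hv hun hvn t
    have h2 : ‖z‖ ≤ dist (M.geodesic (pt 0 0) (pt n 0) x t) z
        + ‖M.geodesic (pt 0 0) (pt n 0) x t‖ := by
      rw [← dist_zero_right, ← dist_zero_right]
      refine (dist_triangle z (M.geodesic (pt 0 0) (pt n 0) x t) 0).trans ?_
      rw [dist_comm z]
    linarith
  have hac : dist (pt (i * r) (Y (i * r))) (pt ((i + 1 : ℕ) * r) (Y ((i + 1 : ℕ) * r)))
      ≤ B * r := by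
    refine le_trans ?_ hIB
    have h1 := hI i him
    have h2 : 0 ≤ I := (abs_nonneg _).trans h1
    rw [dist_plane, Real.sqrt_le_left (by positivity)]
    simp only [pt_zero, pt_one]
    have h3 := pow_le_pow_left₀ (abs_nonneg _) h1 2
    rw [sq_abs] at h3
    have e : ((i : ℝ) * r - (i + 1 : ℕ) * r) ^ 2 = r ^ 2 := by push_cast; ring
    have h4 : 0 ≤ r * I := by positivity
    rw [e]
    linarith
  have hex := excess_le_of_scale hμ (by positivity) hx.crude (by positivity) (hD i _) hz
    (hD (i + 1) _) (hnorm i him.le) hzn (hnorm (i + 1) him) hal hB hl hel hρ hrl hac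
  have h1 := abs_le_of_dist_add_dist_le (hA i him.le) (hA (i + 1) him) (by positivity) hex
  have h2 : |M.geodesic (pt 0 0) (pt n 0) x t 1| ≤ |z 1| + 1 := by
    have h3 := PiLp.norm_apply_le (M.geodesic (pt 0 0) (pt n 0) x t - z) 1
    rw [← dist_eq_norm, Real.norm_eq_abs, PiLp.sub_apply] at h3
    have h4 := abs_sub_abs_le_abs_sub (M.geodesic (pt 0 0) (pt n 0) x t 1) (z 1)
    linarith
  have h3 : √(2 * dist (pt (i * r) (Y (i * r))) (pt ((i + 1 : ℕ) * r) (Y ((i + 1 : ℕ) * r)))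
      * (excessConst μ B * l)) ≤ √(2 * (B * r) * (excessConst μ B * l)) := by
    gcongr
  linarith [hI i him]

end Model

/-! ### The scales of the chaining -/

/-- The length `n / N ^ k` of the segments at level `k`. -/
def scaleLen (n : ℝ) (N k : ℕ) : ℝ := n / N ^ k

/-- The admissible deviation of passage times at level `k`: it decays more slowly in `k` than the
fluctuation scale of the segments does. -/
def scaleDev (y α : ℝ) (N k : ℕ) : ℝ := y * ((N : ℝ) ^ (-(α / 2))) ^ k

/-- The transversal scale at level `k`. -/
def scaleWidth (n y α : ℝ) (N k : ℕ) : ℝ := √(scaleLen n N k * scaleDev y α N k)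

section Scales

variable {n y α : ℝ} {N : ℕ}

@[simp] theorem scaleLen_zero : scaleLen n N 0 = n := by simp [scaleLen]

@[simp] theorem scaleDev_zero : scaleDev y α N 0 = y := by simp [scaleDev]

theorem scaleWidth_zero : scaleWidth n y α N 0 = √(n * y) := by simp [scaleWidth]

theorem scaleLen_succ (k : ℕ) : scaleLen n N (k + 1) = scaleLen n N k / N := by
  rw [scaleLen, scaleLen, pow_succ, div_div]

theorem scaleDev_succ (k : ℕ) :
    scaleDev y α N (k + 1) = scaleDev y α N k * (N : ℝ) ^ (-(α / 2)) := by
  rw [scaleDev, scaleDev, pow_succ, mul_assoc]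

theorem scaleLen_pos (hn : 0 < n) (hN : 0 < N) (k : ℕ) : 0 < scaleLen n N k := by
  rw [scaleLen]; positivity

theorem scaleDev_pos (hy : 0 < y) (hN : 0 < N) (k : ℕ) : 0 < scaleDev y α N k := by
  rw [scaleDev]; positivity

theorem scaleWidth_nonneg (k : ℕ) : 0 ≤ scaleWidth n y α N k := Real.sqrt_nonneg _

theorem pow_mul_scaleLen (hN : 0 < N) (k : ℕ) : (N : ℝ) ^ k * scaleLen n N k = n := by
  rw [scaleLen]; field_simp

theorem rpow_neg_half_le (hN : 0 < N) (hNα : 16 ≤ (N : ℝ) ^ α) : (N : ℝ) ^ (-(α / 2)) ≤ 1 / 4 := by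
  have hN' : (0 : ℝ) < N := by exact_mod_cast hN
  have h1 : ((N : ℝ) ^ (α / 2)) ^ 2 = N ^ α := by
    rw [← Real.rpow_natCast, ← Real.rpow_mul hN'.le]; norm_num
  have h2 : 4 ≤ (N : ℝ) ^ (α / 2) := by
    refine le_of_sq_le_sq ?_ (by positivity)
    rw [h1]; linarith
  rw [Real.rpow_neg hN'.le, one_div]
  exact inv_anti₀ (by norm_num) h2

theorem scaleDev_succ_le (hy : 0 < y) (hN : 0 < N) (hNα : 16 ≤ (N : ℝ) ^ α) (k : ℕ) :
    scaleDev y α N (k + 1) ≤ scaleDev y α N k := by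
  rw [scaleDev_succ]
  exact mul_le_of_le_one_right (scaleDev_pos hy hN k).le
    ((rpow_neg_half_le hN hNα).trans (by norm_num))

theorem scaleDev_le (hy : 0 < y) (hN : 0 < N) (hNα : 16 ≤ (N : ℝ) ^ α) (k : ℕ) :
    scaleDev y α N k ≤ y := by
  have := antitone_nat_of_succ_le (scaleDev_succ_le hy hN hNα) (Nat.zero_le k)
  rwa [scaleDev_zero] at this

theorem two_mul_scaleWidth_succ_le (hn : 0 < n) (hy : 0 < y) (hN : 1 ≤ N)
    (hNα : 16 ≤ (N : ℝ) ^ α) (k : ℕ) :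
    2 * scaleWidth n y α N (k + 1) ≤ scaleWidth n y α N k := by
  have hN' : (1 : ℝ) ≤ N := by exact_mod_cast hN
  refine Real.le_sqrt_of_sq_le ?_
  have hr := scaleLen_pos hn hN k
  have hl := scaleDev_pos (α := α) hy hN k
  have hr' := scaleLen_pos hn hN (k + 1)
  have hl' := scaleDev_pos (α := α) hy hN (k + 1)
  rw [mul_pow, scaleWidth, Real.sq_sqrt (by positivity), scaleLen_succ, scaleDev_succ]
  have h1 : scaleLen n N k / N ≤ scaleLen n N k := div_le_self hr.le hN'
  have h2 : scaleDev y α N k * (N : ℝ) ^ (-(α / 2)) ≤ scaleDev y α N k * (1 / 4) :=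
    mul_le_mul_of_nonneg_left (rpow_neg_half_le hN hNα) hl.le
  calc (2 : ℝ) ^ 2 * (scaleLen n N k / N * (scaleDev y α N k * (N : ℝ) ^ (-(α / 2))))
      ≤ 2 ^ 2 * (scaleLen n N k * (scaleDev y α N k * (1 / 4))) := by gcongr
    _ = _ := by ring

theorem two_mul_scaleWidth_le (hn : 0 < n) (hy : 0 < y) (hN : 16 ≤ N) (hα : α ≤ 1) (k : ℕ) :
    2 * scaleWidth n y α N k ≤ N * scaleWidth n y α N (k + 1) := by
  have hN16 : (16 : ℝ) ≤ N := by exact_mod_cast hN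
  have hN0 : 0 < N := by omega
  have hr := scaleLen_pos hn hN0 k
  have hl := scaleDev_pos (α := α) hy hN0 k
  have hr' := scaleLen_pos hn hN0 (k + 1)
  have hl' := scaleDev_pos (α := α) hy hN0 (k + 1)
  refine le_of_sq_le_sq ?_ (mul_nonneg (by linarith) (scaleWidth_nonneg _))
  rw [mul_pow, mul_pow, scaleWidth, scaleWidth, Real.sq_sqrt (by positivity),
    Real.sq_sqrt (by positivity), scaleLen_succ, scaleDev_succ]
  have h1 : 4 ≤ N * (N : ℝ) ^ (-(α / 2)) := by
    calc (4 : ℝ) ≤ √N := Real.le_sqrt_of_sq_le (by linarith)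
      _ = (N : ℝ) ^ (1 / 2 : ℝ) := Real.sqrt_eq_rpow _
      _ ≤ (N : ℝ) ^ (1 + -(α / 2)) := Real.rpow_le_rpow_of_exponent_le (by linarith) (by linarith)
      _ = _ := by rw [Real.rpow_add (by linarith), Real.rpow_one]
  calc (2 : ℝ) ^ 2 * (scaleLen n N k * scaleDev y α N k)
      = 4 * (scaleLen n N k * scaleDev y α N k) := by ring
    _ ≤ (N * (N : ℝ) ^ (-(α / 2))) * (scaleLen n N k * scaleDev y α N k) := by gcongr
    _ = _ := by field_simp

theorem scaleWidth_le (hn : 0 < n) (hy : 0 < y) (hN : 1 ≤ N) (hNα : 16 ≤ (N : ℝ) ^ α) (k : ℕ) :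
    scaleWidth n y α N k ≤ √(n * y) := by
  have h : Antitone (scaleWidth n y α N) := antitone_nat_of_succ_le fun j => by
    have h1 := two_mul_scaleWidth_succ_le hn hy hN hNα j
    have h2 := scaleWidth_nonneg (n := n) (y := y) (α := α) (N := N) (j + 1)
    linarith
  have := h (Nat.zero_le k)
  rwa [scaleWidth_zero] at this

theorem scaleDev_eq (hn : 0 < n) (hN : 0 < N) (k : ℕ) :
    scaleDev y α N k = y * (scaleLen n N k / n) ^ (α / 2) := by
  have hN' : (0 : ℝ) < N := by exact_mod_cast hN
  have h : scaleLen n N k / n = ((N : ℝ) ^ k)⁻¹ := by rw [scaleLen]; field_simp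
  rw [scaleDev, h, Real.inv_rpow (by positivity), ← Real.rpow_neg (by positivity),
    ← Real.rpow_natCast, ← Real.rpow_natCast, ← Real.rpow_mul hN'.le, ← Real.rpow_mul hN'.le,
    mul_comm]
  ring_nf

theorem exists_scale_stop (hn : 0 < n) (hy : 0 < y) (hN : 2 ≤ N) (hα : α ≤ 1) :
    ∃ K, (∀ k < K, scaleDev y α N k < scaleLen n N k ^ (3 / 5 : ℝ)) ∧
      scaleLen n N K ^ (3 / 5 : ℝ) ≤ scaleDev y α N K := by
  have hN' : (2 : ℝ) ≤ N := by exact_mod_cast hN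
  have hN0 : (0 : ℝ) < N := by linarith
  have hex : ∃ k, scaleLen n N k ^ (3 / 5 : ℝ) ≤ scaleDev y α N k := by
    have hg : 1 < (N : ℝ) ^ (3 / 5 - α / 2) := Real.one_lt_rpow (by linarith) (by linarith)
    obtain ⟨k, hk⟩ := pow_unbounded_of_one_lt (n ^ (3 / 5 : ℝ) / y) hg
    refine ⟨k, ?_⟩
    rw [div_lt_iff₀ hy, sub_eq_add_neg, Real.rpow_add hN0, mul_pow] at hk
    rw [scaleLen, scaleDev, Real.div_rpow hn.le (by positivity), div_le_iff₀ (by positivity)]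
    refine hk.le.trans (le_of_eq ?_)
    rw [← Real.rpow_natCast ((N : ℝ) ^ (3 / 5 : ℝ)), ← Real.rpow_natCast (N : ℝ),
      ← Real.rpow_mul hN0.le, ← Real.rpow_mul hN0.le, mul_comm (k : ℝ)]
    ring
  classical
  exact ⟨Nat.find hex, fun k hk => not_le.1 (Nat.find_min hex hk), Nat.find_spec hex⟩

/-- All the scales that are used are large, and the deviations stay above a power of `n`. -/
theorem scale_bounds {μ C₁ C' S₀ Y A : ℝ} (hn : 1 ≤ n) (hA : 1 ≤ A) (hAY : Y ≤ A)
    (hy : A * n ^ (1 / 12 : ℝ) ≤ y) (hN : 2 ≤ N) (hα : α ≤ 1 / 15)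
    (hY : ∀ t, Y ≤ t → LargeScale μ C₁ C' S₀ N t) {K : ℕ}
    (hK : ∀ k < K, scaleDev y α N k < scaleLen n N k ^ (3 / 5 : ℝ)) :
    ∀ k ≤ K, (1 ≤ scaleLen n N k ∧ A * n ^ (1 / 20 : ℝ) ≤ scaleDev y α N k) ∧
      (k < K → Y ≤ scaleLen n N k) := by
  have hN' : (2 : ℝ) ≤ N := by exact_mod_cast hN
  have hN0 : (0 : ℝ) < N := by linarith
  have hNN : 0 < N := by omega
  have hn0 : 0 < n := by linarith
  have hA0 : 0 < A := by linarith
  have hy0 : 0 < y := lt_of_lt_of_le (by positivity) hy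
  have hdev : ∀ k, 1 ≤ scaleLen n N k → A * n ^ (1 / 20 : ℝ) ≤ scaleDev y α N k := by
    intro k hk
    rw [scaleDev_eq hn0 hNN]
    have h0 : 0 < scaleLen n N k / n := by positivity
    have hle : scaleLen n N k / n ≤ 1 := by
      rw [div_le_one hn0, scaleLen]
      exact div_le_self hn0.le (one_le_pow₀ (by linarith))
    have h1 : n⁻¹ ^ (1 / 30 : ℝ) ≤ (scaleLen n N k / n) ^ (α / 2) := by
      calc n⁻¹ ^ (1 / 30 : ℝ) ≤ (scaleLen n N k / n) ^ (1 / 30 : ℝ) := by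
            rw [inv_eq_one_div]; gcongr
        _ ≤ _ := Real.rpow_le_rpow_of_exponent_ge h0 hle (by linarith)
    calc A * n ^ (1 / 20 : ℝ) = (A * n ^ (1 / 12 : ℝ)) * n⁻¹ ^ (1 / 30 : ℝ) := by
          rw [Real.inv_rpow hn0.le, ← Real.rpow_neg hn0.le, mul_assoc, ← Real.rpow_add hn0]
          norm_num
      _ ≤ _ := by gcongr
  have hbig : ∀ k, k < K → 1 ≤ scaleLen n N k → Y ≤ scaleLen n N k := by
    intro k hk h1
    have h2 : 1 ≤ n ^ (1 / 20 : ℝ) := Real.one_le_rpow hn (by norm_num)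
    have h3 : A * 1 ≤ A * n ^ (1 / 20 : ℝ) := by gcongr
    have h4 : scaleLen n N k ^ (3 / 5 : ℝ) ≤ scaleLen n N k := by
      calc scaleLen n N k ^ (3 / 5 : ℝ) ≤ scaleLen n N k ^ (1 : ℝ) :=
            Real.rpow_le_rpow_of_exponent_le h1 (by norm_num)
        _ = _ := Real.rpow_one _
    linarith [hdev k h1, hK k hk]
  have hone : ∀ k ≤ K, 1 ≤ scaleLen n N k := by
    intro k
    induction k with
    | zero => intro _; simpa using hn
    | succ k ih =>
      intro hk
      have h1 := hbig k (by omega) (ih (by omega))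
      have h2 := (hY _ h1).ratio
      rw [scaleLen_succ, one_le_div hN0]
      exact le_trans (le_self_pow₀ (by linarith) (by norm_num)) h2
  exact fun k hk => ⟨⟨hone k hk, hdev k (hone k hk)⟩, fun hk' => hbig k hk' (hone k hk)⟩

end Scales

namespace Model

variable {Ω E : Type*} [MeasurableSpace Ω] [MeasurableSpace E] [MulAction ISO2 E]
  {P : Measure Ω} {M : Model Ω E P} {κ D₀ n₀ μ : ℝ}

/-- The constant in the bound for the transversal fluctuations. -/
def transversalConst (μ : ℝ) (N : ℕ) : ℝ :=
  1 + 2 * N + 5 * N ^ 2 + √(2 * (1 + 5 * N ^ 3) * excessConst μ (1 + 5 * N ^ 3))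
    + excessConst μ (1 + 5 * N ^ 3)

/-- On the good events, the optimal path stays within a multiple of `√(n y)` of the axis. -/
theorem abs_geodesic_le_of_cells {D : Set Plane} {n y α A C₁ C₂ C' S₀ Y β : ℝ} {N K : ℕ} {x : Ω}
    (hx : M.RoughGeometry μ D (4 * n) x) (hμ : 0 < μ) (hC₂ : 0 ≤ C₂)
    (hN : GoodFactor μ C₁ C₂ α β N) (hα : α ≤ 1 / 15)
    (hY : ∀ t, Y ≤ t → LargeScale μ C₁ C' S₀ N t) (hn : 1 ≤ n) (hyn : y ≤ n)
    (hA : 1 ≤ A) (hAY : Y ≤ A) (hAμ : 8000 * μ ≤ A) (hy : A * n ^ (1 / 12 : ℝ) ≤ y)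
    (hK : ∀ k < K, scaleDev y α N k < scaleLen n N k ^ (3 / 5 : ℝ))
    (hK' : scaleLen n N K ^ (3 / 5 : ℝ) ≤ scaleDev y α N K)
    (hdense : ∀ z : Plane, ∀ δ > 0, ∃ k ∈ D, dist z k < δ)
    (hD : ∀ i k : ℕ, ∀ j : ℤ, pt (i * scaleLen n N k) j ∈ D)
    (hF : ∀ k < K, ∀ f : ℕ → ℝ, |f N - f 0| ≤ scaleLen n N k → (k = 0 → f 0 = 0 ∧ f N = 0) →
      M.ChordBound μ C₂ (scaleLen n N k) (scaleDev y α N k) N f)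
    (hcell : ∀ k, 1 ≤ k → k ≤ K → ∀ i : ℕ, i < N ^ k → ∀ b : ℝ, |b| ≤ 2 * N * √(n * y) →
      ∃ c : ℤ, |(c : ℝ) - b| ≤ 2 * scaleWidth n y α N k ∧
        x ∉ M.BadCell ((N : ℝ) ^ 2) (scaleLen n N k) (scaleDev y α N k) (i * scaleLen n N k) c)
    (hT : M.T (pt 0 0) (pt n 0) x ≤ M.meanX n + N * y) (t : unitInterval) :
    |M.geodesic (pt 0 0) (pt n 0) x t 1| ≤ transversalConst μ N * √(n * y) := by
  have hN1 := hN.large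
  have hN0' : (0 : ℝ) < N := by linarith
  have hN0 : 0 < N := by exact_mod_cast hN0'
  have hN16 : 16 ≤ N := by exact_mod_cast (show (16 : ℝ) ≤ N by linarith)
  have hn0 : 0 < n := by linarith
  have hA0 : 0 < A := by linarith
  have hn12 : 1 ≤ n ^ (1 / 12 : ℝ) := Real.one_le_rpow hn (by norm_num)
  have hy1 : 1 ≤ y := by
    refine le_trans ?_ hy
    exact one_le_mul_of_one_le_of_one_le hA hn12
  have hy0 : 0 < y := by linarith
  have hsb := scale_bounds hn hA hAY hy (by omega) hα hY hK
  have hrp := scaleLen_pos (N := N) hn0 hN0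
  have hlp := scaleDev_pos (α := α) (N := N) hy0 hN0
  have hpow : ∀ a : ℝ, a ≤ 1 / 20 → n ^ a ≤ n ^ (1 / 20 : ℝ) := fun a ha =>
    Real.rpow_le_rpow_of_exponent_le hn ha
  have herr : ∀ k ≤ K, 2000 * μ * (4 * n) ^ (1 / 40 : ℝ) ≤ scaleDev y α N k := by
    intro k hk
    have h1 := four_mul_rpow_le (a := 1 / 40) hn0.le (by norm_num)
    have h2 := hpow (1 / 40) (by norm_num)
    have h3 := (hsb k hk).1.2
    have h4 : 2000 * μ * (4 * n) ^ (1 / 40 : ℝ) ≤ 2000 * μ * (4 * n ^ (1 / 20 : ℝ)) := by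
      gcongr; linarith
    have h5 : 8000 * μ * n ^ (1 / 20 : ℝ) ≤ A * n ^ (1 / 20 : ℝ) :=
      mul_le_mul_of_nonneg_right hAμ (by positivity)
    linarith
  have hsmall : ∀ k < K, 4 / μ * (scaleDev y α N k + μ + 3 * ((4 * n) ^ (1 / 200 : ℝ)) ^ 2 / μ)
      ≤ scaleLen n N k := by
    intro k hk
    obtain ⟨⟨h1, h2⟩, h3⟩ := hsb k hk.le
    refine le_trans ?_ (hY _ (h3 hk)).small
    have h4 : ((4 * n) ^ (1 / 200 : ℝ)) ^ 2 ≤ 4 * scaleLen n N k ^ (3 / 5 : ℝ) := by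
      rw [← Real.rpow_natCast, ← Real.rpow_mul (by linarith)]
      refine (four_mul_rpow_le hn0.le (by norm_num)).trans ?_
      have h5 := hpow (1 / 200 * (2 : ℕ)) (by norm_num)
      have h6 : 1 * n ^ (1 / 20 : ℝ) ≤ A * n ^ (1 / 20 : ℝ) := by gcongr
      have := hK k hk
      linarith
    have h5 : 1 ≤ scaleLen n N k ^ (3 / 5 : ℝ) := Real.one_le_rpow h1 (by norm_num)
    rw [mul_assoc]
    gcongr
    have h6 : 3 * ((4 * n) ^ (1 / 200 : ℝ)) ^ 2 / μ ≤ 12 / μ * scaleLen n N k ^ (3 / 5 : ℝ) := by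
      rw [div_mul_eq_mul_div]
      exact div_le_div_of_nonneg_right (by linarith) hμ.le
    have h7 : μ * 1 ≤ μ * scaleLen n N k ^ (3 / 5 : ℝ) := by gcongr
    linarith [hK k hk]
  have hwn : ∀ k < K, 5 * N ^ 2 * scaleWidth n y α N k ≤ scaleLen n N k := by
    intro k hk
    refine window_le_of_sq (hrp k).le (le_trans ?_ (hY _ ((hsb k hk.le).2 hk)).window)
    have := (hK k hk).le
    gcongr
  have hu : pt 0 0 ∈ D := by simpa using hD 0 0 0
  have hv : pt n 0 ∈ D := by simpa using hD 1 0 0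
  have hun : ‖pt 0 0‖ ≤ 4 * n := by
    rw [← dist_zero_right, dist_plane]
    simp only [pt_zero, pt_one, PiLp.zero_apply]
    norm_num
    linarith
  have hvn : ‖pt n 0‖ ≤ 4 * n := by
    rw [← dist_zero_right, dist_plane]
    simp only [pt_zero, pt_one, PiLp.zero_apply]
    norm_num
    rw [Real.sqrt_sq hn0.le]
    linarith
  obtain ⟨h, Z, hs⟩ := hx.exists_skeleton (x₀ := 0) (L := n) (j := 0) (j' := 0) hn0
    (by simpa using hu) (by simpa using hv) (by simpa using hun) (by simpa using hvn)
  have hH : 10 * (4 * n) + 1 ≤ 11 * (4 * n) := by linarith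
  have hw0 := scaleWidth_zero (n := n) (y := y) (α := α) (N := N)
  have hchain := hs.abs_le_of_cells hx hH hn0 hμ hC₂ hN.loc hN1 (r := scaleLen n N)
    (l := scaleDev y α N) (w := scaleWidth n y α N) (K := K) scaleLen_zero scaleLen_succ hlp
    (scaleDev_succ_le hy0 hN0 hN.gain) (fun _ => rfl)
    (two_mul_scaleWidth_succ_le hn0 hy0 hN0 hN.gain)
    (two_mul_scaleWidth_le hn0 hy0 hN16 (by linarith)) hD (fun k hk => herr k hk.le) hsmall hwn hF
    (by rw [hw0]; exact hcell) (by rw [scaleDev_zero]; exact hT) K le_rfl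
  obtain ⟨hc1, hc2⟩ := hchain
  obtain ⟨⟨hr1, hl1⟩, -⟩ := hsb K le_rfl
  obtain ⟨r, hr⟩ : ∃ r, r = scaleLen n N K := ⟨_, rfl⟩
  obtain ⟨l, hl⟩ : ∃ l, l = scaleDev y α N K := ⟨_, rfl⟩
  obtain ⟨w, hw⟩ : ∃ w, w = scaleWidth n y α N K := ⟨_, rfl⟩
  obtain ⟨W, hW⟩ : ∃ W, W = √(n * y) := ⟨_, rfl⟩
  have hwW : w ≤ W := by rw [hw, hW]; exact scaleWidth_le hn0 hy0 hN0 hN.gain K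
  have hw0' : 0 ≤ w := by rw [hw]; exact scaleWidth_nonneg K
  have hwrl : w = √(r * l) := by rw [hw, hr, hl, scaleWidth]
  have hly : l ≤ y := by rw [hl]; exact scaleDev_le hy0 hN0 hN.gain K
  have hyW : y ≤ W := by
    rw [hW]
    refine Real.le_sqrt_of_sq_le ?_
    rw [sq]
    gcongr
  have hn20 : 1 ≤ n ^ (1 / 20 : ℝ) := Real.one_le_rpow hn (by norm_num)
  rw [← hl] at hl1
  have hl20 : n ^ (1 / 20 : ℝ) ≤ l := (le_mul_of_one_le_left (by linarith) hA).trans hl1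
  have hl1' : 1 ≤ l := hn20.trans hl20
  have hr0 : 0 < r := by rw [hr]; exact hrp K
  -- the increments at the last level
  obtain ⟨I, hI0, hIw, hIr, hI⟩ : ∃ I, 0 ≤ I ∧ I ≤ 5 * N ^ 2 * W ∧ r + I ≤ (1 + 5 * N ^ 3) * r ∧
      ∀ i < N ^ K, |(Z ((i + 1 : ℕ) * r) : ℝ) - Z (i * r)| ≤ I := by
    rcases Nat.eq_zero_or_pos K with h0 | h0
    · refine ⟨0, le_rfl, by rw [hW]; positivity, ?_, ?_⟩
      · have : 0 ≤ 5 * (N : ℝ) ^ 3 * r := by positivity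
        linarith
      · intro i hi
        have hi0 : i = 0 := by simpa [h0] using hi
        have e1 : (Z n : ℝ) = 0 := by rw [hs.Y_end]; simp
        have e2 : (Z 0 : ℝ) = 0 := by rw [hs.Y_zero]; simp
        rw [hi0, hr, h0, scaleLen_zero]
        simp [e1, e2]
    · refine ⟨5 * N ^ 2 * w, by positivity, by gcongr, ?_, by rw [hr, hw]; exact hc2⟩
      obtain ⟨k, rfl⟩ : ∃ k, K = k + 1 := ⟨K - 1, by omega⟩
      have h1 : l ≤ N * r := by
        have h2 : scaleDev y α N (k + 1) ≤ scaleDev y α N k := scaleDev_succ_le hy0 hN0 hN.gain k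
        have h3 := hK k (by omega)
        have h4 : scaleLen n N k ^ (3 / 5 : ℝ) ≤ scaleLen n N k := by
          calc scaleLen n N k ^ (3 / 5 : ℝ) ≤ scaleLen n N k ^ (1 : ℝ) :=
                Real.rpow_le_rpow_of_exponent_le (hsb k (by omega)).1.1 (by norm_num)
            _ = _ := Real.rpow_one _
        have h5 : N * r = scaleLen n N k := by rw [hr, scaleLen_succ]; field_simp
        rw [hl, h5]
        linarith
      have h2 : w ≤ N * r := by
        rw [hwrl, Real.sqrt_le_left (by positivity)]
        have h3 : r * l ≤ r * (N * r) := by gcongr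
        have h4 : r * (N * r) * 1 ≤ r * (N * r) * N := by gcongr; linarith
        linarith
      have h3 : 5 * (N : ℝ) ^ 2 * w ≤ 5 * N ^ 2 * (N * r) := by gcongr
      linarith
  have hρ : (4 * n) ^ (1 / 200 : ℝ) ≤ 2 * l ^ (1 / 6 : ℝ) := by
    have h1 : n ^ (1 / 120 : ℝ) ≤ l ^ (1 / 6 : ℝ) := by
      calc n ^ (1 / 120 : ℝ) = (n ^ (1 / 20 : ℝ)) ^ (1 / 6 : ℝ) := by
            rw [← Real.rpow_mul hn0.le]; norm_num
        _ ≤ _ := by gcongr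
    have h2 : (4 : ℝ) ^ (1 / 200 : ℝ) ≤ 2 := by
      calc (4 : ℝ) ^ (1 / 200 : ℝ) ≤ 4 ^ (1 / 2 : ℝ) :=
            Real.rpow_le_rpow_of_exponent_le (by norm_num) (by norm_num)
        _ = √4 := (Real.sqrt_eq_rpow 4).symm
        _ = 2 := by
          rw [show (4 : ℝ) = 2 ^ 2 by norm_num]; exact Real.sqrt_sq (by norm_num)
    rw [Real.mul_rpow (by norm_num) hn0.le]
    have h3 : n ^ (1 / 200 : ℝ) ≤ n ^ (1 / 120 : ℝ) :=
      Real.rpow_le_rpow_of_exponent_le hn (by norm_num)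
    exact mul_le_mul h2 (h3.trans h1) (by positivity) (by norm_num)
  have hrl : r ≤ l ^ (5 / 3 : ℝ) := by
    calc r = (r ^ (3 / 5 : ℝ)) ^ (5 / 3 : ℝ) := by
          rw [← Real.rpow_mul hr0.le]; norm_num
      _ ≤ l ^ (5 / 3 : ℝ) := by rw [hr, hl]; gcongr
  have key := hs.abs_geodesic_le hx hH hn hμ hdense (r := r) (l := l) (A := 2 * N * W) (I := I)
    (B := 1 + 5 * N ^ 3) (m := N ^ K) hr0 (by rw [hr]; push_cast; exact pow_mul_scaleLen hN0 K)
    (by rw [hr]; exact fun i j => hD i K j) hl1' (by rw [hl]; exact herr K le_rfl) hρ hrl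
    (by positivity) hIr (fun i hi => by
      rw [hr]
      refine (hc1 i hi).trans ?_
      rw [hw0, ← hW, ← hw]
      gcongr
      linarith) hI t
  refine key.trans ?_
  rw [transversalConst, ← hW]
  obtain ⟨B, hB⟩ : ∃ B : ℝ, B = 1 + 5 * (N : ℝ) ^ 3 := ⟨_, rfl⟩
  have hB0 : 0 ≤ B := by rw [hB]; positivity
  rw [← hB]
  have hE := (excessConst_pos (B := B) hμ).le
  have h1 : √(2 * (B * r) * (excessConst μ B * l)) ≤ √(2 * B * excessConst μ B) * W := by
    have e : 2 * (B * r) * (excessConst μ B * l) = (2 * B * excessConst μ B) * (r * l) := by ring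
    rw [e, Real.sqrt_mul (by positivity), ← hwrl]
    gcongr
  have h2 : excessConst μ B * l ≤ excessConst μ B * W := by gcongr; linarith
  linarith

end Model

/-! ### Summation over the levels -/

section Sums

variable {μ C₁ C₂ α β : ℝ} {N : ℕ}

/-- The exponents of the cell estimates at level `k` grow at least linearly in `k`. -/
theorem GoodFactor.exp_level_le (hN : GoodFactor μ C₁ C₂ α β N) (hβ : 0 < β) {v : ℝ} (hv : 1 ≤ v)
    {k : ℕ} (hk : 1 ≤ k) :
    Real.exp (-(v * ((N : ℝ) ^ (α / 2)) ^ k / 3) ^ β) ≤ Real.exp (-v ^ β)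
      * Real.exp (1 - (N : ℝ) ^ (α * β / 2) / 3 ^ β) ^ k := by
  have hN0 : (0 : ℝ) < N := by linarith [hN.large]
  obtain ⟨b, hb⟩ : ∃ b, b = (N : ℝ) ^ (α * β / 2) := ⟨_, rfl⟩
  obtain ⟨B, hB⟩ : ∃ B, B = b / 3 ^ β := ⟨_, rfl⟩
  have h3 : (1 : ℝ) ≤ 3 ^ β := Real.one_le_rpow (by norm_num) hβ.le
  have hB2 : 2 ≤ B := by
    by_contra hcon
    push Not at hcon
    have h1 := hN.scales
    rw [← hb, ← hB] at h1
    have h2 : Real.exp (-1) ≤ Real.exp (1 - B) := Real.exp_le_exp.2 (by linarith)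
    have h4 : 1 / 3 ≤ Real.exp (-1) := by
      rw [Real.exp_neg, one_div]
      exact inv_anti₀ (Real.exp_pos 1) (by linarith [Real.exp_one_lt_d9])
    have h5 := levelWeight_pos hβ
    have h6 : (20000 : ℝ) ^ 4 ≤ N ^ 4 := by have := hN.large; gcongr
    have h7 : 1 * (20000 : ℝ) ^ 4 * (1 / 3) ≤ (1 + 6 * levelWeight β) * N ^ 4 * Real.exp (1 - B) := by
      gcongr
      · linarith
      · linarith
    norm_num at h7
    linarith
  have hbB : B ≤ b := by
    rw [hB]
    exact div_le_self (by rw [hb]; positivity) h3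
  have hv1 : 1 ≤ v ^ β := Real.one_le_rpow hv hβ.le
  have e : (v * ((N : ℝ) ^ (α / 2)) ^ k / 3) ^ β = v ^ β * (b ^ (k - 1) * B) := by
    have e1 : b ^ (k - 1) * B = b ^ k / 3 ^ β := by
      obtain ⟨j, rfl⟩ : ∃ j, k = j + 1 := ⟨k - 1, by omega⟩
      rw [hB, Nat.add_sub_cancel, pow_succ]
      ring
    have e2 : (((N : ℝ) ^ (α / 2)) ^ k) ^ β = b ^ k := by
      rw [hb, ← Real.rpow_natCast, ← Real.rpow_natCast, ← Real.rpow_mul hN0.le,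
        ← Real.rpow_mul (by positivity), ← Real.rpow_mul (by positivity)]
      congr 1
      ring
    rw [Real.div_rpow (by positivity) (by norm_num), Real.mul_rpow (by linarith) (by positivity), e1,
      e2]
    ring
  have hkb : (k : ℝ) ≤ b ^ (k - 1) := by
    have h1 : k ≤ 2 ^ (k - 1) := by
      have := Nat.lt_two_pow_self (n := k - 1)
      omega
    calc (k : ℝ) ≤ (2 : ℝ) ^ (k - 1) := by exact_mod_cast h1
      _ ≤ b ^ (k - 1) := by gcongr; linarith
  have hk1 : (1 : ℝ) ≤ k := by exact_mod_cast hk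
  rw [e, ← hb, ← hB, ← Real.exp_nat_mul, ← Real.exp_add]
  apply Real.exp_le_exp.2
  have h1 : k * B ≤ b ^ (k - 1) * B := by gcongr
  have h2 : v ^ β * (k * B) ≤ v ^ β * (b ^ (k - 1) * B) := by gcongr
  have h4 : 1 ≤ k * B := by nlinarith only [hk1, hB2]
  have h5 : 0 ≤ (v ^ β - 1) * (k * B - 1) := mul_nonneg (by linarith) (by linarith)
  linarith

theorem GoodFactor.sum_levels_le (hN : GoodFactor μ C₁ C₂ α β N) (hβ : 0 < β) {v : ℝ} (hv : 1 ≤ v)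
    (K : ℕ) :
    ∑ k ∈ Finset.Ico 1 (K + 1), ((N : ℝ) ^ 4) ^ k * (levelWeight β
      * Real.exp (-(v * ((N : ℝ) ^ (α / 2)) ^ k / 3) ^ β)) ≤ 1 / 3 * Real.exp (1 - v ^ β) := by
  obtain ⟨s, hs⟩ : ∃ s, s = (N : ℝ) ^ 4 * Real.exp (1 - (N : ℝ) ^ (α * β / 2) / 3 ^ β) := ⟨_, rfl⟩
  have hlw := levelWeight_pos hβ
  have hs0 : 0 ≤ s := by rw [hs]; positivity
  have h1 : (1 + 6 * levelWeight β) * s ≤ 1 / 2 := by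
    rw [hs, ← mul_assoc]
    exact hN.scales
  have h2 : 0 ≤ levelWeight β * s := by positivity
  have hs2 : s ≤ 1 / 2 := by linarith
  calc ∑ k ∈ Finset.Ico 1 (K + 1), ((N : ℝ) ^ 4) ^ k * (levelWeight β
        * Real.exp (-(v * ((N : ℝ) ^ (α / 2)) ^ k / 3) ^ β))
      ≤ ∑ k ∈ Finset.Ico 1 (K + 1), levelWeight β * Real.exp (-v ^ β) * s ^ k := by
        refine Finset.sum_le_sum fun k hk => ?_
        have h3 := hN.exp_level_le hβ hv (Finset.mem_Ico.1 hk).1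
        calc ((N : ℝ) ^ 4) ^ k * (levelWeight β
              * Real.exp (-(v * ((N : ℝ) ^ (α / 2)) ^ k / 3) ^ β))
            ≤ ((N : ℝ) ^ 4) ^ k * (levelWeight β * (Real.exp (-v ^ β)
              * Real.exp (1 - (N : ℝ) ^ (α * β / 2) / 3 ^ β) ^ k)) := by gcongr
          _ = _ := by rw [hs, mul_pow]; ring
    _ = levelWeight β * Real.exp (-v ^ β) * ∑ k ∈ Finset.Ico 1 (K + 1), s ^ k := by
        rw [Finset.mul_sum]
    _ ≤ levelWeight β * Real.exp (-v ^ β) * (s ^ 1 / (1 - s)) := by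
        gcongr
        exact geom_sum_Ico_le_of_lt_one hs0 (by linarith)
    _ ≤ levelWeight β * Real.exp (-v ^ β) * (2 * s) := by
        gcongr
        rw [pow_one, div_le_iff₀ (by linarith)]
        nlinarith only [hs0, hs2]
    _ = 2 * (levelWeight β * s) * Real.exp (-v ^ β) := by ring
    _ ≤ 1 / 3 * Real.exp (-v ^ β) := by gcongr; linarith
    _ ≤ _ := by gcongr; linarith

end Sums

namespace Model

variable {Ω E : Type*} [MeasurableSpace Ω] [MeasurableSpace E] [MulAction ISO2 E]
  {P : Measure Ω} {M : Model Ω E P} {κ D₀ n₀ μ : ℝ}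

theorem chordBound_of_slope {r l l' C₂ : ℝ} {N : ℕ} {f : ℕ → ℝ} (hC₂ : 0 ≤ C₂)
    (hN : 0 < N) (hr : 0 < r) (hl0 : 0 ≤ l') (hl : l' ≤ l)
    (hsub : M.meanX (polyLen (r / N) f N)
      ≤ ∑ i ∈ Finset.range N, M.meanX (√((r / N) ^ 2 + (f (i + 1) - f i) ^ 2)))
    (hinc : |f N - f 0| ≤ r)
    (hslope : ∀ s, r ≤ s → s ≤ 2 * r → ∀ ℓ, s ≤ ℓ →
      M.meanX s + μ / 4 * (ℓ - s) - C₂ * (N * l') ≤ M.meanX ℓ) :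
    M.ChordBound μ C₂ r l N f := by
  have hN' : (0 : ℝ) < N := by exact_mod_cast hN
  have h1 := hslope (√(r ^ 2 + (f N - f 0) ^ 2))
    (Real.le_sqrt_of_sq_le (by linarith [sq_nonneg (f N - f 0)])) (by
      have h2 := pow_le_pow_left₀ (abs_nonneg _) hinc 2
      rw [sq_abs] at h2
      rw [Real.sqrt_le_left (by positivity)]
      nlinarith only [h2]) _
    (le_polyLen f (N := N) (r := r / N) (show r = N * (r / N) by field_simp))
  have h2 : C₂ * (N * l') ≤ C₂ * (N * l) := by gcongr
  have h3 : 0 ≤ C₂ * (N * l) := by have := hl0.trans hl; positivity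
  unfold ChordBound
  linarith

/-- The fluctuation scale at level `k` is smaller than the admissible deviation at this level. -/
theorem scale_mul_le {α θ c x Λ n : ℝ} {q : ℝ → ℝ} {N k : ℕ}
    (hq : M.FluctuationScale α θ q c) (hc : 0 < c) (hα : α ≤ 1) (hN : 3 ≤ N)
    (hn : 1 ≤ n) (hx : 0 ≤ x) (hΛ : 0 < Λ) (hk : 1 ≤ k) (hr : 1 ≤ scaleLen n N k) :
    Λ * (x / Λ * ((N : ℝ) ^ (α / 2)) ^ k / 3) * q (3 * scaleLen n N k)
      ≤ scaleDev (x * q n) α N k := by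
  have hN3 : (3 : ℝ) ≤ N := by exact_mod_cast hN
  have hN0 : (0 : ℝ) < N := by linarith
  have hn0 : 0 < n := by linarith
  have hqn : 0 < q n := by
    have h : 0 < c * n ^ (1 / 12 : ℝ) := by positivity
    exact h.trans_le (hq.lower hn)
  have hNk : (N : ℝ) ≤ N ^ k := le_self_pow₀ (by linarith) (by omega)
  have h3r : 3 * scaleLen n N k ≤ n := by
    rw [scaleLen, ← mul_div_assoc, div_le_iff₀ (by positivity)]
    nlinarith only [hNk, hN3, hn0]
  have h1 := hq.growth (m := 3 * scaleLen n N k) (n := n) (by linarith) h3r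
  obtain ⟨g, hg⟩ : ∃ g, g = (N : ℝ) ^ (α / 2) := ⟨_, rfl⟩
  have hg0 : 0 < g := by rw [hg]; positivity
  have h2 : (3 * scaleLen n N k / n) ^ α ≤ 3 * (g ^ k * g ^ k)⁻¹ := by
    have e : 3 * scaleLen n N k / n = 3 * ((N : ℝ) ^ k)⁻¹ := by rw [scaleLen]; field_simp
    rw [e, Real.mul_rpow (by norm_num) (by positivity), Real.inv_rpow (by positivity)]
    have e2 : ((N : ℝ) ^ k) ^ α = g ^ k * g ^ k := by
      rw [hg, ← Real.rpow_natCast, ← Real.rpow_natCast, ← Real.rpow_mul hN0.le,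
        ← Real.rpow_mul hN0.le, ← Real.rpow_add hN0]
      congr 1
      ring
    rw [e2]
    gcongr
    calc (3 : ℝ) ^ α ≤ 3 ^ (1 : ℝ) := Real.rpow_le_rpow_of_exponent_le (by norm_num) hα
      _ = 3 := Real.rpow_one _
  rw [scaleDev, Real.rpow_neg hN0.le, ← hg, inv_pow]
  calc Λ * (x / Λ * g ^ k / 3) * q (3 * scaleLen n N k)
      ≤ Λ * (x / Λ * g ^ k / 3) * (3 * (g ^ k * g ^ k)⁻¹ * q n) := by
        gcongr
        exact h1.trans (by gcongr)
    _ = _ := by field_simp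

variable [IsProbabilityMeasure P]

/-- For a chord along the axis, slopes of the mean passage time at scales below `n` suffice. -/
theorem chordBound_axis (hM : M.Assumptions κ D₀ n₀ μ) {n l C₂ : ℝ} {N : ℕ} {f : ℕ → ℝ}
    (hN : 2 ≤ N) (hn : 0 < n) (hf0 : f 0 = 0) (hfN : f N = 0)
    (hs1 : ∀ ℓ, n - n / N ≤ ℓ →
      M.meanX (n - n / N) + μ / 4 * (ℓ - (n - n / N)) - C₂ * (N * l) ≤ M.meanX ℓ)
    (hs2 : ∀ ℓ, n / N ≤ ℓ → M.meanX (n / N) + μ / 4 * (ℓ - n / N) - C₂ * (N * l) ≤ M.meanX ℓ) :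
    M.ChordBound μ C₂ n l N f := by
  obtain ⟨k, rfl⟩ : ∃ k, N = k + 1 := ⟨N - 1, by omega⟩
  have hN' : (0 : ℝ) < (k + 1 : ℕ) := by positivity
  obtain ⟨r, hr⟩ : ∃ r, r = n / (k + 1 : ℕ) := ⟨_, rfl⟩
  have hr0 : 0 < r := by rw [hr]; positivity
  have hkr : n - r = k * r := by
    rw [hr]
    field_simp
    push_cast
    ring
  unfold ChordBound
  rw [hf0, hfN]
  rw [← hr] at hs1 hs2 ⊢
  have hpl : polyLen r f (k + 1) = polyLen r f k + √(r ^ 2 + (f (k + 1) - f k) ^ 2) :=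
    Finset.sum_range_succ _ _
  have h1 := hM.meanX_polyLen_le r f (N := k) (by omega)
  have h2 := hs1 (polyLen r f k) (by
    refine le_trans ?_ (le_polyLen f (N := k) (r := r) rfl)
    rw [hkr]
    exact Real.le_sqrt_of_sq_le (by linarith [sq_nonneg (f k - f 0)]))
  have h3 := hs2 (√(r ^ 2 + (f (k + 1) - f k) ^ 2))
    (Real.le_sqrt_of_sq_le (by linarith [sq_nonneg (f (k + 1) - f k)]))
  have h4 := hM.meanX_add_le (s := n - r) (t := r) (by rw [hkr]; positivity) hr0.le
  rw [sub_add_cancel] at h4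
  have e : √(n ^ 2 + (0 - 0) ^ 2) = n := by
    rw [sub_zero, zero_pow two_ne_zero, add_zero, Real.sqrt_sq hn.le]
  rw [Finset.sum_range_succ, hpl, e]
  linarith

theorem slope_of_largeScale {C₁ C₂ S₀ α θ β c C' G Y Λ : ℝ} {q : ℝ → ℝ} {N : ℕ}
    (hM : M.Assumptions κ D₀ n₀ μ) (hq : M.FluctuationScale α θ q c) (hc : 0 < c) (hα : 0 < α)
    (hβ : 0 < β) (hs : M.SlopeBound μ C₂ S₀) (hC₂ : 0 < C₂) (hS₀ : 1 ≤ S₀)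
    (hN : GoodFactor μ C₁ C₂ α β N)
    (hΛ : GoodScaling μ c β θ G κ N Y Λ) (hW : ∀ m, 1 ≤ m → M.WindowBound N Λ β q m) {r : ℝ}
    (hr : LargeScale μ C₁ C' S₀ N r) :
    ∀ s, r ≤ s → s ≤ 2 * r → ∀ ℓ, s ≤ ℓ →
      M.meanX s + μ / 4 * (ℓ - s) - C₂ * (N * (Λ * q (3 * r))) ≤ M.meanX ℓ :=
  slope_of_windowBound hM hq hc hα hβ hs hC₂ hS₀ hN hΛ.one_le hΛ.theta
    ((le_self_pow₀ (by linarith [hN.large]) (by norm_num)).trans hr.ratio) hr.slope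
    hr.two_mul_add_rpow_le (hΛ.rpow_le_scale hq hc hr.one_le) fun m hm _ => hW m hm

/-- The slope of the mean passage time slightly below `n`, in terms of the fluctuation scale
at `n`. -/
theorem slope_below {C₁ C₂ S₀ α θ β c C' G Y Λ n : ℝ} {q : ℝ → ℝ} {N : ℕ}
    (hM : M.Assumptions κ D₀ n₀ μ) (hq : M.FluctuationScale α θ q c) (hc : 0 < c) (hα : 0 < α)
    (hβ : 0 < β) (hs : M.SlopeBound μ C₂ S₀) (hC₂ : 0 < C₂) (hS₀ : 1 ≤ S₀)
    (hN : GoodFactor μ C₁ C₂ α β N)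
    (hΛ : GoodScaling μ c β θ G κ N Y Λ) (hW : ∀ m, 1 ≤ m → M.WindowBound N Λ β q m)
    (hr : LargeScale μ C₁ C' S₀ N (n / N)) :
    ∀ ℓ, n - n / N ≤ ℓ →
      M.meanX (n - n / N) + μ / 4 * (ℓ - (n - n / N)) - C₂ * (N * (Λ * q n)) ≤ M.meanX ℓ := by
  have hμ := hM.μ_pos
  have hN1 := hN.large
  have hN0' : (0 : ℝ) < N := by linarith
  have hN0 : 0 < N := by exact_mod_cast hN0'
  have hΛ1 := hΛ.one_le
  obtain ⟨r, hr'⟩ : ∃ r, r = n / N := ⟨_, rfl⟩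
  have hnr : n = N * r := by rw [hr']; field_simp
  rw [← hr'] at hr ⊢
  have hr1 := hr.one_le
  have hrn : 20000 * r ≤ n := by rw [hnr]; gcongr
  have hn1 : 1 ≤ n := by linarith
  obtain ⟨s, hs'⟩ : ∃ s, s = n - r := ⟨_, rfl⟩
  rw [← hs']
  have hsr : r ≤ s := by linarith
  have hs0 : 0 ≤ s := by linarith
  have hsn : s ≤ n := by linarith
  have hsN1 : 1 ≤ s / N := by
    rw [one_le_div hN0']
    have h1 : (N : ℝ) ≤ r := (le_self_pow₀ (by linarith) (by norm_num)).trans hr.ratio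
    linarith
  have hsNn : 3 * (s / N) ≤ n := by
    have h1 : s / N ≤ n / N := by gcongr
    rw [← hr'] at h1
    linarith
  have hX : 1 ≤ ((N : ℝ) / 6) ^ α := Real.one_le_rpow (by linarith) hα.le
  have hq0 : 0 < q n := by
    have h : 0 < c * n ^ (1 / 12 : ℝ) := by positivity
    exact h.trans_le (hq.lower hn1)
  have hgr : ((N : ℝ) / 6) ^ α * q (3 * (s / N)) ≤ q n := by
    have h1 := hq.growth (m := 3 * (s / N)) (n := n) (by linarith) hsNn
    have h2 : (3 * (s / N) / n) ^ α ≤ (6 / N) ^ α := by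
      have : 3 * (s / N) / n ≤ 6 / N := by
        rw [div_le_div_iff₀ (by positivity) hN0']
        field_simp
        linarith
      gcongr
    calc ((N : ℝ) / 6) ^ α * q (3 * (s / N)) ≤ ((N : ℝ) / 6) ^ α * ((6 / N) ^ α * q n) := by
          gcongr
          exact h1.trans (by gcongr)
      _ = q n := by
          rw [← mul_assoc, ← Real.mul_rpow (by positivity) (by positivity)]
          rw [show (N : ℝ) / 6 * (6 / N) = 1 by field_simp, Real.one_rpow, one_mul]
  have hN4800 : 4800 / μ ≤ (N : ℝ) ^ 2 := by
    have h1 : 4800 / μ ≤ 1200 / μ * (2 * C₂ + 1004) := by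
      rw [div_mul_eq_mul_div]
      gcongr
      linarith
    have h2 := hN.loc
    have h3 : (N : ℝ) ≤ N ^ 2 := by nlinarith only [hN1]
    linarith
  have hgap : s + s ^ (2 / 3 : ℝ) ≤ n := by
    have h1 : s ^ (2 / 3 : ℝ) ≤ n ^ (2 / 3 : ℝ) := by gcongr
    have h2 : (N : ℝ) ≤ n ^ (1 / 3 : ℝ) := by
      have h3 : (N : ℝ) ^ 3 ≤ n := by
        refine le_trans ?_ (hr.ratio.trans (by linarith))
        exact pow_le_pow_right₀ (by linarith) (by norm_num)
      calc (N : ℝ) = ((N : ℝ) ^ 3) ^ (1 / 3 : ℝ) := by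
            rw [← Real.rpow_natCast, ← Real.rpow_mul hN0'.le]; norm_num
        _ ≤ _ := by gcongr
    have h3 : N * n ^ (2 / 3 : ℝ) ≤ N * r := by
      calc N * n ^ (2 / 3 : ℝ) ≤ n ^ (1 / 3 : ℝ) * n ^ (2 / 3 : ℝ) := by gcongr
        _ = n := by rw [← Real.rpow_add (by linarith)]; norm_num
        _ = N * r := hnr
    have h4 := le_of_mul_le_mul_left h3 hN0'
    linarith
  have hτ : s ^ (1 / 20 : ℝ) ≤ Λ * q n := by
    have h1 : s ^ (1 / 20 : ℝ) ≤ n ^ (1 / 20 : ℝ) := by gcongr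
    have h2 : n ^ (1 / 20 : ℝ) ≤ n ^ (1 / 12 : ℝ) :=
      Real.rpow_le_rpow_of_exponent_le hn1 (by norm_num)
    have h3 : 2 * n ^ (1 / 12 : ℝ) ≤ Λ * c * n ^ (1 / 12 : ℝ) :=
      mul_le_mul_of_nonneg_right hΛ.two_le (by positivity)
    have h4 : Λ * (c * n ^ (1 / 12 : ℝ)) ≤ Λ * q n := by gcongr; exact hq.lower hn1
    have h5 : 0 ≤ n ^ (1 / 12 : ℝ) := by positivity
    linarith
  have hτX : Λ * (N / 6) ^ α * q (3 * (s / N)) ≤ Λ * q n := by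
    rw [mul_assoc]; gcongr
  exact hs.of_windowBound (s := s) (n' := n) (τ := Λ * q n) hS₀ hM hq hc hβ hN0
    hN4800 (by linarith) hΛ.theta (hr.slope.trans hsr) hgap hτ le_rfl
    (hW _ hsN1) (by linarith) hX hτX hN.slope

end Model

/-! ### Transversal fluctuations -/

namespace Model

variable {Ω E : Type*} [MeasurableSpace Ω] [MeasurableSpace E] [MulAction ISO2 E]
  {P : Measure Ω} {M : Model Ω E P} {κ D₀ n₀ μ : ℝ}

/-- A cell along one of the segments at level `k`, with centre in a grid whose mesh is the
transversal scale at this level, is bad. -/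
def BadLevel (M : Model Ω E P) (n y α : ℝ) (N k : ℕ) : Set Ω :=
  ⋃ p ∈ Finset.range (N ^ k) ×ˢ Finset.Icc (-(3 * (N : ℤ) ^ (k + 1))) (3 * (N : ℤ) ^ (k + 1)),
    M.BadCell ((N : ℝ) ^ 2) (scaleLen n N k) (scaleDev y α N k) (p.1 * scaleLen n N k)
      ((p.2 * ⌈scaleWidth n y α N k⌉ : ℤ) : ℝ)

theorem exists_center_of_notMem_badLevel {n y α : ℝ} {N k : ℕ} {x : Ω} (hn : 0 < n) (hy : 0 < y)
    (hN : 16 ≤ N) (hα : α ≤ 1) (hr : 1 ≤ scaleLen n N k) (hl : 1 ≤ scaleDev y α N k)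
    (hx : x ∉ M.BadLevel n y α N k) {i : ℕ} (hi : i < N ^ k) {b : ℝ}
    (hb : |b| ≤ 2 * N * √(n * y)) :
    ∃ c : ℤ, |(c : ℝ) - b| ≤ 2 * scaleWidth n y α N k ∧
      x ∉ M.BadCell ((N : ℝ) ^ 2) (scaleLen n N k) (scaleDev y α N k) (i * scaleLen n N k) c := by
  have hN16 : (16 : ℝ) ≤ N := by exact_mod_cast hN
  obtain ⟨w, hw⟩ : ∃ w, w = scaleWidth n y α N k := ⟨_, rfl⟩
  have hw1 : 1 ≤ w := by
    rw [hw]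
    refine Real.le_sqrt_of_sq_le ?_
    rw [one_pow]
    exact one_le_mul_of_one_le_of_one_le hr hl
  have hσ1 : w ≤ ⌈w⌉ := Int.le_ceil w
  have hσ2 : (⌈w⌉ : ℝ) ≤ 2 * w := by linarith [Int.ceil_lt_add_one w]
  have hσ0 : 0 < ⌈w⌉ := by
    have : (0 : ℝ) < ⌈w⌉ := by linarith
    exact_mod_cast this
  have hW : ∀ k, √(n * y) ≤ N ^ k * scaleWidth n y α N k := by
    intro k
    induction k with
    | zero => rw [scaleWidth_zero, pow_zero, one_mul]
    | succ k ih =>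
      have h1 := two_mul_scaleWidth_le hn hy hN hα k
      have h2 := scaleWidth_nonneg (n := n) (y := y) (α := α) (N := N) k
      calc √(n * y) ≤ N ^ k * scaleWidth n y α N k := ih
        _ ≤ N ^ k * (N * scaleWidth n y α N (k + 1)) := by gcongr; linarith
        _ = _ := by ring
  obtain ⟨m, hm1, hm2⟩ := exists_multiple_near b hσ0
  refine ⟨m * ⌈w⌉, by rw [← hw]; exact hm1.trans hσ2, ?_⟩
  have hm3 : |(m : ℝ)| ≤ 3 * N ^ (k + 1) := by
    have h1 : |b| / ⌈w⌉ ≤ 2 * N ^ (k + 1) := by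
      rw [div_le_iff₀ (by linarith)]
      calc |b| ≤ 2 * N * √(n * y) := hb
        _ ≤ 2 * N * (N ^ k * w) := by rw [hw]; gcongr; exact hW k
        _ = 2 * N ^ (k + 1) * w := by ring
        _ ≤ _ := by gcongr
    have h2 : (1 : ℝ) ≤ N ^ (k + 1) := one_le_pow₀ (by linarith)
    linarith
  have hmem : m ∈ Finset.Icc (-(3 * (N : ℤ) ^ (k + 1))) (3 * (N : ℤ) ^ (k + 1)) := by
    rw [Finset.mem_Icc, ← abs_le]
    exact_mod_cast hm3
  intro hbad
  refine hx ?_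
  rw [BadLevel]
  simp only [Set.mem_iUnion]
  refine ⟨(i, m), Finset.mem_product.2 ⟨Finset.mem_range.2 hi, hmem⟩, ?_⟩
  rw [← hw]
  exact hbad

theorem infDist_axis_le (p : Plane) (n : ℝ) (hn : n ≠ 0) :
    Metric.infDist p (line[ℝ, (0 : Plane), pt n 0] : Set Plane) ≤ |p 1| := by
  have hmem : pt (p 0) 0 ∈ (line[ℝ, (0 : Plane), pt n 0] : Set Plane) := by
    have h := AffineMap.lineMap_mem_affineSpan_pair (p 0 / n) (0 : Plane) (pt n 0)
    have e : pt (p 0) 0 = AffineMap.lineMap (0 : Plane) (pt n 0) (p 0 / n) := by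
      rw [AffineMap.lineMap_apply]
      ext i
      fin_cases i
      · simp [hn]
      · simp
    rw [e]
    exact h
  refine (Metric.infDist_le_dist_of_mem hmem).trans (le_of_eq ?_)
  rw [dist_plane]
  simp only [pt_zero, pt_one, sub_self, sub_zero]
  rw [zero_pow two_ne_zero, zero_add, Real.sqrt_sq_eq_abs]

theorem zero_eq_pt : (0 : Plane) = pt 0 0 := by
  ext i
  fin_cases i <;> simp

theorem transversalN_le {n B : ℝ} {x : Ω} (hn : n ≠ 0)
    (h : ∀ t, |M.geodesic (pt 0 0) (pt n 0) x t 1| ≤ B) : M.transversalN n x ≤ B := by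
  rw [transversalN, transversal]
  refine ciSup_le fun t => (infDist_axis_le _ n hn).trans ?_
  rw [zero_eq_pt]
  exact h t

variable [IsProbabilityMeasure P]

/-- The union bound over the cells at level `k`: there are of order `N ^ (2 k + 1)` of them, and
each is bad with a probability that is superexponentially small in `k`. -/
theorem measureReal_badLevel_le {C₁ C₂ α θ β c Λ x n : ℝ} {q : ℝ → ℝ} {N k : ℕ}
    (hM : M.Assumptions κ D₀ n₀ μ) (hq : M.FluctuationScale α θ q c) (hc : 0 < c) (hα : α ≤ 1)
    (hβ : 0 < β) (hN : GoodFactor μ C₁ C₂ α β N) (hΛ : 0 < Λ)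
    (hW : ∀ m, 1 ≤ m → M.WindowBound N Λ β q m) (hn : 1 ≤ n) (hx : Λ ≤ x) (hk : 1 ≤ k)
    (hr : 1 ≤ scaleLen n N k) :
    P.real (M.BadLevel n (x * q n) α N k) ≤ ((N : ℝ) ^ 4) ^ k * (levelWeight β
      * Real.exp (-(x / Λ * ((N : ℝ) ^ (α / 2)) ^ k / 3) ^ β)) := by
  have hN1 := hN.large
  have hN0' : (0 : ℝ) < N := by linarith
  have hN0 : 0 < N := by exact_mod_cast hN0'
  have hN3 : 3 ≤ N := by exact_mod_cast (show (3 : ℝ) ≤ N by linarith)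
  have hq0 : 0 < q (3 * scaleLen n N k) := by
    have h : 0 < c * (3 * scaleLen n N k) ^ (1 / 12 : ℝ) := by positivity
    exact h.trans_le (hq.lower (by linarith))
  have hX : 1 ≤ x / Λ * ((N : ℝ) ^ (α / 2)) ^ k / 3 := by
    have h1 : 1 ≤ x / Λ := by rwa [one_le_div hΛ]
    have h2 : 3 ≤ (N : ℝ) ^ (α / 2) := by
      have h3 := rpow_neg_half_le hN0 hN.gain
      rw [Real.rpow_neg hN0'.le, one_div] at h3
      have h4 := (inv_le_inv₀ (by positivity) (by norm_num)).1 h3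
      linarith
    have h3 : (N : ℝ) ^ (α / 2) ≤ ((N : ℝ) ^ (α / 2)) ^ k := le_self_pow₀ (by linarith) (by omega)
    rw [le_div_iff₀ (by norm_num)]
    nlinarith only [h1, h2, h3]
  refine (measureReal_biUnion_finset_le _ _).trans ?_
  refine (Finset.sum_le_card_nsmul _ _ (levelWeight β
      * Real.exp (-(x / Λ * ((N : ℝ) ^ (α / 2)) ^ k / 3) ^ β)) fun p _ => ?_).trans ?_
  · exact hM.measureReal_badCell_le hβ hΛ hq0 (hW _ hr) hX
      (scale_mul_le hq hc hα hN3 hn (by linarith) hΛ hk hr) _ _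
  · rw [nsmul_eq_mul]
    refine mul_le_mul_of_nonneg_right ?_ (by have := levelWeight_pos hβ; positivity)
    rw [Finset.card_product, Finset.card_range, Int.card_Icc, Nat.cast_mul]
    have h1 : ((3 * (N : ℤ) ^ (k + 1) + 1 - -(3 * (N : ℤ) ^ (k + 1))).toNat : ℝ)
        = 6 * N ^ (k + 1) + 1 := by
      have : (((3 * (N : ℤ) ^ (k + 1) + 1 - -(3 * (N : ℤ) ^ (k + 1))).toNat : ℤ) : ℝ)
          = 6 * N ^ (k + 1) + 1 := by
        rw [Int.toNat_of_nonneg (by rw [sub_neg_eq_add]; positivity)]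
        push_cast
        ring
      exact_mod_cast this
    rw [h1]
    have h2 : (1 : ℝ) ≤ N ^ (k + 1) := one_le_pow₀ (by linarith)
    have h3 : 7 * (N : ℝ) ^ (k + 1) ≤ N * N ^ (k + 1) := by gcongr; linarith
    have h4 : (N : ℝ) ^ (2 * k + 2) ≤ N ^ (4 * k) :=
      pow_le_pow_right₀ (by linarith) (by omega)
    push_cast
    calc (N : ℝ) ^ k * (6 * N ^ (k + 1) + 1) ≤ N ^ k * (N * N ^ (k + 1)) := by gcongr; linarith
      _ = N ^ (2 * k + 2) := by ring
      _ ≤ N ^ (4 * k) := h4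
      _ = _ := by rw [← pow_mul]

/-- The comparison of the chords at all levels of the multiscale decomposition. -/
theorem chordBound_of_levels {C₁ C₂ S₀ α θ β c C' G Y Λ x n : ℝ} {q : ℝ → ℝ} {N K : ℕ}
    (hM : M.Assumptions κ D₀ n₀ μ) (hq : M.FluctuationScale α θ q c) (hc : 0 < c) (hα : 0 < α)
    (hα' : α ≤ 1 / 15)
    (hβ : 0 < β) (hs : M.SlopeBound μ C₂ S₀) (hC₂ : 0 < C₂) (hS₀ : 1 ≤ S₀)
    (hN : GoodFactor μ C₁ C₂ α β N) (hY : ∀ t, Y ≤ t → LargeScale μ C₁ C' S₀ N t)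
    (hΛ : GoodScaling μ c β θ G κ N Y Λ) (hW : ∀ m, 1 ≤ m → M.WindowBound N Λ β q m)
    (hn : 1 ≤ n) (hx : Λ ≤ x)
    (hK : ∀ k < K, scaleDev (x * q n) α N k < scaleLen n N k ^ (3 / 5 : ℝ))
    (hYK : ∀ k < K, Y ≤ scaleLen n N k) (hYy : Y ≤ x * q n) {k : ℕ} (hk : k < K) {f : ℕ → ℝ}
    (hf : |f N - f 0| ≤ scaleLen n N k) (hf0 : k = 0 → f 0 = 0 ∧ f N = 0) :
    M.ChordBound μ C₂ (scaleLen n N k) (scaleDev (x * q n) α N k) N f := by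
  have hμ := hM.μ_pos
  have hN1 := hN.large
  have hN0' : (0 : ℝ) < N := by linarith
  have hN0 : 0 < N := by exact_mod_cast hN0'
  have hn0 : 0 < n := by linarith
  have hΛ0 : 0 < Λ := by linarith [hΛ.one_le]
  have hqp : ∀ m, 1 ≤ m → 0 < q m := by
    intro m hm
    have h : 0 < c * m ^ (1 / 12 : ℝ) := by positivity
    exact h.trans_le (hq.lower hm)
  have hqmono : ∀ m, 1 ≤ m → m ≤ n → q m ≤ q n := by
    intro m hm hmn
    refine (hq.growth hm hmn).trans (mul_le_of_le_one_left (hqp n hn).le ?_)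
    exact Real.rpow_le_one (by positivity) ((div_le_one hn0).2 hmn) hα.le
  have hsl := fun r hr => slope_of_largeScale hM hq hc hα hβ hs hC₂ hS₀ hN hΛ hW (r := r) (hY r hr)
  have hsub : ∀ r, M.meanX (polyLen r f N)
      ≤ ∑ i ∈ Finset.range N, M.meanX (√(r ^ 2 + (f (i + 1) - f i) ^ 2)) := fun r =>
    hM.meanX_polyLen_le r f hN0
  rcases Nat.eq_zero_or_pos k with rfl | hk0
  · obtain ⟨h0, hN'⟩ := hf0 rfl
    rw [scaleLen_zero, scaleDev_zero]
    have hy := hK 0 hk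
    rw [scaleLen_zero, scaleDev_zero] at hy
    have hLy := hY _ hYy
    have hyn : x * q n ≤ n / N := by
      have hLn := hY n (by simpa using hYK 0 hk)
      rw [le_div_iff₀ hN0']
      have h1 : (N : ℝ) ≤ n ^ (2 / 5 : ℝ) := by
        have h2 : (N : ℝ) ^ 3 ≤ n :=
          le_trans (pow_le_pow_right₀ (by linarith) (by norm_num)) hLn.ratio
        calc (N : ℝ) = ((N : ℝ) ^ 3) ^ (1 / 3 : ℝ) := by
              rw [← Real.rpow_natCast, ← Real.rpow_mul hN0'.le]; norm_num
          _ ≤ n ^ (1 / 3 : ℝ) := by gcongr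
          _ ≤ _ := Real.rpow_le_rpow_of_exponent_le hn (by norm_num)
      calc x * q n * N ≤ n ^ (3 / 5 : ℝ) * n ^ (2 / 5 : ℝ) := by gcongr
        _ = n := by rw [← Real.rpow_add hn0]; norm_num
    have hr := hY _ (hYy.trans hyn)
    have hΛx : Λ * q n ≤ x * q n := by have := (hqp n hn).le; gcongr
    have h3n : 3 * (n / N) ≤ n := by
      rw [← mul_div_assoc, div_le_iff₀ hN0']
      nlinarith only [hN1, hn0]
    refine chordBound_axis hM (by exact_mod_cast (show (2 : ℝ) ≤ N by linarith)) hn0 h0 hN' ?_ ?_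
    · intro ℓ hℓ
      have h1 := slope_below hM hq hc hα hβ hs hC₂ hS₀ hN hΛ hW hr ℓ hℓ
      have h2 : C₂ * (N * (Λ * q n)) ≤ C₂ * (N * (x * q n)) := by gcongr
      linarith
    · intro ℓ hℓ
      have h1 := hsl _ (hYy.trans hyn) (n / N) le_rfl (by linarith [hr.one_le]) ℓ hℓ
      have h2 : Λ * q (3 * (n / N)) ≤ x * q n := by
        refine le_trans ?_ hΛx
        have := hqmono (3 * (n / N)) (by linarith [hr.one_le]) h3n
        gcongr
      have h3 : C₂ * (N * (Λ * q (3 * (n / N)))) ≤ C₂ * (N * (x * q n)) := by gcongr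
      linarith
  · have hr := hY _ (hYK k hk)
    have hr1 := hr.one_le
    refine chordBound_of_slope hC₂.le hN0 (by linarith) ?_ ?_ (hsub _) hf (hsl _ (hYK k hk))
    · have := (hqp (3 * scaleLen n N k) (by linarith)).le
      positivity
    · refine le_trans ?_ (scale_mul_le hq hc (by linarith)
        (by exact_mod_cast (show (3 : ℝ) ≤ N by linarith)) hn (by linarith) hΛ0 hk0 hr1)
      have h1 : 1 ≤ x / Λ := by rwa [one_le_div hΛ0]
      have h2 : 3 ≤ (N : ℝ) ^ (α / 2) := by
        have h3 := rpow_neg_half_le hN0 hN.gain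
        rw [Real.rpow_neg hN0'.le, one_div] at h3
        have h4 := (inv_le_inv₀ (by positivity) (by norm_num)).1 h3
        linarith
      have h3 : (N : ℝ) ^ (α / 2) ≤ ((N : ℝ) ^ (α / 2)) ^ k :=
        le_self_pow₀ (by linarith) (by omega)
      have h4 : 1 ≤ x / Λ * ((N : ℝ) ^ (α / 2)) ^ k / 3 := by
        rw [le_div_iff₀ (by norm_num)]
        nlinarith only [h1, h2, h3]
      have := (hqp (3 * scaleLen n N k) (by linarith)).le
      gcongr
      exact le_mul_of_one_le_right hΛ0.le h4

/-- If the deviation `x q(n)` exceeds `n`, the crude confinement of optimal paths suffices. -/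
theorem measureReal_transversalN_le_of_far {α θ β c G Y Λ x n s : ℝ} {q : ℝ → ℝ} {N : ℕ}
    (hM : M.Assumptions κ D₀ n₀ μ) (hq : M.FluctuationScale α θ q c) (hc : 0 < c) (hG : 0 ≤ G)
    (hrough : ∀ D : Set Plane, D.Countable → (∀ o : ℤ × ℤ, latticePt o ∈ D) →
      (∀ z : Plane, ∀ δ > 0, ∃ k ∈ D, dist z k < δ) → ∀ R : ℝ, 1 ≤ R →
      P.real {x | ¬ M.RoughGeometry μ D R x} ≤ G * Real.exp (-R ^ (κ / 500)))
    (hΛ : GoodScaling μ c β θ G κ N Y Λ) (hn : 1 ≤ n) (hx : Λ ≤ x) (hfar : n ≤ x * q n)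
    (hs : 10 * √(n * (x * q n)) < s) :
    P.real {a | s ≤ M.transversalN n a} ≤ Real.exp (1 - (x / Λ) ^ β) := by
  have hκ := hM.κ_pos
  have hn0 : 0 < n := by linarith
  have hx0 : 0 < x := by linarith [hΛ.one_le]
  have hy0 : 0 ≤ x * q n := by linarith
  obtain ⟨R, hR⟩ : ∃ R, R = √(n * (x * q n)) := ⟨_, rfl⟩
  rw [← hR] at hs
  have hnR : n ≤ R := by
    rw [hR]
    refine Real.le_sqrt_of_sq_le ?_
    rw [sq]
    gcongr
  have hcR : c * x ≤ R ^ 2 := by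
    rw [hR, Real.sq_sqrt (mul_nonneg hn0.le hy0)]
    have h1 : c * 1 ≤ c * n ^ (1 / 12 : ℝ) := by
      gcongr
      exact Real.one_le_rpow hn (by norm_num)
    have h2 := hq.lower hn
    have h3 : x * c ≤ x * q n := mul_le_mul_of_nonneg_left (by linarith) hx0.le
    have h4 : 1 * (x * q n) ≤ n * (x * q n) := mul_le_mul_of_nonneg_right hn hy0
    linarith
  obtain ⟨S, hS⟩ : ∃ S : Set ℝ, S = Set.range ((↑) : ℚ → ℝ) ∪ {n} := ⟨_, rfl⟩
  have hSc : S.Countable := by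
    rw [hS]; exact (Set.countable_range _).union (Set.countable_singleton _)
  have hSQ : Set.range ((↑) : ℚ → ℝ) ⊆ S := by rw [hS]; exact Set.subset_union_left
  have h0S : (0 : ℝ) ∈ S := hSQ ⟨0, Rat.cast_zero⟩
  have hnS : n ∈ S := by rw [hS]; exact Or.inr rfl
  have hCP := hrough (stripes S) (stripes_countable hSc) (lattice_mem_stripes hSQ)
    (stripes_dense hSQ) R (by linarith)
  have hsub : {a | s ≤ M.transversalN n a} ⊆ {x | ¬ M.RoughGeometry μ (stripes S) R x} := by
    intro ω hω hgeo
    refine absurd (lt_of_lt_of_le hs hω) (not_lt.2 (transversalN_le hn0.ne' fun t => ?_))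
    have hun : ‖pt 0 0‖ ≤ R := by
      rw [← dist_zero_right, dist_plane]
      simp only [pt_zero, pt_one, PiLp.zero_apply]
      norm_num
      linarith
    have hvn : ‖pt n 0‖ ≤ R := by
      rw [← dist_zero_right, dist_plane]
      simp only [pt_zero, pt_one, PiLp.zero_apply]
      norm_num
      rw [Real.sqrt_sq hn0.le]
      exact hnR
    have h1 := hgeo.norm_le (pt 0 0) (by simpa using pt_mem_stripes h0S 0) (pt n 0)
      (by simpa using pt_mem_stripes hnS 0) hun hvn t
    have h2 := PiLp.norm_apply_le (M.geodesic (pt 0 0) (pt n 0) ω t) 1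
    rw [Real.norm_eq_abs] at h2
    exact h2.trans h1
  refine (measureReal_mono hsub).trans (hCP.trans ?_)
  have h3 := hΛ.far x hx
  have h4 : c ^ (κ / 1000) * x ^ (κ / 1000) ≤ R ^ (κ / 500) := by
    rw [← Real.mul_rpow hc.le hx0.le]
    calc (c * x) ^ (κ / 1000) ≤ (R ^ 2) ^ (κ / 1000) := by gcongr
      _ = R ^ (κ / 500) := by
        rw [← Real.rpow_natCast, ← Real.rpow_mul (by linarith)]
        congr 1
        push_cast
        ring
  have h5 : G * Real.exp (-R ^ (κ / 500)) ≤ G * Real.exp (-(c ^ (κ / 1000) * x ^ (κ / 1000))) := by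
    gcongr
  have := Real.exp_pos (1 - (x / Λ) ^ β)
  linarith

/-- The tail bound for the transversal fluctuations in terms of the deviation parameter `x`. -/
theorem measureReal_transversalN_le {C₁ C₂ S₀ α θ β c C' G Y Λ x n s : ℝ} {q : ℝ → ℝ} {N : ℕ}
    (hM : M.Assumptions κ D₀ n₀ μ) (hq : M.FluctuationScale α θ q c) (hc : 0 < c) (hα : 0 < α)
    (hα' : α ≤ 1 / 15) (hθ : 0 < θ)
    (hβ : 0 < β) (hs : M.SlopeBound μ C₂ S₀) (hC₂ : 0 < C₂) (hS₀ : 1 ≤ S₀) (hG : 0 ≤ G)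
    (hrough : ∀ D : Set Plane, D.Countable → (∀ o : ℤ × ℤ, latticePt o ∈ D) →
      (∀ z : Plane, ∀ δ > 0, ∃ k ∈ D, dist z k < δ) → ∀ R : ℝ, 1 ≤ R →
      P.real {x | ¬ M.RoughGeometry μ D R x} ≤ G * Real.exp (-R ^ (κ / 500)))
    (hN : GoodFactor μ C₁ C₂ α β N) (hY : ∀ t, Y ≤ t → LargeScale μ C₁ C' S₀ N t)
    (hΛ : GoodScaling μ c β θ G κ N Y Λ) (hW : ∀ m, 1 ≤ m → M.WindowBound N Λ β q m)
    (hn : 1 ≤ n) (hx : Λ ≤ x) (hnear : x * q n ≤ n)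
    (hsn : transversalConst μ N * √(n * (x * q n)) < s) :
    P.real {a | s ≤ M.transversalN n a} ≤ Real.exp (1 - (x / Λ) ^ β) := by
  have hκ := hM.κ_pos
  have hμ := hM.μ_pos
  have hN1 := hN.large
  have hN0' : (0 : ℝ) < N := by linarith
  have hN0 : 0 < N := by exact_mod_cast hN0'
  have hN16 : 16 ≤ N := by exact_mod_cast (show (16 : ℝ) ≤ N by linarith)
  have hn0 : 0 < n := by linarith
  have hΛ1 := hΛ.one_le
  have hΛ0 : 0 < Λ := by linarith
  have hx0 : 0 < x := by linarith
  have hqn : c * n ^ (1 / 12 : ℝ) ≤ q n := hq.lower hn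
  have hq0 : 0 < q n := lt_of_lt_of_le (by positivity) hqn
  obtain ⟨y, hy⟩ : ∃ y, y = x * q n := ⟨_, rfl⟩
  have hAy : Λ * c * n ^ (1 / 12 : ℝ) ≤ y := by
    rw [hy, mul_assoc]
    gcongr
  have hn12 : 1 ≤ n ^ (1 / 12 : ℝ) := Real.one_le_rpow hn (by norm_num)
  have hA2 := hΛ.two_le
  have hAle : Λ * c ≤ y := by
    refine le_trans ?_ hAy
    exact le_mul_of_one_le_right (by linarith) hn12
  have hcx : c * x ≤ y := by
    have h1 : c * 1 ≤ c * n ^ (1 / 12 : ℝ) := by gcongr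
    rw [hy, mul_comm]
    exact mul_le_mul_of_nonneg_left (by linarith) hx0.le
  have hy0 : 0 < y := by linarith
  obtain ⟨K, hK, hK'⟩ := exists_scale_stop (α := α) hn0 hy0 (show 2 ≤ N by omega) (by linarith)
  have hsb := scale_bounds hn (by linarith) hΛ.large hAy (by omega) hα' hY hK
  have hdev1 : ∀ k ≤ K, 1 ≤ scaleDev y α N k := by
    intro k hk
    refine le_trans ?_ (hsb k hk).1.2
    exact one_le_mul_of_one_le_of_one_le (by linarith) (Real.one_le_rpow hn (by norm_num))
  obtain ⟨S, hS⟩ : ∃ S : Set ℝ, S = Set.range ((↑) : ℚ → ℝ)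
    ∪ Set.range (fun p : ℕ × ℕ => (p.1 : ℝ) * scaleLen n N p.2) := ⟨_, rfl⟩
  have hSc : S.Countable := by
    rw [hS]; exact (Set.countable_range _).union (Set.countable_range _)
  have hSQ : Set.range ((↑) : ℚ → ℝ) ⊆ S := by rw [hS]; exact Set.subset_union_left
  have hSi : ∀ i k : ℕ, (i : ℝ) * scaleLen n N k ∈ S := fun i k => by
    rw [hS]; exact Or.inr ⟨(i, k), rfl⟩
  have hCP := hrough (stripes S) (stripes_countable hSc) (lattice_mem_stripes hSQ)
    (stripes_dense hSQ) (4 * n) (by linarith)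
  have hd0 : dist (pt 0 0) (pt n 0) = n := by
    rw [Assumptions.dist_pt_axis, zero_sub, abs_neg, abs_of_pos hn0]
  have htail := hq.tail (n := n) (a := pt 0 0) (b := pt n 0) (by rw [hd0]; exact hn)
    (by rw [hd0]) hx0
  rw [hd0, ← hy] at htail
  have hsub : {a | s ≤ M.transversalN n a} ⊆
      (⋃ k ∈ Finset.Ico 1 (K + 1), M.BadLevel n y α N k)
      ∪ {w | |M.T (pt 0 0) (pt n 0) w - M.meanX n| > y}
      ∪ {x | ¬ M.RoughGeometry μ (stripes S) (4 * n) x} := by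
    intro ω hω
    by_contra hnot
    simp only [Set.mem_union, Set.mem_iUnion, not_or, not_exists, Set.mem_ofPred_eq, not_not,
      gt_iff_lt, not_lt] at hnot
    obtain ⟨⟨n1, n2⟩, n3⟩ := hnot
    rw [← hy] at hsn
    refine absurd (lt_of_lt_of_le hsn hω) (not_lt.2 (transversalN_le hn0.ne' fun t => ?_))
    refine abs_geodesic_le_of_cells n3 hμ hC₂.le hN hα' hY hn (hy ▸ hnear)
      (show 1 ≤ Λ * c by linarith) hΛ.large (by linarith [hΛ.err]) hAy hK hK' (stripes_dense hSQ)
      (fun i k j => pt_mem_stripes (hSi i k) j) ?_ ?_ ?_ t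
    · intro k hk f hf hf0
      rw [hy] at hK ⊢
      exact chordBound_of_levels hM hq hc hα hα' hβ hs hC₂ hS₀ hN hY hΛ hW hn hx hK
        (fun k hk => (hsb k hk.le).2 hk) (by rw [← hy]; exact hΛ.large.trans hAle) hk hf hf0
    · intro k hk1 hk i hi b hb
      exact exists_center_of_notMem_badLevel hn0 hy0 hN16 (by linarith) (hsb k hk).1.1 (hdev1 k hk)
        (n1 k (Finset.mem_Ico.2 ⟨hk1, by omega⟩)) hi hb
    · have h1 := (abs_le.1 n2).2
      have h2 : 1 * y ≤ N * y := by gcongr; linarith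
      linarith
  refine (measureReal_mono hsub).trans ((measureReal_union_le _ _).trans ?_)
  have t1 : P.real (⋃ k ∈ Finset.Ico 1 (K + 1), M.BadLevel n y α N k)
      ≤ 1 / 3 * Real.exp (1 - (x / Λ) ^ β) := by
    refine (measureReal_biUnion_finset_le _ _).trans
      (le_trans (Finset.sum_le_sum fun k hk => ?_)
        (hN.sum_levels_le hβ (show 1 ≤ x / Λ by rwa [one_le_div hΛ0]) K))
    rw [Finset.mem_Ico] at hk
    rw [hy]
    exact measureReal_badLevel_le hM hq hc (by linarith) hβ hN hΛ0 hW hn hx hk.1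
      (hsb k (by omega)).1.1
  have t2 : Real.exp (1 - x ^ θ) ≤ 1 / 3 * Real.exp (1 - (x / Λ) ^ β) := by
    refine le_trans ?_ (hΛ.tail x hx)
    have h1 : (1 / 8 : ℝ) ^ θ * x ^ θ ≤ 1 * x ^ θ := by
      gcongr
      exact Real.rpow_le_one (by norm_num) (by norm_num) hθ.le
    have h2 : 1 ≤ 25 * (N : ℝ) ^ 16 := by
      have : (1 : ℝ) ≤ N ^ 16 := one_le_pow₀ (by linarith)
      linarith
    calc Real.exp (1 - x ^ θ) ≤ 1 * (Real.exp 1 * Real.exp (-((1 / 8) ^ θ * x ^ θ))) := by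
          rw [one_mul, ← Real.exp_add]
          exact Real.exp_le_exp.2 (by linarith)
      _ ≤ 25 * (N : ℝ) ^ 16 * (Real.exp 1 * Real.exp (-((1 / 8) ^ θ * x ^ θ))) := by gcongr
      _ = _ := by ring
  have t3 : G * Real.exp (-(4 * n) ^ (κ / 500)) ≤ 1 / 3 * Real.exp (1 - (x / Λ) ^ β) := by
    refine le_trans ?_ (hΛ.rough x hx)
    rw [← Real.mul_rpow hc.le hx0.le]
    have : c * x ≤ 4 * n := by linarith
    gcongr
  have t4 := measureReal_union_le (μ := P) (⋃ k ∈ Finset.Ico 1 (K + 1), M.BadLevel n y α N k)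
    {w | |M.T (pt 0 0) (pt n 0) w - M.meanX n| > y}
  linarith

end Model

end RotFPP

end

theorem theoremt {Ω E : Type*} [MeasurableSpace Ω] [MeasurableSpace E]
    [MulAction RotFPP.ISO2 E] (P : Measure Ω) [IsProbabilityMeasure P]
    (M : RotFPP.Model Ω E P) (κ D₀ n₀ μ : ℝ) (hM : M.Assumptions κ D₀ n₀ μ)
    (α : ℝ) (hα : α ∈ Set.Icc (min (1 / 30) (κ / 2)) (min (1 / 15) κ)) :
    ∃ D > 0, ∀ n : ℝ, 1 ≤ n → ∀ z : ℝ, 0 ≤ z →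
      P.real {a | M.transversalN n a ≥ z * M.W α (RotFPP.theta κ) n} ≤
        Real.exp (1 - D * z ^ (RotFPP.eps κ * RotFPP.theta κ / 2)) := by
  open RotFPP RotFPP.Model in
  have hκ := hM.κ_pos
  have hα0 : 0 < α := lt_of_lt_of_le (by positivity) hα.1
  have hα1 : α ≤ 1 / 15 := hα.2.trans (min_le_left _ _)
  have hθ := theta_pos hκ
  have hθκ := theta_le hκ
  have hθ1 := theta_le_one κ
  obtain ⟨β, hβ⟩ : ∃ β, β = eps κ * theta κ / 4 := ⟨_, rfl⟩
  have hε : 0 < eps κ := by rw [eps]; positivity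
  have hε1 : eps κ ≤ 1 := by rw [eps, div_le_one (by positivity)]; linarith
  have hβ0 : 0 < β := by rw [hβ]; positivity
  have hβθ' : β ≤ theta κ / 4 := by
    rw [hβ]
    have : eps κ * theta κ ≤ 1 * theta κ := by gcongr
    linarith
  obtain ⟨c, hc, hq⟩ := hM.exists_fluctuationScale hα0 (by linarith)
  obtain ⟨C₁, hC₁, hlip⟩ := hM.exists_lipschitz_meanX
  obtain ⟨C', hC', hup⟩ := hM.exists_meanX_le (δ := 1 / 100) (by norm_num)
  obtain ⟨G, hG, hrough⟩ := hM.exists_roughGeometry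
  obtain ⟨C₂, S₀, hC₂, hS₀, hslope⟩ := hM.exists_slope_bound
  obtain ⟨N, hN⟩ := (eventually_goodFactor (μ := μ) (C₁ := C₁) (C₂ := C₂) hα0 hβ0).exists
  obtain ⟨Y, hY⟩ := eventually_atTop.1 (eventually_largeScale μ C₁ C' S₀ N)
  obtain ⟨Λ, hΛ1, hΛ'⟩ := exists_goodScaling (μ := μ) (G := G) (κ := κ) N Y hc hβ0
    (show β < theta κ by linarith) (by linarith)
  have hΛ := hΛ' Λ le_rfl
  have hW : ∀ m, 1 ≤ m → M.WindowBound N Λ β (fun n => 2 * M.Q α (theta κ) n) m := fun m hm =>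
    exists_windowBound hM hq hc hα0 hβ0 hslope hC₂ hS₀ (by linarith) hlip hC' hG.le hup hrough hN hY
      hΛ hm
  obtain ⟨B, hB⟩ : ∃ B, B = transversalConst μ N + 10 := ⟨_, rfl⟩
  have hT0 : 0 < transversalConst μ N := by
    rw [transversalConst]
    have := excessConst_pos (B := 1 + 5 * (N : ℝ) ^ 3) hM.μ_pos
    positivity
  have hB0 : 0 < B := by linarith
  have hΛ0 : 0 < Λ := by linarith
  refine ⟨(1 / (2 * B ^ 2 * Λ)) ^ β, by positivity, fun n hn z hz => ?_⟩
  rcases hz.eq_or_lt with rfl | hz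
  · rw [Real.zero_rpow (by positivity), mul_zero, sub_zero]
    exact measureReal_le_one.trans (Real.one_le_exp zero_le_one)
  have hn0 : 0 < n := by linarith
  -- the deviation parameter is proportional to the square of `z`
  obtain ⟨x, hx⟩ : ∃ x, x = z ^ 2 / (2 * B ^ 2) := ⟨_, rfl⟩
  have hx0 : 0 < x := by rw [hx]; positivity
  have hexp : (1 / (2 * B ^ 2 * Λ)) ^ β * z ^ (eps κ * theta κ / 2) = (x / Λ) ^ β := by
    have e : z ^ (eps κ * theta κ / 2) = (z ^ 2) ^ β := by
      rw [← Real.rpow_natCast, ← Real.rpow_mul hz.le, hβ]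
      congr 1
      push_cast
      ring
    rw [e, ← Real.mul_rpow (by positivity) (by positivity), hx]
    congr 1
    field_simp
  rw [hexp]
  have hQ0 : 0 < 2 * M.Q α (theta κ) n := by
    have h : 0 < c * n ^ (1 / 12 : ℝ) := by positivity
    exact h.trans_le (hq.lower hn)
  have hzW : z * M.W α (theta κ) n = B * √(n * (x * (2 * M.Q α (theta κ) n))) := by
    have e : n * (x * (2 * M.Q α (theta κ) n)) = (z / B) ^ 2 * (n * M.Q α (theta κ) n) := by
      rw [hx]; field_simp
    rw [W, e, Real.sqrt_mul (sq_nonneg (z / B)) (n * M.Q α (theta κ) n),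
      Real.sqrt_sq (by positivity)]
    field_simp
  have hpos : 0 < √(n * (x * (2 * M.Q α (theta κ) n))) := by positivity
  have hs1 : transversalConst μ N * √(n * (x * (2 * M.Q α (theta κ) n)))
      < z * M.W α (theta κ) n := by
    rw [hzW]; gcongr; linarith
  have hs2 : 10 * √(n * (x * (2 * M.Q α (theta κ) n))) < z * M.W α (theta κ) n := by
    rw [hzW]; gcongr; linarith
  rcases lt_or_ge x Λ with hxΛ | hxΛ
  · have h1 : (x / Λ) ^ β ≤ 1 :=
      Real.rpow_le_one (by positivity) (by rw [div_le_one hΛ0]; exact hxΛ.le) hβ0.le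
    exact measureReal_le_one.trans (Real.one_le_exp (by linarith))
  rcases le_total (x * (2 * M.Q α (theta κ) n)) n with hnear | hfar
  · exact measureReal_transversalN_le hM hq hc hα0 hα1 hθ hβ0 hslope hC₂ hS₀ hG.le hrough hN hY hΛ hW
      hn hxΛ hnear hs1
  · refine measureReal_transversalN_le_of_far hM hq hc hG.le hrough hΛ hn hxΛ hfar hs2
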